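/- **Setting.** Let $k$ be a field and $p\in k[x]$ a polynomial with $p(0)=0$. *Matrix factorizations.* A ($\mathbb Z$-graded) matrix factorization over a commutative ring $S$ with potential $\varphi\in S$ is a $\mathbb Z$-graded $S$-module $M$ with $d=d_++d_-$, $d_\pm$ $S$-linear of degree $\pm1$, $d^2=\varphi$. Morphisms are $S$-linear maps that preserve the $\mathbb Z/2$-grading and commute with $d$; $f\simeq g$ if $f-g=dh+hd$ with $h$ $S$-linear and odd. Let $\mathcal K$ denote the homotopy category of complexes over the homotopy category of matrix factorizations: the objects are sequences $(C^n)_{n\in\mathbb Z}$ of matrix factorizations with morphisms $\delta:C^n\to C^{n+1}$, $\delta^2\simeq0$; the morphisms are families $f^n:C^n\to D^n$ with $f\delta\simeq\delta f$, where $f$ and $g$ are identified if $f-g\simeq\delta s+s\delta$ for some family of morphisms $s^n:C^n\to D^{n-1}$. The Koszul matrix factorization of sequences $(x_e)$, $(y_e)$ in $S$ is the tensor product of the $S\rightleftarrows S$ with maps $x_e$ ($d_+$) and $y_e$ ($d_-$), the last term of the Koszul complex of $(x_e)$ being in degree $0$; its potential is $\sum x_ey_e$. *Arc diagrams.* A sign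 sequence is a finite totally ordered set $X$ with signs $\epsilon_x=\pm1$; let $k[X]=k[t_x:x\in X]$, $\varphi_X=\sum_{x\in X}\epsilon_xp(t_x)$, and let $\mathcal M_p(X)$ be the category $\mathcal K$ for $(k[X],\varphi_X)$. An oriented arc diagram $\eta$ with outer boundary $X_0$ and holes $X_1,\dots,X_m$ consists of finitely many oriented arcs, every point of $X_0\sqcup\dots\sqcup X_m$ being an end of exactly one arc, and finitely many closed loops. A point of $X_0$ is positive iff it is the head of its arc; a point of $X_j$, $j\ge1$, is positive iff it is the tail of its arc. Only these incidences matter; planar diagrams are the case in which the arcs and loops are embedded disjointly in the disk with holes, but the statement holds without planarity. Put a mark on each closed loop and let $\tilde Z_\eta$ be the Koszul matrix factorization, over the polynomial ring in the variables of all boundary points and marks, of $$\big(t_{\alpha_+}-t_{\alpha_-}\big)_\alpha,\qquad \Big(\frac{p(t_{\alpha_+})-p(t_{\alpha_-})}{t_{\alpha_+}-t_{\alpha_-}}\Big)_\alpha ,$$ where $\alpha$ runs over the arcs, with head $\alpha_+$ and tail $\alpha_-$, and the loops (a loop with mark $t$ contributes the pair $(0,p'(t))$). Its potential is $\varphi_{X_0}-\sum_{j\ge1}\varphi_{X_j}$.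 Let $$\tilde\eta:\ \mathcal M_p(X_1)\times\dots\times\mathcal M_p(X_m)\to\mathcal M_p(X_0)$$ be the functor of tensor product with $\tilde Z_\eta$ over $k[X_1]\otimes\cdots\otimes k[X_m]$, followed by restriction of scalars to $k[X_0]$. *Khovanov–Rozansky complexes.* For a crossing with outgoing ends $i,j$ and incoming ends $k,\ell$ (in the oriented smoothing $i$ is joined to $\ell$ and $j$ to $k$) let $L'$ and $L''$ be Koszul matrix factorizations with potential $p(t_i)+p(t_j)-p(t_k)-p(t_\ell)$ on the sequences $(t_i+t_j-t_k-t_\ell,\ t_it_j-t_kt_\ell)$ and $(t_i-t_\ell,\ t_j-t_k)$. Let $\rho^+:L'\to L''$ and $\rho^-:L''\to L'$ be morphisms which induce on $H^0$ of the Koszul complexes (that is, on the quotients of the ring by the two sequences) the projection and the multiplication by $t_i-t_k$, respectively. The complex $L_x$ of a crossing $x$ is $\rho^+:L'\to L''$ if $x$ is positive and $\rho^-:L''\to L'$ if $x$ is negative, with $L''$ in homological degree $0$. A tangle diagram $T$ with boundary $X_0$ consists of crossings and of oriented edges and closed loops which connect the ends of the crossings and the points of $X_0$. Its complex is $$KR_p(T)=\Big(\bigotimes_eL_e\Big)\otimes\Big(\bigotimes_xL_x\Big),$$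 where $L_e$ is the Koszul matrix factorization of the pair $\big(t_b-t_a,\ \tfrac{p(t_b)-p(t_a)}{t_b-t_a}\big)$ for an edge $e$ directed from $a$ to $b$ (and of $(0,p'(t))$ for a closed loop). It is considered as an object of $\mathcal M_p(X_0)$ by restriction of scalars to $k[X_0]$. Arc diagrams act on tangle diagrams by gluing. **Theorem.** Fix any choice of the data $L',L'',\rho^\pm$. 1. The functors $\tilde\eta$ define a canopolis structure $\mathcal M_p$ on the categories $\mathcal M_p(X)$: if an arc diagram $\theta_j$ is glued into the $j$-th hole of $\eta$ for every $j$, then the functor of the composite diagram is naturally isomorphic to $\tilde\eta\circ\prod_j\tilde\theta_j$; and renaming the holes of $\eta$ permutes the arguments of $\tilde\eta$, up to natural isomorphism. 2. $KR_p$ is a morphism of canopolises from tangle diagrams to $\mathcal M_p$: for every arc diagram $\eta$ and all tangle diagrams $T_j$ with boundary $X_j$, $$KR_p(\eta(T_1,\dots,T_m))\cong\tilde\eta\big(KR_p(T_1),\dots,KR_p(T_m)\big)\quad\text{in }\mathcal M_p(X_0).$$ 3. If $\eta(T_1,\dots,T_m)$ is closed, i.e. $X_0=\emptyset$, then the complexes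 of $\mathbb Z/2$-graded $k$-vector spaces obtained from $KR_p(\eta(T_1,\dots,T_m))$ and from $\tilde\eta(KR_p(T_1),\dots,KR_p(T_m))$ by taking the homology with respect to $d$ of each term (with the differential induced by $\delta$) are isomorphic as complexes. -/

import Mathlib

open CategoryTheory TensorProduct

universe u

noncomputable section

namespace KRCanopolis

section Grading

variable {R M ι : Type*} [CommRing R] [AddCommGroup M] [Module R M] [DecidableEq ι]

theorem isInternal_of_coaction (A : ι → Submodule R M) (hsup : ⨆ i, A i = ⊤)
    (D : M →+ (ι →₀ M)) (hD : ∀ i, ∀ x ∈ A i, D x = Finsupp.single i x) :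
    DirectSum.IsInternal A := by
  rw [DirectSum.isInternal_submodule_iff_iSupIndep_and_iSup_eq_top]
  refine ⟨?_, hsup⟩
  intro i
  rw [Submodule.disjoint_def]
  intro x hx hx'
  have h1 : D x i = x := by simp [hD i x hx]
  have h2 : D x i = 0 := by
    clear hx h1
    induction hx' using Submodule.iSup_induction' with
    | mem j y hy =>
      by_cases hj : j = i
      · simp [hj] at hy; simp [hy]
      · simp only [ne_eq, hj, not_false_eq_true, iSup_pos] at hy
        rw [hD j y hy, Finsupp.single_eq_of_ne (Ne.symm hj)]
    | zero => simp
    | add y z _ _ hy hz => rw [map_add, Finsupp.add_apply, hy, hz, add_zero]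
  rw [← h1, h2]

/-- The map sending `x` to the family of its homogeneous components. -/
def components {A : ι → Submodule R M} (h : DirectSum.IsInternal A) : M →ₗ[R] (ι →₀ M) :=
  (DirectSum.toModule R ι (ι →₀ M) fun i => Finsupp.lsingle i ∘ₗ (A i).subtype) ∘ₗ
    (LinearEquiv.ofBijective (DirectSum.coeLinearMap A) h).symm.toLinearMap

theorem components_of_mem {A : ι → Submodule R M} (h : DirectSum.IsInternal A) {i : ι} {x : M}
    (hx : x ∈ A i) : components h x = Finsupp.single i x := by
  have : (LinearEquiv.ofBijective (DirectSum.coeLinearMap A) h).symm x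
      = DirectSum.lof R ι (fun i => A i) i ⟨x, hx⟩ := by
    rw [LinearEquiv.symm_apply_eq]
    exact (DirectSum.coeLinearMap_lof A i ⟨x, hx⟩).symm
  simp [components, this]

/-- The operator that multiplies the homogeneous component of degree `i` by `c i`. -/
def scaleBy {A : ι → Submodule R M} (h : DirectSum.IsInternal A) (c : ι → ℤ) : M →ₗ[R] M :=
  (Finsupp.lsum R fun i => c i • (LinearMap.id : M →ₗ[R] M)) ∘ₗ components h

theorem scaleBy_of_mem {A : ι → Submodule R M} (h : DirectSum.IsInternal A) (c : ι → ℤ)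
    {i : ι} {x : M} (hx : x ∈ A i) : scaleBy h c x = c i • x := by
  simp [scaleBy, components_of_mem h hx]

theorem ext_of_isInternal {N : Type*} [AddCommGroup N] [Module R N] {A : ι → Submodule R M}
    (h : DirectSum.IsInternal A) {f g : M →ₗ[R] N} (hfg : ∀ i, ∀ x ∈ A i, f x = g x) : f = g := by
  have hs := h.submodule_iSup_eq_top
  have : (⊤ : Submodule R M) ≤ LinearMap.eqLocus f g := by
    rw [← hs]; exact iSup_le fun i x hx => hfg i x hx
  ext x
  exact this (Submodule.mem_top (x := x))

end Grading

section Par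

variable {R M N P : Type*} [CommRing R] [AddCommGroup M] [Module R M] [AddCommGroup N]
  [Module R N] [AddCommGroup P] [Module R P]

/-- For a module graded by homological degree `n` and internal degree `i`, the part of homological
degree `n` and of internal degree congruent to `b` modulo `2`. -/
def par (gr : ℤ × ℤ → Submodule R M) (n : ℤ) (b : ZMod 2) : Submodule R M :=
  ⨆ (i : ℤ) (_ : (i : ZMod 2) = b), gr (n, i)

/-- `f` raises the homological degree by exactly `a` and the internal degree by `b` modulo `2`. -/
def IsHomog (gr : ℤ × ℤ → Submodule R M) (gr' : ℤ × ℤ → Submodule R N)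
    (a : ℤ) (b : ZMod 2) (f : M →ₗ[R] N) : Prop :=
  ∀ (n : ℤ) (c : ZMod 2), ∀ x ∈ par gr n c, f x ∈ par gr' (n + a) (c + b)

theorem mem_par {gr : ℤ × ℤ → Submodule R M} {n i : ℤ} {x : M} (hx : x ∈ gr (n, i)) :
    x ∈ par gr n (i : ZMod 2) :=
  Submodule.mem_iSup_of_mem i (Submodule.mem_iSup_of_mem rfl hx)

theorem mem_par' {gr : ℤ × ℤ → Submodule R M} {n i : ℤ} {b : ZMod 2} {x : M} (hx : x ∈ gr (n, i))
    (h : (i : ZMod 2) = b) : x ∈ par gr n b := h ▸ mem_par hx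

theorem par_le {gr : ℤ × ℤ → Submodule R M} {n : ℤ} {b : ZMod 2} {Q : Submodule R M}
    (h : ∀ i : ℤ, (i : ZMod 2) = b → gr (n, i) ≤ Q) : par gr n b ≤ Q :=
  iSup_le fun i => iSup_le fun hi => h i hi

variable {gr : ℤ × ℤ → Submodule R M} {gr' : ℤ × ℤ → Submodule R N}
  {gr'' : ℤ × ℤ → Submodule R P}

theorem IsHomog.of_gr {a : ℤ} {b : ZMod 2} {f : M →ₗ[R] N}
    (h : ∀ n i, ∀ x ∈ gr (n, i), f x ∈ par gr' (n + a) ((i : ZMod 2) + b)) :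
    IsHomog gr gr' a b f := by
  intro n c
  refine par_le (Q := (par gr' (n + a) (c + b)).comap f) ?_
  rintro i rfl x hx
  exact h n i x hx

theorem IsHomog.comp {a a' : ℤ} {b b' : ZMod 2} {f : M →ₗ[R] N} {g : N →ₗ[R] P}
    (hg : IsHomog gr' gr'' a' b' g) (hf : IsHomog gr gr' a b f) :
    IsHomog gr gr'' (a + a') (b + b') (g ∘ₗ f) := by
  intro n c x hx
  rw [← add_assoc, ← add_assoc]
  exact hg _ _ _ (hf _ _ _ hx)

theorem IsHomog.add {a : ℤ} {b : ZMod 2} {f g : M →ₗ[R] N}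
    (hf : IsHomog gr gr' a b f) (hg : IsHomog gr gr' a b g) : IsHomog gr gr' a b (f + g) :=
  fun n c x hx => Submodule.add_mem _ (hf n c x hx) (hg n c x hx)

theorem IsHomog.neg {a : ℤ} {b : ZMod 2} {f : M →ₗ[R] N}
    (hf : IsHomog gr gr' a b f) : IsHomog gr gr' a b (-f) :=
  fun n c x hx => Submodule.neg_mem _ (hf n c x hx)

theorem IsHomog.zero (a : ℤ) (b : ZMod 2) : IsHomog gr gr' a b 0 :=
  fun _ _ _ _ => Submodule.zero_mem _

theorem IsHomog.id : IsHomog gr gr 0 0 LinearMap.id := by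
  intro n c x hx
  simpa using hx

theorem IsHomog.cast {a a' : ℤ} {b b' : ZMod 2} {f : M →ₗ[R] N}
    (hf : IsHomog gr gr' a b f) (ha : a = a') (hb : b = b') : IsHomog gr gr' a' b' f := by
  subst ha hb; exact hf

/-- The sign `(-1)^c` for `c` in `ℤ/2`. -/
def sgn2 (c : ZMod 2) : ℤ := if c = 0 then 1 else -1

theorem sgn2_add (b c : ZMod 2) : sgn2 (b + c) = sgn2 b * sgn2 c := by
  revert b c; decide

/-- The sign `(-1)^n`. -/
def intSign (n : ℤ) : ℤ := sgn2 (n : ZMod 2)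

theorem intSign_add (m n : ℤ) : intSign (m + n) = intSign m * intSign n := by
  simp [intSign, sgn2_add]

theorem sgn2_sq (b : ZMod 2) : sgn2 b * sgn2 b = 1 := by revert b; decide

/-- The sign `(-1)^i` of the internal degree, as an operator. -/
def tau (h : DirectSum.IsInternal gr) : M →ₗ[R] M := scaleBy h fun q => intSign q.2
/-- The sign `(-1)^n` of the homological degree, as an operator. -/
def sigma (h : DirectSum.IsInternal gr) : M →ₗ[R] M := scaleBy h fun q => intSign q.1

variable (h : DirectSum.IsInternal gr) (h' : DirectSum.IsInternal gr')

theorem tau_par {n : ℤ} {c : ZMod 2} {x : M} (hx : x ∈ par gr n c) : tau h x = sgn2 c • x := by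
  have : par gr n c ≤ LinearMap.eqLocus (tau h) (sgn2 c • LinearMap.id) := by
    refine par_le ?_
    rintro i rfl y hy
    simp [LinearMap.mem_eqLocus, tau, scaleBy_of_mem h _ hy, intSign]
  simpa using this hx

theorem sigma_par {n : ℤ} {c : ZMod 2} {x : M} (hx : x ∈ par gr n c) :
    sigma h x = intSign n • x := by
  have : par gr n c ≤ LinearMap.eqLocus (sigma h) (intSign n • LinearMap.id) := by
    refine par_le ?_
    rintro i rfl y hy
    simp [LinearMap.mem_eqLocus, sigma, scaleBy_of_mem h _ hy]
  simpa using this hx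

theorem tau_homog : IsHomog gr gr 0 0 (tau h) := by
  intro n c x hx
  rw [tau_par h hx]
  simpa using zsmul_mem hx _

theorem sigma_homog : IsHomog gr gr 0 0 (sigma h) := by
  intro n c x hx
  rw [sigma_par h hx]
  simpa using zsmul_mem hx _

theorem ext_par (h : DirectSum.IsInternal gr) {f g : M →ₗ[R] N} (hfg : ∀ n c, ∀ x ∈ par gr n c, f x = g x) : f = g :=
  ext_of_isInternal h fun i x hx => hfg i.1 i.2 x (mem_par hx)

theorem IsHomog.tau_apply {a : ℤ} {b : ZMod 2} {f : M →ₗ[R] N} (hf : IsHomog gr gr' a b f)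
    (x : M) : f (tau h x) = sgn2 b • tau h' (f x) := by
  have : f ∘ₗ tau h = sgn2 b • (tau h' ∘ₗ f) := by
    refine ext_par h fun n c y hy => ?_
    simp only [LinearMap.comp_apply, LinearMap.smul_apply, tau_par h hy, tau_par h' (hf n c y hy),
      map_zsmul, smul_smul, sgn2_add]
    rw [mul_left_comm, sgn2_sq, mul_one]
  exact congrArg (fun g => g x) this

theorem intSign_sq (b : ℤ) : intSign b * intSign b = 1 := sgn2_sq _

theorem IsHomog.sigma_apply {a : ℤ} {b : ZMod 2} {f : M →ₗ[R] N} (hf : IsHomog gr gr' a b f)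
    (x : M) : f (sigma h x) = intSign a • sigma h' (f x) := by
  have : f ∘ₗ sigma h = intSign a • (sigma h' ∘ₗ f) := by
    refine ext_par h fun n c y hy => ?_
    simp only [LinearMap.comp_apply, LinearMap.smul_apply, sigma_par h hy,
      sigma_par h' (hf n c y hy), map_zsmul, smul_smul, intSign_add]
    rw [mul_left_comm, intSign_sq, mul_one]
  exact congrArg (fun g => g x) this

theorem tau_tau (x : M) : tau h (tau h x) = x := by
  have : tau h ∘ₗ tau h = LinearMap.id := by
    refine ext_par h fun n c y hy => ?_
    simp only [LinearMap.comp_apply, tau_par h hy, map_zsmul, smul_smul, sgn2_sq]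
    simp
  exact congrArg (fun g => g x) this

theorem sigma_sigma (x : M) : sigma h (sigma h x) = x := by
  have : sigma h ∘ₗ sigma h = LinearMap.id := by
    refine ext_par h fun n c y hy => ?_
    simp only [LinearMap.comp_apply, sigma_par h hy, map_zsmul, smul_smul, intSign_sq]
    simp
  exact congrArg (fun g => g x) this

end Par

section TensorGrading

variable {R S N M N' M' : Type*} [CommRing R] [CommRing S] [Algebra S R]
  [AddCommGroup N] [Module R N] [Module S N] [IsScalarTower S R N] [AddCommGroup M] [Module S M]
  [AddCommGroup N'] [Module R N'] [Module S N'] [IsScalarTower S R N']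
  [AddCommGroup M'] [Module S M']

variable (gr : ℤ × ℤ → Submodule R N) (gr' : ℤ × ℤ → Submodule S M)
variable (hr : ℤ × ℤ → Submodule R N') (hr' : ℤ × ℤ → Submodule S M')

/-- The total grading on a tensor product: degree `q` is spanned by the `x ⊗ y` with
`deg x + deg y = q`. -/
def tensorGr (q : ℤ × ℤ) : Submodule R (N ⊗[S] M) :=
  Submodule.span R {z | ∃ a b, a + b = q ∧ ∃ x ∈ gr a, ∃ y ∈ gr' b, z = x ⊗ₜ[S] y}

variable {gr gr' hr hr'}

theorem tmul_mem_tensorGr {a b : ℤ × ℤ} {x : N} {y : M} (hx : x ∈ gr a) (hy : y ∈ gr' b) :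
    x ⊗ₜ[S] y ∈ tensorGr gr gr' (a + b) :=
  Submodule.subset_span ⟨a, b, rfl, x, hx, y, hy, rfl⟩

theorem tensorGr_internal (h : DirectSum.IsInternal gr) (h' : DirectSum.IsInternal gr') :
    DirectSum.IsInternal (tensorGr gr gr') := by
  let D : N ⊗[S] M →ₗ[S] (ℤ × ℤ →₀ N ⊗[S] M) :=
    Finsupp.lmapDomain (N ⊗[S] M) S (fun q : (ℤ × ℤ) × (ℤ × ℤ) => q.1 + q.2) ∘ₗ
    (finsuppTensorFinsupp S S N M (ℤ × ℤ) (ℤ × ℤ)).toLinearMap ∘ₗ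
    TensorProduct.map ((components h).restrictScalars S) (components h')
  refine isInternal_of_coaction _ ?_ D.toAddMonoidHom ?_
  · rw [Submodule.eq_top_iff']
    intro z
    induction z with
    | zero => exact zero_mem _
    | add x y hx hy => exact add_mem hx hy
    | tmul x y =>
      have hx : x ∈ ⨆ i, gr i := by rw [h.submodule_iSup_eq_top]; trivial
      have hy : y ∈ ⨆ i, gr' i := by rw [h'.submodule_iSup_eq_top]; trivial
      induction hx using Submodule.iSup_induction' with
      | zero => simp
      | add a b _ _ ha hb => rw [add_tmul]; exact add_mem ha hb
      | mem i x hx =>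
        induction hy using Submodule.iSup_induction' with
        | zero => simp
        | add a b _ _ ha hb => rw [tmul_add]; exact add_mem ha hb
        | mem j y hy => exact Submodule.mem_iSup_of_mem _ (tmul_mem_tensorGr hx hy)
  · intro q z hz
    have hD : ∀ (r : R) z, D (r • z) = r • D z := by
      intro r z
      induction z with
      | zero => simp
      | add x y hx hy => simp only [smul_add, map_add, hx, hy]
      | tmul x y =>
        have hx : x ∈ ⨆ i, gr i := by rw [h.submodule_iSup_eq_top]; trivial
        have hy : y ∈ ⨆ i, gr' i := by rw [h'.submodule_iSup_eq_top]; trivial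
        induction hx using Submodule.iSup_induction' with
        | zero => simp
        | add a b _ _ ha hb => simp only [add_tmul, smul_add, map_add, ha, hb]
        | mem i x hx =>
          induction hy using Submodule.iSup_induction' with
          | zero => simp
          | add a b _ _ ha hb => simp only [tmul_add, smul_add, map_add, ha, hb]
          | mem j y hy =>
            rw [smul_tmul']
            simp [D, components_of_mem h hx, components_of_mem h ((gr i).smul_mem r hx),
              components_of_mem h' hy, Finsupp.mapDomain_single, smul_tmul']
    change D z = _
    induction hz using Submodule.span_induction with
    | zero => simp
    | add x y _ _ hx hy => simp [hx, hy]
    | smul r x _ hx => rw [hD, hx, Finsupp.smul_single]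
    | mem z hz =>
      obtain ⟨a, b, rfl, x, hx, y, hy, rfl⟩ := hz
      simp [D, components_of_mem h hx, components_of_mem h' hy, Finsupp.mapDomain_single]

theorem tmul_mem_left {A : Submodule R N} {P : Submodule R (N ⊗[S] M)} {y : M}
    (h : A ≤ P.comap ((AlgebraTensorModule.mk S R N M).flip y)) {x : N} (hx : x ∈ A) :
    x ⊗ₜ[S] y ∈ P := h hx

theorem tmul_mem_par {n m : ℤ} {b c : ZMod 2} {x : N} {y : M} (hx : x ∈ par gr n b)
    (hy : y ∈ par gr' m c) : x ⊗ₜ[S] y ∈ par (tensorGr gr gr') (n + m) (b + c) := by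
  refine tmul_mem_left (par_le ?_) hx
  rintro i rfl x hx
  change x ⊗ₜ[S] y ∈ par (tensorGr gr gr') (n + m) (i + c)
  have key : par gr' m c ≤ ((par (tensorGr gr gr') (n + m) (i + c)).restrictScalars S).comap
      (TensorProduct.mk S N M x) := by
    refine par_le ?_
    rintro j rfl y hy
    have hxy := tmul_mem_tensorGr (S := S) hx hy
    rw [Prod.mk_add_mk] at hxy
    have := mem_par hxy
    rwa [Int.cast_add] at this
  exact key hy

theorem IsHomog.tensor {a a' : ℤ} {b b' : ZMod 2} {f : N →ₗ[R] N'} {g : M →ₗ[S] M'}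
    (hf : IsHomog gr hr a b f) (hg : IsHomog gr' hr' a' b' g) :
    IsHomog (tensorGr gr gr') (tensorGr hr hr') (a + a') (b + b')
      (TensorProduct.AlgebraTensorModule.map f g) := by
  refine IsHomog.of_gr fun n i z hz => ?_
  induction hz using Submodule.span_induction with
  | zero => simp
  | add x y _ _ hx hy => rw [map_add]; exact add_mem hx hy
  | smul r x _ hx => rw [map_smul]; exact Submodule.smul_mem _ _ hx
  | mem z hz =>
    obtain ⟨⟨n1, i1⟩, ⟨n2, i2⟩, hq, x, hx, y, hy, rfl⟩ := hz
    obtain ⟨rfl, rfl⟩ := Prod.mk.inj hq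
    rw [TensorProduct.AlgebraTensorModule.map_tmul]
    have := tmul_mem_par (S := S) (hf _ _ _ (mem_par hx)) (hg _ _ _ (mem_par hy))
    rw [add_add_add_comm, add_add_add_comm (i1 : ZMod 2)] at this
    simpa using this

theorem tensorGr_le {q : ℤ × ℤ} {P : Submodule R (N ⊗[S] M)}
    (h : ∀ a b, a + b = q → ∀ x ∈ gr a, ∀ y ∈ gr' b, x ⊗ₜ[S] y ∈ P) :
    tensorGr gr gr' q ≤ P := by
  refine Submodule.span_le.2 ?_
  rintro _ ⟨a, b, hq, x, hx, y, hy, rfl⟩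
  exact h a b hq x hx y hy

theorem tensor_ext {P : Type*} [AddCommGroup P] {f g : N ⊗[S] M → P}
    (hf : ∀ a b, f (a + b) = f a + f b) (hg : ∀ a b, g (a + b) = g a + g b)
    (h : ∀ x y, f (x ⊗ₜ[S] y) = g (x ⊗ₜ[S] y)) (z : N ⊗[S] M) : f z = g z := by
  induction z with
  | zero =>
    have h1 := hf 0 0
    have h2 := hg 0 0
    simp at h1 h2
    rw [h1, h2]
  | add a b ha hb => rw [hf, hg, ha, hb]
  | tmul x y => exact h x y

/-- The map `f ⊗ g`. -/
abbrev tMap (f : N →ₗ[R] N') (g : M →ₗ[S] M') : N ⊗[S] M →ₗ[R] N' ⊗[S] M' :=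
  TensorProduct.AlgebraTensorModule.map f g

/-- The operator `a ⊗ 1 + s ⊗ b`; with `s` a sign operator it is the differential of a tensor
product. -/
def tOp (a s : N →ₗ[R] N) (b : M →ₗ[S] M) : N ⊗[S] M →ₗ[R] N ⊗[S] M :=
  tMap a LinearMap.id + tMap s b

theorem tOp_tmul (a s : N →ₗ[R] N) (b : M →ₗ[S] M) (x : N) (y : M) :
    tOp a s b (x ⊗ₜ[S] y) = a x ⊗ₜ[S] y + s x ⊗ₜ[S] b y := by
  simp [tOp]

theorem tOp_add (a a' s : N →ₗ[R] N) (b b' : M →ₗ[S] M) :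
    tOp a s b + tOp a' s b' = tOp (a + a') s (b + b') := by
  refine LinearMap.ext (tensor_ext (fun a b => by simp only [map_add])
    (fun a b => by simp only [map_add]) fun x y => ?_)
  simp only [LinearMap.add_apply, tOp_tmul, add_tmul, tmul_add]
  abel

theorem tOp_comm {f : N →ₗ[R] N'} {g : M →ₗ[S] M'} {a s : N →ₗ[R] N} {b : M →ₗ[S] M}
    {a' s' : N' →ₗ[R] N'} {b' : M' →ₗ[S] M'} (h1 : ∀ x, f (a x) = a' (f x))
    (h2 : ∀ x, f (s x) = s' (f x)) (h3 : ∀ y, g (b y) = b' (g y)) (z : N ⊗[S] M) :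
    tMap f g (tOp a s b z) = tOp a' s' b' (tMap f g z) := by
  revert z
  refine tensor_ext (fun a b => by simp only [map_add]) (fun a b => by simp only [map_add]) ?_
  intro x y
  simp only [tOp_tmul, map_add, TensorProduct.AlgebraTensorModule.map_tmul, h1, h2, h3]

theorem tOp_sq {r : R} {t : S} {a s : N →ₗ[R] N} {b : M →ₗ[S] M} (h1 : ∀ x, a (a x) = r • x)
    (h2 : ∀ y, b (b y) = t • y) (h3 : ∀ x, s (a x) = -a (s x)) (h4 : ∀ x, s (s x) = x)
    (z : N ⊗[S] M) : tOp a s b (tOp a s b z) = (r + algebraMap S R t) • z := by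
  revert z
  refine tensor_ext (fun a b => by simp only [map_add]) (fun a b => smul_add _ a b) ?_
  intro x y
  simp only [tOp_tmul, map_add, h1, h2, h3, h4, neg_tmul]
  rw [add_smul, smul_tmul', add_assoc, neg_add_cancel_left, algebraMap_smul, tmul_smul]

theorem tOp_tOp_comm {a s : N →ₗ[R] N} {b : M →ₗ[S] M} {δ σ : N →ₗ[R] N} {δ' : M →ₗ[S] M}
    (h1 : ∀ x, δ (a x) = a (δ x)) (h2 : ∀ x, σ (a x) = a (σ x)) (h3 : ∀ x, s (δ x) = δ (s x))
    (h4 : ∀ x, s (σ x) = σ (s x)) (h5 : ∀ y, δ' (b y) = b (δ' y)) (z : N ⊗[S] M) :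
    tOp δ σ δ' (tOp a s b z) = tOp a s b (tOp δ σ δ' z) := by
  revert z
  refine tensor_ext (fun a b => by simp only [map_add]) (fun a b => by simp only [map_add]) ?_
  intro x y
  simp only [tOp_tmul, map_add, h1, h2, h3, h4, h5]
  abel

theorem tOp_del_sq {d τ δ σ h : N →ₗ[R] N} {d' δ' h' : M →ₗ[S] M}
    (e : ∀ x, δ (δ x) = d (h x) + h (d x)) (e' : ∀ y, δ' (δ' y) = d' (h' y) + h' (d' y))
    (h1 : ∀ x, σ (δ x) = -δ (σ x)) (h2 : ∀ x, σ (σ x) = x) (h3 : ∀ x, τ (d x) = -d (τ x))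
    (h4 : ∀ x, τ (h x) = -h (τ x)) (h5 : ∀ x, τ (τ x) = x) (z : N ⊗[S] M) :
    tOp δ σ δ' (tOp δ σ δ' z) =
      tOp d τ d' (tOp h τ h' z) + tOp h τ h' (tOp d τ d' z) := by
  revert z
  refine tensor_ext (fun a b => by simp only [map_add])
    (fun a b => by simp only [map_add]; abel) ?_
  intro x y
  simp only [tOp_tmul, map_add, e, e', h1, h2, h3, h4, h5, neg_tmul, add_tmul, tmul_add]
  abel

theorem tOp_comm_del {f h : N →ₗ[R] N'} {g h' : M →ₗ[S] M'} {d τ δ σ : N →ₗ[R] N}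
    {d' τ' δ' σ' : N' →ₗ[R] N'} {dM δM : M →ₗ[S] M} {dM' δM' : M' →ₗ[S] M'}
    (e : ∀ x, f (δ x) = δ' (f x) + (d' (h x) + h (d x)))
    (e' : ∀ y, g (δM y) = δM' (g y) + (dM' (h' y) + h' (dM y)))
    (hd : ∀ x, f (d x) = d' (f x)) (hg : ∀ y, g (dM y) = dM' (g y))
    (hτ : ∀ x, f (τ x) = τ' (f x)) (hσ : ∀ x, f (σ x) = σ' (f x))
    (h1 : ∀ x, τ' (h x) = -h (τ x)) (h2 : ∀ x, τ' (d' x) = -d' (τ' x))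
    (h3 : ∀ x, σ' (d' x) = d' (σ' x)) (h4 : ∀ x, τ' (σ' x) = σ' (τ' x))
    (h5 : ∀ x, τ' (τ' x) = x) (z : N ⊗[S] M) :
    tMap f g (tOp δ σ δM z) = tOp δ' σ' δM' (tMap f g z) +
      (tOp d' τ' dM' ((tMap h g + tMap (τ' ∘ₗ σ' ∘ₗ f) h') z) +
        (tMap h g + tMap (τ' ∘ₗ σ' ∘ₗ f) h') (tOp d τ dM z)) := by
  revert z
  refine tensor_ext (fun a b => by simp only [map_add])
    (fun a b => by simp only [map_add]; abel) ?_
  intro x y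
  have h1' : ∀ x, h (τ x) = -τ' (h x) := fun x => by rw [h1, neg_neg]
  simp only [tOp_tmul, map_add, LinearMap.add_apply, TensorProduct.AlgebraTensorModule.map_tmul,
    LinearMap.comp_apply, e, e', hd, hg, hτ, hσ, h1', h2, h3, ← h4, h5, neg_tmul,
    add_tmul, tmul_add]
  abel

theorem tOp_homotopy_left {f f' s h : N →ₗ[R] N'} {g k : M →ₗ[S] M'} {d τ δ σ : N →ₗ[R] N}
    {d' τ' δ' σ' : N' →ₗ[R] N'} {dM δM : M →ₗ[S] M} {dM' δM' : M' →ₗ[S] M'}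
    (e : ∀ x, f x = f' x + (δ' (s x) + s (δ x)) + (d' (h x) + h (d x)))
    (e' : ∀ y, g (δM y) = δM' (g y) + (dM' (k y) + k (dM y)))
    (hs : ∀ x, s (d x) = d' (s x)) (hg : ∀ y, g (dM y) = dM' (g y))
    (h1 : ∀ x, τ' (h x) = -h (τ x)) (h2 : ∀ x, τ' (d' x) = -d' (τ' x))
    (h3 : ∀ x, σ (d x) = d (σ x)) (h4 : ∀ x, σ (τ x) = τ (σ x))
    (h5 : ∀ x, τ' (τ' x) = x) (h6 : ∀ x, σ' (s x) = -s (σ x)) (h7 : ∀ x, s (τ x) = τ' (s x))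
    (z : N ⊗[S] M) :
    tMap f g z = tMap f' g z + (tOp δ' σ' δM' (tMap s g z) + tMap s g (tOp δ σ δM z)) +
      (tOp d' τ' dM' ((tMap h g - tMap (τ' ∘ₗ s ∘ₗ σ) k) z) +
        (tMap h g - tMap (τ' ∘ₗ s ∘ₗ σ) k) (tOp d τ dM z)) := by
  revert z
  refine tensor_ext (fun a b => by simp only [map_add])
    (fun a b => by simp only [map_add]; abel) ?_
  intro x y
  have h1' : ∀ x, h (τ x) = -τ' (h x) := fun x => by rw [h1, neg_neg]
  simp only [tOp_tmul, map_add, map_sub, LinearMap.sub_apply,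
    TensorProduct.AlgebraTensorModule.map_tmul, LinearMap.comp_apply, e, e', hs, hg, h1', h2, h3,
    h4, h5, h6, h7, neg_tmul, add_tmul, tmul_add]
  abel

theorem tOp_homotopy_right {f k : N →ₗ[R] N'} {g g' s h : M →ₗ[S] M'} {d τ δ σ : N →ₗ[R] N}
    {d' τ' δ' σ' : N' →ₗ[R] N'} {dM δM : M →ₗ[S] M} {dM' δM' : M' →ₗ[S] M'}
    (e : ∀ x, g x = g' x + (δM' (s x) + s (δM x)) + (dM' (h x) + h (dM x)))
    (e' : ∀ y, f (δ y) = δ' (f y) + (d' (k y) + k (d y)))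
    (hs : ∀ x, s (dM x) = dM' (s x)) (hf : ∀ y, f (d y) = d' (f y))
    (hτ : ∀ x, f (τ x) = τ' (f x)) (hσ : ∀ x, f (σ x) = σ' (f x))
    (h1 : ∀ x, τ' (k x) = -k (τ x)) (h2 : ∀ x, τ' (d' x) = -d' (τ' x))
    (h3 : ∀ x, σ' (d' x) = d' (σ' x)) (h4 : ∀ x, τ' (σ' x) = σ' (τ' x))
    (h5 : ∀ x, τ' (τ' x) = x) (h6 : ∀ x, σ' (σ' x) = x) (h7 : ∀ x, σ' (δ' x) = -δ' (σ' x))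
    (z : N ⊗[S] M) :
    tMap f g z = tMap f g' z +
      (tOp δ' σ' δM' (tMap (σ' ∘ₗ f) s z) + tMap (σ' ∘ₗ f) s (tOp δ σ δM z)) +
      (tOp d' τ' dM' ((tMap (τ' ∘ₗ f) h - tMap (σ' ∘ₗ k) s) z) +
        (tMap (τ' ∘ₗ f) h - tMap (σ' ∘ₗ k) s) (tOp d τ dM z)) := by
  revert z
  refine tensor_ext (fun a b => by simp only [map_add])
    (fun a b => by simp only [map_add]; abel) ?_
  intro x y
  have h1' : ∀ x, k (τ x) = -τ' (k x) := fun x => by rw [h1, neg_neg]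
  simp only [tOp_tmul, map_add, map_sub, LinearMap.sub_apply,
    TensorProduct.AlgebraTensorModule.map_tmul, LinearMap.comp_apply, e, e', hs, hf, hτ, hσ, h1',
    h2, h3, h4, h5, h6, h7, map_neg, neg_tmul, add_tmul, tmul_add]
  abel

end TensorGrading

/-- A `ℤ`-graded matrix factorization over `R` with potential `w`: a `ℤ`-graded `R`-module with
`d = d₊ + d₋`, where `d₊` and `d₋` have degree `1` and `-1`, such that `d² = w`. -/
structure MF (R : Type u) [CommRing R] (w : R) where
  carrier : Type u
  [grp : AddCommGroup carrier]
  [mod : Module R carrier]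
  gr : ℤ → Submodule R carrier
  internal : DirectSum.IsInternal gr
  dp : carrier →ₗ[R] carrier
  dm : carrier →ₗ[R] carrier
  dp_mem : ∀ i, ∀ x ∈ gr i, dp x ∈ gr (i + 1)
  dm_mem : ∀ i, ∀ x ∈ gr i, dm x ∈ gr (i - 1)
  d_sq : ∀ x, (dp + dm) ((dp + dm) x) = w • x

attribute [instance] MF.grp MF.mod

/-- A complex of matrix factorizations over `R` with potential `w`, with the terms of the complex
assembled into one module: the part of homological degree `n` is the `n`-th term, the second
degree is the internal degree of the matrix factorizations, `d = d₊ + d₋` is the differential of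
the terms, and `del` is the differential of the complex. The terms are regarded as objects of
the homotopy category of matrix factorizations: `del` consists of morphisms of matrix
factorizations (they commute with `d` and preserve the internal degree modulo `2`), and `del²` is
homotopic to `0`. -/
structure MFComplex (R : Type u) [CommRing R] (w : R) where
  carrier : Type u
  [grp : AddCommGroup carrier]
  [mod : Module R carrier]
  gr : ℤ × ℤ → Submodule R carrier
  internal : DirectSum.IsInternal gr
  dp : carrier →ₗ[R] carrier
  dm : carrier →ₗ[R] carrier
  dp_mem : ∀ n i, ∀ x ∈ gr (n, i), dp x ∈ gr (n, i + 1)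
  dm_mem : ∀ n i, ∀ x ∈ gr (n, i), dm x ∈ gr (n, i - 1)
  d_sq : ∀ x, (dp + dm) ((dp + dm) x) = w • x
  del : carrier →ₗ[R] carrier
  del_homog : IsHomog gr gr 1 0 del
  del_comm : ∀ x, del ((dp + dm) x) = (dp + dm) (del x)
  del_sq : ∃ h : carrier →ₗ[R] carrier, IsHomog gr gr 2 1 h ∧
    ∀ x, del (del x) = (dp + dm) (h x) + h ((dp + dm) x)

attribute [instance] MFComplex.grp MFComplex.mod

namespace MFComplex

variable {R : Type u} [CommRing R] {w : R}

/-- The total differential of the matrix factorizations. -/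
def d (M : MFComplex R w) : M.carrier →ₗ[R] M.carrier := M.dp + M.dm

theorem d_homog (M : MFComplex R w) : IsHomog M.gr M.gr 0 1 M.d := by
  refine IsHomog.of_gr fun n i x hx => ?_
  refine add_mem ?_ ?_
  · exact mem_par' (i := i + 1) (by simpa using M.dp_mem n i x hx) (by simp)
  · exact mem_par' (i := i - 1) (by simpa using M.dm_mem n i x hx)
      (by simp [sub_eq_add_neg])

theorem d_d (M : MFComplex R w) (x : M.carrier) : M.d (M.d x) = w • x := M.d_sq x

theorem del_d (M : MFComplex R w) (x : M.carrier) : M.del (M.d x) = M.d (M.del x) := M.del_comm x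

/-- A chain map between complexes over the homotopy category of matrix factorizations: in each
homological degree a morphism of matrix factorizations; it commutes with `del` up to homotopy of
morphisms of matrix factorizations. -/
@[ext]
structure PreHom (M N : MFComplex R w) where
  f : M.carrier →ₗ[R] N.carrier
  homog : IsHomog M.gr N.gr 0 0 f
  comm : ∀ x, f (M.d x) = N.d (f x)
  comm_del : ∃ h : M.carrier →ₗ[R] N.carrier, IsHomog M.gr N.gr 1 1 h ∧
    ∀ x, f (M.del x) = N.del (f x) + (N.d (h x) + h (M.d x))

variable {M N P : MFComplex R w}

/-- The identity. -/
def PreHom.id (M : MFComplex R w) : PreHom M M where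
  f := LinearMap.id
  homog := IsHomog.id
  comm _ := rfl
  comm_del := ⟨0, IsHomog.zero _ _, by simp⟩

/-- Composition of chain maps. -/
def PreHom.comp (f : PreHom M N) (g : PreHom N P) : PreHom M P where
  f := g.f ∘ₗ f.f
  homog := (g.homog.comp f.homog).cast (by simp) (by simp)
  comm x := by simp [f.comm, g.comm]
  comm_del := by
    obtain ⟨h, hh, hf⟩ := f.comm_del
    obtain ⟨h', hh', hg⟩ := g.comm_del
    refine ⟨h' ∘ₗ f.f + g.f ∘ₗ h, ((hh'.comp f.homog).cast (by simp) (by simp)).add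
      ((g.homog.comp hh).cast (by simp) (by simp)), fun x => ?_⟩
    simp only [LinearMap.comp_apply, LinearMap.add_apply, hf, map_add, hg, g.comm, f.comm]
    abel

/-- Two chain maps are equal in the homotopy category of complexes over the homotopy category of
matrix factorizations: `f - g = (del s + s del) + (d h + h d)`, where `s` is a chain homotopy made
of morphisms of matrix factorizations, and `h` is a homotopy of morphisms of matrix
factorizations. -/
def Homotopic (f g : PreHom M N) : Prop :=
  ∃ s h : M.carrier →ₗ[R] N.carrier,
    IsHomog M.gr N.gr (-1) 0 s ∧ (∀ x, s (M.d x) = N.d (s x)) ∧ IsHomog M.gr N.gr 0 1 h ∧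
    ∀ x, f.f x = g.f x + (N.del (s x) + s (M.del x)) + (N.d (h x) + h (M.d x))

theorem Homotopic.refl (f : PreHom M N) : Homotopic f f :=
  ⟨0, 0, IsHomog.zero _ _, by simp, IsHomog.zero _ _, by simp⟩

theorem Homotopic.symm {f g : PreHom M N} : Homotopic f g → Homotopic g f := by
  rintro ⟨s, h, hs, hsd, hh, e⟩
  refine ⟨-s, -h, hs.neg, by simp [hsd], hh.neg, fun x => ?_⟩
  simp only [e, LinearMap.neg_apply, map_neg]
  abel

theorem Homotopic.trans {f g k : PreHom M N} : Homotopic f g → Homotopic g k → Homotopic f k := by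
  rintro ⟨s, h, hs, hsd, hh, e⟩ ⟨s', h', hs', hsd', hh', e'⟩
  refine ⟨s + s', h + h', hs.add hs', by simp [hsd, hsd'], hh.add hh', fun x => ?_⟩
  simp only [e, e', LinearMap.add_apply, map_add]
  abel

theorem Homotopic.comp_right {f f' : PreHom M N} (H : Homotopic f f') (g : PreHom N P) :
    Homotopic (f.comp g) (f'.comp g) := by
  obtain ⟨s, h, hs, hsd, hh, e⟩ := H
  obtain ⟨h', hh', hg⟩ := g.comm_del
  refine ⟨g.f ∘ₗ s, g.f ∘ₗ h + h' ∘ₗ s, (g.homog.comp hs).cast (by simp) (by simp),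
    by simp [hsd, g.comm], ((g.homog.comp hh).cast (by simp) (by simp)).add
      ((hh'.comp hs).cast (by simp) (by simp)), fun x => ?_⟩
  simp only [PreHom.comp, LinearMap.comp_apply, LinearMap.add_apply, e, map_add, hg, g.comm, hsd]
  abel

theorem Homotopic.comp_left (f : PreHom M N) {g g' : PreHom N P} (H : Homotopic g g') :
    Homotopic (f.comp g) (f.comp g') := by
  obtain ⟨s, h, hs, hsd, hh, e⟩ := H
  obtain ⟨h', hh', hf⟩ := f.comm_del
  refine ⟨s ∘ₗ f.f, h ∘ₗ f.f - s ∘ₗ h', (hs.comp f.homog).cast (by simp) (by simp),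
    by simp [hsd, f.comm], ?_, fun x => ?_⟩
  · rw [sub_eq_add_neg]
    exact ((hh.comp f.homog).cast (by simp) (by simp)).add
      ((hs.comp hh').cast (by simp) (by simp)).neg
  simp only [PreHom.comp, LinearMap.comp_apply, LinearMap.sub_apply, e, map_add, map_sub, hf,
    f.comm, hsd]
  abel

/-- Chain maps up to homotopy. -/
instance homSetoid (M N : MFComplex R w) : Setoid (PreHom M N) where
  r := Homotopic
  iseqv := ⟨Homotopic.refl, Homotopic.symm, Homotopic.trans⟩

/-- The homotopy category `K(hmf)` of complexes over the homotopy category of matrix factorizations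
over `R` with potential `w`. -/
instance : Category (MFComplex R w) where
  Hom M N := Quotient (homSetoid M N)
  id M := Quotient.mk _ (PreHom.id M)
  comp := Quotient.map₂ PreHom.comp fun _ f' hf g _ hg =>
    (hf.comp_right g).trans (Homotopic.comp_left f' hg)
  id_comp f := by induction f using Quotient.inductionOn; rfl
  comp_id f := by induction f using Quotient.inductionOn; rfl
  assoc f g h := by
    induction f using Quotient.inductionOn
    induction g using Quotient.inductionOn
    induction h using Quotient.inductionOn
    rfl

section Tensor

variable {S : Type u} [CommRing S] [Algebra S R] {w' : S} {w'' : R}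

/-- Restriction of scalars along `S → R`. -/
instance (priority := 10) modS (N : MFComplex R w) : Module S N.carrier :=
  Module.compHom N.carrier (algebraMap S R)

instance (priority := 10) towerS (N : MFComplex R w) : IsScalarTower S R N.carrier where
  smul_assoc s r x := by
    rw [Algebra.smul_def, mul_smul]; rfl

theorem tau_mem {M : Type*} [AddCommGroup M] [Module R M] {gr : ℤ × ℤ → Submodule R M}
    (h : DirectSum.IsInternal gr) {q : ℤ × ℤ} {x : M} (hx : x ∈ gr q) : tau h x ∈ gr q := by
  rw [tau, scaleBy_of_mem h _ hx]
  exact zsmul_mem hx _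

theorem tau_d (N : MFComplex R w) (x : N.carrier) :
    tau N.internal (N.d x) = - N.d (tau N.internal x) := by
  rw [N.d_homog.tau_apply N.internal N.internal]
  simp [sgn2]

theorem sigma_d (N : MFComplex R w) (x : N.carrier) :
    sigma N.internal (N.d x) = N.d (sigma N.internal x) := by
  rw [N.d_homog.sigma_apply N.internal N.internal]
  simp [intSign, sgn2]

theorem sigma_del (N : MFComplex R w) (x : N.carrier) :
    sigma N.internal (N.del x) = - N.del (sigma N.internal x) := by
  rw [N.del_homog.sigma_apply N.internal N.internal]
  simp [intSign, sgn2]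

theorem tau_del (N : MFComplex R w) (x : N.carrier) :
    tau N.internal (N.del x) = N.del (tau N.internal x) := by
  rw [N.del_homog.tau_apply N.internal N.internal]
  simp [sgn2]

theorem tau_sigma (N : MFComplex R w) (x : N.carrier) :
    tau N.internal (sigma N.internal x) = sigma N.internal (tau N.internal x) := by
  rw [(tau_homog N.internal).sigma_apply N.internal N.internal]
  simp [intSign, sgn2]

/-- The tensor product `N ⊗_S M` over a ring homomorphism `S → R`, a complex of matrix
factorizations over `R`; the potentials are added, and the signs are the usual ones:
`d (x ⊗ y) = d x ⊗ y + (-1)^i x ⊗ d y` for `x` of internal degree `i`, and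
`del (x ⊗ y) = del x ⊗ y + (-1)^n x ⊗ del y` for `x` of homological degree `n`. -/
def tensor (hw : w'' = w + algebraMap S R w') (N : MFComplex R w) (M : MFComplex S w') :
    MFComplex R w'' where
  carrier := N.carrier ⊗[S] M.carrier
  gr := tensorGr N.gr M.gr
  internal := tensorGr_internal N.internal M.internal
  dp := tOp N.dp (tau N.internal) M.dp
  dm := tOp N.dm (tau N.internal) M.dm
  dp_mem n i z hz := by
    revert z
    refine tensorGr_le (P := (tensorGr N.gr M.gr (n, i + 1)).comap _) ?_
    rintro ⟨a, a'⟩ ⟨b, b'⟩ hq x hx y hy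
    obtain ⟨rfl, rfl⟩ := Prod.mk.inj hq
    rw [Submodule.mem_comap, tOp_tmul]
    refine add_mem ?_ ?_
    · have := tmul_mem_tensorGr (S := S) (N.dp_mem _ _ _ hx) hy
      rw [Prod.mk_add_mk, add_right_comm] at this
      exact this
    · have := tmul_mem_tensorGr (S := S) (tau_mem N.internal hx) (M.dp_mem _ _ _ hy)
      rw [Prod.mk_add_mk, ← add_assoc] at this
      exact this
  dm_mem n i z hz := by
    revert z
    refine tensorGr_le (P := (tensorGr N.gr M.gr (n, i - 1)).comap _) ?_
    rintro ⟨a, a'⟩ ⟨b, b'⟩ hq x hx y hy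
    obtain ⟨rfl, rfl⟩ := Prod.mk.inj hq
    rw [Submodule.mem_comap, tOp_tmul]
    refine add_mem ?_ ?_
    · have := tmul_mem_tensorGr (S := S) (N.dm_mem _ _ _ hx) hy
      rw [Prod.mk_add_mk, sub_add_eq_add_sub] at this
      exact this
    · have := tmul_mem_tensorGr (S := S) (tau_mem N.internal hx) (M.dm_mem _ _ _ hy)
      rw [Prod.mk_add_mk, ← add_sub_assoc] at this
      exact this
  d_sq z := by
    rw [tOp_add, hw]
    exact tOp_sq N.d_d M.d_d N.tau_d (tau_tau N.internal) z
  del := tOp N.del (sigma N.internal) M.del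
  del_homog := ((N.del_homog.tensor IsHomog.id).cast (by simp) (by simp)).add
    (((sigma_homog N.internal).tensor M.del_homog).cast (by simp) (by simp))
  del_comm z := by
    rw [tOp_add]
    exact tOp_tOp_comm N.del_d N.sigma_d N.tau_del N.tau_sigma M.del_d z
  del_sq := by
    obtain ⟨h, hh, e⟩ := N.del_sq
    obtain ⟨h', hh', e'⟩ := M.del_sq
    refine ⟨tOp h (tau N.internal) h',
      ((hh.tensor IsHomog.id).cast (by simp) (by simp)).add
        (((tau_homog N.internal).tensor hh').cast (by simp) (by simp)), fun z => ?_⟩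
    rw [tOp_add]
    exact tOp_del_sq e e' N.sigma_del (sigma_sigma N.internal) N.tau_d
      (fun x => by rw [hh.tau_apply N.internal N.internal]; simp [sgn2]) (tau_tau N.internal) z

theorem tensor_d (hw : w'' = w + algebraMap S R w') (N : MFComplex R w)
    (M : MFComplex S w') : (tensor hw N M).d = tOp N.d (tau N.internal) M.d :=
  tOp_add _ _ _ _ _

variable {N N' : MFComplex R w} {M M' : MFComplex S w'}

theorem PreHom.f_tau (f : PreHom N N') (x : N.carrier) :
    f.f (tau N.internal x) = tau N'.internal (f.f x) := by
  rw [f.homog.tau_apply N.internal N'.internal]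
  simp [sgn2]

theorem PreHom.f_sigma (f : PreHom N N') (x : N.carrier) :
    f.f (sigma N.internal x) = sigma N'.internal (f.f x) := by
  rw [f.homog.sigma_apply N.internal N'.internal]
  simp [intSign, sgn2]

theorem tau_odd {a : ℤ} {h : N.carrier →ₗ[R] N'.carrier} (hh : IsHomog N.gr N'.gr a 1 h)
    (x : N.carrier) : tau N'.internal (h x) = -h (tau N.internal x) := by
  rw [hh.tau_apply N.internal N'.internal]
  simp [sgn2]

/-- The tensor product of two chain maps. -/
def tensorHom (hw : w'' = w + algebraMap S R w') (f : PreHom N N') (g : PreHom M M') :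
    PreHom (tensor hw N M) (tensor hw N' M') where
  f := tMap f.f g.f
  homog := (f.homog.tensor g.homog).cast (by simp) (by simp)
  comm z := by
    rw [tensor_d, tensor_d]
    exact tOp_comm f.comm f.f_tau g.comm z
  comm_del := by
    obtain ⟨h, hh, e⟩ := f.comm_del
    obtain ⟨h', hh', e'⟩ := g.comm_del
    refine ⟨tMap h g.f + tMap (tau N'.internal ∘ₗ sigma N'.internal ∘ₗ f.f) h',
      ((hh.tensor g.homog).cast (by simp) (by simp)).add
        ((((tau_homog N'.internal).comp ((sigma_homog N'.internal).comp f.homog)).tensor hh').cast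
          (by simp) (by simp)), fun z => ?_⟩
    rw [tensor_d, tensor_d]
    exact tOp_comm_del e e' f.comm g.comm f.f_tau f.f_sigma (tau_odd hh) N'.tau_d N'.sigma_d
      N'.tau_sigma (tau_tau _) z

theorem tensorHom_left (hw : w'' = w + algebraMap S R w') {f f' : PreHom N N'}
    (H : Homotopic f f') (g : PreHom M M') :
    Homotopic (tensorHom hw f g) (tensorHom hw f' g) := by
  obtain ⟨s, h, hs, hsd, hh, e⟩ := H
  obtain ⟨k, hk, e'⟩ := g.comm_del
  refine ⟨tMap s g.f, tMap h g.f - tMap (tau N'.internal ∘ₗ s ∘ₗ sigma N.internal) k,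
    (hs.tensor g.homog).cast (by simp) (by simp), fun z => ?_, ?_, fun z => ?_⟩
  · rw [tensor_d, tensor_d]
    refine tOp_comm hsd (fun x => ?_) g.comm z
    rw [hs.tau_apply N.internal N'.internal]; simp [sgn2]
  · rw [sub_eq_add_neg]
    exact ((hh.tensor g.homog).cast (by simp) (by simp)).add
      ((((tau_homog N'.internal).comp (hs.comp (sigma_homog N.internal))).tensor hk).cast
        (by simp) (by simp)).neg
  · rw [tensor_d, tensor_d]
    exact tOp_homotopy_left e e' hsd g.comm (tau_odd hh) N'.tau_d N.sigma_d
      (fun x => (N.tau_sigma x).symm) (tau_tau _)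
      (fun x => by rw [hs.sigma_apply N.internal N'.internal]; simp [intSign, sgn2])
      (fun x => by rw [hs.tau_apply N.internal N'.internal]; simp [sgn2]) z

theorem tensorHom_right (hw : w'' = w + algebraMap S R w') (f : PreHom N N') {g g' : PreHom M M'}
    (H : Homotopic g g') : Homotopic (tensorHom hw f g) (tensorHom hw f g') := by
  obtain ⟨s, h, hs, hsd, hh, e⟩ := H
  obtain ⟨k, hk, e'⟩ := f.comm_del
  refine ⟨tMap (sigma N'.internal ∘ₗ f.f) s,
    tMap (tau N'.internal ∘ₗ f.f) h - tMap (sigma N'.internal ∘ₗ k) s,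
    (((sigma_homog N'.internal).comp f.homog).tensor hs).cast (by simp) (by simp), fun z => ?_, ?_,
    fun z => ?_⟩
  · rw [tensor_d, tensor_d]
    refine tOp_comm (fun x => ?_) (fun x => ?_) hsd z
    · simp only [LinearMap.comp_apply, f.comm, sigma_d]
    · simp only [LinearMap.comp_apply, f.f_tau, tau_sigma]
  · rw [sub_eq_add_neg]
    exact ((((tau_homog N'.internal).comp f.homog).tensor hh).cast (by simp) (by simp)).add
      ((((sigma_homog N'.internal).comp hk).tensor hs).cast (by simp) (by simp)).neg
  · rw [tensor_d, tensor_d]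
    exact tOp_homotopy_right e e' hsd f.comm f.f_tau f.f_sigma (tau_odd hk) N'.tau_d N'.sigma_d
      N'.tau_sigma (tau_tau _) (sigma_sigma _) N'.sigma_del z

/-- The tensor product over `S` as a functor on homotopy categories. -/
def tensorFunctor (hw : w'' = w + algebraMap S R w') :
    MFComplex R w × MFComplex S w' ⥤ MFComplex R w'' where
  obj X := tensor hw X.1 X.2
  map {X Y} f := Quotient.map₂ (sa := homSetoid X.1 Y.1) (sb := homSetoid X.2 Y.2)
    (sc := homSetoid (tensor hw X.1 X.2) (tensor hw Y.1 Y.2)) (tensorHom hw)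
    (fun _ f' hf g _ hg => (tensorHom_left hw hf g).trans (tensorHom_right hw f' hg)) f.1 f.2
  map_id X := by
    refine congrArg (Quotient.mk _) (PreHom.ext ?_)
    exact TensorProduct.AlgebraTensorModule.map_id
  map_comp {X Y Z} f g := by
    obtain ⟨f1, f2⟩ := f
    obtain ⟨g1, g2⟩ := g
    induction f1 using Quotient.inductionOn
    induction f2 using Quotient.inductionOn
    induction g1 using Quotient.inductionOn
    induction g2 using Quotient.inductionOn
    refine congrArg (Quotient.mk _) (PreHom.ext ?_)
    exact TensorProduct.AlgebraTensorModule.map_comp _ _ _ _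

end Tensor

section Restrict

variable {S : Type u} [CommRing S] [Algebra S R] {w' : S}

theorem mem_par_restrict (N : MFComplex R w) {n : ℤ} {b : ZMod 2} {x : N.carrier} :
    x ∈ par (fun q => (N.gr q).restrictScalars S) n b ↔ x ∈ par N.gr n b := by
  constructor
  · intro hx
    exact par_le (Q := (par N.gr n b).restrictScalars S)
      (fun i hi x hx => mem_par' (gr := N.gr) hx hi) hx
  · intro hx
    induction hx using Submodule.iSup_induction' with
    | zero => exact zero_mem _
    | add x y _ _ hx hy => exact add_mem hx hy
    | mem i x hx =>
      by_cases hi : (i : ZMod 2) = b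
      · simp only [hi, iSup_pos] at hx
        exact mem_par' (gr := fun q => (N.gr q).restrictScalars S) hx hi
      · simp only [hi, not_false_eq_true, iSup_neg, Submodule.mem_bot] at hx
        rw [hx]; exact zero_mem _

theorem isHomog_restrict {N M : MFComplex R w} {a : ℤ} {b : ZMod 2}
    {f : N.carrier →ₗ[R] M.carrier} (hf : IsHomog N.gr M.gr a b f) :
    IsHomog (fun q => (N.gr q).restrictScalars S) (fun q => (M.gr q).restrictScalars S) a b
      (f.restrictScalars S) := by
  intro n c x hx
  rw [mem_par_restrict] at hx
  exact (mem_par_restrict M).2 (hf n c x hx)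

/-- Restriction of scalars along a ring homomorphism `S → R`. -/
def restrict (hw : algebraMap S R w' = w) (N : MFComplex R w) : MFComplex S w' where
  carrier := N.carrier
  gr q := (N.gr q).restrictScalars S
  internal := by
    refine isInternal_of_coaction _ ?_ (components N.internal).toAddMonoidHom
      fun i x hx => components_of_mem N.internal hx
    rw [Submodule.eq_top_iff']
    intro x
    have hx : x ∈ ⨆ q, N.gr q := by rw [N.internal.submodule_iSup_eq_top]; trivial
    induction hx using Submodule.iSup_induction' with
    | zero => exact zero_mem _
    | add x y _ _ hx hy => exact add_mem hx hy
    | mem q x hx =>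
      exact Submodule.mem_iSup_of_mem (p := fun q => (N.gr q).restrictScalars S) q hx
  dp := N.dp.restrictScalars S
  dm := N.dm.restrictScalars S
  dp_mem := N.dp_mem
  dm_mem := N.dm_mem
  d_sq x := by
    have h : algebraMap S R w' • x = w' • x := algebraMap_smul R w' x
    exact (N.d_sq x).trans (by rw [← h, hw])
  del := N.del.restrictScalars S
  del_homog := (isHomog_restrict N.del_homog)
  del_comm := N.del_comm
  del_sq := by
    obtain ⟨h, hh, e⟩ := N.del_sq
    exact ⟨h.restrictScalars S, (isHomog_restrict hh), e⟩

/-- Restriction of scalars of a chain map. -/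
def restrictHom (hw : algebraMap S R w' = w) {N M : MFComplex R w} (f : PreHom N M) :
    PreHom (restrict hw N) (restrict hw M) where
  f := f.f.restrictScalars S
  homog := (isHomog_restrict f.homog)
  comm := f.comm
  comm_del := by
    obtain ⟨h, hh, e⟩ := f.comm_del
    exact ⟨h.restrictScalars S, (isHomog_restrict hh), e⟩

/-- Restriction of scalars along `S → R`, as a functor on homotopy categories. -/
def restrictFunctor (hw : algebraMap S R w' = w) : MFComplex R w ⥤ MFComplex S w' where
  obj N := restrict hw N
  map {N M} := Quotient.map (sa := homSetoid N M) (sb := homSetoid (restrict hw N) (restrict hw M))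
    (restrictHom hw) fun f g ⟨s, h, hs, hsd, hh, e⟩ =>
      ⟨s.restrictScalars S, h.restrictScalars S, (isHomog_restrict hs), hsd, (isHomog_restrict hh), e⟩
  map_id N := rfl
  map_comp {N M P} f g := by
    induction f using Quotient.inductionOn
    induction g using Quotient.inductionOn
    rfl

end Restrict

section Multi

variable {ι : Type} {S : ι → Type u} [∀ j, CommRing (S j)] [∀ j, Algebra (S j) R]

/-- The potential of `Z ⊗ M_{j₁} ⊗ M_{j₂} ⊗ …`, if `Z` has potential `w` and `M_j` has potential
`w' j`. The head of the list is the last factor. -/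
def foldPot (w : R) (w' : ∀ j, S j) : List ι → R
  | [] => w
  | j :: L => foldPot w w' L + algebraMap (S j) R (w' j)

theorem foldPot_eq (w : R) (w' : ∀ j, S j) (L : List ι) :
    foldPot w w' L = w + (L.map fun j => algebraMap (S j) R (w' j)).sum := by
  induction L with
  | nil => simp [foldPot]
  | cons j L ih => simp only [foldPot, ih, List.map_cons, List.sum_cons]; ring

/-- The functor that sends a family `M_j` to `Z ⊗_{S j₁} M_{j₁} ⊗_{S j₂} M_{j₂} ⊗ …`, where `j` runs
through a list (the head of the list is the last factor). -/
def foldFunctor (Z : MFComplex R w) (w' : ∀ j, S j) :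
    ∀ L : List ι, (∀ j, MFComplex (S j) (w' j)) ⥤ MFComplex R (foldPot w w' L)
  | [] => (Functor.const _).obj Z
  | j :: L => Functor.prod' (foldFunctor Z w' L) (Pi.eval _ j) ⋙ tensorFunctor rfl

end Multi

end MFComplex

namespace MF

variable {R : Type u} [CommRing R] {w : R}

/-- A matrix factorization regarded as a complex concentrated in homological degree `0`. -/
def single (A : MF R w) : MFComplex R w where
  carrier := A.carrier
  gr q := if q.1 = 0 then A.gr q.2 else ⊥
  internal := by
    refine isInternal_of_coaction _ ?_
      (Finsupp.mapDomain.addMonoidHom (fun i : ℤ => ((0 : ℤ), i)) |>.comp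
        (components A.internal).toAddMonoidHom) ?_
    · rw [eq_top_iff, ← A.internal.submodule_iSup_eq_top]
      refine iSup_le fun i => ?_
      refine le_trans ?_ (le_iSup _ ((0 : ℤ), i))
      simp
    · rintro ⟨n, i⟩ x hx
      by_cases hn : n = 0
      · subst hn
        simp only [if_true] at hx
        simp [components_of_mem A.internal hx, Finsupp.mapDomain_single]
      · simp only [hn, if_false, Submodule.mem_bot] at hx
        simp [hx]
  dp := A.dp
  dm := A.dm
  dp_mem n i x hx := by
    by_cases hn : n = 0
    · simp only [hn, if_true] at hx ⊢
      exact A.dp_mem i x hx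
    · simp only [hn, if_false, Submodule.mem_bot] at hx ⊢
      simp [hx]
  dm_mem n i x hx := by
    by_cases hn : n = 0
    · simp only [hn, if_true] at hx ⊢
      exact A.dm_mem i x hx
    · simp only [hn, if_false, Submodule.mem_bot] at hx ⊢
      simp [hx]
  d_sq := A.d_sq
  del := 0
  del_homog := IsHomog.zero _ _
  del_comm := by simp
  del_sq := ⟨0, IsHomog.zero _ _, by simp⟩

/-- Morphisms of matrix factorizations: `R`-linear maps that preserve the grading modulo `2` and
commute with `d`. -/
structure Hom (A B : MF R w) where
  f : A.carrier →ₗ[R] B.carrier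
  even : ∀ i, ∀ x ∈ A.gr i, f x ∈ ⨆ (j : ℤ) (_ : (j : ZMod 2) = (i : ZMod 2)), B.gr j
  comm : ∀ x, f ((A.dp + A.dm) x) = (B.dp + B.dm) (f x)

/-- The grading of the two-term complex. -/
def twoTermGr (A B : MF R w) (s : ℤ) (q : ℤ × ℤ) : Submodule R (A.carrier × B.carrier) :=
  if q.1 = s then (A.gr q.2).prod ⊥
  else if q.1 = s + 1 then (⊥ : Submodule R A.carrier).prod (B.gr q.2)
  else ⊥

theorem mem_twoTermGr_iff {A B : MF R w} {s n i : ℤ} {x : A.carrier × B.carrier} :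
    x ∈ twoTermGr A B s (n, i) ↔
      (n = s ∧ x.1 ∈ A.gr i ∧ x.2 = 0) ∨ (n = s + 1 ∧ x.1 = 0 ∧ x.2 ∈ B.gr i) ∨ x = 0 := by
  unfold twoTermGr
  dsimp only
  split_ifs with h1 h2
  · subst h1
    simp only [Submodule.mem_prod, Submodule.mem_bot, true_and, left_eq_add, one_ne_zero,
      false_and, false_or, iff_self_or]
    rintro rfl
    exact ⟨zero_mem _, rfl⟩
  · simp only [h2, Submodule.mem_prod, Submodule.mem_bot, true_and]
    simp only [add_eq_left, one_ne_zero, false_and, false_or, iff_self_or]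
    rintro rfl
    exact ⟨rfl, zero_mem _⟩
  · simp [h1, h2]

theorem inl_mem_twoTermGr {A B : MF R w} {s i : ℤ} {x : A.carrier} (hx : x ∈ A.gr i) :
    (x, (0 : B.carrier)) ∈ twoTermGr A B s (s, i) :=
  mem_twoTermGr_iff.2 (Or.inl ⟨rfl, hx, rfl⟩)

theorem inr_mem_twoTermGr {A B : MF R w} {s i : ℤ} {y : B.carrier} (hy : y ∈ B.gr i) :
    ((0 : A.carrier), y) ∈ twoTermGr A B s (s + 1, i) :=
  mem_twoTermGr_iff.2 (Or.inr (Or.inl ⟨rfl, rfl, hy⟩))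

theorem twoTermGr_internal (A B : MF R w) (s : ℤ) : DirectSum.IsInternal (twoTermGr A B s) := by
  refine isInternal_of_coaction _ ?_
    ((((Finsupp.mapDomain.addMonoidHom fun i : ℤ => (s, i)).comp
        (Finsupp.mapRange.addMonoidHom (LinearMap.inl R A.carrier B.carrier).toAddMonoidHom)).comp
        (components A.internal).toAddMonoidHom).coprod
      (((Finsupp.mapDomain.addMonoidHom fun i : ℤ => (s + 1, i)).comp
        (Finsupp.mapRange.addMonoidHom (LinearMap.inr R A.carrier B.carrier).toAddMonoidHom)).comp
        (components B.internal).toAddMonoidHom)) ?_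
  · rw [Submodule.eq_top_iff']
    have h1 : ∀ x : A.carrier, (x, (0 : B.carrier)) ∈ ⨆ q, twoTermGr A B s q := by
      have : ⨆ i, A.gr i ≤ (⨆ q, twoTermGr A B s q).comap (LinearMap.inl R A.carrier B.carrier) :=
        iSup_le fun i x hx => Submodule.mem_iSup_of_mem (s, i) (inl_mem_twoTermGr hx)
      rw [A.internal.submodule_iSup_eq_top] at this
      exact fun x => this (Submodule.mem_top (x := x))
    have h2 : ∀ y : B.carrier, ((0 : A.carrier), y) ∈ ⨆ q, twoTermGr A B s q := by
      have : ⨆ i, B.gr i ≤ (⨆ q, twoTermGr A B s q).comap (LinearMap.inr R A.carrier B.carrier) :=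
        iSup_le fun i x hx => Submodule.mem_iSup_of_mem (s + 1, i) (inr_mem_twoTermGr hx)
      rw [B.internal.submodule_iSup_eq_top] at this
      exact fun x => this (Submodule.mem_top (x := x))
    rintro ⟨x, y⟩
    have := add_mem (h1 x) (h2 y)
    simpa using this
  · rintro ⟨n, i⟩ ⟨x, y⟩ hx
    rcases mem_twoTermGr_iff.1 hx with ⟨rfl, hx, rfl⟩ | ⟨rfl, rfl, hy⟩ | h
    · simp [components_of_mem A.internal hx, Finsupp.mapDomain_single]
    · simp [components_of_mem B.internal hy, Finsupp.mapDomain_single]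
    · rw [h]; simp

/-- The complex `A → B` given by a morphism `ρ` of matrix factorizations, with `A` in homological
degree `s` and `B` in homological degree `s + 1`. -/
def twoTerm (A B : MF R w) (ρ : Hom A B) (s : ℤ) : MFComplex R w where
  carrier := A.carrier × B.carrier
  gr := twoTermGr A B s
  internal := twoTermGr_internal A B s
  dp := A.dp.prodMap B.dp
  dm := A.dm.prodMap B.dm
  dp_mem n i x hx := by
    rw [mem_twoTermGr_iff] at hx ⊢
    rcases hx with ⟨h, h1, h2⟩ | ⟨h, h1, h2⟩ | h
    · exact Or.inl ⟨h, A.dp_mem _ _ h1, by simp [h2]⟩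
    · exact Or.inr (Or.inl ⟨h, by simp [h1], B.dp_mem _ _ h2⟩)
    · exact Or.inr (Or.inr (by simp [h]))
  dm_mem n i x hx := by
    rw [mem_twoTermGr_iff] at hx ⊢
    rcases hx with ⟨h, h1, h2⟩ | ⟨h, h1, h2⟩ | h
    · exact Or.inl ⟨h, A.dm_mem _ _ h1, by simp [h2]⟩
    · exact Or.inr (Or.inl ⟨h, by simp [h1], B.dm_mem _ _ h2⟩)
    · exact Or.inr (Or.inr (by simp [h]))
  d_sq x := by
    have h1 := A.d_sq x.1
    have h2 := B.d_sq x.2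
    exact Prod.ext h1 h2
  del := LinearMap.inr R _ _ ∘ₗ ρ.f ∘ₗ LinearMap.fst R _ _
  del_homog := by
    refine IsHomog.of_gr fun n i x hx => ?_
    rw [mem_twoTermGr_iff] at hx
    rcases hx with ⟨rfl, h1, h2⟩ | ⟨h, h1, h2⟩ | h
    · have key : (⨆ (j : ℤ) (_ : (j : ZMod 2) = (i : ZMod 2)), B.gr j) ≤
          (par (twoTermGr A B n) (n + 1) (i + 0)).comap (LinearMap.inr R A.carrier B.carrier) := by
        refine iSup_le fun j => iSup_le fun hj y hy => ?_
        exact mem_par' (inr_mem_twoTermGr hy) (by rw [hj, add_zero])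
      exact key (ρ.even i x.1 h1)
    · rw [LinearMap.comp_apply, LinearMap.comp_apply, LinearMap.fst_apply, h1, map_zero, map_zero]
      exact zero_mem _
    · rw [h, map_zero]
      exact zero_mem _
  del_comm x := by
    have := ρ.comm x.1
    refine Prod.ext ?_ this
    simp
  del_sq := ⟨0, IsHomog.zero _ _, by simp⟩

end MF

section Koszul

variable {R : Type u} [CommRing R] {E : Type}

/-- The cohomological grading of the Koszul complex: the `n`-th exterior power is in degree `-n`. -/
def koszulGr (R : Type u) [CommRing R] (E : Type) (i : ℤ) :
    Submodule R (ExteriorAlgebra R (E → R)) :=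
  ⨆ (n : ℕ) (_ : -(n : ℤ) = i), ⋀[R]^n (E → R)

theorem mem_koszulGr {n : ℕ} {v : ExteriorAlgebra R (E → R)} (hv : v ∈ ⋀[R]^n (E → R)) :
    v ∈ koszulGr R E (-(n : ℤ)) :=
  Submodule.mem_iSup_of_mem n (Submodule.mem_iSup_of_mem rfl hv)

theorem koszulGr_le {i : ℤ} {Q : Submodule R (ExteriorAlgebra R (E → R))}
    (h : ∀ n : ℕ, -(n : ℤ) = i → ⋀[R]^n (E → R) ≤ Q) : koszulGr R E i ≤ Q :=
  iSup_le fun n => iSup_le fun hn => h n hn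

theorem koszulGr_internal : DirectSum.IsInternal (koszulGr R E) := by
  have hI := DirectSum.Decomposition.isInternal fun n : ℕ => ⋀[R]^n (E → R)
  refine isInternal_of_coaction _ ?_
    ((Finsupp.lmapDomain _ R fun n : ℕ => -(n : ℤ)) ∘ₗ components hI).toAddMonoidHom ?_
  · rw [eq_top_iff, ← hI.submodule_iSup_eq_top]
    exact iSup_le fun n v hv => Submodule.mem_iSup_of_mem _ (mem_koszulGr hv)
  · intro i v hv
    change (Finsupp.lmapDomain _ R (fun n : ℕ => -(n : ℤ)) ∘ₗ components hI) v =
      Finsupp.lsingle (R := R) i v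
    refine koszulGr_le (Q := LinearMap.eqLocus _ (Finsupp.lsingle (R := R) i)) ?_ hv
    rintro n rfl v hv
    simp [LinearMap.mem_eqLocus, components_of_mem hI hv, Finsupp.mapDomain_single]

theorem contractLeft_mem (φ : Module.Dual R (E → R)) (n : ℕ) :
    ∀ v ∈ ⋀[R]^n (E → R),
      CliffordAlgebra.contractLeft (Q := (0 : QuadraticForm R (E → R))) φ v ∈
        koszulGr R E (-(n : ℤ) + 1) := by
  have mul_mem : ∀ (m : E → R) (i : ℤ), ∀ v ∈ koszulGr R E i,
      ExteriorAlgebra.ι R m * v ∈ koszulGr R E (i - 1) := by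
    intro m i v hv
    refine koszulGr_le (Q := (koszulGr R E (i - 1)).comap
      (LinearMap.mulLeft R (ExteriorAlgebra.ι R m))) ?_ hv
    rintro n rfl v hv
    have h1 : ExteriorAlgebra.ι R m * v ∈ ⋀[R]^(n + 1) (E → R) := by
      rw [ExteriorAlgebra.exteriorPower, pow_succ']
      exact Submodule.mul_mem_mul (LinearMap.mem_range_self _ m) hv
    have h2 := mem_koszulGr h1
    rw [Nat.cast_succ, neg_add] at h2
    exact h2
  induction n with
  | zero =>
    intro v hv
    rw [ExteriorAlgebra.exteriorPower, pow_zero, Submodule.mem_one] at hv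
    obtain ⟨r, rfl⟩ := hv
    rw [CliffordAlgebra.contractLeft_algebraMap]
    exact zero_mem _
  | succ n ih =>
    intro v hv
    rw [ExteriorAlgebra.exteriorPower, pow_succ'] at hv
    induction hv using Submodule.mul_induction_on' with
    | add a _ b _ ha hb => rw [map_add]; exact add_mem ha hb
    | mem_mul_mem a ha b hb =>
      obtain ⟨m, rfl⟩ := ha
      have h1 := CliffordAlgebra.contractLeft_ι_mul (Q := (0 : QuadraticForm R (E → R))) (d := φ) m b
      have h2 : φ m • b ∈ koszulGr R E (-((n + 1 : ℕ) : ℤ) + 1) := by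
        have := mem_koszulGr hb
        rw [Nat.cast_succ, neg_add, neg_add_cancel_right]
        exact Submodule.smul_mem _ _ this
      have h3 := mul_mem m _ _ (ih b hb)
      rw [add_sub_cancel_right] at h3
      have h4 := sub_mem h2 (by rw [Nat.cast_succ, neg_add, neg_add_cancel_right]; exact h3)
      rw [← h1] at h4
      exact h4

variable [Fintype E]

/-- The Koszul matrix factorization of the pair of sequences `x`, `y`, that is, the tensor product
of the factorizations `R ⇄ R` with the maps `x e` and `y e`. On the exterior algebra of the free
module on `E`, `d₊` is contraction with `x` (so that `d₊` is the differential of the Koszul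
complex of `x`, with the ring in degree `0`), and `d₋` is exterior multiplication by `y`. -/
def koszul {w : R} (x y : E → R) (h : ∑ e, x e * y e = w) : MF R w where
  carrier := ExteriorAlgebra R (E → R)
  gr := koszulGr R E
  internal := koszulGr_internal
  dp := CliffordAlgebra.contractLeft (Q := (0 : QuadraticForm R (E → R)))
    (∑ e, x e • (LinearMap.proj e : (E → R) →ₗ[R] R))
  dm := LinearMap.mulLeft R (ExteriorAlgebra.ι R y)
  dp_mem i v hv := koszulGr_le (Q := (koszulGr R E (i + 1)).comap
    (CliffordAlgebra.contractLeft (Q := (0 : QuadraticForm R (E → R))) _))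
    (fun n hn v hv => hn ▸ contractLeft_mem _ n v hv) hv
  dm_mem i v hv := by
    refine koszulGr_le (Q := (koszulGr R E (i - 1)).comap
      (LinearMap.mulLeft R (ExteriorAlgebra.ι R y))) ?_ hv
    rintro n rfl v hv
    have h1 : ExteriorAlgebra.ι R y * v ∈ ⋀[R]^(n + 1) (E → R) := by
      rw [ExteriorAlgebra.exteriorPower, pow_succ']
      exact Submodule.mul_mem_mul (LinearMap.mem_range_self _ y) hv
    have h2 := mem_koszulGr h1
    rw [Nat.cast_succ, neg_add] at h2
    exact h2
  d_sq v := by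
    have h1 : (∑ e, x e • (LinearMap.proj e : (E → R) →ₗ[R] R)) y = w := by
      simpa using h
    have h2 := CliffordAlgebra.contractLeft_ι_mul (Q := (0 : QuadraticForm R (E → R)))
      (d := ∑ e, x e • (LinearMap.proj e : (E → R) →ₗ[R] R)) y v
    rw [h1] at h2
    have h3 : ExteriorAlgebra.ι R y * (ExteriorAlgebra.ι R y * v) = 0 := by
      rw [← mul_assoc, ExteriorAlgebra.ι_sq_zero, zero_mul]
    simp only [LinearMap.add_apply, map_add, LinearMap.mulLeft_apply]
    rw [CliffordAlgebra.contractLeft_contractLeft, h3]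
    refine (congrArg (fun t => 0 + _ + (t + 0)) h2).trans ?_
    abel

end Koszul

/-- A finite totally ordered set of marked points with a sign at each point (`true` for `+`): the
boundary of a disk with a base point. -/
structure SignSeq where
  n : ℕ
  sgn : Fin n → Bool

namespace SignSeq

/-- The marked points. -/
abbrev Pt (X : SignSeq) : Type := Fin X.n
/-- The positive points. -/
abbrev Pos (X : SignSeq) : Type := {x : Fin X.n // X.sgn x = true}
/-- The negative points. -/
abbrev Neg (X : SignSeq) : Type := {x : Fin X.n // ¬ X.sgn x = true}

end SignSeq

/-- An oriented arc diagram with holes indexed by `ι`, up to isotopy of arcs: every marked point is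
an end of exactly one oriented arc, and there may be closed loops. On the outer boundary a point is
positive if it is the head of its arc; on the boundary of a hole a point is positive if it is the
tail of its arc (so that the orientations match when a diagram is glued into a hole). Thus
the arcs are a bijection from the set of tails to the set of heads. A planar arc diagram has such a
datum; nothing below depends on the embedding in the plane, and no planarity is required. -/
@[ext]
structure ArcDiagram {ι : Type} (X : ι → SignSeq) (X₀ : SignSeq) where
  arc : X₀.Neg ⊕ (Σ j, (X j).Pos) ≃ X₀.Pos ⊕ (Σ j, (X j).Neg)
  loops : ℕ

/-- The bijection `e`, with the point to be glued next singled out as `none` on both sides. -/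
def traceStep {T H : Type} {n : ℕ} (e : T ⊕ Fin (n + 1) ≃ H ⊕ Fin (n + 1)) :
    Option (T ⊕ Fin n) ≃ Option (H ⊕ Fin n) :=
  let opt (A : Type) : A ⊕ Fin (n + 1) ≃ Option (A ⊕ Fin n) :=
    ((Equiv.sumCongr (Equiv.refl A)
      ((finSuccEquiv n).trans (Equiv.optionEquivSumPUnit.{0, 0} (Fin n)))).trans
        (Equiv.sumAssoc A (Fin n) PUnit).symm).trans (Equiv.optionEquivSumPUnit (A ⊕ Fin n)).symm
  ((opt T).symm.trans e).trans (opt H)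

/-- Gluing: `e` is the bijection from tails to heads given by a set of oriented arcs, and the tail
numbered `i : Fin n` is glued to the head numbered `i`, for all `i`. The result is the bijection
given by the glued arcs with the remaining ends, with the number of closed loops that arise. -/
def trace {T H : Type} : (n : ℕ) → (T ⊕ Fin n ≃ H ⊕ Fin n) → (T ≃ H) × ℕ
  | 0, e => (((Equiv.sumEmpty T (Fin 0)).symm.trans e).trans (Equiv.sumEmpty H (Fin 0)), 0)
  | n + 1, e =>
    ((trace n (traceStep e).removeNone).1,
      (trace n (traceStep e).removeNone).2 + if traceStep e none = none then 1 else 0)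

/-- Reordering the ends of the arcs of a diagram `η` and of diagrams `θ j` placed in its holes: the
ends on the outer boundary of `η` and in the inner holes remain free, and the ends on the boundary
between `η` and `θ j` (points of `P j`) belong either to `η` or to `θ j`. -/
def regroup {ι : Type} {κ : ι → Type} {A : Type} {B B' P : ι → Type} {C : ∀ j, κ j → Type}
    (s : ∀ j, B j ⊕ B' j ≃ P j) :
    (A ⊕ (Σ q : Lex (Σ j, κ j), C (ofLex q).1 (ofLex q).2)) ⊕ (Σ j, P j) ≃
      (A ⊕ Σ j, B j) ⊕ (Σ j, B' j ⊕ Σ l, C j l) :=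
  let c : (Σ q : Lex (Σ j, κ j), C (ofLex q).1 (ofLex q).2) ≃ Σ j, Σ l, C j l :=
    { toFun := fun z => ⟨(ofLex z.1).1, (ofLex z.1).2, z.2⟩
      invFun := fun z => ⟨toLex ⟨z.1, z.2.1⟩, z.2.2⟩
      left_inv := fun _ => rfl
      right_inv := fun _ => rfl }
  let p : (Σ j, P j) ≃ (Σ j, B j) ⊕ Σ j, B' j :=
    (Equiv.sigmaCongrRight fun j => (s j).symm).trans (Equiv.sigmaSumDistrib B B')
  (((Equiv.sumCongr (Equiv.sumCongr (Equiv.refl A) c) p).trans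
    (Equiv.sumSumSumComm A _ _ _)).trans (Equiv.sumCongr (Equiv.refl _) (Equiv.sumComm _ _))).trans
    (Equiv.sumCongr (Equiv.refl _) (Equiv.sigmaSumDistrib _ _).symm)

namespace ArcDiagram

variable {ι : Type} {X : ι → SignSeq} {X₀ : SignSeq}

/-- Composition of arc diagrams: `θ j` is placed in the `j`-th hole of `η`, for all `j`. At every
point of the common boundary exactly one of the two arcs has its head there and the other one has
its tail there, and the two are glued. -/
def comp [Fintype ι] {κ : ι → Type} {Y : ∀ j, κ j → SignSeq} (η : ArcDiagram X X₀)
    (θ : ∀ j, ArcDiagram (Y j) (X j)) :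
    ArcDiagram (fun q : Lex (Σ j, κ j) => Y (ofLex q).1 (ofLex q).2) X₀ :=
  let e := ((regroup (A := X₀.Neg) (C := fun j l => (Y j l).Pos)
        fun j => Equiv.sumCompl fun x => (X j).sgn x = true).trans
      (Equiv.sumCongr η.arc (Equiv.sigmaCongrRight fun j => (θ j).arc))).trans
    (regroup (A := X₀.Pos) (C := fun j l => (Y j l).Neg)
      fun j => (Equiv.sumComm _ _).trans (Equiv.sumCompl fun x => (X j).sgn x = true)).symm
  let m := Fintype.equivFin (Σ j, (X j).Pt)
  let t := trace _ (((Equiv.sumCongr (Equiv.refl _) m.symm).trans e).trans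
    (Equiv.sumCongr (Equiv.refl _) m))
  { arc := t.1
    loops := η.loops + (∑ j, (θ j).loops) + t.2 }

/-- The same diagram with renamed holes. -/
def relabel {ι' : Type} (e : ι' ≃ ι) (η : ArcDiagram X X₀) : ArcDiagram (fun j => X (e j)) X₀ where
  arc := ((Equiv.sumCongr (Equiv.refl _)
      (Equiv.sigmaCongrLeft (β := fun j => (X j).Pos) e)).trans η.arc).trans
    (Equiv.sumCongr (Equiv.refl _) (Equiv.sigmaCongrLeft (β := fun j => (X j).Neg) e)).symm
  loops := η.loops

/-- The variables: one for each marked point on the outer boundary and on the holes, and one for a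
mark on each closed loop. -/
abbrev Var (η : ArcDiagram X X₀) : Type := X₀.Pt ⊕ (Σ j, (X j).Pt) ⊕ Fin η.loops

/-- The arcs, given by their tails, and the closed loops. -/
abbrev Edge (η : ArcDiagram X X₀) : Type := (X₀.Neg ⊕ Σ j, (X j).Pos) ⊕ Fin η.loops

/-- The variable at the tail of an arc. -/
def tail (η : ArcDiagram X X₀) : η.Edge → η.Var
  | .inl (.inl x) => .inl x
  | .inl (.inr x) => .inr (.inl ⟨x.1, x.2⟩)
  | .inr l => .inr (.inr l)

/-- The variable at the head of an arc (for a closed loop, the mark is both head and tail). -/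
def head (η : ArcDiagram X X₀) : η.Edge → η.Var
  | .inl a => (η.arc a).elim (fun x => .inl x.1) (fun x => .inr (.inl ⟨x.1, x.2.1⟩))
  | .inr l => .inr (.inr l)

end ArcDiagram

section Polynomial

variable {k : Type u} [Field k] (p : Polynomial k)

/-- The polynomial `(p(a) - p(b)) / (a - b)`, evaluated at two elements of an algebra, that is,
`∑ c_n (a^{n-1} + a^{n-2} b + ⋯ + b^{n-1})` for `p = ∑ c_n x^n`. -/
def divDiff {A : Type*} [CommRing A] [Algebra k A] (a b : A) : A :=
  p.sum fun n c => algebraMap k A c * ∑ i ∈ Finset.range n, a ^ i * b ^ (n - 1 - i)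

theorem sub_mul_divDiff {A : Type*} [CommRing A] [Algebra k A] (a b : A) :
    (a - b) * divDiff p a b = Polynomial.aeval a p - Polynomial.aeval b p := by
  rw [divDiff, Polynomial.aeval_eq_sum_range, Polynomial.aeval_eq_sum_range,
    Polynomial.sum_over_range _ (by simp), Finset.mul_sum, ← Finset.sum_sub_distrib]
  refine Finset.sum_congr rfl fun n _ => ?_
  rw [mul_left_comm, mul_comm (a - b), geom_sum₂_mul, mul_sub, Algebra.smul_def, Algebra.smul_def]

/-- The polynomial ring with a variable for each marked point. -/
abbrev SignSeq.ring (k : Type u) [Field k] (X : SignSeq) : Type u := MvPolynomial X.Pt k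

/-- The potential `∑ ε_x p(t_x)`. -/
def pot (X : SignSeq) : X.ring k :=
  ∑ x, (if X.sgn x then 1 else -1) * Polynomial.aeval (MvPolynomial.X x : X.ring k) p

theorem pot_eq (X : SignSeq) {A : Type*} [CommRing A] [Algebra k A] (f : X.ring k →ₐ[k] A) :
    f (pot p X) = ∑ x : X.Pos, Polynomial.aeval (f (MvPolynomial.X x.1)) p -
      ∑ x : X.Neg, Polynomial.aeval (f (MvPolynomial.X x.1)) p := by
  have h : ∀ x : X.Pt, f ((if X.sgn x then 1 else -1) *
      Polynomial.aeval (MvPolynomial.X x : X.ring k) p) =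
      (if X.sgn x then 1 else -1) * Polynomial.aeval (f (MvPolynomial.X x)) p := by
    intro x
    rw [map_mul, ← Polynomial.aeval_algHom_apply]
    split_ifs <;> simp
  rw [pot, map_sum, Finset.sum_congr rfl fun x _ => h x,
    ← Equiv.sum_comp (Equiv.sumCompl fun x => X.sgn x = true), Fintype.sum_sum_type,
    sub_eq_add_neg, ← Finset.sum_neg_distrib]
  congr 1
  · exact Finset.sum_congr rfl fun x _ => by simp [x.2]
  · exact Finset.sum_congr rfl fun x _ => by simp [x.2]

namespace ArcDiagram

variable {ι : Type} [Fintype ι] {X : ι → SignSeq} {X₀ : SignSeq} (η : ArcDiagram X X₀)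

/-- The polynomial ring over which the factorization of a diagram is defined. -/
abbrev ring (k : Type u) [Field k] (η : ArcDiagram X X₀) : Type u := MvPolynomial η.Var k

/-- The inclusion of the polynomial ring of the outer boundary. -/
def outer (k : Type u) [Field k] (η : ArcDiagram X X₀) : X₀.ring k →ₐ[k] η.ring k :=
  MvPolynomial.rename Sum.inl

/-- The inclusion of the polynomial ring of the boundary of the `j`-th hole. -/
def hole (k : Type u) [Field k] (η : ArcDiagram X X₀) (j : ι) : (X j).ring k →ₐ[k] η.ring k :=
  MvPolynomial.rename fun x => Sum.inr (Sum.inl ⟨j, x⟩)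

theorem koszul_pot : ∑ e, (MvPolynomial.X (η.head e) - MvPolynomial.X (η.tail e) : η.ring k) *
      divDiff p (MvPolynomial.X (η.head e)) (MvPolynomial.X (η.tail e)) =
    η.outer k (pot p X₀) - ∑ j, η.hole k j (pot p (X j)) := by
  have h := Equiv.sum_comp η.arc fun a : X₀.Pos ⊕ (Σ j, (X j).Neg) =>
    Polynomial.aeval (MvPolynomial.X (a.elim (fun x => .inl x.1)
      (fun x => .inr (.inl ⟨x.1, x.2.1⟩))) : η.ring k) p
  have h1 : ∀ a, η.head (Sum.inl a) = (η.arc a).elim (fun x => .inl x.1)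
      (fun x => .inr (.inl ⟨x.1, x.2.1⟩)) := fun _ => rfl
  have h2 : ∀ l, η.head (Sum.inr l) = η.tail (Sum.inr l) := fun _ => rfl
  simp only [sub_mul_divDiff, pot_eq, Finset.sum_sub_distrib]
  rw [Fintype.sum_sum_type, Fintype.sum_sum_type]
  simp only [Fintype.sum_sum_type, Fintype.sum_sigma, Sum.elim_inl, Sum.elim_inr] at h
  simp only [h1, h2, Fintype.sum_sum_type, Fintype.sum_sigma, tail, outer, hole,
    MvPolynomial.rename_X]
  linear_combination h

/-- The Koszul matrix factorization `Z_η` of the sequences `t_{head} - t_{tail}` and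
`(p(t_{head}) - p(t_{tail})) / (t_{head} - t_{tail})` indexed by the arcs. -/
def Z : MF (η.ring k) (η.outer k (pot p X₀) - ∑ j, η.hole k j (pot p (X j))) :=
  koszul (fun e => MvPolynomial.X (η.head e) - MvPolynomial.X (η.tail e))
    (fun e => divDiff p (MvPolynomial.X (η.head e)) (MvPolynomial.X (η.tail e))) (η.koszul_pot p)

/-- The functor of an arc diagram: the tensor product of `Z_η` with the given complexes over the
polynomial rings of the holes, regarded as a complex over the polynomial ring of the outer
boundary. -/
def functor [LinearOrder ι] :
    (∀ j, MFComplex ((X j).ring k) (pot p (X j))) ⥤ MFComplex (X₀.ring k) (pot p X₀) :=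
  letI : Algebra (X₀.ring k) (η.ring k) := (η.outer k).toRingHom.toAlgebra
  letI : ∀ j, Algebra ((X j).ring k) (η.ring k) := fun j => (η.hole k j).toRingHom.toAlgebra
  MFComplex.foldFunctor (η.Z p).single (fun j => pot p (X j))
      (Finset.univ.sort (fun i j : ι => j ≤ i)) ⋙
    MFComplex.restrictFunctor (by
      rw [MFComplex.foldPot_eq, ← List.sum_toFinset _ (Finset.sort_nodup _ _),
        Finset.sort_toFinset]
      exact (sub_add_cancel _ _).symm)

end ArcDiagram

end Polynomial

/-- The functors `F` that belong to the arc diagrams make the categories `C X` into a canopolis: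
the functor of a composite diagram is naturally isomorphic to the composite of the functors, and
the functors are compatible with renaming and reordering the holes. -/
structure IsCanopolis {C : SignSeq → Type*} [∀ X, Category (C X)]
    (F : ∀ {ι : Type} [Fintype ι] [LinearOrder ι] {X : ι → SignSeq} {X₀ : SignSeq},
      ArcDiagram X X₀ → ((∀ j, C (X j)) ⥤ C X₀)) : Prop where
  comp : ∀ {ι : Type} [Fintype ι] [LinearOrder ι] {κ : ι → Type} [∀ j, Fintype (κ j)]
    [∀ j, LinearOrder (κ j)] {X : ι → SignSeq} {X₀ : SignSeq} {Y : ∀ j, κ j → SignSeq}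
    (η : ArcDiagram X X₀) (θ : ∀ j, ArcDiagram (Y j) (X j)),
    Nonempty (F (η.comp θ) ≅
      Functor.pi' (fun j => Functor.pi' fun l => Pi.eval (fun q : Lex (Σ j, κ j) => C (Y (ofLex q).1 (ofLex q).2))
          (toLex ⟨j, l⟩)) ⋙
        Functor.pi (fun j => F (θ j)) ⋙ F η)
  relabel : ∀ {ι ι' : Type} [Fintype ι] [LinearOrder ι] [Fintype ι'] [LinearOrder ι']
    {X : ι → SignSeq} {X₀ : SignSeq} (e : ι' ≃ ι) (η : ArcDiagram X X₀),
    Nonempty (Functor.pi' (fun j => Pi.eval (fun i => C (X i)) (e j)) ⋙ F (η.relabel e) ≅ F η)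

section Crossing

open MvPolynomial

/-- The boundary of a crossing: the points `i, j, k, l` (numbered `0, 1, 2, 3`), with outgoing
strands at `i, j` and incoming strands at `k, l`. -/
abbrev crossingSeq : SignSeq := ⟨4, ![true, true, false, false]⟩

variable {k : Type u} [Field k]

/-- The sequence `(t_i + t_j - t_k - t_l, t_i t_j - t_k t_l)`. -/
def xSing (k : Type u) [Field k] : Fin 2 → crossingSeq.ring k :=
  ![X (0 : Fin 4) + X (1 : Fin 4) - X (2 : Fin 4) - X (3 : Fin 4),
    X (0 : Fin 4) * X (1 : Fin 4) - X (2 : Fin 4) * X (3 : Fin 4)]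

/-- The sequence `(t_i - t_l, t_j - t_k)`. -/
def xSmooth (k : Type u) [Field k] : Fin 2 → crossingSeq.ring k :=
  ![X (0 : Fin 4) - X (3 : Fin 4), X (1 : Fin 4) - X (2 : Fin 4)]

/-- A choice of the data that enter the complexes of the crossings: Koszul matrix factorizations
`L'` and `L''` on the two sequences with potential `p(t_i) + p(t_j) - p(t_k) - p(t_l)`, and
morphisms `ρ⁺ : L' → L''` and `ρ⁻ : L'' → L'` such that the map induced by `ρ⁺` on `H⁰` of the Koszul
complexes (the quotients of the ring by the sequences) is the projection, and the map induced by
`ρ⁻` is multiplication by `t_i - t_k`. Here `algebraMapInv` is the component of degree `0`. -/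
structure CrossingData (p : Polynomial k) where
  y' : Fin 2 → crossingSeq.ring k
  y'' : Fin 2 → crossingSeq.ring k
  h' : ∑ e, xSing k e * y' e = pot p crossingSeq
  h'' : ∑ e, xSmooth k e * y'' e = pot p crossingSeq
  rhoPos : MF.Hom (koszul (xSing k) y' h') (koszul (xSmooth k) y'' h'')
  rhoNeg : MF.Hom (koszul (xSmooth k) y'' h'') (koszul (xSing k) y' h')
  rhoPos_one : (ExteriorAlgebra.algebraMapInv (rhoPos.f (1 : ExteriorAlgebra _ _)) - 1) ∈
    Ideal.span (Set.range (xSmooth k))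
  rhoNeg_one : (ExteriorAlgebra.algebraMapInv (rhoNeg.f (1 : ExteriorAlgebra _ _)) -
    (X (0 : Fin 4) - X (2 : Fin 4) : crossingSeq.ring k)) ∈ Ideal.span (Set.range (xSing k))

end Crossing

section CrossingData

open MvPolynomial

variable {k : Type u} [Field k] (p : Polynomial k)

theorem pow_sum_mem {R : Type*} [CommRing R] (I : Ideal R) (a b c d : R)
    (h1 : a + b - c - d ∈ I) (h2 : a * b - c * d ∈ I) :
    ∀ n : ℕ, a ^ n + b ^ n - c ^ n - d ^ n ∈ I
  | 0 => by simp
  | 1 => by simpa using h1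
  | n + 2 => by
    have e : a ^ (n + 2) + b ^ (n + 2) - c ^ (n + 2) - d ^ (n + 2) =
        (a + b) * (a ^ (n + 1) + b ^ (n + 1) - c ^ (n + 1) - d ^ (n + 1)) -
          a * b * (a ^ n + b ^ n - c ^ n - d ^ n) +
        ((c ^ (n + 1) + d ^ (n + 1)) * (a + b - c - d) - (c ^ n + d ^ n) * (a * b - c * d)) := by
      ring
    rw [e]
    exact add_mem (sub_mem (Ideal.mul_mem_left _ _ (pow_sum_mem I a b c d h1 h2 (n + 1)))
      (Ideal.mul_mem_left _ _ (pow_sum_mem I a b c d h1 h2 n)))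
      (sub_mem (Ideal.mul_mem_left _ _ h1) (Ideal.mul_mem_left _ _ h2))

theorem pot_crossing_mem : pot p crossingSeq ∈ Ideal.span (Set.range (xSing k)) := by
  have h1 : xSing k 0 ∈ Ideal.span (Set.range (xSing k)) := Ideal.subset_span ⟨0, rfl⟩
  have h2 : xSing k 1 ∈ Ideal.span (Set.range (xSing k)) := Ideal.subset_span ⟨1, rfl⟩
  have e : pot p crossingSeq = p.sum fun n c => algebraMap k _ c *
      ((X (0 : Fin 4)) ^ n + (X (1 : Fin 4)) ^ n - (X (2 : Fin 4)) ^ n - (X (3 : Fin 4)) ^ n) := by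
    simp only [pot, Fin.sum_univ_four, Polynomial.aeval_eq_sum_range]
    rw [Polynomial.sum_over_range _ (by simp)]
    simp only [mul_sub, mul_add, Finset.sum_sub_distrib, Finset.sum_add_distrib, Algebra.smul_def]
    simp [crossingSeq]
    ring
  rw [e]
  exact Submodule.sum_mem _ fun n _ => Ideal.mul_mem_left _ _ (pow_sum_mem _ _ _ _ _ h1 h2 n)

theorem koszul_d_map {R : Type u} [CommRing R] {E F : Type} [Fintype E] [Fintype F] {w : R}
    (A : (E → R) →ₗ[R] (F → R)) {x y : E → R} {x' y' : F → R} (h : ∑ e, x e * y e = w)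
    (h' : ∑ e, x' e * y' e = w) (hx : ∀ v, ∑ e, x' e * A v e = ∑ e, x e * v e) (hy : A y = y')
    (v : ExteriorAlgebra R (E → R)) :
    ExteriorAlgebra.map A (((koszul x y h).dp + (koszul x y h).dm) v) =
      ((koszul x' y' h').dp + (koszul x' y' h').dm) (ExteriorAlgebra.map A v) := by
  have key : ∀ v : ExteriorAlgebra R (E → R), ExteriorAlgebra.map A
      (CliffordAlgebra.contractLeft (Q := (0 : QuadraticForm R (E → R)))
        (∑ e, x e • (LinearMap.proj e : (E → R) →ₗ[R] R)) v) =
      CliffordAlgebra.contractLeft (Q := (0 : QuadraticForm R (F → R)))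
        (∑ e, x' e • (LinearMap.proj e : (F → R) →ₗ[R] R)) (ExteriorAlgebra.map A v) := by
    intro v
    induction v using CliffordAlgebra.left_induction with
    | algebraMap r =>
      rw [CliffordAlgebra.contractLeft_algebraMap]
      refine (map_zero _).trans ?_
      have : ExteriorAlgebra.map A (algebraMap R _ r) = algebraMap R _ r := AlgHom.commutes _ r
      refine Eq.trans ?_ (congrArg _ this.symm)
      exact (CliffordAlgebra.contractLeft_algebraMap (Q := (0 : QuadraticForm R (F → R))) _ r).symm
    | add a b ha hb =>
      have e1 := map_add (ExteriorAlgebra.map A) a b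
      rw [map_add]
      refine (map_add _ _ _).trans ?_
      refine Eq.trans ?_ (congrArg _ e1.symm)
      rw [map_add, ha, hb]
    | ι_mul a m ha =>
      rw [CliffordAlgebra.contractLeft_ι_mul]
      have e1 : ExteriorAlgebra.map A (CliffordAlgebra.ι (0 : QuadraticForm R (E → R)) m * a) =
        CliffordAlgebra.ι (0 : QuadraticForm R (F → R)) (A m) * ExteriorAlgebra.map A a := by
        refine (map_mul _ _ _).trans ?_
        congr 1
        exact ExteriorAlgebra.map_apply_ι A m
      refine Eq.trans ?_ (congrArg _ e1.symm)
      refine Eq.trans ?_ (CliffordAlgebra.contractLeft_ι_mul _ _ _).symm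
      rw [← ha]
      refine (map_sub _ _ _).trans ?_
      congr 1
      · refine (map_smul _ _ _).trans ?_
        congr 1
        simpa using (hx m).symm
      · refine (map_mul _ _ _).trans ?_
        congr 1
        exact ExteriorAlgebra.map_apply_ι A m
  refine (map_add _ _ _).trans ?_
  refine congrArg₂ (· + ·) (key v) ?_
  refine (map_mul _ _ _).trans ?_
  refine congrArg (· * _) ?_
  rw [← hy]
  exact ExteriorAlgebra.map_apply_ι A y

theorem map_mem_koszulGr {R : Type u} [CommRing R] {E F : Type} (A : (E → R) →ₗ[R] (F → R))
    {i : ℤ} {v : ExteriorAlgebra R (E → R)} (hv : v ∈ koszulGr R E i) :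
    ExteriorAlgebra.map A v ∈ koszulGr R F i := by
  refine koszulGr_le (Q := (koszulGr R F i).comap (ExteriorAlgebra.map A).toLinearMap) ?_ hv
  rintro n rfl
  have hn : ⋀[R]^n (F → R) ≤ koszulGr R F (-(n : ℤ)) := fun x hx => mem_koszulGr (n := n) hx
  refine le_trans ?_ (Submodule.comap_mono hn)
  rw [← Submodule.map_le_iff_le_comap]
  rw [ExteriorAlgebra.exteriorPower, ExteriorAlgebra.exteriorPower, Submodule.map_pow]
  refine pow_le_pow_left' ?_ n
  rw [Submodule.map_le_iff_le_comap]
  rintro _ ⟨m, rfl⟩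
  exact ⟨A m, (ExteriorAlgebra.map_apply_ι A m).symm⟩

theorem algebraMapInv_of_mem {R : Type u} [CommRing R] {E : Type} {i : ℤ} (hi : i ≠ 0)
    {v : ExteriorAlgebra R (E → R)} (hv : v ∈ koszulGr R E i) :
    ExteriorAlgebra.algebraMapInv v = 0 := by
  refine koszulGr_le (Q := LinearMap.ker
    (ExteriorAlgebra.algebraMapInv (R := R) (M := E → R)).toLinearMap) ?_ hv
  rintro (_ | n) hn
  · simp at hn; exact absurd hn.symm hi
  · rw [ExteriorAlgebra.exteriorPower, pow_succ']
    intro v hv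
    induction hv using Submodule.mul_induction_on' with
    | add a _ b _ ha hb => exact add_mem ha hb
    | mem_mul_mem a ha b hb =>
      obtain ⟨m, rfl⟩ := ha
      rw [LinearMap.mem_ker]
      refine (map_mul ExteriorAlgebra.algebraMapInv _ _).trans ?_
      rw [show ExteriorAlgebra.algebraMapInv (ExteriorAlgebra.ι R m) = 0 by
        simp [ExteriorAlgebra.algebraMapInv], zero_mul]

section NormalForm

variable {R : Type u} [CommRing R]

/-- The element `r + v₀ e₀ + v₁ e₁ + t e₀ ∧ e₁` of the exterior algebra of `R²`. -/
def nf (r : R) (v : Fin 2 → R) (t : R) : ExteriorAlgebra R (Fin 2 → R) :=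
  algebraMap R _ r + ExteriorAlgebra.ι R v +
    t • (ExteriorAlgebra.ι R ![1, 0] * ExteriorAlgebra.ι R ![0, 1])

theorem ι_eq (v : Fin 2 → R) : ExteriorAlgebra.ι R v =
    v 0 • ExteriorAlgebra.ι R ![1, 0] + v 1 • ExteriorAlgebra.ι R ![0, 1] := by
  rw [← map_smul, ← map_smul, ← map_add]
  congr 1
  ext i; fin_cases i <;> simp

theorem ι_mul_ι (v w : Fin 2 → R) : ExteriorAlgebra.ι R v * ExteriorAlgebra.ι R w =
    (v 0 * w 1 - v 1 * w 0) • (ExteriorAlgebra.ι R ![1, 0] * ExteriorAlgebra.ι R ![0, 1]) := by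
  have h : ExteriorAlgebra.ι R (![0, 1] : Fin 2 → R) * ExteriorAlgebra.ι R ![1, 0] =
      - (ExteriorAlgebra.ι R ![1, 0] * ExteriorAlgebra.ι R ![0, 1]) :=
    eq_neg_of_add_eq_zero_left (ExteriorAlgebra.ι_add_mul_swap _ _)
  rw [ι_eq v, ι_eq w]
  simp only [add_mul, mul_add, smul_mul_smul_comm, ExteriorAlgebra.ι_sq_zero, h, smul_zero]
  module

theorem ι_mul_top (v : Fin 2 → R) : ExteriorAlgebra.ι R v *
    (ExteriorAlgebra.ι R ![1, 0] * ExteriorAlgebra.ι R ![0, 1]) = 0 := by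
  rw [← mul_assoc, ι_mul_ι, smul_mul_assoc, mul_assoc, ExteriorAlgebra.ι_sq_zero]
  simp

theorem ι_mul_nf (m v : Fin 2 → R) (r t : R) :
    ExteriorAlgebra.ι R m * nf r v t = nf 0 (r • m) (m 0 * v 1 - m 1 * v 0) := by
  rw [nf, nf, mul_add, mul_add, mul_smul_comm, ι_mul_top, ι_mul_ι, ← Algebra.commutes,
    ← Algebra.smul_def, map_smul]
  simp

theorem nf_add (r r' t t' : R) (v v' : Fin 2 → R) :
    nf r v t + nf r' v' t' = nf (r + r') (v + v') (t + t') := by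
  simp only [nf, map_add, add_smul]; abel

theorem exists_nf (x : ExteriorAlgebra R (Fin 2 → R)) : ∃ r v t, x = nf r v t := by
  induction x using CliffordAlgebra.left_induction with
  | algebraMap r => exact ⟨r, 0, 0, by simp [nf]⟩
  | add a b ha hb =>
    obtain ⟨r, v, t, rfl⟩ := ha
    obtain ⟨r', v', t', rfl⟩ := hb
    exact ⟨_, _, _, nf_add _ _ _ _ _ _⟩
  | ι_mul a m ha =>
    obtain ⟨r, v, t, rfl⟩ := ha
    exact ⟨_, _, _, ι_mul_nf m v r t⟩

theorem contract_nf (φ : Module.Dual R (Fin 2 → R)) (r t : R) (v : Fin 2 → R) :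
    CliffordAlgebra.contractLeft (Q := (0 : QuadraticForm R (Fin 2 → R))) φ (nf r v t) =
      nf (φ v) (t • ![-φ ![0, 1], φ ![1, 0]]) 0 := by
  have h1 : CliffordAlgebra.contractLeft (Q := (0 : QuadraticForm R (Fin 2 → R))) φ
      (algebraMap R (ExteriorAlgebra R (Fin 2 → R)) r) = 0 :=
    CliffordAlgebra.contractLeft_algebraMap (Q := (0 : QuadraticForm R (Fin 2 → R))) _ r
  have h2 : ∀ v, CliffordAlgebra.contractLeft (Q := (0 : QuadraticForm R (Fin 2 → R))) φ
      (ExteriorAlgebra.ι R v) = algebraMap R (ExteriorAlgebra R (Fin 2 → R)) (φ v) := fun v =>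
    CliffordAlgebra.contractLeft_ι (Q := (0 : QuadraticForm R (Fin 2 → R))) _ v
  have h3 : CliffordAlgebra.contractLeft (Q := (0 : QuadraticForm R (Fin 2 → R))) φ
      (ExteriorAlgebra.ι R ![1, 0] * ExteriorAlgebra.ι R ![0, 1]) =
      φ ![1, 0] • ExteriorAlgebra.ι R ![0, 1] - ExteriorAlgebra.ι R ![1, 0] *
        CliffordAlgebra.contractLeft (Q := (0 : QuadraticForm R (Fin 2 → R))) φ
          (ExteriorAlgebra.ι R ![0, 1]) :=
    CliffordAlgebra.contractLeft_ι_mul (Q := (0 : QuadraticForm R (Fin 2 → R))) _ _ _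
  rw [h2, ← Algebra.commutes, ← Algebra.smul_def] at h3
  simp only [nf]
  rw [map_add, map_add, map_smul, h1, h2, h3, ι_eq (t • ![-φ ![0, 1], φ ![1, 0]])]
  simp
  module

theorem algebraMapInv_nf (r t : R) (v : Fin 2 → R) :
    ExteriorAlgebra.algebraMapInv (nf r v t) = r := by
  simp [nf, ExteriorAlgebra.algebraMapInv]

theorem koszul_d_nf {w : R} (x y : Fin 2 → R) (h : ∑ e, x e * y e = w) (r t : R)
    (v : Fin 2 → R) : ((koszul x y h).dp + (koszul x y h).dm) (nf r v t) =
      nf (x 0 * v 0 + x 1 * v 1) (t • ![-x 1, x 0] + r • y) (y 0 * v 1 - y 1 * v 0) := by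
  refine (congrArg₂ (· + ·) (contract_nf _ r t v) (ι_mul_nf y v r t)).trans ?_
  refine (nf_add _ _ _ _ _ _).trans ?_
  simp

/-- The map that sends `r + v + t e₀ ∧ e₁` to `D r + B v + t e₀ ∧ e₁`. -/
def nfMap (D : R) (B : (Fin 2 → R) →ₗ[R] (Fin 2 → R)) :
    ExteriorAlgebra R (Fin 2 → R) →ₗ[R] ExteriorAlgebra R (Fin 2 → R) :=
  let c : ExteriorAlgebra R (Fin 2 → R) →ₗ[R] R := ExteriorAlgebra.algebraMapInv.toLinearMap
  let f (i : Fin 2) : ExteriorAlgebra R (Fin 2 → R) →ₗ[R] ExteriorAlgebra R (Fin 2 → R) :=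
    CliffordAlgebra.contractLeft (Q := (0 : QuadraticForm R (Fin 2 → R))) (LinearMap.proj i)
  c.smulRight (algebraMap R _ D) +
    ((c ∘ₗ f 0).smulRight (ExteriorAlgebra.ι R (B ![1, 0])) +
      (c ∘ₗ f 1).smulRight (ExteriorAlgebra.ι R (B ![0, 1]))) +
    (c ∘ₗ f 1 ∘ₗ f 0).smulRight (ExteriorAlgebra.ι R ![1, 0] * ExteriorAlgebra.ι R ![0, 1])

theorem nfMap_nf (D : R) (B : (Fin 2 → R) →ₗ[R] (Fin 2 → R)) (r t : R) (v : Fin 2 → R) :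
    nfMap D B (nf r v t) = nf (D * r) (B v) t := by
  have hv : B v = v 0 • B ![1, 0] + v 1 • B ![0, 1] := by
    rw [← map_smul, ← map_smul, ← map_add]
    congr 1
    ext i; fin_cases i <;> simp
  have hc : ∀ r v t, (ExteriorAlgebra.algebraMapInv (R := R) (M := Fin 2 → R)).toLinearMap
    (nf r v t) = r := fun r v t => algebraMapInv_nf r t v
  simp only [nfMap, LinearMap.add_apply, LinearMap.smulRight_apply, LinearMap.comp_apply,
    contract_nf, hc]
  have e : r • algebraMap R (ExteriorAlgebra R (Fin 2 → R)) D = algebraMap R _ (D * r) := by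
    rw [Algebra.smul_def, ← map_mul, mul_comm]
  rw [hv, nf, e, map_add, map_smul, map_smul]
  simp

theorem nfMap_even (D : R) (B : (Fin 2 → R) →ₗ[R] (Fin 2 → R)) (i : ℤ)
    (x : ExteriorAlgebra R (Fin 2 → R)) (hx : x ∈ koszulGr R (Fin 2) i) :
    nfMap D B x ∈ ⨆ (j : ℤ) (_ : (j : ZMod 2) = (i : ZMod 2)), koszulGr R (Fin 2) j := by
  have h1 : ∀ v : Fin 2 → R, ExteriorAlgebra.ι R v ∈ koszulGr R (Fin 2) (-1) := fun v =>
    mem_koszulGr (n := 1) (by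
      rw [ExteriorAlgebra.exteriorPower, pow_one]; exact LinearMap.mem_range_self _ v)
  have h0 : algebraMap R (ExteriorAlgebra R (Fin 2 → R)) D ∈ koszulGr R (Fin 2) 0 :=
    mem_koszulGr (n := 0) (by
      rw [ExteriorAlgebra.exteriorPower, pow_zero]; exact Submodule.algebraMap_mem D)
  have h2 : (ExteriorAlgebra.ι R ![1, 0] * ExteriorAlgebra.ι R ![0, 1] :
      ExteriorAlgebra R (Fin 2 → R)) ∈ koszulGr R (Fin 2) (-2) :=
    mem_koszulGr (n := 2) (by
      rw [ExteriorAlgebra.exteriorPower, pow_two]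
      exact Submodule.mul_mem_mul (LinearMap.mem_range_self _ _) (LinearMap.mem_range_self _ _))
  have hf : ∀ (l : Fin 2) (j : ℤ), ∀ v ∈ koszulGr R (Fin 2) j,
      CliffordAlgebra.contractLeft (Q := (0 : QuadraticForm R (Fin 2 → R)))
        (LinearMap.proj l) v ∈ koszulGr R (Fin 2) (j + 1) := fun l j v hv =>
    koszulGr_le (Q := (koszulGr R (Fin 2) (j + 1)).comap
      (CliffordAlgebra.contractLeft (Q := (0 : QuadraticForm R (Fin 2 → R))) (LinearMap.proj l)))
      (fun n hn v hv => by rw [← hn]; exact contractLeft_mem _ n v hv) hv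
  have mem : ∀ {j : ℤ} {z : ExteriorAlgebra R (Fin 2 → R)}, (j : ZMod 2) = (i : ZMod 2) →
      z ∈ koszulGr R (Fin 2) j →
      z ∈ ⨆ (j : ℤ) (_ : (j : ZMod 2) = (i : ZMod 2)), koszulGr R (Fin 2) j := fun h hz =>
    Submodule.mem_iSup_of_mem _ (Submodule.mem_iSup_of_mem h hz)
  have sm : ∀ {c : ExteriorAlgebra R (Fin 2 → R) →ₗ[R] R} {z : ExteriorAlgebra R (Fin 2 → R)},
      c x = 0 → c.smulRight z x ∈
        ⨆ (j : ℤ) (_ : (j : ZMod 2) = (i : ZMod 2)), koszulGr R (Fin 2) j := by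
    intro c z h
    rw [LinearMap.smulRight_apply, h, zero_smul]
    exact zero_mem _
  simp only [nfMap, LinearMap.add_apply]
  refine add_mem (add_mem ?_ (add_mem ?_ ?_)) ?_
  · by_cases hi : i = 0
    · exact Submodule.smul_mem _ _ (mem (by rw [hi]) h0)
    · exact sm (algebraMapInv_of_mem hi hx)
  · by_cases hi : i = -1
    · exact Submodule.smul_mem _ _ (mem (by rw [hi]) (h1 _))
    · exact sm (algebraMapInv_of_mem (by omega) (hf 0 _ _ hx))
  · by_cases hi : i = -1
    · exact Submodule.smul_mem _ _ (mem (by rw [hi]) (h1 _))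
    · exact sm (algebraMapInv_of_mem (by omega) (hf 1 _ _ hx))
  · by_cases hi : i = -2
    · exact Submodule.smul_mem _ _ (mem (by rw [hi]) h2)
    · exact sm (algebraMapInv_of_mem (by omega)
        (hf 1 _ _ (hf 0 _ _ hx)))

theorem nfMap_comm {w D : R} {B : (Fin 2 → R) →ₗ[R] (Fin 2 → R)} {x y x' y' : Fin 2 → R}
    (h : ∑ e, x e * y e = w) (h' : ∑ e, x' e * y' e = w)
    (h1 : ∀ v, D * (x 0 * v 0 + x 1 * v 1) = x' 0 * B v 0 + x' 1 * B v 1)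
    (h2 : B ![-x 1, x 0] = ![-x' 1, x' 0]) (h3 : B y = D • y')
    (h4 : ∀ v, y 0 * v 1 - y 1 * v 0 = y' 0 * B v 1 - y' 1 * B v 0)
    (v : ExteriorAlgebra R (Fin 2 → R)) :
    nfMap D B (((koszul x y h).dp + (koszul x y h).dm) v) =
      ((koszul x' y' h').dp + (koszul x' y' h').dm) (nfMap D B v) := by
  obtain ⟨r, v, t, rfl⟩ := exists_nf v
  refine (congrArg (nfMap D B) (koszul_d_nf x y h r t v)).trans ?_
  refine Eq.trans ?_ (congrArg _ (nfMap_nf D B r t v).symm)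
  refine Eq.trans ?_ (koszul_d_nf x' y' h' _ _ _).symm
  rw [nfMap_nf, h1, h4, map_add, map_smul, map_smul, h2, h3, smul_smul, mul_comm r D]

end NormalForm

/-- There are such choices for every `p`. -/
instance : Nonempty (CrossingData p) := by
  obtain ⟨y, hy⟩ := Ideal.mem_span_range_iff_exists_fun.1 (pot_crossing_mem p)
  have h' : ∑ e, xSing k e * y e = pot p crossingSeq := by
    rw [← hy]; exact Finset.sum_congr rfl fun _ _ => mul_comm _ _
  let z : Fin 2 → crossingSeq.ring k :=
    ![y 0 + X (1 : Fin 4) * y 1, y 0 + X (3 : Fin 4) * y 1]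
  have h'' : ∑ e, xSmooth k e * z e = pot p crossingSeq := by
    rw [← h']
    simp [Fin.sum_univ_two, xSing, xSmooth, z]
    ring
  let A : (Fin 2 → crossingSeq.ring k) →ₗ[crossingSeq.ring k] (Fin 2 → crossingSeq.ring k) :=
    Matrix.toLin' !![1, X (1 : Fin 4); 1, X (3 : Fin 4)]
  let B : (Fin 2 → crossingSeq.ring k) →ₗ[crossingSeq.ring k] (Fin 2 → crossingSeq.ring k) :=
    Matrix.toLin' !![X (3 : Fin 4), -X (1 : Fin 4); -1, 1]
  refine ⟨⟨y, z, h', h'', ⟨(ExteriorAlgebra.map A).toLinearMap, fun i x hx => ?_, fun x => ?_⟩,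
    ⟨nfMap (X (3 : Fin 4) - X (1 : Fin 4)) B, nfMap_even _ _, fun x => ?_⟩, ?_, ?_⟩⟩
  · exact Submodule.mem_iSup_of_mem i (Submodule.mem_iSup_of_mem rfl (map_mem_koszulGr A hx))
  · refine koszul_d_map A h' h'' (fun v => ?_) ?_ x
    · simp [Fin.sum_univ_two, xSing, xSmooth, A, Matrix.toLin'_apply, Matrix.mulVec, dotProduct]
      ring
    · funext i; fin_cases i <;>
        simp [A, z, Matrix.toLin'_apply, Matrix.mulVec, dotProduct, Fin.sum_univ_two]
  · refine nfMap_comm h'' h' (fun v => ?_) ?_ ?_ (fun v => ?_) x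
    · simp [B, xSing, xSmooth, Matrix.toLin'_apply, Matrix.mulVec, dotProduct, Fin.sum_univ_two]
      ring
    · funext i; fin_cases i <;>
      · simp [B, xSing, xSmooth, Matrix.toLin'_apply, Matrix.mulVec, dotProduct,
          Fin.sum_univ_two]
        ring
    · funext i; fin_cases i <;>
      · simp [B, z, Matrix.toLin'_apply, Matrix.mulVec, dotProduct, Fin.sum_univ_two]
        ring
    · simp [B, z, Matrix.toLin'_apply, Matrix.mulVec, dotProduct, Fin.sum_univ_two]
      ring
  · have h1 : ExteriorAlgebra.algebraMapInv (ExteriorAlgebra.map A 1) = 1 := by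
      rw [map_one, map_one]
    have h2 : ExteriorAlgebra.algebraMapInv (ExteriorAlgebra.map A 1) - 1 ∈
        Ideal.span (Set.range (xSmooth k)) := by
      rw [h1, sub_self]
      exact zero_mem _
    exact h2
  · have h1 : (1 : ExteriorAlgebra (crossingSeq.ring k) (Fin 2 → crossingSeq.ring k)) =
      nf 1 0 0 := by simp [nf]
    have h2 : ExteriorAlgebra.algebraMapInv
        (nfMap (X (3 : Fin 4) - X (1 : Fin 4) : crossingSeq.ring k) B 1) -
          (X (0 : Fin 4) - X (2 : Fin 4)) ∈ Ideal.span (Set.range (xSing k)) := by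
      rw [h1, nfMap_nf, algebraMapInv_nf]
      have h0 : xSing k 0 ∈ Ideal.span (Set.range (xSing k)) := Ideal.subset_span ⟨0, rfl⟩
      convert neg_mem h0 using 1
      simp [xSing]
      ring
    exact h2

end CrossingData

namespace MFComplex

variable {R : Type u} [CommRing R] {w : R}

/-- The cycles of `d` in the part of homological degree `n` and of internal degree `b` modulo `2`. -/
def cycles (M : MFComplex R w) (n : ℤ) (b : ZMod 2) : Submodule R M.carrier :=
  LinearMap.ker M.d ⊓ par M.gr n b

/-- The boundaries of `d` among these cycles. -/
def boundaries (M : MFComplex R w) (n : ℤ) (b : ZMod 2) : Submodule R (M.cycles n b) :=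
  (LinearMap.range M.d).comap (M.cycles n b).subtype

/-- The map on cycles induced by the differential of the complex. -/
def delCycles (M : MFComplex R w) (n : ℤ) (b : ZMod 2) :
    M.cycles n b →ₗ[R] M.cycles (n + 1) b :=
  M.del.restrict fun x hx => by
    have h : M.d x = 0 := hx.1
    have h2 : M.d (M.del x) = 0 := by rw [← M.del_d, h, map_zero]
    exact ⟨h2, by simpa using M.del_homog n b x hx.2⟩

theorem boundaries_le (M : MFComplex R w) (n : ℤ) (b : ZMod 2) :
    M.boundaries n b ≤ (M.boundaries (n + 1) b).comap (M.delCycles n b) := by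
  rintro x ⟨y, hy⟩
  refine ⟨M.del y, ?_⟩
  rw [← M.del_d, hy]
  rfl

/-- For a complex of matrix factorizations with potential `0`: the complex of modules obtained by
taking the total homology `H(C^n, d)` of each term, in degree `b` of its `ℤ/2`-grading. -/
def homologyComplex (M : MFComplex R w) (b : ZMod 2) : CochainComplex (ModuleCat.{u} R) ℤ :=
  CochainComplex.of (fun n => ModuleCat.of R (M.cycles n b ⧸ M.boundaries n b))
    (fun n => ModuleCat.ofHom (Submodule.mapQ _ _ (M.delCycles n b) (M.boundaries_le n b)))
    (fun n => by
      ext x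
      obtain ⟨h, _, e⟩ := M.del_sq
      refine (Submodule.Quotient.mk_eq_zero (M.boundaries (n + 1 + 1) b)
        (x := M.delCycles (n + 1) b (M.delCycles n b x))).2 ⟨h x, ?_⟩
      have h1 : M.d x = 0 := x.2.1
      have h2 := e x
      change M.del (M.del x) = M.d (h x) + h (M.d x) at h2
      rw [h1, map_zero, add_zero] at h2
      exact h2.symm)

end MFComplex

variable {k : Type u} [Field k] {p : Polynomial k}

/-- The complex of a crossing: `ρ⁺ : L' → L''` for a positive and `ρ⁻ : L'' → L'` for a negative
crossing, in each case with `L''` in homological degree `0`. -/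
def CrossingData.complex (c : CrossingData p) (positive : Bool) :
    MFComplex (crossingSeq.ring k) (pot p crossingSeq) :=
  if positive then MF.twoTerm _ _ c.rhoPos (-1) else MF.twoTerm _ _ c.rhoNeg 0

/-- A diagram of an oriented tangle in a disk with boundary `X₀`: a finite set of crossings with
signs, and the oriented arcs (and closed loops) that connect the ends of the crossings with each
other and with the boundary of the disk. -/
structure Tangle (X₀ : SignSeq) where
  crossing : Type
  [fintype : Fintype crossing]
  [order : LinearOrder crossing]
  positive : crossing → Bool
  dia : ArcDiagram (fun _ : crossing => crossingSeq) X₀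

attribute [instance] Tangle.fintype Tangle.order

/-- The action of an arc diagram on tangle diagrams: the tangle diagram `T j` is placed in the
`j`-th hole of `η`. -/
def ArcDiagram.act {ι : Type} [Fintype ι] [LinearOrder ι] {X : ι → SignSeq} {X₀ : SignSeq}
    (η : ArcDiagram X X₀) (T : ∀ j, Tangle (X j)) : Tangle X₀ where
  crossing := Lex (Σ j, (T j).crossing)
  positive q := (T (ofLex q).1).positive (ofLex q).2
  dia := η.comp fun j => (T j).dia

/-- The Khovanov-Rozansky complex of a tangle diagram, the tensor product of the Koszul
factorizations of all edges and of the complexes of all crossings, over the polynomial ring with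
variables for the ends of the edges, regarded as a complex over the polynomial ring of the boundary
of the tangle. (The factor for the edges is `Z` of the diagram of edges.) -/
def KR (c : CrossingData p) {X₀ : SignSeq} (T : Tangle X₀) : MFComplex (X₀.ring k) (pot p X₀) :=
  (T.dia.functor p).obj fun x => c.complex (T.positive x)

end KRCanopolis

end

open KRCanopolis

-- Everything reduces to the composition law for the functors of arc diagrams. A tangle diagram is
-- an arc diagram whose holes are filled with the complexes of its crossings, so the statement on
-- $KR_p$ is the composition law evaluated at these complexes, whatever the crossing data are.
--
-- The composite $\tilde\eta\circ\prod_j\tilde\theta_j$ is a tensor product in two stages, with a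
-- restriction of scalars in between. The ring of $\theta_j$ is a polynomial ring over the ring of
-- $X_j$, so extension of scalars turns the two stages into one tensor product over the ring of all
-- variables, with the points of the common boundaries identified (`Cx.fold_restr`, `Cx.fold_fold`).
-- In this product the inputs stand beside a single Koszul factorization, whose pairs are the arcs
-- and loops of $\eta$ and of all $\theta_j$ (`Cx.fold_const_kosz`, `ArcDiagram.edges_eq`). It
-- remains to compare that factorization with the one of the composite diagram, and linearity over
-- the ring of the free boundary points is enough for this (`Cx.restrF_fold_congr`).
--
-- At each glued point, with variable $t$, one arc ends and one arc begins. If they are different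
-- arcs and $a$ is the variable at the tail of the arc that ends there, then $t-a$ is not a zero
-- divisor and the total potential does not involve $t$. Division by $t-a$ then gives a homotopy
-- equivalence with the factorization in which $t$ is replaced by $a$ and the pair of that arc is
-- dropped (`Cx.Division.he`, `Cx.kosz_eliminate`); the other arc becomes the glued arc. If the two
-- ends belong to the same arc, its pair is $(0,p'(t))$, and $t$ stays as the mark of a new loop.
-- Induction on the number of glued points gives `trace_he` and `glue_he`.
--
-- All comparison maps commute strictly with $d$ and with $\delta$, and they are invertible up to
-- homotopies for $d$ alone. This has two uses. First, they induce isomorphisms of the complexes of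
-- $d$-homology, whereas an isomorphism in $\mathcal K$ would give only a homotopy equivalence of
-- these complexes. Secondly, they are strictly natural for maps which commute with $\delta$ only up
-- to homotopy. Hence naturality in $\mathcal K$ is checked on representatives of morphisms, with
-- `Models` as the link between functors on $\mathcal K$ and strict functors
-- (`Models.exists_natIso`).

universe v w

noncomputable section

namespace KRCanopolis

/-! ### Homogeneous maps and sign operators -/

section Homogeneous

variable {R M N : Type*} [CommRing R] [AddCommGroup M] [Module R M] [AddCommGroup N]
  [Module R N] {gr : ℤ × ℤ → Submodule R M} {gr' : ℤ × ℤ → Submodule R N}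

/-- The projection to the part of homological degree `n` and internal degree `c` modulo `2`. -/
def parProj (h : DirectSum.IsInternal gr) (n : ℤ) (c : ZMod 2) : M →ₗ[R] M :=
  scaleBy h fun q => if q.1 = n ∧ (q.2 : ZMod 2) = c then 1 else 0

theorem parProj_of_mem (h : DirectSum.IsInternal gr) {n m : ℤ} {c b : ZMod 2} {x : M}
    (hx : x ∈ par gr m b) : parProj h n c x = if m = n ∧ b = c then x else 0 := by
  have : par gr m b ≤ LinearMap.eqLocus (parProj h n c)
      (if m = n ∧ b = c then LinearMap.id else 0) := by
    refine par_le ?_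
    rintro i rfl y hy
    rw [LinearMap.mem_eqLocus, parProj, scaleBy_of_mem h _ hy]
    split_ifs <;> simp
  have := this hx
  rw [LinearMap.mem_eqLocus] at this
  rw [this]
  split_ifs <;> simp

theorem parProj_mem (h : DirectSum.IsInternal gr) (n : ℤ) (c : ZMod 2) (x : M) :
    parProj h n c x ∈ par gr n c := by
  have hx : x ∈ ⨆ i, gr i := by rw [h.submodule_iSup_eq_top]; trivial
  induction hx using Submodule.iSup_induction' with
  | zero => simp
  | add a b _ _ ha hb => rw [map_add]; exact add_mem ha hb
  | mem q x hx =>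
    rw [parProj_of_mem h (mem_par (n := q.1) (i := q.2) hx)]
    split_ifs with hq
    · rw [← hq.1, ← hq.2]; exact mem_par hx
    · exact zero_mem _

/-- A map of degree zero commutes with the projections to the parts of given homological degree and
parity, so the inverse map preserves the images of these projections. The internal degree is
preserved only modulo 2, which is why the projections go to the parts `par` and not to the single
degrees. -/
theorem IsHomog.symm_of_inverse (h : DirectSum.IsInternal gr) (h' : DirectSum.IsInternal gr')
    {f : M →ₗ[R] N} (hf : IsHomog gr gr' 0 0 f) {g : N →ₗ[R] M} (hgf : ∀ x, g (f x) = x)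
    (hfg : ∀ y, f (g y) = y) : IsHomog gr' gr 0 0 g := by
  intro n c y hy
  have hcomm : f ∘ₗ parProj h n c = parProj h' n c ∘ₗ f := by
    refine ext_par h fun m b x hx => ?_
    have hfx := hf m b x hx
    rw [add_zero, add_zero] at hfx
    rw [LinearMap.comp_apply, LinearMap.comp_apply, parProj_of_mem h hx, parProj_of_mem h' hfx]
    split_ifs <;> simp
  have h1 : f (parProj h n c (g y)) = f (g y) := by
    have := LinearMap.congr_fun hcomm (g y)
    rw [LinearMap.comp_apply, LinearMap.comp_apply, hfg, parProj_of_mem h' hy] at this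
    rw [this, hfg]; simp
  have h2 : parProj h n c (g y) = g y := by rw [← hgf (parProj h n c (g y)), h1, hgf]
  rw [← h2, add_zero, add_zero]
  exact parProj_mem h n c _

theorem IsHomog.even_tau {f : M →ₗ[R] N} (hf : IsHomog gr gr' 0 0 f)
    (h : DirectSum.IsInternal gr) (h' : DirectSum.IsInternal gr') (x : M) :
    f (tau h x) = tau h' (f x) := by
  rw [hf.tau_apply h h']; simp [sgn2]

theorem IsHomog.even_sigma {b : ZMod 2} {f : M →ₗ[R] N} (hf : IsHomog gr gr' 0 b f)
    (h : DirectSum.IsInternal gr) (h' : DirectSum.IsInternal gr') (x : M) :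
    f (sigma h x) = sigma h' (f x) := by
  rw [hf.sigma_apply h h']; simp [intSign, sgn2]

theorem IsHomog.odd_tau {a : ℤ} {f : M →ₗ[R] N} (hf : IsHomog gr gr' a 1 f)
    (h : DirectSum.IsInternal gr) (h' : DirectSum.IsInternal gr') (x : M) :
    f (tau h x) = -tau h' (f x) := by
  rw [hf.tau_apply h h']; simp [sgn2]

end Homogeneous

/-- The homotopy is `h ⊗ 1`. The cross terms are `s h ⊗ b + h s ⊗ b`; they cancel because an odd map
anticommutes with the sign operator `s`. -/
theorem tMap_id_homotopy {R S N M : Type*} [CommRing R] [CommRing S] [Algebra S R]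
    [AddCommGroup N] [Module R N] [Module S N] [IsScalarTower S R N] [AddCommGroup M] [Module S M]
    {f h d s : N →ₗ[R] N} {b : M →ₗ[S] M} (e : ∀ x, f x = x + (d (h x) + h (d x)))
    (hs : ∀ x, h (s x) = -s (h x)) (z : N ⊗[S] M) :
    tMap f (LinearMap.id : M →ₗ[S] M) z =
      z + (tOp d s b (tMap h LinearMap.id z) + tMap h LinearMap.id (tOp d s b z)) := by
  revert z
  refine tensor_ext (fun a b => by simp only [map_add])
    (fun a b => by simp only [map_add]; abel) fun x y => ?_
  simp only [tOp_tmul, map_add, TensorProduct.AlgebraTensorModule.map_tmul, e, hs, add_tmul,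
    neg_tmul, LinearMap.id_apply]
  abel

/-! ### Bigraded modules with two operators, and strict maps -/

/-- A bigraded module with two homogeneous operators: the data of a complex of matrix
factorizations, without the conditions on the squares of the operators. -/
structure Cx (R : Type u) [CommRing R] where
  carrier : Type u
  [grp : AddCommGroup carrier]
  [mod : Module R carrier]
  gr : ℤ × ℤ → Submodule R carrier
  internal : DirectSum.IsInternal gr
  d : carrier →ₗ[R] carrier
  del : carrier →ₗ[R] carrier
  d_homog : IsHomog gr gr 0 1 d
  del_homog : IsHomog gr gr 1 0 del

attribute [instance] Cx.grp Cx.mod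

namespace Cx

variable {R : Type u} [CommRing R]

/-- Linear maps that preserve the homological degree and the internal degree modulo `2`. -/
@[ext]
structure Hom (M N : Cx R) where
  f : M.carrier →ₗ[R] N.carrier
  homog : IsHomog M.gr N.gr 0 0 f

/-- The morphisms need not respect `d` and `del`. Chain maps commute with `del` only up to homotopy,
and they have to be morphisms here so that naturality of the comparison maps can be expressed.
Strict compatibility is the separate predicate `IsChain`. -/
instance : Category (Cx R) where
  Hom := Hom
  id M := ⟨LinearMap.id, IsHomog.id⟩
  comp f g := ⟨g.f ∘ₗ f.f, (g.homog.comp f.homog).cast (by simp) (by simp)⟩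

@[simp] theorem id_f (M : Cx R) : Hom.f (𝟙 M) = LinearMap.id := rfl
@[simp] theorem comp_f {M N P : Cx R} (f : M ⟶ N) (g : N ⟶ P) :
    Hom.f (f ≫ g) = Hom.f g ∘ₗ Hom.f f := rfl

theorem hom_ext {M N : Cx R} {f g : M ⟶ N} (h : ∀ x, Hom.f f x = Hom.f g x) : f = g :=
  Hom.ext (LinearMap.ext h)

theorem comp_f_eq {M N P Q : Cx R} {f : M ⟶ N} {g : N ⟶ P} {f' : M ⟶ Q} {g' : Q ⟶ P}
    (h : f ≫ g = f' ≫ g') (x : M.carrier) : Hom.f g (Hom.f f x) = Hom.f g' (Hom.f f' x) :=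
  LinearMap.congr_fun (congrArg Hom.f h) x

/-- Compatibility with both operators. -/
structure IsChain {M N : Cx R} (f : M ⟶ N) : Prop where
  d : ∀ x, Hom.f f (M.d x) = N.d (Hom.f f x)
  del : ∀ x, Hom.f f (M.del x) = N.del (Hom.f f x)

theorem IsChain.id (M : Cx R) : IsChain (𝟙 M) := ⟨fun _ => rfl, fun _ => rfl⟩

theorem IsChain.comp {M N P : Cx R} {f : M ⟶ N} {g : N ⟶ P} (hf : IsChain f) (hg : IsChain g) :
    IsChain (f ≫ g) :=
  ⟨fun x => by simp [hf.d, hg.d], fun x => by simp [hf.del, hg.del]⟩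

/-- A chain map with an inverse up to homotopy with respect to `d`. -/
def IsHEquiv {M N : Cx R} (f : M ⟶ N) : Prop :=
  IsChain f ∧ ∃ g : N ⟶ M, IsChain g ∧
    (∃ h : M.carrier →ₗ[R] M.carrier, IsHomog M.gr M.gr 0 1 h ∧
      ∀ x, Hom.f g (Hom.f f x) = x + (M.d (h x) + h (M.d x))) ∧
    ∃ h : N.carrier →ₗ[R] N.carrier, IsHomog N.gr N.gr 0 1 h ∧
      ∀ x, Hom.f f (Hom.f g x) = x + (N.d (h x) + h (N.d x))

theorem exists_inverse {M N : Cx R} (f : M ⟶ N) (hf : IsChain f)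
    (hb : Function.Bijective (Hom.f f)) : ∃ g : N ⟶ M, IsChain g ∧
      (∀ x, Hom.f g (Hom.f f x) = x) ∧ ∀ x, Hom.f f (Hom.f g x) = x := by
  let e := LinearEquiv.ofBijective (Hom.f f) hb
  have h1 : ∀ x, e.symm (Hom.f f x) = x := fun x => e.symm_apply_apply x
  have h2 : ∀ x, Hom.f f (e.symm x) = x := fun x => e.apply_symm_apply x
  refine ⟨⟨e.symm.toLinearMap, f.homog.symm_of_inverse M.internal N.internal h1 h2⟩,
    ⟨fun x => ?_, fun x => ?_⟩, h1, h2⟩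
  · refine hb.1 ?_
    simp only [LinearEquiv.coe_coe, h2, hf.d]
  · refine hb.1 ?_
    simp only [LinearEquiv.coe_coe, h2, hf.del]

theorem IsHEquiv.of_bijective {M N : Cx R} {f : M ⟶ N} (hf : IsChain f)
    (hb : Function.Bijective (Hom.f f)) : IsHEquiv f := by
  obtain ⟨g, hg, h1, h2⟩ := exists_inverse f hf hb
  exact ⟨hf, g, hg, ⟨0, IsHomog.zero _ _, by simp [h1]⟩, ⟨0, IsHomog.zero _ _, by simp [h2]⟩⟩

theorem IsHEquiv.comp {M N P : Cx R} {f : M ⟶ N} {g : N ⟶ P} (hf : IsHEquiv f)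
    (hg : IsHEquiv g) : IsHEquiv (f ≫ g) := by
  obtain ⟨hf, f', hf', ⟨h, hh, e⟩, ⟨k, hk, e'⟩⟩ := hf
  obtain ⟨hg, g', hg', ⟨l, hl, i⟩, ⟨m, hm, i'⟩⟩ := hg
  refine ⟨hf.comp hg, g' ≫ f', hg'.comp hf', ⟨h + Hom.f f' ∘ₗ l ∘ₗ Hom.f f, ?_, fun x => ?_⟩,
    ⟨m + Hom.f g ∘ₗ k ∘ₗ Hom.f g', ?_, fun x => ?_⟩⟩
  · exact hh.add ((f'.homog.comp (hl.comp f.homog)).cast (by simp) (by simp))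
  · simp only [comp_f, LinearMap.comp_apply, i, map_add, e, LinearMap.add_apply, hf'.d, hf.d]
    abel
  · exact hm.add ((g.homog.comp (hk.comp g'.homog)).cast (by simp) (by simp))
  · simp only [comp_f, LinearMap.comp_apply, i', map_add, e', LinearMap.add_apply, hg'.d, hg.d]
    abel

/-! ### Tensor products over a ring homomorphism -/

section BaseChange

variable {S : Type u} [CommRing S] [Algebra S R]

/-- Restriction of scalars along `S → R`. -/
instance (priority := 10) modS (N : Cx R) : Module S N.carrier :=
  Module.compHom N.carrier (algebraMap S R)

theorem algebraMap_smul' (N : Cx R) (s : S) (x : N.carrier) : algebraMap S R s • x = s • x := rfl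

/-- All scalar actions on the carrier are pulled back from the action of `R`, so a tower of rings
yields a tower of actions. -/
instance (priority := 10) towerT {T : Type u} [CommRing T] [Algebra T S] [Algebra T R]
    [IsScalarTower T S R] (N : Cx R) : IsScalarTower T S N.carrier where
  smul_assoc t s x := by
    rw [← algebraMap_smul' N t, ← algebraMap_smul' N s, ← algebraMap_smul' N (t • s), ← mul_smul,
      Algebra.smul_def, map_mul, ← IsScalarTower.algebraMap_apply T S R]

/-- The tensor product. -/
def tensor (N : Cx R) (M : Cx S) : Cx R where
  carrier := N.carrier ⊗[S] M.carrier
  gr := tensorGr N.gr M.gr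
  internal := tensorGr_internal N.internal M.internal
  d := tOp N.d (tau N.internal) M.d
  del := tOp N.del (sigma N.internal) M.del
  d_homog := ((N.d_homog.tensor IsHomog.id).cast (by simp) (by simp)).add
    (((tau_homog N.internal).tensor M.d_homog).cast (by simp) (by simp))
  del_homog := ((N.del_homog.tensor IsHomog.id).cast (by simp) (by simp)).add
    (((sigma_homog N.internal).tensor M.del_homog).cast (by simp) (by simp))

/-- The pure tensor, as an element of the tensor product. -/
def tm {N : Cx R} {M : Cx S} (x : N.carrier) (y : M.carrier) : (tensor N M).carrier := x ⊗ₜ[S] y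

section

variable {N : Cx R} {M : Cx S}

theorem add_tm (x x' : N.carrier) (y : M.carrier) : tm (x + x') y = tm x y + tm x' y :=
  TensorProduct.add_tmul _ _ _

theorem tm_add (x : N.carrier) (y y' : M.carrier) : tm x (y + y') = tm x y + tm x y' :=
  TensorProduct.tmul_add _ _ _

theorem zero_tm (y : M.carrier) : tm (0 : N.carrier) y = 0 := TensorProduct.zero_tmul _ _

theorem tm_zero (x : N.carrier) : tm x (0 : M.carrier) = 0 := TensorProduct.tmul_zero _ _

theorem neg_tm (x : N.carrier) (y : M.carrier) : tm (-x) y = -tm x y :=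
  TensorProduct.neg_tmul _ _

theorem tm_neg (x : N.carrier) (y : M.carrier) : tm x (-y) = -tm x y :=
  TensorProduct.tmul_neg _ _

theorem zsmul_tm (c : ℤ) (x : N.carrier) (y : M.carrier) : tm (c • x) y = c • tm x y :=
  TensorProduct.smul_tmul' c x y

theorem tm_zsmul (c : ℤ) (x : N.carrier) (y : M.carrier) : tm x (c • y) = c • tm x y :=
  TensorProduct.tmul_smul c x y

theorem smul_tm (r : R) (x : N.carrier) (y : M.carrier) : r • tm x y = tm (r • x) y := rfl

theorem smul_tm' {B : Type u} [CommRing B] [Algebra B R] (b : B) (x : N.carrier)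
    (y : M.carrier) : b • tm x y = tm (b • x) y := rfl

theorem smul_tm_comm (s : S) (x : N.carrier) (y : M.carrier) : tm (s • x) y = tm x (s • y) :=
  TensorProduct.smul_tmul _ _ _

theorem tm_smul (s : S) (x : N.carrier) (y : M.carrier) :
    tm x (s • y) = algebraMap S R s • tm x y := (smul_tm_comm s x y).symm

theorem tm_induction {p : (tensor N M).carrier → Prop} (h0 : p 0) (h : ∀ x y, p (tm x y))
    (ha : ∀ z w, p z → p w → p (z + w)) (z : (tensor N M).carrier) : p z :=
  TensorProduct.induction_on z h0 h ha

theorem tm_ext {W : Type*} [AddCommGroup W] {f g : (tensor N M).carrier →+ W}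
    (h : ∀ x y, f (tm x y) = g (tm x y)) (z : (tensor N M).carrier) : f z = g z := by
  refine tm_induction (p := fun z => f z = g z) ?_ h (fun z w hz hw => ?_) z
  · rw [map_zero, map_zero]
  · rw [map_add, map_add, hz, hw]

/-- The additive map out of the tensor product given by a balanced biadditive map. -/
def tmLift {W : Type*} [AddCommGroup W] (f : N.carrier →+ M.carrier →+ W)
    (hf : ∀ (s : S) x y, f (s • x) y = f x (s • y)) : (tensor N M).carrier →+ W :=
  TensorProduct.liftAddHom f hf

theorem tm_mem {a b : ℤ × ℤ} {x : N.carrier} {y : M.carrier} (hx : x ∈ N.gr a) (hy : y ∈ M.gr b) :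
    tm x y ∈ (tensor N M).gr (a + b) := tmul_mem_tensorGr hx hy

theorem tm_mem_par {n m : ℤ} {b c : ZMod 2} {x : N.carrier} {y : M.carrier}
    (hx : x ∈ par N.gr n b) (hy : y ∈ par M.gr m c) :
    tm x y ∈ par (tensor N M).gr (n + m) (b + c) := tmul_mem_par hx hy

theorem d_tm (x : N.carrier) (y : M.carrier) :
    (tensor N M).d (tm x y) = tm (N.d x) y + tm (tau N.internal x) (M.d y) :=
  tOp_tmul _ _ _ _ _

theorem del_tm (x : N.carrier) (y : M.carrier) :
    (tensor N M).del (tm x y) = tm (N.del x) y + tm (sigma N.internal x) (M.del y) :=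
  tOp_tmul _ _ _ _ _

theorem gr_le {q : ℤ × ℤ} {P : Submodule R (tensor N M).carrier}
    (h : ∀ a b, a + b = q → ∀ x ∈ N.gr a, ∀ y ∈ M.gr b, tm x y ∈ P) :
    (tensor N M).gr q ≤ P :=
  tensorGr_le (P := P) h

end

/-- The tensor product of homogeneous maps. -/
def tensorMap {N N' : Cx R} {M M' : Cx S} (f : N ⟶ N') (g : M ⟶ M') :
    tensor N M ⟶ tensor N' M' :=
  ⟨tMap (Hom.f f) (Hom.f g), (f.homog.tensor g.homog).cast (by simp) (by simp)⟩

theorem tensor_hom_ext {N : Cx R} {M : Cx S} {P : Cx R} {f g : tensor N M ⟶ P}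
    (h : ∀ x y, Hom.f f (tm x y) = Hom.f g (tm x y)) : f = g :=
  hom_ext (tm_ext (f := (Hom.f f).toAddMonoidHom) (g := (Hom.f g).toAddMonoidHom) h)

theorem IsChain.tensorMap {N N' : Cx R} {M M' : Cx S} {f : N ⟶ N'} {g : M ⟶ M'}
    (hf : IsChain f) (hg : IsChain g) : IsChain (tensorMap f g) :=
  ⟨fun z => tOp_comm hf.d (f.homog.even_tau N.internal N'.internal) hg.d z,
    fun z => tOp_comm hf.del (f.homog.even_sigma N.internal N'.internal) hg.del z⟩

theorem tensorMap_bijective {N N' : Cx R} {M M' : Cx S} {f : N ⟶ N'} {g : M ⟶ M'}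
    (hf : Function.Bijective (Hom.f f)) (hg : Function.Bijective (Hom.f g)) :
    Function.Bijective (Hom.f (tensorMap f g)) :=
  (TensorProduct.AlgebraTensorModule.congr (LinearEquiv.ofBijective _ hf)
    (LinearEquiv.ofBijective _ hg)).bijective

theorem tensorMap_homotopy {N : Cx R} {f : N ⟶ N} {h : N.carrier →ₗ[R] N.carrier} (M : Cx S)
    (hh : IsHomog N.gr N.gr 0 1 h) (e : ∀ x, Hom.f f x = x + (N.d (h x) + h (N.d x))) :
    ∃ h' : (tensor N M).carrier →ₗ[R] (tensor N M).carrier,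
      IsHomog (tensor N M).gr (tensor N M).gr 0 1 h' ∧
      ∀ z, Hom.f (tensorMap f (𝟙 M)) z =
        z + ((tensor N M).d (h' z) + h' ((tensor N M).d z)) :=
  ⟨tMap h LinearMap.id, (hh.tensor IsHomog.id).cast (by simp) (by simp),
    tMap_id_homotopy e (hh.odd_tau N.internal N.internal)⟩

/-- The identity on the second factor is all that is required: homotopy equivalences are applied to
the leading Koszul factor, while the input complexes remain unchanged. -/
theorem IsHEquiv.tensorMap {N N' : Cx R} {f : N ⟶ N'} (hf : IsHEquiv f) (M : Cx S) :
    IsHEquiv (tensorMap f (𝟙 M)) := by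
  obtain ⟨hf, g, hg, ⟨h, hh, e⟩, ⟨k, hk, e'⟩⟩ := hf
  obtain ⟨h', hh', i⟩ := tensorMap_homotopy (f := f ≫ g) M hh e
  obtain ⟨k', hk', i'⟩ := tensorMap_homotopy (f := g ≫ f) M hk e'
  refine ⟨hf.tensorMap (IsChain.id M), Cx.tensorMap g (𝟙 M), hg.tensorMap (IsChain.id M),
    ⟨h', hh', fun x => ?_⟩, ⟨k', hk', fun x => ?_⟩⟩
  · refine Eq.trans ?_ (i x)
    exact (LinearMap.congr_fun (TensorProduct.AlgebraTensorModule.map_comp (Hom.f g) (Hom.f f)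
      (LinearMap.id : M.carrier →ₗ[S] M.carrier) LinearMap.id) x).symm
  · refine Eq.trans ?_ (i' x)
    exact (LinearMap.congr_fun (TensorProduct.AlgebraTensorModule.map_comp (Hom.f f) (Hom.f g)
      (LinearMap.id : M.carrier →ₗ[S] M.carrier) LinearMap.id) x).symm

end BaseChange

/-! ### Restriction of scalars -/

section Restrict

variable (S : Type u) [CommRing S] [Algebra S R]

theorem mem_par_restrict (N : Cx R) {n : ℤ} {b : ZMod 2} {x : N.carrier} :
    x ∈ par (fun q => (N.gr q).restrictScalars S) n b ↔ x ∈ par N.gr n b := by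
  constructor
  · intro hx
    exact par_le (Q := (par N.gr n b).restrictScalars S)
      (fun i hi x hx => mem_par' (gr := N.gr) hx hi) hx
  · intro hx
    induction hx using Submodule.iSup_induction' with
    | zero => exact zero_mem _
    | add x y _ _ hx hy => exact add_mem hx hy
    | mem i x hx =>
      by_cases hi : (i : ZMod 2) = b
      · simp only [hi, iSup_pos] at hx
        exact mem_par' (gr := fun q => (N.gr q).restrictScalars S) hx hi
      · simp only [hi, not_false_eq_true, iSup_neg, Submodule.mem_bot] at hx
        rw [hx]; exact zero_mem _

theorem isHomog_restrict {N M : Cx R} {a : ℤ} {b : ZMod 2}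
    {f : N.carrier →ₗ[R] M.carrier} (hf : IsHomog N.gr M.gr a b f) :
    IsHomog (fun q => (N.gr q).restrictScalars S) (fun q => (M.gr q).restrictScalars S) a b
      (f.restrictScalars S) := by
  intro n c x hx
  rw [mem_par_restrict] at hx
  exact (mem_par_restrict S M).2 (hf n c x hx)

/-- Restriction of scalars. -/
def restr (N : Cx R) : Cx S where
  carrier := N.carrier
  gr q := (N.gr q).restrictScalars S
  internal := by
    refine isInternal_of_coaction _ ?_ (components N.internal).toAddMonoidHom
      fun i x hx => components_of_mem N.internal hx
    rw [Submodule.eq_top_iff']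
    intro x
    have hx : x ∈ ⨆ q, N.gr q := by rw [N.internal.submodule_iSup_eq_top]; trivial
    induction hx using Submodule.iSup_induction' with
    | zero => exact zero_mem _
    | add x y _ _ hx hy => exact add_mem hx hy
    | mem q x hx =>
      exact Submodule.mem_iSup_of_mem (p := fun q => (N.gr q).restrictScalars S) q hx
  d := N.d.restrictScalars S
  del := N.del.restrictScalars S
  d_homog := isHomog_restrict S N.d_homog
  del_homog := isHomog_restrict S N.del_homog

theorem restr_tau (N : Cx R) (x : N.carrier) : tau (restr S N).internal x = tau N.internal x := by
  have : tau (restr S N).internal = (tau N.internal).restrictScalars S := by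
    refine ext_par (restr S N).internal fun n c x hx => ?_
    rw [tau_par _ hx]
    exact (tau_par N.internal ((mem_par_restrict S N).1 hx)).symm
  exact LinearMap.congr_fun this x

theorem restr_sigma (N : Cx R) (x : N.carrier) :
    sigma (restr S N).internal x = sigma N.internal x := by
  have : sigma (restr S N).internal = (sigma N.internal).restrictScalars S := by
    refine ext_par (restr S N).internal fun n c x hx => ?_
    rw [sigma_par _ hx]
    exact (sigma_par N.internal ((mem_par_restrict S N).1 hx)).symm
  exact LinearMap.congr_fun this x

/-- Restriction of scalars of a homogeneous map. -/
def restrMap {N M : Cx R} (f : N ⟶ M) : restr S N ⟶ restr S M :=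
  ⟨(Hom.f f).restrictScalars S, isHomog_restrict S f.homog⟩

theorem IsHEquiv.restrMap {N M : Cx R} {f : N ⟶ M} (hf : IsHEquiv f) :
    IsHEquiv (restrMap S f) := by
  obtain ⟨hf, g, hg, ⟨h, hh, e⟩, ⟨k, hk, e'⟩⟩ := hf
  exact ⟨⟨hf.d, hf.del⟩, Cx.restrMap S g, ⟨hg.d, hg.del⟩,
    ⟨h.restrictScalars S, isHomog_restrict S hh, e⟩,
    ⟨k.restrictScalars S, isHomog_restrict S hk, e'⟩⟩

end Restrict

/-! ### Natural families of complexes and equivalences between them -/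

section Families

variable {D : Type v} [Category.{w} D]

/-- The functor of tensor products of two families. -/
@[simps obj map]
def tens {S : Type u} [CommRing S] [Algebra S R] (F : D ⥤ Cx R) (G : D ⥤ Cx S) : D ⥤ Cx R where
  obj X := tensor (F.obj X) (G.obj X)
  map φ := tensorMap (F.map φ) (G.map φ)
  map_id X := by
    rw [F.map_id, G.map_id]
    exact Hom.ext TensorProduct.AlgebraTensorModule.map_id
  map_comp φ ψ := by
    rw [F.map_comp, G.map_comp]
    exact Hom.ext (TensorProduct.AlgebraTensorModule.map_comp _ _ _ _)

/-- Restriction of scalars of a family. -/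
@[simps obj map]
def restrF (S : Type u) [CommRing S] [Algebra S R] (F : D ⥤ Cx R) : D ⥤ Cx S where
  obj X := restr S (F.obj X)
  map φ := restrMap S (F.map φ)
  map_id X := by rw [F.map_id]; rfl
  map_comp φ ψ := by rw [F.map_comp]; rfl

/-- Two families are isomorphic, naturally and compatibly with the operators. -/
def SIso (F G : D ⥤ Cx R) : Prop :=
  ∃ α : F ⟶ G, ∀ X, IsChain (α.app X) ∧ Function.Bijective (Hom.f (α.app X))

/-- Two families are homotopy equivalent, by a natural chain map. -/
def HEqv (F G : D ⥤ Cx R) : Prop :=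
  ∃ α : F ⟶ G, ∀ X, IsHEquiv (α.app X)

variable {F F' F'' : D ⥤ Cx R}

theorem SIso.of_app (α : ∀ X, F.obj X ⟶ F'.obj X)
    (hn : ∀ {X Y} (φ : X ⟶ Y), F.map φ ≫ α Y = α X ≫ F'.map φ) (hc : ∀ X, IsChain (α X))
    (hb : ∀ X, Function.Bijective (Hom.f (α X))) : SIso F F' :=
  ⟨⟨α, fun _ _ φ => hn φ⟩, fun X => ⟨hc X, hb X⟩⟩

theorem SIso.refl (F : D ⥤ Cx R) : SIso F F :=
  ⟨𝟙 F, fun _ => ⟨IsChain.id _, Function.bijective_id⟩⟩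

theorem SIso.trans (h : SIso F F') (h' : SIso F' F'') : SIso F F'' := by
  obtain ⟨α, hα⟩ := h
  obtain ⟨β, hβ⟩ := h'
  exact ⟨α ≫ β, fun X => ⟨(hα X).1.comp (hβ X).1, (hβ X).2.comp (hα X).2⟩⟩

theorem SIso.symm (h : SIso F F') : SIso F' F := by
  obtain ⟨α, hα⟩ := h
  choose β hβ h1 h2 using fun X => exists_inverse (α.app X) (hα X).1 (hα X).2
  refine SIso.of_app β (fun {X Y} φ => hom_ext fun x => ?_) hβ fun X =>
    ⟨Function.LeftInverse.injective (h2 X), Function.RightInverse.surjective (h1 X)⟩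
  -- Naturality of the inverses is tested after applying the injective component at `Y`, where it
  -- becomes naturality of `α`.
  refine (hα Y).2.1 ?_
  have := comp_f_eq (α.naturality φ) (Hom.f (β X) x)
  rw [h2] at this
  simpa [h2] using this.symm

theorem SIso.hEqv (h : SIso F F') : HEqv F F' := by
  obtain ⟨α, hα⟩ := h
  exact ⟨α, fun X => IsHEquiv.of_bijective (hα X).1 (hα X).2⟩

theorem HEqv.trans (h : HEqv F F') (h' : HEqv F' F'') : HEqv F F'' := by
  obtain ⟨α, hα⟩ := h
  obtain ⟨β, hβ⟩ := h'
  exact ⟨α ≫ β, fun X => (hα X).comp (hβ X)⟩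

variable {S : Type u} [CommRing S]

theorem SIso.tens [Algebra S R] {G G' : D ⥤ Cx S} (h : SIso F F') (h' : SIso G G') :
    SIso (tens F G) (tens F' G') := by
  obtain ⟨α, hα⟩ := h
  obtain ⟨β, hβ⟩ := h'
  refine SIso.of_app (fun X => tensorMap (α.app X) (β.app X)) (fun {X Y} φ => ?_)
    (fun X => (hα X).1.tensorMap (hβ X).1) fun X => tensorMap_bijective (hα X).2 (hβ X).2
  refine tensor_hom_ext fun x y => ?_
  exact congrArg₂ tm (comp_f_eq (α.naturality φ) x) (comp_f_eq (β.naturality φ) y)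

theorem HEqv.tens [Algebra S R] (h : HEqv F F') (G : D ⥤ Cx S) :
    HEqv (tens F G) (Cx.tens F' G) := by
  obtain ⟨α, hα⟩ := h
  refine ⟨⟨fun X => tensorMap (α.app X) (𝟙 (G.obj X)), fun X Y φ => ?_⟩, fun X =>
    (hα X).tensorMap _⟩
  refine tensor_hom_ext fun x y => ?_
  exact congrArg (tm · (Hom.f (G.map φ) y)) (comp_f_eq (α.naturality φ) x)

theorem SIso.restr (S : Type u) [CommRing S] [Algebra S R] (h : SIso F F') :
    SIso (restrF S F) (restrF S F') := by
  obtain ⟨α, hα⟩ := h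
  exact SIso.of_app (fun X => restrMap S (α.app X))
    (fun φ => hom_ext fun x => comp_f_eq (α.naturality φ) x)
    (fun X => ⟨(hα X).1.d, (hα X).1.del⟩) fun X => (hα X).2

theorem HEqv.restr (S : Type u) [CommRing S] [Algebra S R] (h : HEqv F F') :
    HEqv (restrF S F) (restrF S F') := by
  obtain ⟨α, hα⟩ := h
  exact ⟨⟨fun X => restrMap S (α.app X), fun X Y φ => hom_ext fun x =>
    comp_f_eq (α.naturality φ) x⟩, fun X => (hα X).restrMap S⟩

end Families

end Cx

/-- The signs needed below depend only on the homological degree and on the parity of the internal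
degree, hence they are constant on each `par`. -/
theorem scaleBy_par {R M : Type*} [CommRing R] [AddCommGroup M] [Module R M]
    {gr : ℤ × ℤ → Submodule R M} (h : DirectSum.IsInternal gr) {c : ℤ × ℤ → ℤ} {n : ℤ}
    {b : ZMod 2} {v : ℤ} (hc : ∀ i : ℤ, (i : ZMod 2) = b → c (n, i) = v) {x : M}
    (hx : x ∈ par gr n b) : scaleBy h c x = v • x := by
  have : par gr n b ≤ LinearMap.eqLocus (scaleBy h c) (v • LinearMap.id) := by
    refine par_le fun i hi y hy => ?_
    rw [LinearMap.mem_eqLocus, scaleBy_of_mem h _ hy, hc i hi]; rfl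
  exact this hx

namespace Cx

variable {R : Type u} [CommRing R]

/-! ### Symmetry of the tensor product -/

section Structural

variable {S T : Type u} [CommRing S] [CommRing T] [Algebra S R] [Algebra T R]

/-- The additive map out of the tensor product given by a balanced biadditive function. -/
def tmMap {N : Cx R} {M : Cx S} {W : Type*} [AddCommGroup W] (f : N.carrier → M.carrier → W)
    (hl : ∀ x x' y, f (x + x') y = f x y + f x' y) (hr : ∀ x y y', f x (y + y') = f x y + f x y')
    (hs : ∀ (s : S) x y, f (s • x) y = f x (s • y)) : (tensor N M).carrier →+ W :=
  tmLift (AddMonoidHom.mk' (fun x => AddMonoidHom.mk' (f x) (hr x))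
    fun x x' => AddMonoidHom.ext fun y => hl x x' y) hs

theorem iSup_gr (M : Cx R) (y : M.carrier) : y ∈ ⨆ q, M.gr q := by
  rw [M.internal.submodule_iSup_eq_top]; trivial

theorem par_induction {M : Cx R} {p : M.carrier → Prop} (h0 : p 0)
    (h : ∀ n b, ∀ x ∈ par M.gr n b, p x) (ha : ∀ x y, p x → p y → p (x + y)) (x : M.carrier) :
    p x := by
  have hx := iSup_gr M x
  induction hx using Submodule.iSup_induction' with
  | zero => exact h0
  | add a b _ _ ha' hb => exact ha _ _ ha' hb
  | mem q x hx => exact h _ _ x (mem_par (n := q.1) (i := q.2) hx)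

theorem tm_ext_par {N : Cx R} {M : Cx S} {W : Type*} [AddCommGroup W]
    {f g : (tensor N M).carrier →+ W}
    (h : ∀ x n b, ∀ y ∈ par M.gr n b, f (tm x y) = g (tm x y)) (z : (tensor N M).carrier) :
    f z = g z := by
  refine tm_ext (fun x y => ?_) z
  refine par_induction (p := fun y => f (tm x y) = g (tm x y)) ?_ (h x) (fun y y' hy hy' => ?_) y
  · rw [tm_zero, map_zero, map_zero]
  · rw [tm_add, map_add, map_add, hy, hy']

theorem tm_tm_ext_par {N : Cx R} {M : Cx S} {L : Cx T} {W : Type*} [AddCommGroup W]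
    {f g : (tensor (tensor N M) L).carrier →+ W}
    (h : ∀ x n b, ∀ y ∈ par M.gr n b, ∀ m c, ∀ z ∈ par L.gr m c,
      f (tm (tm x y) z) = g (tm (tm x y) z)) (t : (tensor (tensor N M) L).carrier) :
    f t = g t := by
  refine tm_ext_par (fun w m c z hz => ?_) t
  exact tm_ext_par (f := f.comp (AddMonoidHom.mk' (fun w => tm w z) fun a b => add_tm a b z))
    (g := g.comp (AddMonoidHom.mk' (fun w => tm w z) fun a b => add_tm a b z))
    (fun x n b y hy => h x n b y hy m c z hz) w

theorem tm_tm_ext {N : Cx R} {M : Cx S} {L : Cx T} {W : Type*} [AddCommGroup W]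
    {f g : (tensor (tensor N M) L).carrier →+ W}
    (h : ∀ x y z, f (tm (tm x y) z) = g (tm (tm x y) z)) (t : (tensor (tensor N M) L).carrier) :
    f t = g t :=
  tm_tm_ext_par (fun x _ _ y _ _ _ z _ => h x y z) t

/-- A weight that is multiplicative in the degree takes on `x ⊗ y` the product of the two weights.
Both sign operators are of this kind, so the signs on iterated tensor products are computed factor
by factor. -/
theorem tensor_scale {N : Cx R} {M : Cx S} (c : ℤ × ℤ → ℤ) (hc : ∀ a b, c (a + b) = c a * c b)
    (x : N.carrier) (y : M.carrier) :
    scaleBy (tensor N M).internal c (tm x y) =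
      tm (scaleBy N.internal c x) (scaleBy M.internal c y) := by
  have hx := iSup_gr N x
  have hy := iSup_gr M y
  induction hx using Submodule.iSup_induction' with
  | zero => simp only [map_zero, zero_tm]
  | add a b _ _ ha hb => simp only [map_add, add_tm, ha, hb]
  | mem p x hx =>
    induction hy using Submodule.iSup_induction' with
    | zero => simp only [map_zero, tm_zero]
    | add a b _ _ ha hb => simp only [map_add, tm_add, ha, hb]
    | mem q y hy =>
      rw [scaleBy_of_mem _ _ (tm_mem hx hy), scaleBy_of_mem _ _ hx, scaleBy_of_mem _ _ hy, hc,
        mul_smul, tm_zsmul, zsmul_tm, smul_comm]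

theorem tau_tm {N : Cx R} {M : Cx S} (x : N.carrier) (y : M.carrier) :
    tau (tensor N M).internal (tm x y) = tm (tau N.internal x) (tau M.internal y) :=
  tensor_scale _ (fun _ _ => intSign_add _ _) x y

theorem sigma_tm {N : Cx R} {M : Cx S} (x : N.carrier) (y : M.carrier) :
    sigma (tensor N M).internal (tm x y) = tm (sigma N.internal x) (sigma M.internal y) :=
  tensor_scale _ (fun _ _ => intSign_add _ _) x y

/-- A homogeneous map from an additive map out of a tensor product. -/
def homOfAdd {N : Cx R} {M : Cx S} {P : Cx R} (f : (tensor N M).carrier →+ P.carrier)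
    (hs : ∀ (r : R) x y, f (tm (r • x) y) = r • f (tm x y))
    (hh : ∀ n b, ∀ x ∈ par N.gr n b, ∀ m c, ∀ y ∈ par M.gr m c,
      f (tm x y) ∈ par P.gr (n + m) (b + c)) : tensor N M ⟶ P where
  f := { f with
    map_smul' := fun r z => tm_ext (W := P.carrier)
      (f := f.comp (DistribSMul.toAddMonoidHom (tensor N M).carrier r))
      (g := (DistribSMul.toAddMonoidHom P.carrier r).comp f) (hs r) z }
  homog := by
    refine IsHomog.of_gr fun n i => ?_
    refine gr_le (P := (par P.gr (n + 0) (i + 0)).comap _) ?_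
    rintro ⟨n1, i1⟩ ⟨n2, i2⟩ hq x hx y hy
    obtain ⟨rfl, rfl⟩ := Prod.mk.inj hq
    have := hh _ _ x (mem_par hx) _ _ y (mem_par hy)
    simpa using this

/-- A homogeneous element of `N ⊗ M` is not a pure tensor in general. With `z` fixed, `w ↦ f (w ⊗
z)` is a linear map, and its degree may be tested on pure tensors `w`. -/
theorem tensor_tensor_homog {N : Cx R} {M : Cx S} {L : Cx T} {P : Cx R}
    {f : (tensor (tensor N M) L).carrier →+ P.carrier}
    (h : ∀ n b, ∀ x ∈ par N.gr n b, ∀ m c, ∀ y ∈ par M.gr m c, ∀ l a, ∀ z ∈ par L.gr l a,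
      f (tm (tm x y) z) ∈ par P.gr (n + m + l) (b + c + a))
    (hs : ∀ (r : R) x y z, f (tm (tm (r • x) y) z) = r • f (tm (tm x y) z)) :
    ∀ n b, ∀ x ∈ par (tensor N M).gr n b, ∀ m c, ∀ y ∈ par L.gr m c,
      f (tm x y) ∈ par P.gr (n + m) (b + c) := by
  intro n b w hw l a z hz
  let g : (tensor N M).carrier →+ P.carrier :=
    f.comp (AddMonoidHom.mk' (fun w => tm w z) fun a b => add_tm a b z)
  let g' : (tensor N M).carrier →ₗ[R] P.carrier := { g with
    map_smul' := fun r w => tm_ext (W := P.carrier)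
      (f := g.comp (DistribSMul.toAddMonoidHom (tensor N M).carrier r))
      (g := (DistribSMul.toAddMonoidHom P.carrier r).comp g) (fun x y => hs r x y z) w }
  have : IsHomog (tensor N M).gr P.gr l a g' := by
    refine IsHomog.of_gr fun n i => ?_
    refine gr_le (P := (par P.gr (n + l) (i + a)).comap _) ?_
    rintro ⟨n1, i1⟩ ⟨n2, i2⟩ hq x hx y hy
    obtain ⟨rfl, rfl⟩ := Prod.mk.inj hq
    have := h _ _ x (mem_par hx) _ _ y (mem_par hy) l a z hz
    rw [Int.cast_add]
    exact this
  exact this n b w hw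

section Swap

variable {N N' : Cx R} {M M' : Cx S} {L L' : Cx T}

/-- The projection to the elements of a given parity of both degrees. -/
def parityProj (L : Cx T) (a : ZMod 2 × ZMod 2) : L.carrier →ₗ[T] L.carrier :=
  scaleBy L.internal fun q => if ((q.1 : ZMod 2), (q.2 : ZMod 2)) = a then 1 else 0

/-- The sign that arises from an exchange with an element of given parities. -/
def signOp (M : Cx S) (a : ZMod 2 × ZMod 2) : M.carrier →ₗ[S] M.carrier :=
  scaleBy M.internal fun q => sgn2 (q.1 * a.1 + q.2 * a.2)

theorem parityProj_par {n : ℤ} {b : ZMod 2} {z : L.carrier} (hz : z ∈ par L.gr n b)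
    (a : ZMod 2 × ZMod 2) : parityProj L a z = if ((n : ZMod 2), b) = a then z else 0 := by
  rw [parityProj, scaleBy_par (v := if ((n : ZMod 2), b) = a then 1 else 0) _
    (fun i hi => by rw [hi]) hz]
  split_ifs <;> simp

theorem signOp_par {n : ℤ} {b : ZMod 2} {y : M.carrier} (hy : y ∈ par M.gr n b)
    (a : ZMod 2 × ZMod 2) : signOp M a y = sgn2 (n * a.1 + b * a.2) • y :=
  scaleBy_par _ (fun i hi => by rw [hi]) hy

/-- The exchange of the last two factors, for a fixed element of the last factor. -/
def swapAt (N : Cx R) (M : Cx S) {L : Cx T} (z : L.carrier) :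
    (tensor N M).carrier →+ (tensor (tensor N L) M).carrier :=
  -- The sign of the exchange depends on the parities of both elements. Splitting `z` into its four
  -- parity components and letting each sign act on `y` as an operator gives an expression which is
  -- additive and balanced for arbitrary elements.
  tmMap (fun x y => ∑ a, tm (tm x (parityProj L a z)) (signOp M a y))
    (fun x x' y => by simp only [add_tm, Finset.sum_add_distrib])
    (fun x y y' => by simp only [tm_add, map_add, Finset.sum_add_distrib])
    (fun s x y => by simp only [map_smul, ← smul_tm_comm, smul_tm'])

theorem swapAt_tm (z : L.carrier) (x : N.carrier) (y : M.carrier) :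
    swapAt N M z (tm x y) = ∑ a, tm (tm x (parityProj L a z)) (signOp M a y) := rfl

/-- The exchange of the last two factors of a tensor product, with the usual signs. -/
def swapAdd (N : Cx R) (M : Cx S) (L : Cx T) :
    (tensor (tensor N M) L).carrier →+ (tensor (tensor N L) M).carrier :=
  tmMap (fun w z => swapAt N M z w) (fun w w' z => map_add _ _ _)
    (fun w z z' => tm_ext (f := swapAt N M (z + z')) (g := swapAt N M z + swapAt N M z')
      (fun x y => by
        simp only [AddMonoidHom.add_apply, swapAt_tm, map_add, tm_add, add_tm,
          Finset.sum_add_distrib]) w)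
    (fun s w z => tm_ext (f := (swapAt N M z).comp (DistribSMul.toAddMonoidHom _ s))
      (g := swapAt N M (s • z)) (fun x y => by
        change swapAt N M z (tm (s • x) y) = _
        simp only [swapAt_tm, map_smul, smul_tm_comm]) w)

/-- For homogeneous `z` only one of the four parity components survives. The sign pairs homological
degree with homological degree and internal parity with internal parity; there are no mixed terms,
because the tensor product uses only `tau` for `d` and only `sigma` for `del`. -/
theorem swapAdd_tm (x : N.carrier) {n : ℤ} {b : ZMod 2} {y : M.carrier} (hy : y ∈ par M.gr n b)
    {m : ℤ} {c : ZMod 2} {z : L.carrier} (hz : z ∈ par L.gr m c) :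
    swapAdd N M L (tm (tm x y) z) = sgn2 (n * m + b * c) • tm (tm x z) y := by
  change swapAt N M z (tm x y) = _
  rw [swapAt_tm, Finset.sum_eq_single ((m : ZMod 2), c)]
  · rw [parityProj_par hz, if_pos rfl, signOp_par hy, tm_zsmul]
  · intro a _ ha
    rw [parityProj_par hz, if_neg (Ne.symm ha), tm_zero, zero_tm]
  · intro h; exact absurd (Finset.mem_univ _) h

theorem swapAdd_swapAdd (t : (tensor (tensor N M) L).carrier) :
    swapAdd N L M (swapAdd N M L t) = t := by
  refine tm_tm_ext_par (f := (swapAdd N L M).comp (swapAdd N M L)) (g := AddMonoidHom.id _)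
    (fun x n b y hy m c z hz => ?_) t
  rw [AddMonoidHom.comp_apply, swapAdd_tm x hy hz, map_zsmul, swapAdd_tm x hz hy, smul_smul,
    mul_comm (m : ZMod 2), mul_comm c, sgn2_sq, one_smul]
  rfl

theorem swapAdd_bijective : Function.Bijective (swapAdd N M L) :=
  ⟨Function.LeftInverse.injective (swapAdd_swapAdd (N := N) (M := M) (L := L)),
    Function.RightInverse.surjective (swapAdd_swapAdd (N := N) (M := L) (L := M))⟩

theorem swapAdd_smul (r : R) (x : N.carrier) (y : M.carrier) (z : L.carrier) :
    swapAdd N M L (tm (tm (r • x) y) z) = r • swapAdd N M L (tm (tm x y) z) := by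
  change swapAt N M z (tm (r • x) y) = r • swapAt N M z (tm x y)
  rw [swapAt_tm, swapAt_tm, Finset.smul_sum]
  rfl

/-- The exchange of the last two factors of a tensor product, with the usual signs. -/
def swap (N : Cx R) (M : Cx S) (L : Cx T) : tensor (tensor N M) L ⟶ tensor (tensor N L) M :=
  homOfAdd (swapAdd N M L)
    (fun r w z => tm_ext (f := (swapAt N M z).comp (DistribSMul.toAddMonoidHom _ r))
      (g := (DistribSMul.toAddMonoidHom _ r).comp (swapAt N M z))
      (fun x y => swapAdd_smul r x y z) w)
    (tensor_tensor_homog (fun n b x hx m c y hy l a z hz => by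
      rw [swapAdd_tm x hy hz, add_right_comm, add_right_comm b]
      exact zsmul_mem (tm_mem_par (tm_mem_par hx hz) hy) _) swapAdd_smul)

theorem swap_tm (x : N.carrier) {n : ℤ} {b : ZMod 2} {y : M.carrier} (hy : y ∈ par M.gr n b)
    {m : ℤ} {c : ZMod 2} {z : L.carrier} (hz : z ∈ par L.gr m c) :
    Hom.f (swap N M L) (tm (tm x y) z) = sgn2 (n * m + b * c) • tm (tm x z) y :=
  swapAdd_tm x hy hz

/-- Both sides consist of the same three terms. An operator that hits `y` or `z` shifts one of its
degrees by one; this changes the exchange sign by the sign of the other element, and that is the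
amount by which the signs from `tau` or `sigma` differ between the two orders of the factors. -/
theorem swap_isChain : IsChain (swap N M L) := by
  constructor
  · refine tm_tm_ext_par (f := (swapAdd N M L).comp (tensor (tensor N M) L).d.toAddMonoidHom)
      (g := (tensor (tensor N L) M).d.toAddMonoidHom.comp (swapAdd N M L)) ?_
    intro x n b y hy m c z hz
    have hdy := M.d_homog n b y hy
    have hdz := L.d_homog m c z hz
    rw [add_zero] at hdy hdz
    simp only [AddMonoidHom.comp_apply, LinearMap.toAddMonoidHom_coe]
    rw [swapAdd_tm x hy hz, map_zsmul, d_tm, d_tm, add_tm, tau_tm, map_add, map_add,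
      swapAdd_tm _ hy hz, swapAdd_tm _ hdy hz, tau_par _ hy, tm_zsmul, zsmul_tm, map_zsmul,
      swapAdd_tm _ hy hdz, d_tm, d_tm, tau_tm, tau_par _ hz, add_tm, tm_zsmul, zsmul_tm, smul_add,
      smul_add, smul_smul, smul_smul, add_mul, mul_add, one_mul, mul_one, ← add_assoc, ← add_assoc,
      sgn2_add _ c, sgn2_add _ b, mul_left_comm, sgn2_sq, mul_one]
    abel
  · refine tm_tm_ext_par (f := (swapAdd N M L).comp (tensor (tensor N M) L).del.toAddMonoidHom)
      (g := (tensor (tensor N L) M).del.toAddMonoidHom.comp (swapAdd N M L)) ?_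
    intro x n b y hy m c z hz
    have hdy := M.del_homog n b y hy
    have hdz := L.del_homog m c z hz
    rw [add_zero] at hdy hdz
    simp only [AddMonoidHom.comp_apply, LinearMap.toAddMonoidHom_coe]
    rw [swapAdd_tm x hy hz, map_zsmul, del_tm, del_tm, add_tm, sigma_tm, map_add, map_add,
      swapAdd_tm _ hy hz, swapAdd_tm _ hdy hz, sigma_par _ hy, tm_zsmul, zsmul_tm, map_zsmul,
      swapAdd_tm _ hy hdz, del_tm, del_tm, sigma_tm, sigma_par _ hz, add_tm, tm_zsmul, zsmul_tm,
      smul_add, smul_add, smul_smul, smul_smul]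
    -- `h1` is the change of the exchange sign when `del` hits `y`. In `h2` the change that occurs
    -- when `del` hits `z` is cancelled by the value of `sigma` on `y`.
    have h1 : sgn2 (((n + 1 : ℤ) : ZMod 2) * m + b * c) = sgn2 (n * m + b * c) * intSign m := by
      rw [intSign, ← sgn2_add]; congr 1; push_cast; ring
    have h2 : intSign n * sgn2 ((n : ZMod 2) * ((m + 1 : ℤ) : ZMod 2) + b * c) =
        sgn2 (n * m + b * c) := by
      rw [intSign, ← sgn2_add]; congr 1; push_cast
      have : (n : ZMod 2) + n = 0 := CharTwo.add_self_eq_zero _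
      linear_combination this
    rw [h1, h2]
    abel

end Swap

end Structural

end Cx

namespace Cx

variable {R : Type u} [CommRing R]

/-! ### Associativity, and restriction of one factor -/

section Associativity

variable {A T : Type u} [CommRing A] [CommRing T] [Algebra A R] [Algebra T R] [Algebra T A]
  [IsScalarTower T A R]

theorem tower_smul (N : Cx R) (t : T) (x : N.carrier) : algebraMap T A t • x = t • x := by
  rw [← algebraMap_smul' N t, ← algebraMap_smul' N (algebraMap T A t),
    ← IsScalarTower.algebraMap_apply T A R]

/-- The map `(x ⊗ y) ⊗ z ↦ x ⊗ (y ⊗ z)` for fixed `z`. -/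
def assocAt (F : Cx R) (G : Cx A) {H : Cx T} (z : H.carrier) :
    (tensor F G).carrier →+ (tensor F (tensor G H)).carrier :=
  tmMap (fun x y => tm x (tm y z)) (fun x x' y => add_tm _ _ _)
    (fun x y y' => by rw [add_tm, tm_add])
    (fun a x y => by rw [smul_tm_comm, smul_tm])

/-- The map `(x ⊗ y) ⊗ z ↦ x ⊗ (y ⊗ z)`. -/
def assocAdd (F : Cx R) (G : Cx A) (H : Cx T) :
    (tensor (tensor F G) H).carrier →+ (tensor F (tensor G H)).carrier :=
  tmMap (fun w z => assocAt F G z w) (fun w w' z => map_add _ _ _)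
    (fun w z z' => tm_ext (f := assocAt F G (z + z')) (g := assocAt F G z + assocAt F G z')
      (fun x y => by
        change tm x (tm y (z + z')) = tm x (tm y z) + tm x (tm y z')
        rw [tm_add, tm_add]) w)
    (fun s w z => tm_ext (f := (assocAt F G z).comp (DistribSMul.toAddMonoidHom _ s))
      (g := assocAt F G (s • z)) (fun x y => by
        change tm (s • x) (tm y z) = tm x (tm y (s • z))
        rw [← smul_tm_comm s y z, ← tower_smul (A := A) F s x, smul_tm_comm]
        rfl) w)

theorem assocAdd_tm {F : Cx R} {G : Cx A} {H : Cx T} (x : F.carrier) (y : G.carrier)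
    (z : H.carrier) : assocAdd F G H (tm (tm x y) z) = tm x (tm y z) := rfl

/-- The map `y ⊗ z ↦ (x ⊗ y) ⊗ z` for fixed `x`. -/
def assocInvAt {F : Cx R} (G : Cx A) (H : Cx T) (x : F.carrier) :
    (tensor G H).carrier →+ (tensor (tensor F G) H).carrier :=
  tmMap (fun y z => tm (tm x y) z) (fun y y' z => by rw [tm_add, add_tm])
    (fun y z z' => tm_add _ _ _)
    (fun s y z => by
      rw [← smul_tm_comm s (tm x y) z, smul_tm', ← tower_smul (A := A) F s x, smul_tm_comm]
      rfl)

/-- The map `x ⊗ (y ⊗ z) ↦ (x ⊗ y) ⊗ z`. -/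
def assocInv (F : Cx R) (G : Cx A) (H : Cx T) :
    (tensor F (tensor G H)).carrier →+ (tensor (tensor F G) H).carrier :=
  tmMap (fun x v => assocInvAt G H x v)
    (fun x x' v => tm_ext (f := assocInvAt G H (x + x'))
      (g := assocInvAt G H x + assocInvAt G H x') (fun y z => by
        change tm (tm (x + x') y) z = tm (tm x y) z + tm (tm x' y) z
        rw [add_tm, add_tm]) v)
    (fun x v v' => map_add _ _ _)
    (fun a x v => tm_ext (f := assocInvAt G H (a • x))
      (g := (assocInvAt G H x).comp (DistribSMul.toAddMonoidHom _ a)) (fun y z => by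
        change tm (tm (a • x) y) z = tm (tm x (a • y)) z
        rw [smul_tm_comm]) v)

theorem tm_tm_ext' {F : Cx R} {G : Cx A} {H : Cx T} {W : Type*} [AddCommGroup W]
    {f g : (tensor F (tensor G H)).carrier →+ W}
    (h : ∀ x y z, f (tm x (tm y z)) = g (tm x (tm y z))) (t : (tensor F (tensor G H)).carrier) :
    f t = g t := by
  refine tm_ext (fun x w => ?_) t
  exact tm_ext (f := f.comp (AddMonoidHom.mk' (fun w => tm x w) fun a b => tm_add x a b))
    (g := g.comp (AddMonoidHom.mk' (fun w => tm x w) fun a b => tm_add x a b))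
    (fun y z => h x y z) w

theorem assoc_bijective (F : Cx R) (G : Cx A) (H : Cx T) : Function.Bijective (assocAdd F G H) :=
  ⟨Function.LeftInverse.injective (g := assocInv F G H) fun t =>
      tm_tm_ext (f := (assocInv F G H).comp (assocAdd F G H)) (g := AddMonoidHom.id _)
        (fun _ _ _ => rfl) t,
    Function.RightInverse.surjective (g := assocInv F G H) fun t =>
      tm_tm_ext' (f := (assocAdd F G H).comp (assocInv F G H)) (g := AddMonoidHom.id _)
        (fun _ _ _ => rfl) t⟩

/-- Associativity of the tensor product. -/
def assoc (F : Cx R) (G : Cx A) (H : Cx T) : tensor (tensor F G) H ⟶ tensor F (tensor G H) :=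
  homOfAdd (assocAdd F G H)
    (fun r w z => tm_ext (f := (assocAt F G z).comp (DistribSMul.toAddMonoidHom _ r))
      (g := (DistribSMul.toAddMonoidHom _ r).comp (assocAt F G z))
      (fun x y => rfl) w)
    (tensor_tensor_homog (fun n b x hx m c y hy l a z hz => by
      rw [assocAdd_tm, add_assoc, add_assoc b]
      exact tm_mem_par hx (tm_mem_par hy hz)) (fun r x y z => rfl))

/-- The order of the factors is kept, so the map has no sign; the signs in the differentials agree
because `tau` and `sigma` are multiplicative on pure tensors. -/
theorem assoc_isChain (F : Cx R) (G : Cx A) (H : Cx T) : IsChain (assoc F G H) := by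
  constructor
  · refine tm_tm_ext (f := (assocAdd F G H).comp (tensor (tensor F G) H).d.toAddMonoidHom)
      (g := (tensor F (tensor G H)).d.toAddMonoidHom.comp (assocAdd F G H)) fun x y z => ?_
    simp only [AddMonoidHom.comp_apply, LinearMap.toAddMonoidHom_coe]
    rw [d_tm, d_tm, add_tm, tau_tm, map_add, map_add]
    simp only [assocAdd_tm]
    rw [d_tm, d_tm, tm_add, add_assoc]
  · refine tm_tm_ext (f := (assocAdd F G H).comp (tensor (tensor F G) H).del.toAddMonoidHom)
      (g := (tensor F (tensor G H)).del.toAddMonoidHom.comp (assocAdd F G H)) fun x y z => ?_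
    simp only [AddMonoidHom.comp_apply, LinearMap.toAddMonoidHom_coe]
    rw [del_tm, del_tm, add_tm, sigma_tm, map_add, map_add]
    simp only [assocAdd_tm]
    rw [del_tm, del_tm, tm_add, add_assoc]

end Associativity

section Restriction

variable (B : Type u) {T : Type u} [CommRing B] [CommRing T] [Algebra B R] [Algebra T R]
  [Algebra T B] [IsScalarTower T B R]

/-- The map `x ⊗ y ↦ x ⊗ y` between tensor products over a restriction of scalars. -/
def restrTensor (F : Cx R) (H : Cx T) : tensor (restr B F) H ⟶ restr B (tensor F H) :=
  homOfAdd (P := restr B (tensor F H))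
    (tmMap (W := (tensor F H).carrier) (N := restr B F) (fun x y => tm (N := F) x y)
      (fun x x' y => add_tm (N := F) _ _ _) (fun x y y' => tm_add (N := F) _ _ _)
      (fun s x y => by
        exact (congrArg (fun z => tm (N := F) (M := H) z y) (tower_smul (A := B) F s x)).trans
          (smul_tm_comm (N := F) s x y)))
    (fun r x y => rfl)
    (fun n b x hx m c y hy => by
      refine (mem_par_restrict B (tensor F H)).2 ?_
      exact tm_mem_par (N := F) ((mem_par_restrict B F).1 hx) hy)

/-- `T` acts on `F` through `B`, so the two tensor products over `T` have the same relations. The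
maps in both directions are the identity on pure tensors. -/
theorem restrTensor_bijective (F : Cx R) (H : Cx T) :
    Function.Bijective (Hom.f (restrTensor B F H)) := by
  let g : (tensor F H).carrier →+ (tensor (restr B F) H).carrier :=
    tmMap (fun x y => tm (N := restr B F) x y) (fun x x' y => add_tm (N := restr B F) _ _ _)
      (fun x y y' => tm_add (N := restr B F) _ _ _)
      (fun s x y => by
        exact (congrArg (fun z => tm (N := restr B F) (M := H) z y)
          (tower_smul (A := B) F s x)).symm.trans (smul_tm_comm (N := restr B F) s x y))
  exact ⟨Function.LeftInverse.injective (g := g) fun t =>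
      tm_ext (f := g.comp (Hom.f (restrTensor B F H)).toAddMonoidHom) (g := AddMonoidHom.id _)
        (fun _ _ => rfl) t,
    Function.RightInverse.surjective (g := g) fun t =>
      tm_ext (N := F) (f := (AddMonoidHom.comp (Hom.f (restrTensor B F H)).toAddMonoidHom g :
          (tensor F H).carrier →+ (tensor F H).carrier))
        (g := AddMonoidHom.id _) (fun _ _ => rfl) t⟩

theorem restrTensor_isChain (F : Cx R) (H : Cx T) : IsChain (restrTensor B F H) := by
  constructor
  · refine tm_ext (W := (tensor F H).carrier)
      (f := (Hom.f (restrTensor B F H)).toAddMonoidHom.comp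
        (tensor (restr B F) H).d.toAddMonoidHom)
      (g := (restr B (tensor F H)).d.toAddMonoidHom.comp
        (Hom.f (restrTensor B F H)).toAddMonoidHom) fun x y => ?_
    refine Eq.trans ?_ (d_tm (N := F) x y).symm
    refine (congrArg (Hom.f (restrTensor B F H)) (d_tm x y)).trans ?_
    exact (map_add _ _ _).trans (congrArg (fun z => tm (N := F) (M := H) _ y +
      tm (N := F) (M := H) z _) (restr_tau B F x))
  · refine tm_ext (W := (tensor F H).carrier)
      (f := (Hom.f (restrTensor B F H)).toAddMonoidHom.comp
        (tensor (restr B F) H).del.toAddMonoidHom)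
      (g := (restr B (tensor F H)).del.toAddMonoidHom.comp
        (Hom.f (restrTensor B F H)).toAddMonoidHom) fun x y => ?_
    refine Eq.trans ?_ (del_tm (N := F) x y).symm
    refine (congrArg (Hom.f (restrTensor B F H)) (del_tm x y)).trans ?_
    exact (map_add _ _ _).trans (congrArg (fun z => tm (N := F) (M := H) _ y +
      tm (N := F) (M := H) z _) (restr_sigma B F x))

end Restriction

section Families

variable {D : Type v} [Category.{w} D] {S T : Type u} [CommRing S] [CommRing T]

theorem tens_comm [Algebra S R] [Algebra T R] (F : D ⥤ Cx R) (G : D ⥤ Cx S) (H : D ⥤ Cx T) :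
    SIso (tens (tens F G) H) (tens (tens F H) G) := by
  refine SIso.of_app (fun X => swap (F.obj X) (G.obj X) (H.obj X)) (fun {X Y} φ => ?_)
    (fun X => swap_isChain) fun X => swapAdd_bijective
  refine hom_ext fun t => ?_
  refine tm_tm_ext_par
    (f := (Hom.f ((tens (tens F G) H).map φ ≫ swap (F.obj Y) (G.obj Y) (H.obj Y))).toAddMonoidHom)
    (g := (Hom.f (swap (F.obj X) (G.obj X) (H.obj X) ≫
      (tens (tens F H) G).map φ)).toAddMonoidHom) (fun x n b y hy m c z hz => ?_) t
  have hy' := (G.map φ).homog n b y hy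
  have hz' := (H.map φ).homog m c z hz
  rw [add_zero, add_zero] at hy' hz'
  refine (swap_tm _ hy' hz').trans ?_
  exact ((congrArg (Hom.f (tensorMap (tensorMap (F.map φ) (H.map φ)) (G.map φ)))
    (swap_tm x hy hz)).trans (map_zsmul (Hom.f (tensorMap (tensorMap (F.map φ) (H.map φ))
      (G.map φ))) (sgn2 (n * m + b * c)) (tm (tm x z) y))).symm

theorem tens_assoc [Algebra S R] [Algebra T R] [Algebra T S] [IsScalarTower T S R]
    (F : D ⥤ Cx R) (G : D ⥤ Cx S) (H : D ⥤ Cx T) :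
    SIso (tens (tens F G) H) (tens F (tens G H)) := by
  refine SIso.of_app (fun X => assoc (F.obj X) (G.obj X) (H.obj X)) (fun {X Y} φ => ?_)
    (fun X => assoc_isChain _ _ _) fun X => assoc_bijective _ _ _
  refine hom_ext fun t => ?_
  exact tm_tm_ext
    (f := (Hom.f ((tens (tens F G) H).map φ ≫ assoc (F.obj Y) (G.obj Y) (H.obj Y))).toAddMonoidHom)
    (g := (Hom.f (assoc (F.obj X) (G.obj X) (H.obj X) ≫
      (tens F (tens G H)).map φ)).toAddMonoidHom) (fun x y z => rfl) t

theorem restr_tens (B : Type u) [CommRing B] [Algebra B R] [Algebra T R] [Algebra T B]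
    [IsScalarTower T B R] (F : D ⥤ Cx R) (H : D ⥤ Cx T) :
    SIso (restrF B (tens F H)) (tens (restrF B F) H) := by
  refine SIso.symm (SIso.of_app (fun X => restrTensor B (F.obj X) (H.obj X)) (fun {X Y} φ => ?_)
    (fun X => restrTensor_isChain _ _ _) fun X => restrTensor_bijective _ _ _)
  exact tensor_hom_ext fun x y => rfl

/-- The map is the identity; only the two actions of `T`, the direct one and the one through `B`,
have to be identified. -/
theorem restr_restr (B : Type u) [CommRing B] [Algebra B R] [Algebra T R] [Algebra T B]
    [IsScalarTower T B R] (F : D ⥤ Cx R) : SIso (restrF T (restrF B F)) (restrF T F) := by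
  refine SIso.of_app (F := restrF T (restrF B F)) (F' := restrF T F) (fun X => ⟨
    { toFun := fun x => x
      map_add' := fun _ _ => rfl
      map_smul' := fun t x => tower_smul (A := B) (F.obj X) t x }, fun n c x hx => ?_⟩)
    (fun φ => rfl) (fun X => ⟨fun _ => rfl, fun _ => rfl⟩) fun X => Function.bijective_id
  rw [add_zero, add_zero]
  exact (mem_par_restrict T (F.obj X)).2 ((mem_par_restrict B (F.obj X)).1
    ((mem_par_restrict T (restr B (F.obj X))).1 hx))

end Families

end Cx

/-! ### Extension of scalars -/

/-- If `X` is `A ⊗_S F`, then `X ⊗_A G` is `F ⊗_S G`. The map is merely additive with prescribed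
values on pure tensors, so that it can be the underlying map of a morphism that is linear over yet
another ring. -/
theorem cancelBaseChange_bijective {S A F G X : Type*} [CommRing S] [CommRing A] [Algebra S A]
    [AddCommGroup F] [Module S F] [AddCommGroup G] [Module A G] [Module S G] [IsScalarTower S A G]
    [AddCommGroup X] [Module A X] [Module S X] [IsScalarTower S A X] {j : F →ₗ[S] X}
    (hj : IsBaseChange A j) (φ : F ⊗[S] G →+ X ⊗[A] G)
    (h : ∀ x y, φ (x ⊗ₜ y) = j x ⊗ₜ y) : Function.Bijective φ := by
  let e : F ⊗[S] G ≃+ X ⊗[A] G :=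
    (((TensorProduct.comm S F G).toAddEquiv.trans
      (AlgebraTensorModule.cancelBaseChange S A A G F).symm.toAddEquiv).trans
        (TensorProduct.congr (LinearEquiv.refl A G) hj.equiv).toAddEquiv).trans
          (TensorProduct.comm A G X).toAddEquiv
  have : ∀ z, φ z = e z := by
    refine tensor_ext (fun a b => map_add _ _ _) (fun a b => map_add _ _ _) fun x y => ?_
    rw [h]
    simp [e, IsBaseChange.equiv_tmul]
  rw [show ⇑φ = ⇑e from funext this]
  exact e.bijective

/-- A free module of rank one takes the place of `P`; the lemma is applied to the carrier of `unit
P`. -/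
theorem isBaseChange_tmul {R P U : Type*} [CommRing R] [CommRing P] [Algebra R P]
    [AddCommGroup U] [Module P U] [Module R U] [IsScalarTower R P U] (e : U ≃ₗ[P] P)
    (N : Type*) [AddCommGroup N] [Module R N] :
    IsBaseChange P (TensorProduct.mk R U N (e.symm 1)) :=
  IsBaseChange.of_equiv (AlgebraTensorModule.congr e.symm (LinearEquiv.refl R N)) fun x => by
    simp

/-- For `Q = R ⊗_S A` one has `Q ⊗_R F = A ⊗_S F`. -/
theorem isBaseChange_of_pushout {S R A Q F X : Type*} [CommRing S] [CommRing R] [CommRing A]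
    [CommRing Q] [Algebra S R] [Algebra S A] [Algebra R Q] [Algebra A Q] [Algebra S Q]
    [IsScalarTower S R Q] [IsScalarTower S A Q] [Algebra.IsPushout S R A Q]
    [AddCommGroup F] [Module S F] [Module R F] [IsScalarTower S R F]
    [AddCommGroup X] [Module Q X] [Module A X] [Module R X] [Module S X]
    [IsScalarTower A Q X] [IsScalarTower R Q X] [IsScalarTower S R X]
    [IsScalarTower S A X] {j : F →ₗ[R] X} (hj : IsBaseChange Q j) :
    IsBaseChange A (j.restrictScalars S) := by
  have : Algebra.IsPushout S A R Q := Algebra.IsPushout.symm inferInstance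
  refine IsBaseChange.of_equiv ((Algebra.IsPushout.cancelBaseChange S A R Q F).symm.trans
    (hj.equiv.restrictScalars A)) fun x => ?_
  simp [IsBaseChange.equiv_tmul]

namespace Cx

variable {R : Type u} [CommRing R]

/-- The ring as a complex concentrated in degree `0`. -/
def unit (Q : Type u) [CommRing Q] : Cx Q where
  carrier := Q
  gr q := if q = 0 then ⊤ else ⊥
  internal := by
    refine isInternal_of_coaction _ ?_ (Finsupp.singleAddHom (0 : ℤ × ℤ)) ?_
    · refine eq_top_iff.2 (le_trans ?_ (le_iSup _ (0 : ℤ × ℤ)))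
      simp
    · intro i x hx
      by_cases hi : i = 0
      · rw [hi]; rfl
      · rw [if_neg hi, Submodule.mem_bot] at hx
        rw [hx]; simp
  d := 0
  del := 0
  d_homog := IsHomog.zero _ _
  del_homog := IsHomog.zero _ _

/-- The generator. -/
def one (Q : Type u) [CommRing Q] : (unit Q).carrier := (1 : Q)

/-- The elements of the ring as elements of the unit complex. -/
def toUnit {Q : Type u} [CommRing Q] : Q →+ (unit Q).carrier := AddMonoidHom.id Q

/-- The elements of the unit complex as elements of the ring. -/
def ofUnit {Q : Type u} [CommRing Q] : (unit Q).carrier →+ Q := AddMonoidHom.id Q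

theorem smul_one {Q : Type u} [CommRing Q] (q : Q) : q • one Q = toUnit q := mul_one q

theorem unit_d {Q : Type u} [CommRing Q] (x : (unit Q).carrier) : (unit Q).d x = 0 := rfl

theorem unit_del {Q : Type u} [CommRing Q] (x : (unit Q).carrier) : (unit Q).del x = 0 := rfl

theorem mem_unit {Q : Type u} [CommRing Q] (x : (unit Q).carrier) : x ∈ (unit Q).gr 0 := by
  change x ∈ (if (0 : ℤ × ℤ) = 0 then (⊤ : Submodule Q Q) else ⊥)
  rw [if_pos rfl]; trivial

theorem mem_unit_par {Q : Type u} [CommRing Q] (x : (unit Q).carrier) :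
    x ∈ par (unit Q).gr 0 0 := by
  have := mem_par (n := 0) (i := 0) (mem_unit x)
  rwa [Int.cast_zero] at this

theorem unit_par {Q : Type u} [CommRing Q] {n : ℤ} {b : ZMod 2} {x : (unit Q).carrier}
    (hx : x ∈ par (unit Q).gr n b) (h : ¬(n = 0 ∧ b = 0)) : x = 0 := by
  have : par (unit Q).gr n b ≤ ⊥ := by
    refine par_le fun i hi y hy => ?_
    change y ∈ (if (n, i) = (0 : ℤ × ℤ) then (⊤ : Submodule Q Q) else ⊥) at hy
    rw [if_neg] at hy
    · exact hy
    · rintro e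
      obtain ⟨rfl, rfl⟩ := Prod.mk.inj e
      exact h ⟨rfl, by rw [← hi, Int.cast_zero]⟩
  exact this hx

theorem unit_tau {Q : Type u} [CommRing Q] (x : (unit Q).carrier) :
    tau (unit Q).internal x = x := by
  rw [tau_par _ (mem_unit_par x)]; simp [sgn2]

theorem unit_sigma {Q : Type u} [CommRing Q] (x : (unit Q).carrier) :
    sigma (unit Q).internal x = x := by
  rw [sigma_par _ (mem_unit_par x)]; simp [intSign, sgn2]

section TensorUnit

variable {S : Type u} [CommRing S] [Algebra S R]

/-- The map `x ↦ x ⊗ 1`. -/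
def tensorUnit (S : Type u) [CommRing S] [Algebra S R] (N : Cx R) : N ⟶ tensor N (unit S) where
  f :=
    { toFun := fun x => tm x (one S)
      map_add' := fun x y => add_tm x y _
      map_smul' := fun r x => rfl }
  homog n b x hx := tm_mem_par hx (mem_unit_par (one S))

theorem tensorUnit_isChain (N : Cx R) : IsChain (tensorUnit S N) := by
  constructor
  · intro x
    refine Eq.trans ?_ (d_tm x (one S)).symm
    rw [unit_d, tm_zero, add_zero]; rfl
  · intro x
    refine Eq.trans ?_ (del_tm x (one S)).symm
    rw [unit_del, tm_zero, add_zero]; rfl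

theorem tensorUnit_bijective (N : Cx R) : Function.Bijective (Hom.f (tensorUnit S N)) := by
  let g : (tensor N (unit S)).carrier →+ N.carrier :=
    tmMap (M := unit S) (fun x s => ofUnit s • x)
      (fun x x' s => smul_add (ofUnit s) x x')
      (fun x s s' => (congrArg (· • x) (map_add ofUnit s s')).trans
        (add_smul (ofUnit s) (ofUnit s') x))
      (fun s x s' => by
        refine (smul_smul (ofUnit s') s x).trans ?_
        rw [mul_comm]; rfl)
  refine ⟨Function.LeftInverse.injective (g := g) fun x => one_smul S x,
    Function.RightInverse.surjective (g := g) fun t =>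
      tm_ext (f := (Hom.f (tensorUnit S N)).toAddMonoidHom.comp g) (g := AddMonoidHom.id _)
        (fun x s => ?_) t⟩
  exact (smul_tm_comm (M := unit S) (ofUnit s) x (one S)).trans
    (congrArg (tm x) (smul_one (ofUnit s)))

/-- The map `x ↦ 1 ⊗ x` to the extension of scalars. -/
def unitTensorLin (P : Type u) [CommRing P] [Algebra R P] (N : Cx R) :
    N.carrier →ₗ[R] (tensor (unit P) N).carrier where
  toFun x := tm (one P) x
  map_add' x y := tm_add (one P) x y
  map_smul' r x := tm_smul r (one P) x

/-- The map `x ↦ 1 ⊗ x`. -/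
def unitTensor (P : Type u) [CommRing P] [Algebra R P] (N : Cx R) :
    N ⟶ restr R (tensor (unit P) N) where
  f :=
    { toFun := fun x => tm (one P) x
      map_add' := fun x y => tm_add (one P) x y
      map_smul' := fun r x => tm_smul r (one P) x }
  homog n b x hx := by
    rw [add_zero, add_zero]
    refine (mem_par_restrict R (tensor (unit P) N)).2 ?_
    have := tm_mem_par (mem_unit_par (one P)) hx
    rwa [zero_add, zero_add] at this

theorem unitTensor_isChain (P : Type u) [CommRing P] [Algebra R P] (N : Cx R) :
    IsChain (unitTensor P N) := by
  constructor
  · intro x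
    refine Eq.trans ?_ (d_tm (one P) x).symm
    rw [unit_d, zero_tm, zero_add, unit_tau]; rfl
  · intro x
    refine Eq.trans ?_ (del_tm (one P) x).symm
    rw [unit_del, zero_tm, zero_add, unit_sigma]; rfl

theorem unitTensor_bijective {P : Type u} [CommRing P] [Algebra R P] (N : Cx R)
    (h : Function.Bijective (algebraMap R P)) : Function.Bijective (Hom.f (unitTensor P N)) := by
  let e : R ≃+* P := RingEquiv.ofBijective (algebraMap R P) h
  have he : ∀ r, e.symm (algebraMap R P r) = r := fun r => e.symm_apply_apply r
  have he' : ∀ p, algebraMap R P (e.symm p) = p := fun r => e.apply_symm_apply r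
  let g : (tensor (unit P) N).carrier →+ N.carrier :=
    tmMap (N := unit P) (fun (q : P) x => e.symm q • x)
      (fun q q' x => (congrArg (· • x) (map_add e.symm q q')).trans (add_smul _ _ _))
      (fun q x x' => smul_add _ _ _)
      (fun s (q : P) x => by
        have : e.symm (algebraMap R P s * q) = e.symm q * s := by rw [map_mul, he, mul_comm]
        exact (congrArg (· • x) this).trans (mul_smul _ _ _))
  refine ⟨Function.LeftInverse.injective (g := g) fun x => ?_,
    Function.RightInverse.surjective (g := g) fun t =>
      tm_ext (f := AddMonoidHom.comp (Hom.f (unitTensor P N)).toAddMonoidHom g)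
        (W := (tensor (unit P) N).carrier) (g := AddMonoidHom.id _) (fun (q : P) x => ?_) t⟩
  · exact (congrArg (· • x) (map_one e.symm)).trans (one_smul R x)
  · refine (smul_tm_comm (M := N) (e.symm q) (one P) x).symm.trans ?_
    exact congrArg (fun q => tm q x) ((mul_one (algebraMap R P (e.symm q))).trans (he' q))

theorem isBaseChange_unitTensorLin (P : Type u) [CommRing P] [Algebra R P] (N : Cx R) :
    IsBaseChange P (unitTensorLin P N) :=
  isBaseChange_tmul (U := (unit P).carrier)
    ({ ofUnit with map_smul' := fun _ _ => rfl
                   invFun := toUnit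
                   left_inv := fun _ => rfl
                   right_inv := fun _ => rfl } : (unit P).carrier ≃ₗ[P] P) N.carrier

end TensorUnit

section Pushout

variable {S A Q : Type u} [CommRing S] [CommRing A] [CommRing Q] [Algebra S R] [Algebra S A]
  [Algebra R Q] [Algebra A Q] [Algebra S Q] [IsScalarTower S R Q] [IsScalarTower S A Q]

/-- The map `x ⊗ y ↦ (1 ⊗ x) ⊗ y`. -/
def pushoutMap (Q : Type u) [CommRing Q] [Algebra R Q] [Algebra A Q] [Algebra S Q]
    [IsScalarTower S R Q] [IsScalarTower S A Q] (F : Cx R) (G : Cx A) :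
    tensor F (restr S G) ⟶ restr R (tensor (tensor (unit Q) F) G) :=
  homOfAdd (P := restr R (tensor (tensor (unit Q) F) G))
    (tmMap (M := restr S G) (W := (tensor (tensor (unit Q) F) G).carrier)
      (fun x y => tm (M := G) (tm (one Q) x) y)
      (fun x x' y => (congrArg (fun z => tm (M := G) z y) (tm_add (one Q) x x')).trans
        (add_tm (M := G) _ _ _))
      (fun x y y' => tm_add (M := G) _ _ _)
      (fun s x y => by
        have h1 : tm (one Q) (s • x) = algebraMap S A s • tm (one Q) x := by
          refine (tm_smul (algebraMap S R s) (one Q) x).trans ?_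
          rw [← IsScalarTower.algebraMap_apply S R Q, IsScalarTower.algebraMap_apply S A Q]
          rfl
        exact (congrArg (fun z => tm (M := G) z y) h1).trans (smul_tm_comm (M := G) _ _ _)))
    (fun r x y => congrArg (fun z => tm (M := G) z y) (tm_smul r (one Q) x))
    (fun n b x hx m c y hy => by
      refine (mem_par_restrict R (tensor (tensor (unit Q) F) G)).2 ?_
      have h1 := tm_mem_par (mem_unit_par (one Q)) hx
      rw [zero_add, zero_add] at h1
      exact tm_mem_par h1 ((mem_par_restrict S G).1 hy))

theorem pushoutMap_isChain (F : Cx R) (G : Cx A) : IsChain (pushoutMap (S := S) Q F G) := by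
  constructor
  · refine tm_ext (W := (tensor (tensor (unit Q) F) G).carrier)
      (f := (Hom.f (pushoutMap (S := S) Q F G)).toAddMonoidHom.comp
        (tensor F (restr S G)).d.toAddMonoidHom)
      (g := (restr R (tensor (tensor (unit Q) F) G)).d.toAddMonoidHom.comp
        (Hom.f (pushoutMap (S := S) Q F G)).toAddMonoidHom) fun x y => ?_
    refine Eq.trans ?_ (d_tm (M := G) (tm (one Q) x) y).symm
    rw [d_tm, unit_d, zero_tm, zero_add, tau_tm, unit_tau]
    refine (congrArg (Hom.f (pushoutMap (S := S) Q F G)) (d_tm x y)).trans ?_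
    rw [map_add]
    rfl
  · refine tm_ext (W := (tensor (tensor (unit Q) F) G).carrier)
      (f := (Hom.f (pushoutMap (S := S) Q F G)).toAddMonoidHom.comp
        (tensor F (restr S G)).del.toAddMonoidHom)
      (g := (restr R (tensor (tensor (unit Q) F) G)).del.toAddMonoidHom.comp
        (Hom.f (pushoutMap (S := S) Q F G)).toAddMonoidHom) fun x y => ?_
    refine Eq.trans ?_ (del_tm (M := G) (tm (one Q) x) y).symm
    rw [del_tm, unit_del, zero_tm, zero_add, sigma_tm, unit_sigma]
    refine (congrArg (Hom.f (pushoutMap (S := S) Q F G)) (del_tm x y)).trans ?_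
    rw [map_add]
    rfl

theorem pushoutMap_bijective [Algebra.IsPushout S R A Q] (F : Cx R) (G : Cx A) :
    Function.Bijective (Hom.f (pushoutMap (S := S) Q F G)) := by
  have : IsScalarTower S A (tensor (unit Q) F).carrier := towerT (R := Q) _
  have : IsScalarTower S R (tensor (unit Q) F).carrier := towerT (R := Q) _
  have h := isBaseChange_of_pushout (S := S) (A := A) (isBaseChange_unitTensorLin Q F)
  let φ : F.carrier ⊗[S] G.carrier →+ (tensor (unit Q) F).carrier ⊗[A] G.carrier :=
    (Hom.f (pushoutMap (S := S) Q F G)).toAddMonoidHom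
  exact cancelBaseChange_bijective h φ fun x y => rfl

end Pushout

section Families

variable {D : Type v} [Category.{w} D] {S : Type u} [CommRing S]

theorem tens_unit [Algebra S R] (F : D ⥤ Cx R) :
    SIso F (tens F ((Functor.const D).obj (unit S))) :=
  SIso.of_app (F' := tens F ((Functor.const D).obj (unit S))) (fun X => tensorUnit S (F.obj X))
    (fun φ => rfl) (fun X => tensorUnit_isChain _) fun X => tensorUnit_bijective _

/-- Extension of scalars along an isomorphism of rings, followed by restriction, changes nothing.
This is where the induction in `fold_restr` ends. -/
theorem unit_tens {P : Type u} [CommRing P] [Algebra R P] (F : D ⥤ Cx R)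
    (h : Function.Bijective (algebraMap R P)) :
    SIso F (restrF R (tens ((Functor.const D).obj (unit P)) F)) :=
  SIso.of_app (F' := restrF R (tens ((Functor.const D).obj (unit P)) F))
    (fun X => unitTensor P (F.obj X)) (fun φ => rfl) (fun X => unitTensor_isChain _ _)
    fun X => unitTensor_bijective _ h

/-- A tensor product over `S` with a restricted complex becomes a tensor product over the larger
ring `A`, once the first factor is extended to `Q = R ⊗_S A`. In this way the restriction of scalars
at the end of an inner functor is moved outwards. -/
theorem tens_pushout {A Q : Type u} [CommRing A] [CommRing Q] [Algebra S R] [Algebra S A]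
    [Algebra R Q] [Algebra A Q] [Algebra S Q] [IsScalarTower S R Q] [IsScalarTower S A Q]
    [Algebra.IsPushout S R A Q] (F : D ⥤ Cx R) (G : D ⥤ Cx A) :
    SIso (tens F (restrF S G)) (restrF R (tens (tens ((Functor.const D).obj (unit Q)) F) G)) :=
  SIso.of_app (F' := restrF R (tens (tens ((Functor.const D).obj (unit Q)) F) G))
    (fun X => pushoutMap Q (F.obj X) (G.obj X)) (fun φ => tensor_hom_ext fun x y => rfl)
    (fun X => pushoutMap_isChain _ _) fun X => pushoutMap_bijective _ _

end Families

end Cx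

namespace Cx

variable {R : Type u} [CommRing R] {D : Type v} [Category.{w} D]

/-! ### Iterated tensor products -/

section Fold

variable {ι : Type} {S : ι → Type u} [∀ j, CommRing (S j)] [∀ j, Algebra (S j) R]

/-- The tensor product of a family over `R` with the families `M j`, for `j` in a list, the head of
the list being the last factor. -/
def fold (N : D ⥤ Cx R) (M : ∀ j, D ⥤ Cx (S j)) : List ι → (D ⥤ Cx R)
  | [] => N
  | j :: L => tens (fold N M L) (M j)

theorem SIso.fold {N N' : D ⥤ Cx R} {M M' : ∀ j, D ⥤ Cx (S j)} (h : SIso N N')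
    (h' : ∀ j, SIso (M j) (M' j)) : ∀ L : List ι, SIso (fold N M L) (Cx.fold N' M' L)
  | [] => h
  | j :: L => (SIso.fold h h' L).tens (h' j)

theorem HEqv.fold {N N' : D ⥤ Cx R} (M : ∀ j, D ⥤ Cx (S j)) (h : HEqv N N') :
    ∀ L : List ι, HEqv (fold N M L) (Cx.fold N' M L)
  | [] => h
  | j :: L => (HEqv.fold M h L).tens (M j)

/-- Adjacent factors are exchanged by the symmetry, so the order of the holes of a diagram is
immaterial. -/
theorem fold_perm (N : D ⥤ Cx R) (M : ∀ j, D ⥤ Cx (S j)) {L L' : List ι} (h : L.Perm L') :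
    SIso (fold N M L) (fold N M L') := by
  induction h with
  | nil => exact SIso.refl _
  | cons j _ ih => exact ih.tens (SIso.refl _)
  | swap i j L => exact tens_comm _ _ _
  | trans _ _ ih ih' => exact ih.trans ih'

theorem fold_map {κ : Type} (g : κ → ι) (N : D ⥤ Cx R) (M : ∀ j, D ⥤ Cx (S j)) :
    ∀ L : List κ, fold N M (L.map g) = fold (S := fun i => S (g i)) N (fun i => M (g i)) L
  | [] => rfl
  | j :: L => congrArg (fun F => tens F (M (g j))) (fold_map g N M L)

theorem fold_append (N : D ⥤ Cx R) (M : ∀ j, D ⥤ Cx (S j)) (L' : List ι) :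
    ∀ L : List ι, fold N M (L ++ L') = fold (fold N M L') M L
  | [] => rfl
  | j :: L => congrArg (fun F => tens F (M j)) (fold_append N M L' L)

theorem restr_fold (B : Type u) [CommRing B] [Algebra B R] [∀ j, Algebra (S j) B]
    [∀ j, IsScalarTower (S j) B R] (N : D ⥤ Cx R) (M : ∀ j, D ⥤ Cx (S j)) :
    ∀ L : List ι, SIso (restrF B (fold N M L)) (fold (restrF B N) M L)
  | [] => SIso.refl _
  | j :: L => (restr_tens B _ _).trans ((restr_fold B N M L).tens (SIso.refl _))

theorem tens_fold {A : Type u} [CommRing A] [Algebra A R] [∀ j, Algebra (S j) A]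
    [∀ j, IsScalarTower (S j) A R] (F : D ⥤ Cx R) (G : D ⥤ Cx A) (M : ∀ j, D ⥤ Cx (S j)) :
    ∀ L : List ι, SIso (tens F (fold G M L)) (fold (tens F G) M L)
  | [] => SIso.refl _
  | _ :: L => (tens_assoc F _ _).symm.trans ((tens_fold F G M L).tens (SIso.refl _))

theorem fold_tens {A : Type u} [CommRing A] [Algebra A R] (F : D ⥤ Cx R) (G : D ⥤ Cx A)
    (M : ∀ j, D ⥤ Cx (S j)) :
    ∀ L : List ι, SIso (tens (fold F M L) G) (fold (tens F G) M L)
  | [] => SIso.refl _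
  | _ :: L => (tens_comm _ _ _).trans ((fold_tens F G M L).tens (SIso.refl _))

end Fold

section FoldFold

variable {ι : Type} {κ : ι → Type} {A : ι → Type u} {T : (Σ j, κ j) → Type u}
  [∀ j, CommRing (A j)] [∀ q, CommRing (T q)] [∀ j, Algebra (A j) R] [∀ q, Algebra (T q) R]
  [∀ j l, Algebra (T ⟨j, l⟩) (A j)] [∀ j l, IsScalarTower (T ⟨j, l⟩) (A j) R]

/-- In the induction step associativity attaches the inner product for `j` factor by factor, and the
symmetry then moves its leading factor `Z j` in front of the inputs that belong to the other
indices. -/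
theorem fold_fold (N : D ⥤ Cx R) (Z : ∀ j, D ⥤ Cx (A j)) (M : ∀ q, D ⥤ Cx (T q))
    (K : ∀ j, List (κ j)) : ∀ L : List ι,
      SIso (fold N (fun j => fold (S := fun l => T ⟨j, l⟩) (Z j) (fun l => M ⟨j, l⟩) (K j)) L)
        (fold (fold N Z L) M (L.flatMap fun j => (K j).map (Sigma.mk j)))
  | [] => SIso.refl _
  | j :: L => by
    have h := (((fold_fold N Z M K L).tens (SIso.refl
      (fold (S := fun l => T ⟨j, l⟩) (Z j) (fun l => M ⟨j, l⟩) (K j)))).trans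
        (tens_fold (S := fun l => T ⟨j, l⟩) _ _ _ (K j))).trans
          (SIso.fold (fold_tens _ _ _ _) (fun _ => SIso.refl _) (K j))
    rw [List.flatMap_cons, fold_append, fold_map]
    exact h

end FoldFold

/-! ### Base change to a common polynomial ring -/

section BaseChange

variable {ι : Type} {S A : ι → Type u} [∀ j, CommRing (S j)] [∀ j, CommRing (A j)]
  [∀ j, Algebra (S j) (A j)] {V : ι → Type} (e : ∀ j, MvPolynomial (V j) (S j) ≃ₐ[S j] A j)
  {P : Type u} [CommRing P] [∀ j, Algebra (S j) P] [∀ j, Algebra (A j) P]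
  [∀ j, IsScalarTower (S j) (A j) P]

/-- The ring `P` is the polynomial ring over `R` in the variables of the polynomial rings `A j`, for
`j` in a list. -/
def IsIteratedPolynomial : List ι → ∀ (R : Type u) [CommRing R], (R →+* P) → Prop
  | [], _, _, f => Function.Bijective f
  | j :: L, R, _, f => IsIteratedPolynomial L (MvPolynomial (V j) R)
      (MvPolynomial.eval₂Hom f fun v => algebraMap (A j) P (e j (MvPolynomial.X v)))

/-- Since `A j` is polynomial over `S j`, its pushout with `R` is the polynomial ring over `R` in
the variables `V j`, and `tens_pushout` replaces the factor restricted to `S j` by one over `A j`.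
The remaining factors are treated in the same way over the larger ring, until `P` is reached. -/
theorem fold_restr (G : ∀ j, D ⥤ Cx (A j)) : ∀ (L : List ι) {R : Type u} [CommRing R]
    [∀ j, Algebra (S j) R] [Algebra R P] [∀ j, IsScalarTower (S j) R P] (N : D ⥤ Cx R),
    IsIteratedPolynomial e L R (algebraMap R P) →
    SIso (fold N (fun j => restrF (S j) (G j)) L)
      (restrF R (fold (tens ((Functor.const D).obj (unit P)) N) G L))
  | [], _, _, _, _, _, N, h => unit_tens N h
  | j :: L, R, _, _, _, _, N, h => by
    letI : Algebra (A j) (MvPolynomial (V j) R) :=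
      ((MvPolynomial.map (algebraMap (S j) R)).comp (e j).symm.toRingEquiv.toRingHom).toAlgebra
    letI : Algebra (MvPolynomial (V j) R) P := (MvPolynomial.eval₂Hom (algebraMap R P)
      fun v => algebraMap (A j) P (e j (MvPolynomial.X v))).toAlgebra
    have hA : ∀ x, algebraMap (A j) (MvPolynomial (V j) R) (e j x) =
        MvPolynomial.map (algebraMap (S j) R) x := fun x =>
      congrArg (MvPolynomial.map (algebraMap (S j) R)) ((e j).symm_apply_apply x)
    have : IsScalarTower R (MvPolynomial (V j) R) P := .of_algebraMap_eq fun r =>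
      (MvPolynomial.eval₂_C _ _ r).symm
    have hS : ∀ i, IsScalarTower (S i) (MvPolynomial (V j) R) P := fun i => .of_algebraMap_eq fun s => by
      rw [IsScalarTower.algebraMap_apply (S i) R P,
        IsScalarTower.algebraMap_apply (S i) R (MvPolynomial (V j) R),
        IsScalarTower.algebraMap_apply R (MvPolynomial (V j) R) P]
    have : IsScalarTower (S j) (A j) (MvPolynomial (V j) R) := .of_algebraMap_eq fun s => by
      rw [← (e j).commutes, hA, MvPolynomial.algebraMap_eq, MvPolynomial.map_C]
      rfl
    have : IsScalarTower (A j) (MvPolynomial (V j) R) P := .of_algebraMap_eq fun a => by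
      obtain ⟨x, rfl⟩ := (e j).surjective a
      rw [hA]
      change _ = MvPolynomial.eval₂ _ _ _
      rw [MvPolynomial.eval₂_map]
      have : (algebraMap (A j) P).comp (e j).toRingEquiv.toRingHom = MvPolynomial.eval₂Hom
          ((algebraMap R P).comp (algebraMap (S j) R))
          fun v => algebraMap (A j) P (e j (MvPolynomial.X v)) := by
        refine MvPolynomial.ringHom_ext (fun s => ?_) fun v => ?_
        · rw [MvPolynomial.eval₂Hom_C, ← IsScalarTower.algebraMap_eq,
            IsScalarTower.algebraMap_apply (S j) (A j) P, ← (e j).commutes]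
          rfl
        · rw [MvPolynomial.eval₂Hom_X']
          rfl
      exact RingHom.congr_fun this x
    -- Extension of scalars of a polynomial ring is a polynomial ring; the isomorphism is
    -- transported along `e j`.
    have : Algebra.IsPushout (S j) R (A j) (MvPolynomial (V j) R) := by
      refine ⟨IsBaseChange.of_equiv ((TensorProduct.AlgebraTensorModule.congr
        (LinearEquiv.refl R R) (e j).symm.toLinearEquiv).trans
          (MvPolynomial.algebraTensorAlgEquiv (S j) R).toLinearEquiv) fun a => ?_⟩
      obtain ⟨x, rfl⟩ := (e j).surjective a
      simp [hA]
    -- The factor `j` is the last one. It is moved to the front, next to `N`, and replaced there.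
    have h1 := (fold_tens N (restrF (S j) (G j)) (fun j => restrF (S j) (G j)) L).trans
      (SIso.fold (tens_pushout (Q := MvPolynomial (V j) R) N (G j)) (fun _ => SIso.refl _) L)
    have h2 := (restr_fold R _ (fun j => restrF (S j) (G j)) L).symm.trans
      (SIso.restr R (fold_restr G L (tens (tens ((Functor.const D).obj
        (unit (MvPolynomial (V j) R))) N) (G j)) h))
    -- The extension of scalars made in this step is absorbed into the extension to `P`.
    have h3 : SIso (tens ((Functor.const D).obj (unit P)) (tens (tens ((Functor.const D).obj
        (unit (MvPolynomial (V j) R))) N) (G j)))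
        (tens (tens ((Functor.const D).obj (unit P)) N) (G j)) :=
      (tens_assoc _ _ _).symm.trans (SIso.tens ((tens_assoc _ _ _).symm.trans
        (SIso.tens (tens_unit _).symm (SIso.refl _))) (SIso.refl _))
    exact (h1.trans h2).trans ((restr_restr _ _).trans (SIso.restr R
      ((SIso.fold h3 (fun _ => SIso.refl _) L).trans (fold_tens _ _ _ _).symm)))

end BaseChange

end Cx

/-! ### Equivalences of single complexes; products with two-term factorizations -/

namespace Cx

variable {R : Type u} [CommRing R]

/-- Isomorphism of complexes. -/
def SE (M N : Cx R) : Prop := ∃ f : M ⟶ N, IsChain f ∧ Function.Bijective (Hom.f f)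

/-- Homotopy equivalence of complexes. -/
def HE (M N : Cx R) : Prop := ∃ f : M ⟶ N, IsHEquiv f

theorem SE.refl (M : Cx R) : SE M M := ⟨𝟙 M, IsChain.id M, Function.bijective_id⟩

theorem SE.of_eq {M N : Cx R} (h : M = N) : SE M N := h ▸ SE.refl M

theorem SE.trans {M N P : Cx R} : SE M N → SE N P → SE M P := by
  rintro ⟨f, hf, hf'⟩ ⟨g, hg, hg'⟩
  exact ⟨f ≫ g, hf.comp hg, hg'.comp hf'⟩

theorem SE.symm {M N : Cx R} : SE M N → SE N M := by
  rintro ⟨f, hf, hf'⟩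
  obtain ⟨g, hg, h1, h2⟩ := exists_inverse f hf hf'
  exact ⟨g, hg, Function.LeftInverse.injective h2, Function.RightInverse.surjective h1⟩

theorem SE.he {M N : Cx R} : SE M N → HE M N := fun ⟨f, hf, hb⟩ =>
  ⟨f, IsHEquiv.of_bijective hf hb⟩

theorem HE.trans {M N P : Cx R} : HE M N → HE N P → HE M P := by
  rintro ⟨f, hf⟩ ⟨g, hg⟩
  exact ⟨f ≫ g, hf.comp hg⟩

theorem SE.tensor {S : Type u} [CommRing S] [Algebra S R] {M M' : Cx R} {N N' : Cx S} :
    SE M M' → SE N N' → SE (tensor M N) (tensor M' N') := by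
  rintro ⟨f, hf, hf'⟩ ⟨g, hg, hg'⟩
  exact ⟨tensorMap f g, hf.tensorMap hg, tensorMap_bijective hf' hg'⟩

theorem SE.restr (S : Type u) [CommRing S] [Algebra S R] {M M' : Cx R} :
    SE M M' → SE (restr S M) (restr S M') := by
  rintro ⟨f, hf, hf'⟩
  exact ⟨restrMap S f, ⟨hf.d, hf.del⟩, hf'⟩

theorem HE.restr (S : Type u) [CommRing S] [Algebra S R] {M M' : Cx R} :
    HE M M' → HE (restr S M) (restr S M') := by
  rintro ⟨f, hf⟩
  exact ⟨restrMap S f, hf.restrMap S⟩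

section Const

variable (D : Type v) [Category.{w} D]

theorem SE.const {M N : Cx R} : SE M N → SIso ((Functor.const D).obj M)
    ((Functor.const D).obj N) := fun ⟨f, hf, hb⟩ =>
  ⟨(Functor.const D).map f, fun _ => ⟨hf, hb⟩⟩

theorem HE.const {M N : Cx R} : HE M N → HEqv ((Functor.const D).obj M)
    ((Functor.const D).obj N) := fun ⟨f, hf⟩ =>
  ⟨(Functor.const D).map f, fun _ => hf⟩

theorem SIso.se {D : Type v} [Category.{w} D] {F G : D ⥤ Cx R} (h : SIso F G) (X : D) :
    SE (F.obj X) (G.obj X) := h.elim fun α hα => ⟨α.app X, hα X⟩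

theorem tens_const {S : Type u} [CommRing S] [Algebra S R] (M : Cx R) (N : Cx S) :
    SIso (tens ((Functor.const D).obj M) ((Functor.const D).obj N))
      ((Functor.const D).obj (Cx.tensor M N)) :=
  SIso.of_app (F' := (Functor.const D).obj (Cx.tensor M N)) (fun _ => 𝟙 _)
    (fun _ => tensor_hom_ext fun _ _ => rfl)
    (fun _ => IsChain.id _) fun _ => Function.bijective_id

end Const

theorem restr_restr_se {T : Type u} [CommRing T] (B : Type u) [CommRing B] [Algebra B R]
    [Algebra T R] [Algebra T B] [IsScalarTower T B R] (F : Cx R) :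
    SE (restr T (restr B F)) (restr T F) :=
  (restr_restr B ((Functor.const (Discrete PUnit.{1})).obj F)).se ⟨⟨⟩⟩

section Kos

/-- The tensor product of a complex with the factorization `R ⇄ R` with the maps `a` and `b`. -/
def kosGr (N : Cx R) (q : ℤ × ℤ) : Submodule R (N.carrier × N.carrier) :=
  (N.gr q).prod (N.gr (q.1, q.2 + 1))

theorem kosGr_internal (N : Cx R) : DirectSum.IsInternal (kosGr N) := by
  refine isInternal_of_coaction _ ?_
    (((Finsupp.mapRange.addMonoidHom (LinearMap.inl R N.carrier N.carrier).toAddMonoidHom).comp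
        (components N.internal).toAddMonoidHom).coprod
      -- The second copy of `N` belongs to the generator of internal degree `-1`.
      (((Finsupp.mapDomain.addMonoidHom fun i : ℤ × ℤ => (i.1, i.2 - 1)).comp
        (Finsupp.mapRange.addMonoidHom (LinearMap.inr R N.carrier N.carrier).toAddMonoidHom)).comp
        (components N.internal).toAddMonoidHom)) ?_
  · rw [Submodule.eq_top_iff']
    have h1 : ⨆ q, N.gr q ≤ (⨆ q, kosGr N q).comap (LinearMap.inl R N.carrier N.carrier) :=
      iSup_le fun q x hx => Submodule.mem_iSup_of_mem q ⟨hx, zero_mem _⟩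
    have h2 : ⨆ q, N.gr q ≤ (⨆ q, kosGr N q).comap (LinearMap.inr R N.carrier N.carrier) :=
      iSup_le fun q x hx => Submodule.mem_iSup_of_mem (q.1, q.2 - 1) ⟨zero_mem _, by
        change x ∈ N.gr (q.1, q.2 - 1 + 1)
        rw [sub_add_cancel]; exact hx⟩
    rintro ⟨x, y⟩
    have h3 : (x, (0 : N.carrier)) ∈ ⨆ q, kosGr N q := h1 (iSup_gr N x)
    have h4 : ((0 : N.carrier), y) ∈ ⨆ q, kosGr N q := h2 (iSup_gr N y)
    simpa using add_mem h3 h4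
  · rintro ⟨n, i⟩ ⟨x, y⟩ ⟨hx, hy⟩
    change x ∈ N.gr (n, i) at hx
    change y ∈ N.gr (n, i + 1) at hy
    simp [components_of_mem N.internal hx, components_of_mem N.internal hy,
      Finsupp.mapDomain_single, ← Finsupp.single_add]

theorem mem_par_kosGr {N : Cx R} {n : ℤ} {b : ZMod 2} {x : N.carrier × N.carrier} :
    x ∈ par (kosGr N) n b ↔ x.1 ∈ par N.gr n b ∧ x.2 ∈ par N.gr n (b + 1) := by
  constructor
  · intro hx
    have : par (kosGr N) n b ≤ (par N.gr n b).prod (par N.gr n (b + 1)) := by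
      refine par_le ?_
      rintro i rfl ⟨x, y⟩ ⟨h1, h2⟩
      refine ⟨mem_par h1, ?_⟩
      have := mem_par (n := n) (i := i + 1) h2
      rwa [Int.cast_add, Int.cast_one] at this
    exact this hx
  · rintro ⟨h1, h2⟩
    have e1 : par N.gr n b ≤ (par (kosGr N) n b).comap (LinearMap.inl R _ _) := by
      refine par_le fun i hi y hy => ?_
      exact mem_par' (gr := kosGr N) (i := i) ⟨hy, zero_mem _⟩ hi
    have e2 : par N.gr n (b + 1) ≤ (par (kosGr N) n b).comap (LinearMap.inr R _ _) := by
      refine par_le fun i hi y hy => ?_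
      refine mem_par' (gr := kosGr N) (i := i - 1) ⟨zero_mem _, ?_⟩ ?_
      · change y ∈ N.gr (n, i - 1 + 1)
        rw [sub_add_cancel]; exact hy
      · rw [Int.cast_sub, hi, Int.cast_one, add_sub_cancel_right]
    have h3 : (x.1, (0 : N.carrier)) ∈ par (kosGr N) n b := e1 h1
    have h4 : ((0 : N.carrier), x.2) ∈ par (kosGr N) n b := e2 h2
    simpa using add_mem h3 h4

/-- The tensor product of a complex with the factorization `R ⇄ R` with the maps `a` and `b`. -/
def kos (a b : R) (N : Cx R) : Cx R where
  carrier := N.carrier × N.carrier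
  gr := kosGr N
  internal := kosGr_internal N
  d := LinearMap.prod (N.d ∘ₗ LinearMap.fst R _ _ + a • LinearMap.snd R _ _)
    (b • LinearMap.fst R _ _ - N.d ∘ₗ LinearMap.snd R _ _)
  del := N.del.prodMap N.del
  d_homog n c x hx := by
    rw [mem_par_kosGr] at hx ⊢
    have h1 := N.d_homog _ _ _ hx.1
    have h2 := N.d_homog _ _ _ hx.2
    have e : c + 1 + 1 = c := by rw [add_assoc, CharTwo.add_self_eq_zero, add_zero]
    rw [add_zero, e] at h2
    rw [add_zero] at h1 ⊢
    refine ⟨add_mem h1 (Submodule.smul_mem _ _ hx.2), sub_mem (Submodule.smul_mem _ _ ?_) ?_⟩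
    · rw [e]; exact hx.1
    · rw [e]; exact h2
  del_homog n c x hx := by
    rw [mem_par_kosGr] at hx ⊢
    have h1 := N.del_homog _ _ _ hx.1
    have h2 := N.del_homog _ _ _ hx.2
    rw [add_zero] at h1 h2 ⊢
    exact ⟨h1, h2⟩

/-- A pair of elements as an element of the Koszul complex. -/
def pr {a b : R} {N : Cx R} (x y : N.carrier) : (kos a b N).carrier := (x, y)

variable {a b : R} {N : Cx R}

theorem pr_surj (z : (kos a b N).carrier) : ∃ x y, z = pr x y := ⟨z.1, z.2, rfl⟩

theorem pr_add (x y x' y' : N.carrier) :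
    (pr x y + pr x' y' : (kos a b N).carrier) = pr (x + x') (y + y') := rfl

theorem smul_pr (r : R) (x y : N.carrier) :
    (r • pr x y : (kos a b N).carrier) = pr (r • x) (r • y) := rfl

theorem kos_d (x y : N.carrier) : (kos a b N).d (pr x y) = pr (N.d x + a • y) (b • x - N.d y) :=
  rfl

theorem kos_del (x y : N.carrier) : (kos a b N).del (pr x y) = pr (N.del x) (N.del y) := rfl

theorem pr_mem {n : ℤ} {c : ZMod 2} {x y : N.carrier} :
    (pr x y : (kos a b N).carrier) ∈ par (kos a b N).gr n c ↔
      x ∈ par N.gr n c ∧ y ∈ par N.gr n (c + 1) := mem_par_kosGr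

/-- The mixed terms `a d y` and `b d x` cancel because of the minus sign on the second copy; `ab`
and the square of `N.d` remain. -/
theorem kos_d_d {w : R} (h : ∀ x, N.d (N.d x) = w • x) (z : (kos a b N).carrier) :
    (kos a b N).d ((kos a b N).d z) = (a * b + w) • z := by
  obtain ⟨x, y, rfl⟩ := pr_surj z
  rw [kos_d, kos_d, smul_pr]
  simp only [map_add, map_sub, map_smul, h, smul_add, smul_sub, smul_smul, add_smul]
  rw [mul_comm b a]
  congr 1 <;> abel

theorem SE.kos {N' : Cx R} (a b : R) : SE N N' → SE (kos a b N) (Cx.kos a b N') := by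
  rintro ⟨f, hf, hb⟩
  refine ⟨⟨(Hom.f f).prodMap (Hom.f f), fun n c z hz => ?_⟩, ⟨fun z => ?_, fun z => ?_⟩,
    hb.prodMap hb⟩
  · obtain ⟨x, y, rfl⟩ := pr_surj z
    rw [pr_mem] at hz
    have h1 := f.homog _ _ _ hz.1
    have h2 := f.homog _ _ _ hz.2
    rw [add_zero, add_zero] at h1 h2 ⊢
    exact pr_mem.2 ⟨h1, h2⟩
  · obtain ⟨x, y, rfl⟩ := pr_surj z
    refine congrArg₂ (pr (a := a) (b := b)) ?_ ?_
    · exact (map_add _ _ _).trans (congrArg₂ _ (hf.d x) (map_smul _ _ _))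
    · exact (map_sub _ _ _).trans (congrArg₂ _ (map_smul _ _ _) (hf.d y))
  · obtain ⟨x, y, rfl⟩ := pr_surj z
    exact congrArg₂ (pr (a := a) (b := b)) (hf.del x) (hf.del y)

/-- The two generators of degree `-1` anticommute, hence the sign on the component that contains
both of them, and on no other component. -/
theorem kos_comm (a b a' b' : R) (N : Cx R) :
    SE (kos a b (kos a' b' N)) (kos a' b' (kos a b N)) := by
  let f : (kos a b (kos a' b' N)).carrier →ₗ[R] (kos a' b' (kos a b N)).carrier :=
    { toFun := fun z => pr (pr z.1.1 z.2.1) (pr z.1.2 (-z.2.2))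
      map_add' := fun z w => by
        refine congrArg (fun t => pr (pr _ _) (pr _ t)) (neg_add z.2.2 w.2.2)
      map_smul' := fun r z => by
        refine congrArg (fun t => pr (pr _ _) (pr _ t)) (smul_neg r z.2.2).symm }
  have hf : ∀ x y x' y', f (pr (pr x y) (pr x' y')) = pr (pr x x') (pr y (-y')) :=
    fun _ _ _ _ => rfl
  refine ⟨⟨f, fun n c z hz => ?_⟩, ⟨fun z => ?_, fun z => ?_⟩, ?_, ?_⟩
  · obtain ⟨z, z', rfl⟩ := pr_surj z
    obtain ⟨x, y, rfl⟩ := pr_surj z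
    obtain ⟨x', y', rfl⟩ := pr_surj z'
    rw [add_zero, add_zero, hf, pr_mem, pr_mem, pr_mem]
    rw [pr_mem, pr_mem, pr_mem] at hz
    exact ⟨⟨hz.1.1, hz.2.1⟩, hz.1.2, neg_mem hz.2.2⟩
  · obtain ⟨z, z', rfl⟩ := pr_surj z
    obtain ⟨x, y, rfl⟩ := pr_surj z
    obtain ⟨x', y', rfl⟩ := pr_surj z'
    change f _ = (kos a' b' (kos a b N)).d (f _)
    rw [hf]
    refine congrArg₂ pr (congrArg₂ pr ?_ ?_) (congrArg₂ pr ?_ ?_)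
    · change N.d x + a' • y + a • x' = N.d x + a • x' + a' • y
      abel
    · change b • x - (N.d x' + a' • y') = b • x - N.d x' + a' • -y'
      rw [smul_neg]; abel
    · change b' • x - N.d y + a • y' = b' • x - (N.d y + a • -y')
      rw [smul_neg]; abel
    · change -(b • y - (b' • x' - N.d y')) = b' • x' - (b • y - N.d (-y'))
      rw [map_neg]; abel
  · obtain ⟨z, z', rfl⟩ := pr_surj z
    obtain ⟨x, y, rfl⟩ := pr_surj z
    obtain ⟨x', y', rfl⟩ := pr_surj z'
    exact congrArg (fun t => pr (pr (N.del x) (N.del x')) (pr (N.del y) t)) (map_neg _ _).symm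
  · refine Function.LeftInverse.injective
      (g := fun z => pr (pr z.1.1 z.2.1) (pr z.1.2 (-z.2.2))) fun z => ?_
    exact congrArg (fun t => pr (pr z.1.1 z.1.2) (pr z.2.1 t)) (neg_neg z.2.2)
  · refine Function.RightInverse.surjective
      (g := fun z => pr (pr z.1.1 z.2.1) (pr z.1.2 (-z.2.2))) fun z => ?_
    exact congrArg (fun t => pr (pr z.1.1 z.1.2) (pr z.2.1 t)) (neg_neg z.2.2)

theorem restr_kos (S : Type u) [CommRing S] [Algebra S R] (a b : S) (N : Cx R) :
    SE (kos a b (restr S N)) (restr S (kos (algebraMap S R a) (algebraMap S R b) N)) := by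
  refine ⟨⟨LinearMap.id, fun n c z hz => ?_⟩, ⟨fun _ => rfl, fun _ => rfl⟩,
    Function.bijective_id⟩
  obtain ⟨x, y, rfl⟩ := pr_surj z
  rw [pr_mem] at hz
  rw [add_zero, add_zero]
  refine (mem_par_restrict S (kos (algebraMap S R a) (algebraMap S R b) N)).2 (pr_mem.2 ?_)
  exact ⟨(mem_par_restrict S N).1 hz.1, (mem_par_restrict S N).1 hz.2⟩

/-- The map moves the generator of degree `-1` to the left past `x`, whence the operator `tau` on
the second component. As `tau` anticommutes with `N.d`, it accounts for the minus sign on the second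
copy. -/
theorem tensor_kos {S : Type u} [CommRing S] [Algebra S R] (a b : S) (N : Cx R) (M : Cx S) :
    SE (tensor N (kos a b M)) (kos (algebraMap S R a) (algebraMap S R b) (tensor N M)) := by
  have hτ : ∀ (s : S) x, tau N.internal (s • x) = s • tau N.internal x := fun s x =>
    map_smul (tau N.internal) (algebraMap S R s) x
  let f : (tensor N (kos a b M)).carrier →+
      (kos (algebraMap S R a) (algebraMap S R b) (tensor N M)).carrier :=
    tmMap (fun x z => pr (tm x z.1) (tm (tau N.internal x) z.2))
      (fun x x' z => by rw [add_tm, map_add, add_tm, pr_add])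
      (fun x z z' => by
        rw [pr_add, ← tm_add, ← tm_add]; rfl)
      (fun s x z => by
        rw [smul_tm_comm, hτ, smul_tm_comm]; rfl)
  have hf : ∀ x y z, f (tm x (pr y z)) = pr (tm x y) (tm (tau N.internal x) z) :=
    fun _ _ _ => rfl
  let g₁ : (tensor N M).carrier →+ (tensor N (kos a b M)).carrier :=
    tmMap (fun x y => tm x (pr y 0)) (fun x x' y => add_tm _ _ _)
      (fun x y y' => by rw [← tm_add, pr_add, add_zero])
      (fun s x y => by rw [smul_tm_comm, smul_pr, smul_zero])
  let g₂ : (tensor N M).carrier →+ (tensor N (kos a b M)).carrier :=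
    tmMap (fun x y => tm (tau N.internal x) (pr 0 y))
      (fun x x' y => by rw [map_add, add_tm])
      (fun x y y' => by rw [← tm_add, pr_add, add_zero])
      (fun s x y => by rw [hτ, smul_tm_comm, smul_pr, smul_zero])
  have hg₁ : ∀ x y, g₁ (tm x y) = tm x (pr y 0) := fun _ _ => rfl
  have hg₂ : ∀ x y, g₂ (tm x y) = tm (tau N.internal x) (pr 0 y) := fun _ _ => rfl
  let g : (kos (algebraMap S R a) (algebraMap S R b) (tensor N M)).carrier →+
      (tensor N (kos a b M)).carrier := AddMonoidHom.coprod g₁ g₂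
  have hg : ∀ z z', g (pr z z') = g₁ z + g₂ z' := fun _ _ => rfl
  have hgf : ∀ z, g (f z) = z := fun z => by
    refine tm_ext (f := g.comp f) (g := AddMonoidHom.id _) (fun x z => ?_) z
    obtain ⟨y, y', rfl⟩ := pr_surj z
    rw [AddMonoidHom.comp_apply, hf, hg, hg₁, hg₂, tau_tau, ← tm_add, pr_add, add_zero, zero_add]
    rfl
  have h₁ : ∀ z, f (g₁ z) = pr z 0 := fun z => by
    refine tm_ext (f := f.comp g₁) (g := AddMonoidHom.inl (tensor N M).carrier
      (tensor N M).carrier) (fun x y => ?_) z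
    rw [AddMonoidHom.comp_apply, hg₁, hf, tm_zero]; rfl
  have h₂ : ∀ z, f (g₂ z) = pr 0 z := fun z => by
    refine tm_ext (f := f.comp g₂) (g := AddMonoidHom.inr (tensor N M).carrier
      (tensor N M).carrier) (fun x y => ?_) z
    rw [AddMonoidHom.comp_apply, hg₂, hf, tm_zero, tau_tau]; rfl
  have hfg : ∀ z, f (g z) = z := by
    intro z
    obtain ⟨z, z', rfl⟩ := pr_surj z
    rw [hg, map_add, h₁, h₂, pr_add, add_zero, zero_add]
  refine ⟨homOfAdd f (fun r x y => ?_) (fun n c x hx m c' z hz => ?_), ⟨fun z => ?_, fun z => ?_⟩,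
    Function.LeftInverse.injective hgf, Function.RightInverse.surjective hfg⟩
  · obtain ⟨y, y', rfl⟩ := pr_surj y
    rw [hf, hf, map_smul]; rfl
  · obtain ⟨y, y', rfl⟩ := pr_surj z
    rw [pr_mem] at hz
    rw [hf, pr_mem]
    refine ⟨tm_mem_par hx hz.1, ?_⟩
    rw [add_assoc]
    have := tau_homog N.internal n c x hx
    rw [add_zero, add_zero] at this
    exact tm_mem_par this hz.2
  · refine tm_ext (f := f.comp (tensor N (kos a b M)).d.toAddMonoidHom)
      (g := AddMonoidHom.comp (LinearMap.toAddMonoidHom (Cx.d _)) f) (fun x z => ?_) z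
    obtain ⟨y, y', rfl⟩ := pr_surj z
    simp only [AddMonoidHom.comp_apply, LinearMap.toAddMonoidHom_coe]
    rw [d_tm, kos_d, hf, map_add, hf, hf, kos_d, pr_add, d_tm, d_tm, tau_tau,
      N.d_homog.odd_tau N.internal N.internal, neg_tm, tm_add, sub_eq_add_neg (b • y), tm_add,
      tm_neg, tm_smul, tm_smul]
    congr 1 <;> abel
  · refine tm_ext (f := f.comp (tensor N (kos a b M)).del.toAddMonoidHom)
      (g := AddMonoidHom.comp (LinearMap.toAddMonoidHom (Cx.del _)) f) (fun x z => ?_) z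
    obtain ⟨y, y', rfl⟩ := pr_surj z
    simp only [AddMonoidHom.comp_apply, LinearMap.toAddMonoidHom_coe]
    rw [del_tm, kos_del, hf, map_add, hf, hf, kos_del, pr_add, del_tm, del_tm]
    have h1 : N.del (tau N.internal x) = tau N.internal (N.del x) := by
      rw [N.del_homog.tau_apply N.internal N.internal]; simp [sgn2]
    have h2 : tau N.internal (sigma N.internal x) = sigma N.internal (tau N.internal x) :=
      (tau_homog N.internal).even_sigma N.internal N.internal x
    rw [h1, h2]

end Kos

/-! ### Koszul factorizations given by multisets of pairs -/

section KoszulComplex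

variable {S : Type u} [CommRing S] [Algebra S R]

/-- The tensor product with the factorizations `R ⇄ R` given by a multiset of pairs. -/
def kosList (l : List (R × R)) (N : Cx R) : Cx R := l.foldr (fun c => kos c.1 c.2) N

/-- The tensor product with the factorizations `R ⇄ R` given by a multiset of pairs. -/
def kosz (s : Multiset (R × R)) (N : Cx R) : Cx R := kosList s.toList N

theorem SE.kosList {N N' : Cx R} (h : SE N N') : ∀ l : List (R × R),
    SE (kosList l N) (Cx.kosList l N')
  | [] => h
  | c :: l => SE.kos c.1 c.2 (SE.kosList h l)

theorem SE.kosz {N N' : Cx R} (h : SE N N') (s : Multiset (R × R)) :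
    SE (kosz s N) (Cx.kosz s N') := h.kosList _

theorem kosList_perm {l l' : List (R × R)} (h : l.Perm l') (N : Cx R) :
    SE (kosList l N) (kosList l' N) := by
  induction h with
  | nil => exact SE.refl _
  | cons c _ ih => exact SE.kos _ _ ih
  | swap c c' l => exact kos_comm _ _ _ _ _
  | trans _ _ ih ih' => exact ih.trans ih'

/-- The definition of `kosz` chooses an order of the multiset; by `kos_comm` every other order gives
an isomorphic complex. Multisets then spare all further bookkeeping of orders. -/
theorem kosz_coe (l : List (R × R)) (N : Cx R) : SE (kosz l N) (kosList l N) :=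
  kosList_perm (Multiset.coe_eq_coe.1 (Multiset.coe_toList _)) N

theorem kosz_zero (N : Cx R) : SE (kosz 0 N) N := kosz_coe [] N

theorem kosz_cons (c : R × R) (s : Multiset (R × R)) (N : Cx R) :
    SE (kosz (c ::ₘ s) N) (kos c.1 c.2 (kosz s N)) := by
  induction s using Quotient.inductionOn with
  | h l => exact (kosz_coe (c :: l) N).trans (SE.kos _ _ (kosz_coe l N).symm)

theorem kosz_add (s t : Multiset (R × R)) (N : Cx R) :
    SE (kosz (s + t) N) (kosz s (kosz t N)) := by
  induction s using Multiset.induction_on with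
  | empty => rw [zero_add]; exact (kosz_zero _).symm
  | cons c s ih =>
    rw [Multiset.cons_add]
    exact (kosz_cons _ _ _).trans ((SE.kos _ _ ih).trans (kosz_cons _ _ _).symm)

/-- The image of a pair under a ring homomorphism. -/
abbrev mapPair {A B : Type*} [CommRing A] [CommRing B] (f : A →+* B) (c : A × A) : B × B :=
  (f c.1, f c.2)

/-- The pairs are pulled out of the second factor one by one. Applied to a second factor built on
the unit, this merges a tensor product of Koszul factorizations into one factorization. -/
theorem tensor_kosz (s : Multiset (S × S)) (N : Cx R) (M : Cx S) :
    SE (tensor N (kosz s M)) (kosz (s.map (mapPair (algebraMap S R))) (tensor N M)) := by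
  induction s using Multiset.induction_on with
  | empty => exact (SE.tensor (SE.refl N) (kosz_zero M)).trans (kosz_zero _).symm
  | cons c s ih =>
    rw [Multiset.map_cons]
    exact (SE.tensor (SE.refl N) (kosz_cons c s M)).trans ((tensor_kos _ _ _ _).trans
      ((SE.kos _ _ ih).trans (kosz_cons (mapPair (algebraMap S R) c) _ _).symm))

theorem restr_kosz (s : Multiset (S × S)) (N : Cx R) :
    SE (kosz s (restr S N)) (restr S (kosz (s.map (mapPair (algebraMap S R))) N)) := by
  induction s using Multiset.induction_on with
  | empty => exact (kosz_zero _).trans (SE.restr S (kosz_zero N).symm)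
  | cons c s ih =>
    rw [Multiset.map_cons]
    exact (kosz_cons _ _ _).trans ((SE.kos _ _ ih).trans ((restr_kos S _ _ _).trans
      (SE.restr S (kosz_cons (mapPair (algebraMap S R) c) _ _).symm)))

theorem SE.d_d {N N' : Cx R} (h : SE N N') {w : R} (hN : ∀ x, N'.d (N'.d x) = w • x)
    (x : N.carrier) : N.d (N.d x) = w • x := by
  obtain ⟨f, hf, hb⟩ := h
  refine hb.1 ?_
  rw [hf.d, hf.d, hN, map_smul]

/-- Each pair adds its product to the potential. The value of the potential is an ingredient of the
elimination of a variable. -/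
theorem kosz_d_d (s : Multiset (R × R)) {N : Cx R} {w : R} (h : ∀ x, N.d (N.d x) = w • x) :
    ∀ z, (kosz s N).d ((kosz s N).d z) = ((s.map fun c => c.1 * c.2).sum + w) • z := by
  induction s using Multiset.induction_on with
  | empty => exact SE.d_d (kosz_zero N) (by simpa using h)
  | cons c s ih =>
    refine SE.d_d (kosz_cons c s N) fun z => ?_
    rw [Multiset.map_cons, Multiset.sum_cons, add_assoc]
    exact kos_d_d ih z

end KoszulComplex

end Cx

/-- The complex of matrix factorizations without the conditions on the squares. -/
def MFComplex.toCx {R : Type u} [CommRing R] {w : R} (M : MFComplex R w) : Cx R where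
  carrier := M.carrier
  gr := M.gr
  internal := M.internal
  d := M.d
  del := M.del
  d_homog := M.d_homog
  del_homog := M.del_homog

/-! ### The exterior algebra of a free module with one more basis vector -/

namespace Exterior

variable {R : Type*} [CommRing R] {M N : Type*} [AddCommGroup M] [Module R M] [AddCommGroup N]
  [Module R N]

/-- Contraction on the exterior algebra. -/
def contr (φ : Module.Dual R M) : ExteriorAlgebra R M →ₗ[R] ExteriorAlgebra R M :=
  CliffordAlgebra.contractLeft (Q := (0 : QuadraticForm R M)) φ

theorem contr_algebraMap (φ : Module.Dual R M) (r : R) :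
    contr φ (algebraMap R (ExteriorAlgebra R M) r) = 0 :=
  CliffordAlgebra.contractLeft_algebraMap (Q := (0 : QuadraticForm R M)) φ r

theorem contr_ι_mul (φ : Module.Dual R M) (m : M) (v : ExteriorAlgebra R M) :
    contr φ (ExteriorAlgebra.ι R m * v) = φ m • v - ExteriorAlgebra.ι R m * contr φ v :=
  CliffordAlgebra.contractLeft_ι_mul (Q := (0 : QuadraticForm R M)) (d := φ) m v

theorem contr_zero (v : ExteriorAlgebra R M) : contr (0 : Module.Dual R M) v = 0 := by
  have : CliffordAlgebra.contractLeft (Q := (0 : QuadraticForm R M)) (0 : Module.Dual R M) = 0 :=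
    map_zero _
  exact LinearMap.congr_fun this v

theorem induction {C : ExteriorAlgebra R M → Prop}
    (h0 : ∀ r, C (algebraMap R (ExteriorAlgebra R M) r)) (ha : ∀ x y, C x → C y → C (x + y))
    (hm : ∀ m x, C x → C (ExteriorAlgebra.ι R m * x)) (x : ExteriorAlgebra R M) : C x :=
  CliffordAlgebra.left_induction (Q := (0 : QuadraticForm R M)) h0 ha
    (fun x m hx => hm m x hx) x

theorem map_contr (A : M →ₗ[R] N) (ψ : Module.Dual R N) (v : ExteriorAlgebra R M) :
    ExteriorAlgebra.map A (contr (ψ ∘ₗ A) v) = contr ψ (ExteriorAlgebra.map A v) := by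
  induction v using induction with
  | h0 r =>
    rw [contr_algebraMap, map_zero, AlgHom.commutes, contr_algebraMap]
  | ha x y hx hy => simp only [map_add, hx, hy]
  | hm m x hx =>
    rw [contr_ι_mul, map_sub, map_smul, map_mul, map_mul, ExteriorAlgebra.map_apply_ι,
      contr_ι_mul, hx]
    rfl

theorem ι_mul_ι_mul (m n : M) (x : ExteriorAlgebra R M) :
    ExteriorAlgebra.ι R m * (ExteriorAlgebra.ι R n * x) =
      -(ExteriorAlgebra.ι R n * (ExteriorAlgebra.ι R m * x)) := by
  rw [← mul_assoc, ← mul_assoc, ← neg_mul]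
  congr 1
  exact eq_neg_of_add_eq_zero_left (ExteriorAlgebra.ι_add_mul_swap m n)

section Option

variable {E : Type}

/-- Extension by zero. -/
def ext (R : Type*) [CommRing R] (E : Type) : (E → R) →ₗ[R] (Option E → R) where
  toFun v o := o.elim 0 v
  map_add' v w := by funext o; cases o <;> simp
  map_smul' r v := by funext o; cases o <;> simp

/-- Restriction. -/
def res (R : Type*) [CommRing R] (E : Type) : (Option E → R) →ₗ[R] (E → R) :=
  LinearMap.funLeft R R some

theorem res_ext : res R E ∘ₗ ext R E = LinearMap.id := rfl

variable [DecidableEq (Option E)]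

/-- The additional basis vector. -/
def e₀ (R : Type*) [CommRing R] (E : Type) [DecidableEq (Option E)] : Option E → R :=
  Pi.single none 1

theorem decomp (m : Option E → R) : m = ext R E (res R E m) + m none • e₀ R E := by
  funext o
  cases o <;> simp [ext, res, e₀]

theorem res_e₀ : res R E (e₀ R E) = 0 := by
  funext o; simp [res, e₀]

/-- The map `(x, y) ↦ x + e₀ ∧ y`. -/
def join (R : Type*) [CommRing R] (E : Type) [DecidableEq (Option E)] :
    ExteriorAlgebra R (E → R) × ExteriorAlgebra R (E → R) →ₗ[R]
      ExteriorAlgebra R (Option E → R) :=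
  (ExteriorAlgebra.map (ext R E)).toLinearMap.coprod
    (LinearMap.mulLeft R (ExteriorAlgebra.ι R (e₀ R E)) ∘ₗ
      (ExteriorAlgebra.map (ext R E)).toLinearMap)

theorem join_apply (x y : ExteriorAlgebra R (E → R)) : join R E (x, y) =
    ExteriorAlgebra.map (ext R E) x +
      ExteriorAlgebra.ι R (e₀ R E) * ExteriorAlgebra.map (ext R E) y := rfl

/-- Split `m` into its restriction to `E` and a multiple of `e₀`. The first part anticommutes with
`e₀`, and the second part kills the summand `e₀ ∧ y`. -/
theorem ι_mul_join (m : Option E → R) (x y : ExteriorAlgebra R (E → R)) :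
    ExteriorAlgebra.ι R m * join R E (x, y) =
      join R E (ExteriorAlgebra.ι R (res R E m) * x,
        m none • x - ExteriorAlgebra.ι R (res R E m) * y) := by
  have h0 : ExteriorAlgebra.ι R (e₀ R E) * (ExteriorAlgebra.ι R (e₀ R E) *
      ExteriorAlgebra.map (ext R E) y) = 0 := by
    rw [← mul_assoc, ExteriorAlgebra.ι_sq_zero, zero_mul]
  have h1 : ExteriorAlgebra.ι R m = ExteriorAlgebra.ι R (ext R E (res R E m)) +
      m none • ExteriorAlgebra.ι R (e₀ R E) := by
    rw [← map_smul, ← map_add, ← decomp]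
  rw [join_apply, join_apply, h1, map_mul, map_sub, map_smul, map_mul,
    ExteriorAlgebra.map_apply_ι, mul_sub, mul_smul_comm, add_mul, mul_add, mul_add,
    smul_mul_assoc, smul_mul_assoc, h0, smul_zero, add_zero, ι_mul_ι_mul (ext R E (res R E m))]
  abel

/-- Contraction is an antiderivation: from `e₀ ∧ y` it produces `φ e₀ • y` and, with a minus sign,
`e₀` times the contraction of `y`. This minus sign is the one on the second copy in `kos`. -/
theorem contr_join (φ : Module.Dual R (Option E → R)) (x y : ExteriorAlgebra R (E → R)) :
    contr φ (join R E (x, y)) = join R E (contr (φ ∘ₗ ext R E) x + φ (e₀ R E) • y,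
      -contr (φ ∘ₗ ext R E) y) := by
  rw [join_apply, join_apply, map_add, contr_ι_mul, ← map_contr, ← map_contr, map_add, map_smul,
    map_neg, mul_neg]
  abel

/-- Both components can be recovered. Setting `e₀` to zero gives `x`. Contracting first with the
coordinate `none` gives `y`, because this contraction vanishes on the exterior algebra of the old
module. -/
theorem join_injective : Function.Injective (join R E) := by
  let φ : Module.Dual R (Option E → R) := LinearMap.proj none
  have h0 : φ ∘ₗ ext R E = 0 := rfl
  have h1 : φ (e₀ R E) = 1 := by simp [φ, e₀]
  have hres : ∀ x, ExteriorAlgebra.map (res R E) (ExteriorAlgebra.map (ext R E) x) = x := fun x => by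
    have := ExteriorAlgebra.map_comp_map (R := R) (ext R E) (res R E)
    rw [res_ext, ExteriorAlgebra.map_id] at this
    exact AlgHom.congr_fun this x
  refine Function.LeftInverse.injective (g := fun z =>
    (ExteriorAlgebra.map (res R E) z, ExteriorAlgebra.map (res R E) (contr φ z))) fun z => ?_
  obtain ⟨x, y⟩ := z
  refine Prod.ext ?_ ?_
  · change ExteriorAlgebra.map (res R E) (join R E (x, y)) = x
    rw [join_apply, map_add, hres, map_mul, ExteriorAlgebra.map_apply_ι, res_e₀, map_zero,
      zero_mul, add_zero]
  · change ExteriorAlgebra.map (res R E) (contr φ (join R E (x, y))) = y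
    rw [contr_join, h0, contr_zero, contr_zero, h1, one_smul, zero_add, join_apply, neg_zero,
      map_zero, mul_zero, add_zero, hres]

/-- The image contains the scalars and is stable under sums and, by `ι_mul_join`, under left
multiplication by vectors. -/
theorem join_surjective : Function.Surjective (join R E) := by
  intro z
  induction z using induction with
  | h0 r =>
    refine ⟨(algebraMap R _ r, 0), ?_⟩
    rw [join_apply, map_zero, mul_zero, add_zero, AlgHom.commutes]
  | ha x y hx hy =>
    obtain ⟨x, rfl⟩ := hx
    obtain ⟨y, rfl⟩ := hy
    exact ⟨x + y, map_add _ _ _⟩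
  | hm m x hx =>
    obtain ⟨⟨x, y⟩, rfl⟩ := hx
    exact ⟨_, (ι_mul_join m x y).symm⟩

end Option

end Exterior

/-! ### The exterior algebra as an iterated product of two-term factorizations -/

namespace Cx

open Exterior

variable {R : Type u} [CommRing R]

/-- The Koszul matrix factorization on the exterior algebra. -/
def ext {E : Type} [Fintype E] (x y : E → R) : Cx R :=
  (koszul x y rfl).single.toCx

theorem ext_gr {E : Type} [Fintype E] (x y : E → R) {i : ℤ} {v : ExteriorAlgebra R (E → R)}
    (hv : v ∈ koszulGr R E i) : v ∈ (ext x y).gr (0, i) := by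
  change v ∈ (if (0 : ℤ) = 0 then koszulGr R E i else ⊥)
  rwa [if_pos rfl]

theorem ext_gr_cases {E : Type} [Fintype E] {x y : E → R} {n i : ℤ}
    {v : ExteriorAlgebra R (E → R)} (hv : v ∈ (ext x y).gr (n, i)) :
    (n = 0 ∧ v ∈ koszulGr R E i) ∨ v = 0 := by
  change v ∈ (if n = 0 then koszulGr R E i else ⊥) at hv
  split_ifs at hv with h
  · exact Or.inl ⟨h, hv⟩
  · exact Or.inr hv

theorem ext_equiv {E F : Type} [Fintype E] [Fintype F] (e : E ≃ F) (x y : F → R) :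
    SE (ext x y) (ext (fun a => x (e a)) (fun a => y (e a))) := by
  let A : (F → R) →ₗ[R] (E → R) := LinearMap.funLeft R R e
  let B : (E → R) →ₗ[R] (F → R) := LinearMap.funLeft R R e.symm
  have hAB : A ∘ₗ B = LinearMap.id := by
    refine LinearMap.ext fun v => funext fun a => ?_
    simp [A, B, LinearMap.funLeft]
  have hBA : B ∘ₗ A = LinearMap.id := by
    refine LinearMap.ext fun v => funext fun a => ?_
    simp [A, B, LinearMap.funLeft]
  have key : ∀ {X Y : Type} [Fintype X] [Fintype Y] (A : (X → R) →ₗ[R] (Y → R))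
      (B : (Y → R) →ₗ[R] (X → R)), A ∘ₗ B = LinearMap.id → ∀ v,
      ExteriorAlgebra.map A (ExteriorAlgebra.map B v) = v := by
    intro X Y _ _ A B h v
    have := ExteriorAlgebra.map_comp_map (R := R) B A
    rw [h, ExteriorAlgebra.map_id] at this
    exact AlgHom.congr_fun this v
  refine ⟨⟨(ExteriorAlgebra.map A).toLinearMap, IsHomog.of_gr fun n i v hv => ?_⟩,
    ⟨fun v => ?_, fun v => ?_⟩,
    Function.LeftInverse.injective (g := ExteriorAlgebra.map B) (key B A hBA),
    Function.RightInverse.surjective (g := ExteriorAlgebra.map B) (key A B hAB)⟩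
  · rw [add_zero, add_zero]
    obtain ⟨rfl, hv⟩ | rfl := ext_gr_cases hv
    · exact mem_par (ext_gr _ _ (map_mem_koszulGr A hv))
    · exact (congrArg (· ∈ _) (map_zero (ExteriorAlgebra.map A).toLinearMap)).mpr (zero_mem _)
  · have h : ∑ a, x (e a) * y (e a) = ∑ b, x b * y b := Equiv.sum_comp e fun b => x b * y b
    exact koszul_d_map A rfl h (fun v => Equiv.sum_comp e fun b => x b * v b) rfl v
  · exact map_zero (ExteriorAlgebra.map A)

/-- The exterior algebra of the enlarged module is `Λ ⊕ e₀ ∧ Λ`, with `Λ` the exterior algebra of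
the old module and the second summand shifted by `-1`. On this decomposition contraction with `x`
and multiplication by `y` add up to the differential of `kos`, by `contr_join` and `ι_mul_join`. -/
theorem ext_option {E : Type} [Fintype E] (x y : Option E → R) :
    SE (kos (x none) (y none) (ext (fun a => x (some a)) (fun a => y (some a)))) (ext x y) := by
  classical
  let f := join R E
  refine ⟨⟨f, IsHomog.of_gr fun n i z hz => ?_⟩, ⟨fun z => ?_, fun z => ?_⟩,
    join_injective, join_surjective⟩
  · obtain ⟨v, w⟩ := z
    obtain ⟨hv, hw⟩ := hz
    rw [add_zero, add_zero]
    have h1 : ExteriorAlgebra.map (Exterior.ext R E) v ∈ par (ext x y).gr n i := by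
      obtain ⟨rfl, hv⟩ | rfl := ext_gr_cases hv
      · have := ext_gr x y (map_mem_koszulGr (Exterior.ext R E) hv)
        exact mem_par (M := (ext x y).carrier) (gr := (ext x y).gr) this
      · have h : ExteriorAlgebra.map (Exterior.ext R E) 0 = 0 := map_zero _
        exact (congrArg (· ∈ _) h).mpr (zero_mem _)
    have h2 : ExteriorAlgebra.ι R (e₀ R E) * ExteriorAlgebra.map (Exterior.ext R E) w ∈
        par (ext x y).gr n i := by
      obtain ⟨rfl, hw⟩ | rfl := ext_gr_cases hw
      · have := (koszul (0 : Option E → R) (e₀ R E) rfl).dm_mem _ _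
          (map_mem_koszulGr (Exterior.ext R E) hw)
        change _ ∈ koszulGr R (Option E) (i + 1 - 1) at this
        rw [add_sub_cancel_right] at this
        exact mem_par (M := (ext x y).carrier) (gr := (ext x y).gr) (ext_gr x y this)
      · have h : ExteriorAlgebra.ι R (e₀ R E) * ExteriorAlgebra.map (Exterior.ext R E) 0 = 0 := by
          rw [map_zero, mul_zero]
        exact (congrArg (· ∈ _) h).mpr (zero_mem _)
    exact add_mem h1 h2
  · obtain ⟨v, w⟩ := z
    have h0 : (∑ e, x e • (LinearMap.proj e : (Option E → R) →ₗ[R] R)) (e₀ R E) = x none := by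
      simp [Fintype.sum_option, e₀]
    have h1 : (∑ e, x e • (LinearMap.proj e : (Option E → R) →ₗ[R] R)) ∘ₗ Exterior.ext R E =
        ∑ e, x (some e) • (LinearMap.proj e : (E → R) →ₗ[R] R) := by
      refine LinearMap.ext fun v => ?_
      simp [Fintype.sum_option, Exterior.ext]
    refine Eq.trans ?_ (congrArg₂ (· + ·) (contr_join (∑ e, x e • LinearMap.proj e) v w)
      (ι_mul_join y v w)).symm
    rw [h0, h1]
    have key : ∀ (φ : Module.Dual R (E → R)) (m : E → R) (v w : ExteriorAlgebra R (E → R)),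
        join R E (contr φ v + ExteriorAlgebra.ι R m * v + x none • w,
          y none • v - (contr φ w + ExteriorAlgebra.ι R m * w)) =
        join R E (contr φ v + x none • w, -contr φ w) +
          join R E (ExteriorAlgebra.ι R m * v, y none • v - ExteriorAlgebra.ι R m * w) := by
      intro φ m v w
      rw [← map_add, Prod.mk_add_mk]
      congr 2 <;> abel
    exact key _ _ v w
  · exact map_zero (join R E)

/-- Without generators the exterior algebra is the ring, and contraction and multiplication by a
vector vanish. -/
theorem ext_empty (x y : PEmpty → R) : SE (unit R) (ext x y) := by
  let f : R →ₗ[R] ExteriorAlgebra R (PEmpty → R) := Algebra.linearMap R _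
  have h0 : f 0 = 0 := map_zero f
  have hs : Function.Surjective f := by
    intro z
    induction z using induction with
    | h0 r => exact ⟨r, rfl⟩
    | ha a b ha hb =>
      obtain ⟨a, rfl⟩ := ha
      obtain ⟨b, rfl⟩ := hb
      exact ⟨a + b, map_add f a b⟩
    | hm m z hz =>
      refine ⟨0, h0.trans ?_⟩
      rw [Subsingleton.elim m 0, map_zero, zero_mul]
  have hi : Function.Injective f := (ExteriorAlgebra.algebraMap_leftInverse (PEmpty → R)).injective
  have hd : ∀ (φ : Module.Dual R (PEmpty → R)) (r : R),
      contr φ (f r) + ExteriorAlgebra.ι R y * f r = 0 := fun φ r => by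
    rw [Subsingleton.elim y 0, map_zero, zero_mul, add_zero]
    exact contr_algebraMap φ r
  refine ⟨⟨f, IsHomog.of_gr fun n i z hz => ?_⟩, ⟨fun z => h0.trans (hd _ z).symm, fun z => h0⟩,
    hi, hs⟩
  rw [add_zero, add_zero]
  by_cases h : (n, i) = (0 : ℤ × ℤ)
  · obtain ⟨rfl, rfl⟩ := Prod.mk.inj h
    refine mem_par (ext_gr _ _ (mem_koszulGr (n := 0) ?_))
    rw [ExteriorAlgebra.exteriorPower, pow_zero]
    exact Submodule.algebraMap_mem _
  · have hz' : z ∈ (if (n, i) = (0 : ℤ × ℤ) then (⊤ : Submodule R (unit R).carrier) else ⊥) := hz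
    rw [if_neg h, Submodule.mem_bot] at hz'
    rw [hz']
    exact (congrArg (· ∈ _) h0).mpr (zero_mem _)

/-- Pairs are added one at a time by `ext_option`. The exterior algebra is thereby replaced by a
form in which pairs can be permuted, split off and mapped along ring homomorphisms. -/
theorem ext_kosz {E : Type} [Fintype E] : ∀ (x y : E → R),
    SE (ext x y) (kosz (Finset.univ.val.map fun e => (x e, y e)) (unit R)) := by
  refine Fintype.induction_empty_option
    (P := fun E _ => ∀ (x y : E → R),
      SE (ext x y) (kosz (Finset.univ.val.map fun e => (x e, y e)) (unit R))) ?_ ?_ ?_ E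
  · intro E F _ e h x y
    letI := Fintype.ofEquiv F e.symm
    have h1 := h (fun a => x (e a)) (fun a => y (e a))
    rw [← Multiset.map_univ_val_equiv e, Multiset.map_map]
    exact (ext_equiv e x y).trans h1
  · intro x y
    exact (ext_empty x y).symm.trans (kosz_zero _).symm
  · intro E _ h x y
    refine (ext_option x y).symm.trans ((SE.kos _ _ (h _ _)).trans ?_)
    have : (Finset.univ : Finset (Option E)).val.map (fun e => (x e, y e)) =
      (x none, y none) ::ₘ Finset.univ.val.map fun e => (x (some e), y (some e)) := by
      rw [univ_option]
      refine (Multiset.map_cons _ _ _).trans ?_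
      exact congrArg _ (Multiset.map_map _ _ _)
    rw [this]
    exact (kosz_cons (x none, y none) _ _).symm

end Cx

/-! ### Elimination of a variable -/

namespace Cx

variable {W V : Type u} [CommRing W] [CommRing V] [Algebra V W]

/-- The data of a split surjection from `N` to `N'` over a split surjection of rings `W → V`, with
kernel the multiples of `u`, and of the division by `u`. -/
structure Division (ev : W →+* V) (u : W) (N : Cx W) (N' : Cx V) where
  E : N.carrier →+ N'.carrier
  s : N'.carrier →+ N.carrier
  q : N.carrier →+ N.carrier
  E_smul : ∀ w x, E (w • x) = ev w • E x
  s_smul : ∀ v y, s (v • y) = algebraMap V W v • s y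
  q_smul : ∀ v x, q (algebraMap V W v • x) = algebraMap V W v • q x
  E_s : ∀ y, E (s y) = y
  E_d : ∀ x, E (N.d x) = N'.d (E x)
  u_q : ∀ x, u • q x = x - s (E x)
  q_u : ∀ x, q (u • x) = x
  E_mem : ∀ {n c x}, x ∈ par N.gr n c → E x ∈ par N'.gr n c
  s_mem : ∀ {n c y}, y ∈ par N'.gr n c → s y ∈ par N.gr n c
  q_mem : ∀ {n c x}, x ∈ par N.gr n c → q x ∈ par N.gr n c
  del_zero : ∀ x, N.del x = 0
  del_zero' : ∀ x, N'.del x = 0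

/-- The division on the unit complex. -/
theorem Division.unit {ev : W →+* V} {u : W} (hev : ∀ v, ev (algebraMap V W v) = v)
    (hu : ∀ x, u * x = 0 → x = 0) (hu0 : ev u = 0) (hk : ∀ x, ev x = 0 → ∃ y, x = u * y) :
    Nonempty (Division ev u (unit W) (unit V)) := by
  -- Division with remainder: `x` minus its value under `ev` lies in the kernel of `ev` and so is a
  -- multiple of `u`. Since `u` is not a zero divisor the quotient is unique, hence additive and
  -- linear over `V`.
  have hk' : ∀ x, ∃ y, u * y = x - algebraMap V W (ev x) := fun x => by
    obtain ⟨y, hy⟩ := hk (x - algebraMap V W (ev x)) (by rw [map_sub, hev, sub_self])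
    exact ⟨y, hy.symm⟩
  have huu : ∀ x y, u * x = u * y → x = y := fun x y h =>
    sub_eq_zero.1 (hu _ (by rw [mul_sub, h, sub_self]))
  choose q hq using hk'
  let q' : W →+ W := AddMonoidHom.mk' q fun x y => huu _ _ (by
    rw [mul_add, hq, hq, hq, map_add, map_add]; ring)
  -- The unit complexes live in degree zero only, so every additive map between them preserves the
  -- parts.
  have par_mem : ∀ {A B : Type u} [CommRing A] [CommRing B]
      (f : (Cx.unit A).carrier →+ (Cx.unit B).carrier) {n : ℤ} {c : ZMod 2}
      {x : (Cx.unit A).carrier}, x ∈ par (Cx.unit A).gr n c → f x ∈ par (Cx.unit B).gr n c := by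
    intro A B _ _ f n c x hx
    by_cases h : n = 0 ∧ c = 0
    · rw [h.1, h.2]; exact mem_unit_par _
    · rw [unit_par hx h, map_zero]; exact zero_mem _
  exact ⟨{
    E := toUnit.comp (ev.toAddMonoidHom.comp ofUnit)
    s := toUnit.comp ((algebraMap V W).toAddMonoidHom.comp ofUnit)
    q := toUnit.comp (q'.comp ofUnit)
    E_smul := fun w (x : W) => map_mul ev w x
    s_smul := fun v (y : V) => map_mul (algebraMap V W) v y
    q_smul := fun v (x : W) => by
      have : q (algebraMap V W v * x) = algebraMap V W v * q x := huu _ _ (by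
        rw [hq, map_mul, hev, map_mul, mul_left_comm, hq]; ring)
      exact this
    E_s := fun y => hev y
    E_d := fun x => map_zero ev
    u_q := fun x => hq x
    q_u := fun (x : W) => by
      have : q (u * x) = x := huu _ _ (by
        rw [hq, map_mul, hu0, zero_mul, map_zero, sub_zero])
      exact this
    E_mem := fun hx => par_mem _ hx
    s_mem := fun hx => par_mem _ hx
    q_mem := fun hx => par_mem _ hx
    del_zero := fun _ => rfl
    del_zero' := fun _ => rfl }⟩

variable {ev : W →+* V} {u : W} {N : Cx W} {N' : Cx V}

/-- The division on a tensor product with `R ⇄ R`. -/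
def Division.kos (D : Division ev u N N') (a b : W) :
    Division ev u (kos a b N) (Cx.kos (ev a) (ev b) N') where
  E := D.E.prodMap D.E
  s := D.s.prodMap D.s
  q := D.q.prodMap D.q
  E_smul w z := by
    obtain ⟨x, y, rfl⟩ := pr_surj z
    exact congrArg₂ pr (D.E_smul w x) (D.E_smul w y)
  s_smul w z := by
    obtain ⟨x, y, rfl⟩ := pr_surj z
    exact congrArg₂ pr (D.s_smul w x) (D.s_smul w y)
  q_smul w z := by
    obtain ⟨x, y, rfl⟩ := pr_surj z
    exact congrArg₂ pr (D.q_smul w x) (D.q_smul w y)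
  E_s z := by
    obtain ⟨x, y, rfl⟩ := pr_surj z
    exact congrArg₂ pr (D.E_s x) (D.E_s y)
  E_d z := by
    obtain ⟨x, y, rfl⟩ := pr_surj z
    refine congrArg₂ pr ((map_add D.E _ _).trans ?_) ((map_sub D.E _ _).trans ?_)
    · exact congrArg₂ _ (D.E_d x) (D.E_smul a y)
    · exact congrArg₂ _ (D.E_smul b x) (D.E_d y)
  u_q z := by
    obtain ⟨x, y, rfl⟩ := pr_surj z
    exact congrArg₂ pr (D.u_q x) (D.u_q y)
  q_u z := by
    obtain ⟨x, y, rfl⟩ := pr_surj z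
    exact congrArg₂ pr (D.q_u x) (D.q_u y)
  E_mem {n c z} hz := by
    obtain ⟨x, y, rfl⟩ := pr_surj z
    rw [pr_mem] at hz
    exact pr_mem.2 ⟨D.E_mem hz.1, D.E_mem hz.2⟩
  s_mem {n c z} hz := by
    obtain ⟨x, y, rfl⟩ := pr_surj z
    rw [pr_mem] at hz
    exact pr_mem.2 ⟨D.s_mem hz.1, D.s_mem hz.2⟩
  q_mem {n c z} hz := by
    obtain ⟨x, y, rfl⟩ := pr_surj z
    rw [pr_mem] at hz
    exact pr_mem.2 ⟨D.q_mem hz.1, D.q_mem hz.2⟩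
  del_zero z := by
    obtain ⟨x, y, rfl⟩ := pr_surj z
    exact congrArg₂ pr (D.del_zero x) (D.del_zero y)
  del_zero' z := by
    obtain ⟨x, y, rfl⟩ := pr_surj z
    exact congrArg₂ pr (D.del_zero' x) (D.del_zero' y)

/-- The division on an iterated tensor product with `R ⇄ R`. -/
def Division.kosList (D : Division ev u N N') : ∀ l : List (W × W),
    Division ev u (kosList l N) (Cx.kosList (l.map (mapPair ev)) N')
  | [] => D
  | c :: l => (D.kosList l).kos c.1 c.2

/-- Elimination of a variable. -/
theorem Division.he (D : Division ev u N N') (hu : ev u = 0)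
    (hev : ∀ v, ev (algebraMap V W v) = v) {b w : W} {c : V}
    (hw : ∀ x, N.d (N.d x) = w • x) (hc : u * b + w = algebraMap V W c) :
    HE (restr V (Cx.kos u b N)) N' := by
  have qd : ∀ x : N.carrier, u • x = 0 → x = 0 := fun x hx => by rw [← D.q_u x, hx, map_zero]
  have huu : ∀ {x y : N.carrier}, u • x = u • y → x = y := fun {x y} h =>
    sub_eq_zero.1 (qd _ (by rw [smul_sub, h, sub_self]))
  -- `ev` kills `u`, so it sends the remaining potential `w` to `c`; therefore `N'` has potential
  -- `c`.
  have hevw : ev w = c := by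
    have := congrArg ev hc
    rwa [map_add, map_mul, hu, zero_mul, zero_add, hev] at this
  have hdd : ∀ y, N'.d (N'.d y) = c • y := fun y => by
    have := D.E_smul w (D.s y)
    rwa [← hw, D.E_d, D.E_d, D.E_s, hevw] at this
  let f : restr V (Cx.kos u b N) ⟶ N' :=
    { f := { toFun := fun z => D.E z.1
             map_add' := fun z z' => map_add D.E z.1 z'.1
             map_smul' := fun v z => (D.E_smul _ _).trans (congrArg (· • D.E z.1) (hev v)) }
      homog := fun n e z hz => by
        obtain ⟨x, y⟩ := z
        rw [add_zero, add_zero]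
        exact D.E_mem (pr_mem.1 ((mem_par_restrict V (Cx.kos u b N)).1 hz)).1 }
  -- The section `s` need not commute with `d`, but the error `s d - d s` is killed by `E` and hence
  -- divisible by `u`. The quotient is `k`, and with it `y ↦ (s y, k y)` is a chain map.
  let k : N'.carrier →+ N.carrier :=
    -(D.q.comp (AddMonoidHom.comp N.d.toAddMonoidHom D.s))
  have hk : ∀ y, k y = -D.q (N.d (D.s y)) := fun _ => rfl
  have hk_mem : ∀ {n e y}, y ∈ par N'.gr n e → k y ∈ par N.gr n (e + 1) := fun {n e y} hy => by
    have := N.d_homog n e _ (D.s_mem hy)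
    rw [add_zero] at this
    exact neg_mem (D.q_mem this)
  have huk : ∀ y, u • k y = D.s (N'.d y) - N.d (D.s y) := fun y => by
    rw [hk, smul_neg, D.u_q, D.E_d, D.E_s]; abel
  have hkv : ∀ v y, k (v • y) = algebraMap V W v • k y := fun v y => by
    rw [hk, hk, D.s_smul, map_smul, D.q_smul, smul_neg]
  let g : N' ⟶ restr V (Cx.kos u b N) :=
    { f := { toFun := fun y => pr (a := u) (b := b) (D.s y) (k y)
             map_add' := fun y y' => congrArg₂ (pr (a := u) (b := b)) (map_add D.s y y') (map_add k y y')
             map_smul' := fun v y => congrArg₂ (pr (a := u) (b := b)) (D.s_smul v y) (hkv v y) }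
      homog := fun n e y hy => by
        rw [add_zero, add_zero]
        exact (mem_par_restrict V (Cx.kos u b N)).2 ((pr_mem (a := u) (b := b)).2 ⟨D.s_mem hy, hk_mem hy⟩) }
  -- If `E x = 0`, then `x = u • q x` is the first component of the differential of `(0, q x)`. This
  -- dictates the homotopy, up to its sign.
  let h : (restr V (Cx.kos u b N)).carrier →ₗ[V] (restr V (Cx.kos u b N)).carrier :=
    { toFun := fun z => pr (a := u) (b := b) 0 (-D.q z.1)
      map_add' := fun z z' => by
        refine congrArg₂ (pr (a := u) (b := b)) (add_zero 0).symm ?_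
        exact (congrArg Neg.neg (map_add D.q z.1 z'.1)).trans (neg_add _ _)
      map_smul' := fun v z => by
        refine congrArg₂ (pr (a := u) (b := b)) (smul_zero _).symm ?_
        exact (congrArg Neg.neg (D.q_smul v z.1)).trans (smul_neg _ _).symm }
  refine ⟨f, ⟨⟨fun z => ?_, fun z => ?_⟩, g, ⟨fun y => ?_, fun y => ?_⟩,
    ⟨h, fun n e z hz => ?_, fun z => ?_⟩, 0, IsHomog.zero _ _, fun y => ?_⟩⟩
  · obtain ⟨x, y⟩ := z
    change D.E (N.d x + u • y) = _
    rw [map_add, D.E_smul, hu, zero_smul, add_zero, D.E_d]; rfl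
  · obtain ⟨x, y⟩ := z
    refine Eq.trans ?_ (D.del_zero' _).symm
    exact (congrArg D.E (D.del_zero x)).trans (map_zero D.E)
  · refine congrArg₂ (pr (a := u) (b := b)) ?_ ?_
    · change D.s (N'.d y) = N.d (D.s y) + u • k y
      rw [huk]; abel
    · change k (N'.d y) = b • D.s y - N.d (k y)
      -- After multiplication by `u` the identity follows from the relation `u b + w = c`: the total
      -- potential has to come from `V`.
      refine huu ?_
      rw [huk, hdd, D.s_smul, smul_sub, ← map_smul N.d, huk, map_sub, hw, ← hc, add_smul, mul_smul]
      abel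
  · refine Eq.trans (map_zero (Hom.f g) ▸ congrArg (Hom.f g) (D.del_zero' y)) ?_
    exact (congrArg₂ (pr (a := u) (b := b)) (D.del_zero _) (D.del_zero _)).symm
  · obtain ⟨x, y⟩ := z
    have hx := (pr_mem.1 ((mem_par_restrict V (Cx.kos u b N)).1 hz)).1
    refine (mem_par_restrict V (Cx.kos u b N)).2 ((pr_mem (a := u) (b := b)).2 ⟨zero_mem _, ?_⟩)
    rw [add_zero, add_assoc, CharTwo.add_self_eq_zero, add_zero]
    exact neg_mem (D.q_mem hx)
  · obtain ⟨x, y⟩ := z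
    refine congrArg₂ (pr (a := u) (b := b)) ?_ ?_
    · change D.s (D.E x) = x + (N.d 0 + u • -D.q x + 0)
      rw [map_zero, smul_neg, D.u_q]; abel
    · change k (D.E x) = y + (b • 0 - N.d (-D.q x) + -D.q (N.d x + u • y))
      refine huu ?_
      rw [huk, map_add, D.q_u, map_neg, smul_zero]
      simp only [smul_add, smul_sub, smul_neg, ← map_smul, D.u_q, D.E_d]
      rw [map_sub, smul_zero]; abel
  · refine (D.E_s y).trans ?_
    rw [LinearMap.zero_apply, LinearMap.zero_apply, map_zero, add_zero, add_zero]

/-- Elimination of a variable from a Koszul factorization. -/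
theorem kosz_eliminate {ev : W →+* V} {u b : W} (hev : ∀ v, ev (algebraMap V W v) = v)
    (hu : ∀ x, u * x = 0 → x = 0) (hu0 : ev u = 0) (hk : ∀ x, ev x = 0 → ∃ y, x = u * y)
    (l : Multiset (W × W)) {c : V}
    (hc : (((u, b) ::ₘ l).map fun a => a.1 * a.2).sum = algebraMap V W c) :
    HE (restr V (kosz ((u, b) ::ₘ l) (unit W))) (kosz (l.map (mapPair ev)) (unit V)) := by
  obtain ⟨D⟩ := Division.unit hev hu hu0 hk
  have hw := kosz_d_d l (N := unit W) (w := 0) fun x => (zero_smul W x).symm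
  rw [Multiset.map_cons, Multiset.sum_cons] at hc
  induction l using Quotient.inductionOn with
  | h l =>
    have hw' : ∀ x, (kosList l (unit W)).d ((kosList l (unit W)).d x) = _ • x :=
      SE.d_d (kosz_coe l _).symm hw
    have key := (D.kosList l).he hu0 hev hw' (by rwa [add_zero])
    refine ((SE.restr V (kosz_coe ((u, b) :: l) (unit W))).he.trans key).trans ?_
    exact (kosz_coe (l.map (mapPair ev)) (unit V)).symm.he

end Cx

/-! ### Gluing the ends of arcs -/

section Pairs

variable {k : Type u} [Field k] (p : Polynomial k)

/-- The pair of elements given by an arc with variables `a` and `b` at its head and tail. -/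
def edgePair {A : Type*} [CommRing A] [Algebra k A] (a b : A) : A × A := (a - b, divDiff p a b)

theorem divDiff_map {A B : Type*} [CommRing A] [Algebra k A] [CommRing B] [Algebra k B]
    (f : A →ₐ[k] B) (a b : A) : f (divDiff p a b) = divDiff p (f a) (f b) := by
  rw [divDiff, divDiff, Polynomial.sum, Polynomial.sum, map_sum]
  refine Finset.sum_congr rfl fun n _ => ?_
  rw [map_mul, map_sum, AlgHom.commutes]
  simp

theorem mapPair_edgePair {A B : Type*} [CommRing A] [Algebra k A] [CommRing B] [Algebra k B]
    {f : A →+* B} (hf : f.comp (algebraMap k A) = algebraMap k B) (a b : A) :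
    Cx.mapPair f (edgePair p a b) = edgePair p (f a) (f b) := by
  let g : A →ₐ[k] B := { f with commutes' := fun r => RingHom.congr_fun hf r }
  exact Prod.ext (map_sub f a b) (divDiff_map p g a b)

end Pairs

section OptionEquiv

variable {A B : Type} [Fintype A] {γ : Type*} (G : Option B → Option A → γ)
  (E : Option A ≃ Option B)

theorem univ_option_val : (Finset.univ : Finset (Option A)).val =
    none ::ₘ Finset.univ.val.map some := by
  rw [univ_option, Finset.insertNone]
  rfl

/-- A point glued to itself closes up its own arc; `removeNone` then leaves all other arcs as they
are. -/
theorem univ_map_option_none (h : E none = none) :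
    (Finset.univ : Finset (Option A)).val.map (fun o => G (E o) o) =
      G none none ::ₘ Finset.univ.val.map fun a => G (some (E.removeNone a)) (some a) := by
  rw [univ_option_val, Multiset.map_cons, Multiset.map_map, h]
  congr 1
  refine Multiset.map_congr rfl fun a _ => ?_
  have : ∃ b, E (some a) = some b := by
    rw [← Option.ne_none_iff_exists', ← h]
    exact fun h' => Option.some_ne_none a (E.injective h')
  rw [Equiv.removeNone_some E this]
  rfl

/-- The arc from `a₀` to the glued point and the arc from the glued point to `b₀` are listed
separately. `removeNone` joins them to one arc from `a₀` to `b₀` and does not change the arcs with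
tails in `s`. -/
theorem univ_map_option_some {a₀ : A} {b₀ : B} (h : E none = some b₀)
    (h' : E (some a₀) = none) :
    ∃ s : Multiset A, Finset.univ.val = a₀ ::ₘ s ∧ E.removeNone a₀ = b₀ ∧
      (Finset.univ : Finset (Option A)).val.map (fun o => G (E o) o) =
        G none (some a₀) ::ₘ G (some b₀) none ::ₘ
          s.map fun a => G (some (E.removeNone a)) (some a) := by
  classical
  have hs : (Finset.univ : Finset A).val = a₀ ::ₘ (Finset.univ.erase a₀).val := by
    rw [Finset.erase_val, Multiset.cons_erase (Finset.mem_univ a₀)]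
  refine ⟨(Finset.univ.erase a₀).val, hs, Option.some_injective _ ?_, ?_⟩
  · rw [Equiv.removeNone_none E h', h]
  · rw [univ_option_val, Multiset.map_cons, hs, Multiset.map_cons, Multiset.map_cons,
      Multiset.map_map, h, h', Multiset.cons_swap]
    congr 2
    refine Multiset.map_congr rfl fun a ha => ?_
    have : ∃ b, E (some a) = some b := by
      rw [← Option.ne_none_iff_exists', ← h']
      exact fun h' => (Finset.mem_erase.1 ha).1 (Option.some_injective _ (E.injective h'))
    rw [Equiv.removeNone_some E this]
    rfl

end OptionEquiv

namespace Cx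

/-- Koszul factorizations over isomorphic rings. -/
theorem restr_kosz_equiv {Q W V : Type u} [CommRing Q] [CommRing W] [CommRing V] [Algebra Q W]
    [Algebra Q V] (φ : W ≃ₐ[Q] V) (l : Multiset (W × W)) :
    SE (restr Q (kosz l (unit W))) (restr Q (kosz (l.map (mapPair (φ : W →+* V))) (unit V))) := by
  letI : Algebra W V := φ.toRingEquiv.toRingHom.toAlgebra
  haveI : IsScalarTower Q W V := IsScalarTower.of_algebraMap_eq fun q => (φ.commutes q).symm
  have h : SE (unit W) (restr W (unit V)) := by
    refine ⟨⟨{ toFun := φ, map_add' := map_add φ, map_smul' := map_mul φ }, fun n c x hx => ?_⟩,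
      ⟨fun _ => map_zero φ, fun _ => map_zero φ⟩, φ.bijective⟩
    rw [add_zero, add_zero]
    refine (mem_par_restrict W (unit V)).2 ?_
    by_cases h : n = 0 ∧ c = 0
    · rw [h.1, h.2]; exact mem_unit_par _
    · rw [unit_par hx h, map_zero]; exact zero_mem _
  exact (SE.restr Q ((h.kosz l).trans (restr_kosz l (unit V)))).trans (restr_restr_se W _)

end Cx

/-- The point to be glued next, singled out as `none`. -/
def splitPoint (A : Type) (n : ℕ) : A ⊕ Fin (n + 1) ≃ Option (A ⊕ Fin n) :=
  ((Equiv.sumCongr (Equiv.refl A)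
    ((finSuccEquiv n).trans (Equiv.optionEquivSumPUnit.{0, 0} (Fin n)))).trans
      (Equiv.sumAssoc A (Fin n) PUnit).symm).trans (Equiv.optionEquivSumPUnit (A ⊕ Fin n)).symm

theorem splitPoint_symm_none (A : Type) (n : ℕ) : (splitPoint A n).symm none = Sum.inr 0 := by
  simp [splitPoint]

theorem splitPoint_symm_inl {A : Type} (n : ℕ) (a : A) :
    (splitPoint A n).symm (some (Sum.inl a)) = Sum.inl a := by
  simp [splitPoint]

theorem splitPoint_symm_inr {A : Type} {n : ℕ} (i : Fin n) :
    (splitPoint A n).symm (some (Sum.inr i)) = Sum.inr i.succ := by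
  simp [splitPoint]

theorem traceStep_splitPoint {T H : Type} {n : ℕ} (e : T ⊕ Fin (n + 1) ≃ H ⊕ Fin (n + 1))
    (o : Option (T ⊕ Fin n)) :
    e ((splitPoint T n).symm o) = (splitPoint H n).symm (traceStep e o) :=
  ((splitPoint H n).symm_apply_apply _).symm

open MvPolynomial in
/-- The variables of the ends of arcs, the glued ends being variables over `Q`. -/
def endVar {A : Type} {n : ℕ} {Q : Type u} [CommRing Q] (f : A → Q) :
    A ⊕ Fin n → MvPolynomial (Fin n) Q :=
  Sum.elim (fun a => C (f a)) X

section

variable {k : Type u} [Field k] (p : Polynomial k)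

/-- `φ` is a ring map that singles out the variable `0`, with value `x₀`, and `ψ` describes it on
everything else. The arcs are rewritten in the form to which `univ_map_option_none` and
`univ_map_option_some` apply. Both cases of `trace_he` use this, with different target rings. -/
theorem map_endVar {T H : Type} [Fintype T] {n : ℕ} {Q : Type u} [CommRing Q] [Algebra k Q]
    {P : Type u} [CommRing P] [Algebra k P] (e : T ⊕ Fin (n + 1) ≃ H ⊕ Fin (n + 1))
    (tq : T → Q) (hq : H → Q) {φ : MvPolynomial (Fin (n + 1)) Q →+* P}
    (hφ : φ.comp (algebraMap k _) = algebraMap k P) {x₀ : P} (hx : φ (MvPolynomial.X 0) = x₀)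
    {ψ : MvPolynomial (Fin n) Q → P} (hC : ∀ q, φ (MvPolynomial.C q) = ψ (MvPolynomial.C q))
    (hX : ∀ i : Fin n, φ (MvPolynomial.X i.succ) = ψ (MvPolynomial.X i)) :
    (Finset.univ.val.map fun a => edgePair p (endVar hq (e a)) (endVar tq a)).map
        (Cx.mapPair φ) =
      Finset.univ.val.map fun o => edgePair p ((traceStep e o).elim x₀ fun a => ψ (endVar hq a))
        (o.elim x₀ fun a => ψ (endVar tq a)) := by
  have h : ∀ {A : Type} (f : A → Q) (o : Option (A ⊕ Fin n)),
      φ (endVar f ((splitPoint A n).symm o)) = o.elim x₀ fun a => ψ (endVar f a) := by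
    rintro A f (_ | a | i)
    · rw [splitPoint_symm_none]; exact hx
    · rw [splitPoint_symm_inl]; exact hC _
    · rw [splitPoint_symm_inr]; exact hX _
  have hu : (Finset.univ : Finset (T ⊕ Fin (n + 1))).val =
      Finset.univ.val.map (splitPoint T n).symm := by
    rw [← Finset.map_univ_equiv (splitPoint T n).symm]; rfl
  rw [hu, Multiset.map_map, Multiset.map_map]
  refine Multiset.map_congr rfl fun o _ => ?_
  rw [Function.comp_apply, Function.comp_apply, mapPair_edgePair p hφ, traceStep_splitPoint, h, h]

/-- By `sub_mul_divDiff` an arc contributes `p(head) - p(tail)` to the potential. Every glued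
variable is the head of one arc and the tail of one arc, so its contributions cancel and the total
potential has coefficients in `Q` only. The elimination of a glued variable rests on this. -/
theorem sum_endVar {T H : Type} [Fintype T] [Fintype H] {n : ℕ} {Q : Type u} [CommRing Q]
    [Algebra k Q] (e : T ⊕ Fin n ≃ H ⊕ Fin n) (tq : T → Q) (hq : H → Q)
    (l : Multiset (Q × Q)) :
    ∃ c : Q, ((l.map (Cx.mapPair MvPolynomial.C) + Finset.univ.val.map fun a =>
      edgePair p (endVar hq (e a)) (endVar tq a)).map
        fun c : MvPolynomial (Fin n) Q × MvPolynomial (Fin n) Q => c.1 * c.2).sum =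
        MvPolynomial.C c := by
  refine ⟨(l.map fun c => c.1 * c.2).sum + (∑ y, Polynomial.aeval (hq y) p -
    ∑ x, Polynomial.aeval (tq x) p), ?_⟩
  have h1 := Equiv.sum_comp e fun y => Polynomial.aeval (endVar (n := n) hq y) p
  have h2 : ∀ {A : Type} (f : A → Q) (a : A), Polynomial.aeval
      (endVar (n := n) f (Sum.inl a)) p = MvPolynomial.C (Polynomial.aeval (f a) p) := by
    intro A f a
    exact (Polynomial.aeval_algHom_apply (IsScalarTower.toAlgHom k Q
      (MvPolynomial (Fin n) Q)) (f a) p)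
  rw [Multiset.map_add, Multiset.sum_add, map_add, Multiset.map_map, map_multiset_sum,
    Multiset.map_map]
  congr 1
  · rw [Multiset.map_map]
    congr 1
    refine Multiset.map_congr rfl fun c _ => ?_
    simp
  · change ∑ a, (endVar hq (e a) - endVar tq a) * divDiff p (endVar hq (e a)) (endVar tq a) = _
    simp only [sub_mul_divDiff, Finset.sum_sub_distrib, h1, Fintype.sum_sum_type, h2, map_sub,
      map_sum]
    simp only [endVar, Sum.elim_inr]
    ring

theorem mapPair_C {Q : Type u} [CommRing Q] [Algebra k Q] {σ : Type} (a b : Q) :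
    Cx.mapPair (MvPolynomial.C (σ := σ)) (edgePair p a b) =
      edgePair p (MvPolynomial.C a) (MvPolynomial.C b) := 
  mapPair_edgePair p (IsScalarTower.algebraMap_eq k Q (MvPolynomial σ Q)).symm a b

theorem sum_mapPair {A B : Type*} [CommRing A] [CommRing B] (f : A →+* B)
    (l : Multiset (A × A)) : ((l.map (Cx.mapPair f)).map fun c => c.1 * c.2).sum =
      f (l.map fun c => c.1 * c.2).sum := by
  rw [map_multiset_sum, Multiset.map_map, Multiset.map_map]
  congr 1
  exact Multiset.map_congr rfl fun c _ => (map_mul f _ _).symm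

open MvPolynomial in
/-- The first variable as a coefficient. -/
def headVarEquiv (Q : Type u) [CommRing Q] (n : ℕ) :
    MvPolynomial (Fin (n + 1)) Q ≃ₐ[Q] MvPolynomial (Fin n) (Polynomial Q) :=
  (renameEquiv Q (finSuccEquiv n)).trans (optionEquivRight Q (Fin n))

section HeadVar

open MvPolynomial

variable {Q : Type u} [CommRing Q] {n : ℕ}

theorem headVarEquiv_C (q : Q) : headVarEquiv Q n (C q) = C (Polynomial.C q) := by
  simp [headVarEquiv]

theorem headVarEquiv_zero : headVarEquiv Q n (X 0) = C Polynomial.X := by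
  simp [headVarEquiv]

theorem headVarEquiv_succ (i : Fin n) : headVarEquiv Q n (X i.succ) = X i := by
  simp [headVarEquiv]

theorem headVarEquiv_algebraMap [Algebra k Q] :
    (headVarEquiv Q n : MvPolynomial (Fin (n + 1)) Q →+* _).comp (algebraMap k _) =
      algebraMap k (MvPolynomial (Fin n) (Polynomial Q)) :=
  RingHom.ext fun r => ((headVarEquiv Q n).restrictScalars k).commutes r

theorem map_headVarEquiv_C (l : Multiset (Q × Q)) :
    (l.map (Cx.mapPair C)).map (Cx.mapPair (headVarEquiv Q n :
        MvPolynomial (Fin (n + 1)) Q →+* MvPolynomial (Fin n) (Polynomial Q))) =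
      (l.map (Cx.mapPair Polynomial.C)).map (Cx.mapPair C) := by
  rw [Multiset.map_map, Multiset.map_map]
  exact Multiset.map_congr rfl fun c _ => Prod.ext (headVarEquiv_C _) (headVarEquiv_C _)

theorem map_C_endVar {A : Type} (f : A → Q) (a : A ⊕ Fin n) :
    MvPolynomial.map Polynomial.C (endVar f a) = endVar (fun a => Polynomial.C (f a)) a := by
  rcases a with a | i
  · exact map_C _ _
  · exact map_X _ _

end HeadVar

open MvPolynomial in
/-- Gluing arcs at the ends with variables over `Q`: these variables can be eliminated, up to
homotopy, except for one variable for each closed loop that arises. -/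
theorem trace_he : ∀ (n : ℕ) {T H : Type} [Fintype T] [Fintype H] {Q : Type u} [CommRing Q]
    [Algebra k Q] (e : T ⊕ Fin n ≃ H ⊕ Fin n) (tq : T → Q) (hq : H → Q) (l : Multiset (Q × Q))
    (m : ℕ), m = (trace n e).2 → Cx.HE
      (Cx.restr Q (Cx.kosz (l.map (Cx.mapPair C) + Finset.univ.val.map fun a =>
        edgePair p (endVar hq (e a)) (endVar tq a)) (Cx.unit (MvPolynomial (Fin n) Q))))
      (Cx.restr Q (Cx.kosz ((l + Finset.univ.val.map fun t =>
          edgePair p (hq ((trace n e).1 t)) (tq t)).map (Cx.mapPair C) +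
        Finset.univ.val.map fun i : Fin m => edgePair p (X i) (X i))
          (Cx.unit (MvPolynomial (Fin m) Q)))) := by
  -- The induction is over all rings `Q` and all extra pairs `l`, since a closed loop moves its
  -- variable into `Q` and its pair into `l`. The equation for `m` keeps the type `Fin m` free of
  -- the term `trace n e`.
  intro n
  induction n with
  | zero =>
    intro T H _ _ Q _ _ e tq hq l m hm
    obtain rfl : m = 0 := hm
    refine (Cx.SE.of_eq ?_).he
    congr 2
    rw [Multiset.map_add, add_assoc]
    congr 1
    have hu : (Finset.univ : Finset (T ⊕ Fin 0)).val =
        Finset.univ.val.map (Equiv.sumEmpty T (Fin 0)).symm := by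
      rw [← Finset.map_univ_equiv (Equiv.sumEmpty T (Fin 0)).symm]; rfl
    rw [hu, Multiset.map_map, Multiset.map_map]
    rw [show (Finset.univ : Finset (Fin 0)).val = 0 from rfl, Multiset.map_zero, add_zero]
    refine Multiset.map_congr rfl fun t _ => ?_
    rw [Function.comp_apply, Function.comp_apply, mapPair_C]
    have h1 : ∀ y : H ⊕ Fin 0, endVar hq y = C (hq (Equiv.sumEmpty H (Fin 0) y)) := by
      rintro (h | i)
      · rfl
      · exact i.elim0
    rw [h1]
    rfl
  | succ n ih =>
    intro T H _ _ Q _ _ e tq hq l m hm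
    have ht : trace (n + 1) e = ((trace n (traceStep e).removeNone).1,
      (trace n (traceStep e).removeNone).2 + if traceStep e none = none then 1 else 0) := rfl
    rw [ht] at hm ⊢
    dsimp only at hm ⊢
    cases hE : traceStep e none with
    | none =>
      rw [hE, if_pos rfl] at hm
      subst hm
      set e' := (traceStep e).removeNone with he'
      -- The glued point is joined to itself and becomes the mark of a new loop. Nothing is
      -- eliminated: its variable turns into a coefficient, and its pair, with first member zero, is
      -- added to `l`.
      have IH := ih e' (fun t => Polynomial.C (tq t)) (fun t => Polynomial.C (hq t))
        (edgePair p Polynomial.X Polynomial.X ::ₘ l.map (Cx.mapPair Polynomial.C)) _ rfl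
      have h1 := Cx.restr_kosz_equiv (headVarEquiv Q n) (l.map (Cx.mapPair C) +
        Finset.univ.val.map fun a => edgePair p (endVar hq (e a)) (endVar tq a))
      have h2 := Cx.restr_kosz_equiv (headVarEquiv Q (trace n e').2)
        ((l + Finset.univ.val.map fun t => edgePair p (hq ((trace n e').1 t)) (tq t)).map
          (Cx.mapPair C) + Finset.univ.val.map fun i : Fin ((trace n e').2 + 1) =>
            edgePair p (X i) (X i))
      have h3 : (l.map (Cx.mapPair C) + Finset.univ.val.map fun a =>
            edgePair p (endVar hq (e a)) (endVar tq a)).map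
              (Cx.mapPair (headVarEquiv Q n :
        MvPolynomial (Fin (n + 1)) Q →+* MvPolynomial (Fin n) (Polynomial Q))) =
          (edgePair p Polynomial.X Polynomial.X ::ₘ l.map (Cx.mapPair Polynomial.C)).map
            (Cx.mapPair C) + Finset.univ.val.map fun a =>
              edgePair p (endVar (fun t => Polynomial.C (hq t)) (e' a))
                (endVar (fun t => Polynomial.C (tq t)) a) := by
        rw [Multiset.map_add, map_headVarEquiv_C, Multiset.map_cons, mapPair_C,
          Multiset.cons_add, ← Multiset.add_cons]
        congr 1
        refine (map_endVar p e tq hq headVarEquiv_algebraMap headVarEquiv_zero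
          (ψ := MvPolynomial.map Polynomial.C)
          (fun q => (headVarEquiv_C q).trans (map_C _ _).symm)
          (fun i => (headVarEquiv_succ i).trans (map_X _ _).symm)).trans ?_
        rw [univ_map_option_none (fun y x => edgePair p
          (y.elim (C Polynomial.X) fun a => MvPolynomial.map Polynomial.C (endVar hq a))
          (x.elim (C Polynomial.X) fun a => MvPolynomial.map Polynomial.C (endVar tq a))) _ hE]
        simp only [Option.elim_some, Option.elim_none, map_C_endVar]
        rfl
      -- The result has one loop more than the one in the induction hypothesis. The variable `0` is
      -- taken as the mark of this loop and corresponds to the coefficient `X`.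
      have h4 : ((l + Finset.univ.val.map fun t =>
            edgePair p (hq ((trace n e').1 t)) (tq t)).map (Cx.mapPair C) +
            Finset.univ.val.map fun i : Fin ((trace n e').2 + 1) => edgePair p (X i) (X i)).map
              (Cx.mapPair (headVarEquiv Q (trace n e').2 : MvPolynomial (Fin ((trace n e').2 + 1)) Q →+*
                MvPolynomial (Fin (trace n e').2) (Polynomial Q))) =
          (edgePair p Polynomial.X Polynomial.X ::ₘ l.map (Cx.mapPair Polynomial.C) +
            Finset.univ.val.map fun t => edgePair p (Polynomial.C (hq ((trace n e').1 t)))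
              (Polynomial.C (tq t))).map (Cx.mapPair C) +
            Finset.univ.val.map fun i : Fin (trace n e').2 => edgePair p (X i) (X i) := by
        rw [Multiset.map_add, map_headVarEquiv_C, Fin.univ_succ, Finset.cons_val,
          Multiset.map_cons, Multiset.map_cons,
          mapPair_edgePair p headVarEquiv_algebraMap, Multiset.cons_add, Multiset.map_cons,
          mapPair_C, Multiset.cons_add, Multiset.add_cons]
        rw [RingHom.coe_coe, headVarEquiv_zero]
        congr 2
        rw [Multiset.map_add, Multiset.map_add, Multiset.map_add]
        congr 1
        · congr 2
          rw [Multiset.map_map]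
          exact Multiset.map_congr rfl fun t _ =>
            mapPair_edgePair p (IsScalarTower.algebraMap_eq k Q (Polynomial Q)).symm _ _
        · rw [Finset.map_val, Multiset.map_map, Multiset.map_map]
          refine Multiset.map_congr rfl fun i _ => ?_
          exact (mapPair_edgePair p headVarEquiv_algebraMap _ _).trans
            (congrArg₂ (edgePair p) (headVarEquiv_succ i) (headVarEquiv_succ i))
      rw [h3] at h1
      rw [h4] at h2
      exact (h1.trans (Cx.restr_restr_se (Polynomial Q) _).symm).he.trans
        ((Cx.HE.restr Q IH).trans ((Cx.restr_restr_se (Polynomial Q) _).trans h2.symm).he)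
    | some b₀ =>
      rw [hE, if_neg (Option.some_ne_none b₀), add_zero] at hm
      set E := traceStep e with hE'
      -- The glued point is the head of an arc that does not start at the glued point itself; `a₀`
      -- is the tail of this arc.
      obtain ⟨a₀, ha₀⟩ : ∃ a₀, E (some a₀) = none := by
        cases h : E.symm none with
        | none => rw [Equiv.symm_apply_eq, hE] at h; cases h
        | some a => exact ⟨a, ((Equiv.symm_apply_eq E).1 h).symm⟩
      have IH := ih E.removeNone tq hq l m hm
      let φ := finSuccEquiv Q n
      have hφk : (φ : MvPolynomial (Fin (n + 1)) Q →+* _).comp (algebraMap k _) =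
          algebraMap k (Polynomial (MvPolynomial (Fin n) Q)) :=
        RingHom.ext fun r => (φ.restrictScalars k).commutes r
      have h1 := Cx.restr_kosz_equiv φ (l.map (Cx.mapPair C) +
        Finset.univ.val.map fun a => edgePair p (endVar hq (e a)) (endVar tq a))
      have h2 := map_endVar p e tq hq hφk (finSuccEquiv_X_zero (R := Q) (n := n))
        (ψ := Polynomial.C) (fun q => finSuccEquiv_apply _ _ _ |>.trans (by simp))
        (fun i => finSuccEquiv_X_succ)
      obtain ⟨s, hs, hb, hG⟩ := univ_map_option_some (fun y x => edgePair p
        (y.elim Polynomial.X fun a => Polynomial.C (endVar hq a))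
        (x.elim Polynomial.X fun a => Polynomial.C (endVar tq a))) E hE ha₀
      rw [← hE', hG] at h2
      simp only [Option.elim_some, Option.elim_none] at h2
      obtain ⟨c, hc⟩ := sum_endVar p e tq hq l
      have h3 : (l.map (Cx.mapPair C)).map
          (Cx.mapPair (φ : MvPolynomial (Fin (n + 1)) Q →+* Polynomial (MvPolynomial (Fin n) Q))) =
            (l.map (Cx.mapPair C)).map (Cx.mapPair Polynomial.C) := by
        rw [Multiset.map_map, Multiset.map_map]
        have h : ∀ q : Q, φ (C q) = Polynomial.C (C q) := fun q =>
          (finSuccEquiv_apply _ _ _).trans (by simp)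
        exact Multiset.map_congr rfl fun c _ => Prod.ext (h _) (h _)
      rw [Multiset.map_add, h2, h3, Multiset.add_cons] at h1
      refine h1.he.trans (Cx.HE.trans ?_ IH)
      -- The variable of the glued point is set equal to the one at the tail `a₀` of the arc that
      -- ends there. The kernel of this evaluation is generated by the first member of the pair of
      -- that arc, which is monic in the variable and hence not a zero divisor.
      let ev : Polynomial (MvPolynomial (Fin n) Q) →+* MvPolynomial (Fin n) Q :=
        Polynomial.evalRingHom (endVar tq a₀)
      have hev : ∀ v, ev (Polynomial.C v) = v := fun v => Polynomial.eval_C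
      have hevX : ev Polynomial.X = endVar tq a₀ := Polynomial.eval_X
      have hevk : ev.comp (algebraMap k _) = algebraMap k _ := RingHom.ext fun r => hev _
      have key := Cx.kosz_eliminate (ev := ev) (u := Polynomial.X - Polynomial.C (endVar tq a₀))
        (b := divDiff p Polynomial.X (Polynomial.C (endVar tq a₀))) hev
        (fun x hx => (Polynomial.monic_X_sub_C _).mul_right_eq_zero_iff.1 hx)
        (by rw [map_sub, hevX, hev, sub_self])
        (fun x hx => by
          obtain ⟨y, hy⟩ := Polynomial.dvd_iff_isRoot.2 (show x.IsRoot (endVar tq a₀) from hx)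
          exact ⟨y, hy⟩)
        ((l.map (Cx.mapPair C)).map (Cx.mapPair Polynomial.C) +
          edgePair p (Polynomial.C (endVar hq b₀)) Polynomial.X ::ₘ
            s.map fun a => edgePair p (Polynomial.C (endVar hq (E.removeNone a)))
              (Polynomial.C (endVar tq a)))
        (c := C c) (by
          have h5 := sum_mapPair (φ : MvPolynomial (Fin (n + 1)) Q →+*
            Polynomial (MvPolynomial (Fin n) Q)) (l.map (Cx.mapPair C) +
              Finset.univ.val.map fun a => edgePair p (endVar hq (e a)) (endVar tq a))
          rw [hc, Multiset.map_add, h2, h3, Multiset.add_cons] at h5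
          exact h5.trans ((finSuccEquiv_apply _ _ _).trans (by simp)))
      -- Under the evaluation the arc from the glued point to `b₀` turns into the arc from `a₀` to
      -- `b₀`, as in `removeNone`.
      have h4 : ((l.map (Cx.mapPair C)).map (Cx.mapPair Polynomial.C) +
          edgePair p (Polynomial.C (endVar hq b₀)) Polynomial.X ::ₘ
            s.map fun a => edgePair p (Polynomial.C (endVar hq (E.removeNone a)))
              (Polynomial.C (endVar tq a))).map (Cx.mapPair ev) =
          l.map (Cx.mapPair C) + Finset.univ.val.map fun a =>
            edgePair p (endVar hq (E.removeNone a)) (endVar tq a) := by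
        rw [hs, Multiset.map_cons, Multiset.map_add, Multiset.map_cons, hb,
          mapPair_edgePair p hevk, hev, hevX, Multiset.map_map, Multiset.map_map]
        congr 2
        · have h : ∀ c, Cx.mapPair ev (Cx.mapPair Polynomial.C c) = c := fun c =>
            Prod.ext (hev _) (hev _)
          exact funext fun c => h _
        · rw [Multiset.map_map]
          refine Multiset.map_congr rfl fun a _ => ?_
          rw [Function.comp_apply, mapPair_edgePair p hevk, hev, hev]
      rw [h4] at key
      exact (Cx.restr_restr_se (MvPolynomial (Fin n) Q) _).symm.he.trans (Cx.HE.restr Q key)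

end

/-! ### From strict maps to the homotopy category -/

namespace MFComplex

variable {R : Type u} [CommRing R] {w : R}

/-- A map compatible with both operators as a chain map. -/
def PreHom.ofChain {M N : MFComplex R w} (f : M.toCx ⟶ N.toCx) (hf : Cx.IsChain f) :
    PreHom M N where
  f := Cx.Hom.f f
  homog := f.homog
  comm := hf.d
  comm_del := ⟨0, IsHomog.zero _ _, fun x => by
    rw [LinearMap.zero_apply, LinearMap.zero_apply, map_zero, add_zero, add_zero]
    exact hf.del x⟩

/-- A homotopy for `d` alone is the case `s = 0` of the homotopies that define this category. -/
theorem exists_iso {M N : MFComplex R w} (f : M.toCx ⟶ N.toCx) (hf : Cx.IsHEquiv f) :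
    ∃ e : M ≅ N, e.hom = Quotient.mk (homSetoid M N) (PreHom.ofChain f hf.1) := by
  obtain ⟨hf', g, hg, ⟨h, hh, e⟩, ⟨h', hh', e'⟩⟩ := hf
  refine ⟨⟨Quotient.mk (homSetoid M N) (PreHom.ofChain f hf'),
    Quotient.mk (homSetoid N M) (PreHom.ofChain g hg), ?_, ?_⟩, rfl⟩
  · refine Quotient.sound (s := homSetoid M M) ⟨0, h, IsHomog.zero _ _, by simp, hh, fun x => ?_⟩
    rw [LinearMap.zero_apply, LinearMap.zero_apply, map_zero, add_zero, add_zero]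
    exact e x
  · refine Quotient.sound (s := homSetoid N N) ⟨0, h', IsHomog.zero _ _, by simp, hh', fun x => ?_⟩
    rw [LinearMap.zero_apply, LinearMap.zero_apply, map_zero, add_zero, add_zero]
    exact e' x

end MFComplex

/-- A family of complexes of matrix factorizations. -/
structure Fam {J : Type} {A : J → Type u} [∀ j, CommRing (A j)] (v : ∀ j, A j) where
  obj : ∀ j, MFComplex (A j) (v j)

namespace Fam

variable {J : Type} {A : J → Type u} [∀ j, CommRing (A j)] {v : ∀ j, A j}

/-- The morphisms of families are families of chain maps, without passing to homotopy classes. -/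
instance : Category (Fam v) where
  Hom X Y := ∀ j, MFComplex.PreHom (X.obj j) (Y.obj j)
  id X j := MFComplex.PreHom.id (X.obj j)
  comp φ ψ j := (φ j).comp (ψ j)

/-- The `j`-th member of the family. -/
def eval (v : ∀ j, A j) (j : J) : Fam v ⥤ Cx (A j) where
  obj X := (X.obj j).toCx
  map φ := ⟨(φ j).f, (φ j).homog⟩

end Fam

section Models

variable {J : Type} {A : J → Type u} [∀ j, CommRing (A j)] {v : ∀ j, A j}
  {R : Type u} [CommRing R] {w : R}

/-- The functor `F` lifts the functor `𝓕` on the homotopy category. -/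
def Models (𝓕 : (∀ j, MFComplex (A j) (v j)) ⥤ MFComplex R w) (F : Fam v ⥤ Cx R) : Prop :=
  ∃ α : ∀ X : Fam v, F.obj X ⟶ (𝓕.obj X.obj).toCx,
    (∀ X, Cx.IsChain (α X) ∧ Function.Bijective (Cx.Hom.f (α X))) ∧
    ∀ {X Y : Fam v} (φ : X ⟶ Y), ∃ ψ : MFComplex.PreHom (𝓕.obj X.obj) (𝓕.obj Y.obj),
      (𝓕.map fun j => Quotient.mk (MFComplex.homSetoid (X.obj j) (Y.obj j)) (φ j)) =
        Quotient.mk (MFComplex.homSetoid (𝓕.obj X.obj) (𝓕.obj Y.obj)) ψ ∧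
      ∀ x, ψ.f (Cx.Hom.f (α X) x) = Cx.Hom.f (α Y) (Cx.Hom.f (F.map φ) x)

theorem Models.eval (j : J) : Models (Pi.eval (fun j => MFComplex (A j) (v j)) j) (Fam.eval v j) :=
  ⟨fun X => 𝟙 (X.obj j).toCx, fun X => ⟨Cx.IsChain.id (X.obj j).toCx, Function.bijective_id⟩,
    fun φ => ⟨φ j, rfl, fun _ => rfl⟩⟩

theorem Models.const (Z : MFComplex R w) :
    Models ((Functor.const (∀ j, MFComplex (A j) (v j))).obj Z)
      ((Functor.const (Fam v)).obj Z.toCx) :=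
  ⟨fun _ => 𝟙 Z.toCx, fun _ => ⟨Cx.IsChain.id Z.toCx, Function.bijective_id⟩,
    fun _ => ⟨MFComplex.PreHom.id Z, rfl, fun _ => rfl⟩⟩

/-- The carriers coincide, but `d` is one operator on the left and the sum of `d₊` and `d₋` on the
right; the identity map mediates between them. -/
theorem MFComplex.toCx_tensor {S : Type u} [CommRing S] [Algebra S R] {w' : S} {w'' : R}
    (hw : w'' = w + algebraMap S R w') (N : MFComplex R w) (M : MFComplex S w') :
    ∃ α : Cx.tensor N.toCx M.toCx ⟶ (MFComplex.tensor hw N M).toCx,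
      Cx.IsChain α ∧ Function.Bijective (Cx.Hom.f α) ∧ ∀ x, Cx.Hom.f α x = x :=
  ⟨⟨LinearMap.id, IsHomog.id⟩, ⟨fun x =>
    (LinearMap.congr_fun (MFComplex.tensor_d hw N M) x).symm, fun _ => rfl⟩,
    Function.bijective_id, fun _ => rfl⟩

theorem Models.tensor {S : Type u} [CommRing S] [Algebra S R] {w' : S} {w'' : R}
    (hw : w'' = w + algebraMap S R w')
    {𝓕 : (∀ j, MFComplex (A j) (v j)) ⥤ MFComplex R w} {F : Fam v ⥤ Cx R} (hF : Models 𝓕 F)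
    {𝓖 : (∀ j, MFComplex (A j) (v j)) ⥤ MFComplex S w'} {G : Fam v ⥤ Cx S} (hG : Models 𝓖 G) :
    Models (Functor.prod' 𝓕 𝓖 ⋙ MFComplex.tensorFunctor hw) (Cx.tens F G) := by
  obtain ⟨α, hα, nα⟩ := hF
  obtain ⟨β, hβ, nβ⟩ := hG
  choose γ hγ hγ' hγ'' using fun (X : Fam v) =>
    MFComplex.toCx_tensor hw (𝓕.obj X.obj) (𝓖.obj X.obj)
  refine ⟨fun X => Cx.tensorMap (α X) (β X) ≫ γ X, fun X =>
    ⟨((hα X).1.tensorMap (hβ X).1).comp (hγ X),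
      (hγ' X).comp (Cx.tensorMap_bijective (hα X).2 (hβ X).2)⟩, fun {X Y} φ => ?_⟩
  obtain ⟨ψ, hψ, eψ⟩ := nα φ
  obtain ⟨χ, hχ, eχ⟩ := nβ φ
  refine ⟨MFComplex.tensorHom hw ψ χ, ?_, fun x => ?_⟩
  · exact congrArg₂ (fun (a : 𝓕.obj X.obj ⟶ 𝓕.obj Y.obj) (b : 𝓖.obj X.obj ⟶ 𝓖.obj Y.obj) =>
      (MFComplex.tensorFunctor hw).map (X := (𝓕.obj X.obj, 𝓖.obj X.obj))
        (Y := (𝓕.obj Y.obj, 𝓖.obj Y.obj)) (a, b)) hψ hχ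
  · refine Cx.tm_ext (W := (MFComplex.tensor hw (𝓕.obj Y.obj) (𝓖.obj Y.obj)).carrier)
      (f := AddMonoidHom.comp (MFComplex.tensorHom hw ψ χ).f.toAddMonoidHom
        (Cx.Hom.f (Cx.tensorMap (α X) (β X) ≫ γ X)).toAddMonoidHom)
      (g := AddMonoidHom.comp (Cx.Hom.f (Cx.tensorMap (α Y) (β Y) ≫ γ Y)).toAddMonoidHom
        (Cx.Hom.f ((Cx.tens F G).map φ)).toAddMonoidHom) (fun x y => ?_) x
    refine (congrArg (MFComplex.tensorHom hw ψ χ).f (hγ'' X _)).trans ?_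
    refine Eq.trans ?_ (hγ'' Y _).symm
    exact congrArg₂ (Cx.tm (N := (𝓕.obj Y.obj).toCx) (M := (𝓖.obj Y.obj).toCx)) (eψ x) (eχ y)

theorem Models.restrict {S : Type u} [CommRing S] [Algebra S R] {w' : S}
    (hw : algebraMap S R w' = w)
    {𝓕 : (∀ j, MFComplex (A j) (v j)) ⥤ MFComplex R w} {F : Fam v ⥤ Cx R} (hF : Models 𝓕 F) :
    Models (𝓕 ⋙ MFComplex.restrictFunctor hw) (Cx.restrF S F) := by
  obtain ⟨α, hα, nα⟩ := hF
  have h : ∀ M : MFComplex R w, ∃ γ : Cx.restr S M.toCx ⟶ (MFComplex.restrict hw M).toCx,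
      Cx.IsChain γ ∧ Function.Bijective (Cx.Hom.f γ) ∧ ∀ x, Cx.Hom.f γ x = x := fun M =>
    ⟨⟨LinearMap.id, IsHomog.id⟩, ⟨fun x => rfl, fun x => rfl⟩, Function.bijective_id, fun _ => rfl⟩
  choose γ hγ hγ' hγ'' using h
  refine ⟨fun X => Cx.restrMap S (α X) ≫ γ _, fun X => ?_, fun {X Y} φ => ?_⟩
  · have h1 : Cx.IsChain (Cx.restrMap S (α X)) := ⟨(hα X).1.d, (hα X).1.del⟩
    exact ⟨h1.comp (hγ _), (hγ' _).comp (hα X).2⟩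
  · obtain ⟨ψ, hψ, eψ⟩ := nα φ
    refine ⟨MFComplex.restrictHom hw ψ, congrArg (MFComplex.restrictFunctor hw).map hψ,
      fun x => ?_⟩
    refine (congrArg ψ.f (hγ'' _ _)).trans ?_
    exact (eψ x).trans (hγ'' _ _).symm

theorem Models.fold {ι : Type} {S : ι → Type u} [∀ j, CommRing (S j)] [∀ j, Algebra (S j) R]
    (Z : MFComplex R w) (w' : ∀ j, S j)
    {𝓖 : ∀ i, (∀ j, MFComplex (A j) (v j)) ⥤ MFComplex (S i) (w' i)} {G : ∀ i, Fam v ⥤ Cx (S i)}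
    (hG : ∀ i, Models (𝓖 i) (G i)) : ∀ L : List ι,
    Models (Functor.pi' 𝓖 ⋙ MFComplex.foldFunctor Z w' L)
      (Cx.fold ((Functor.const (Fam v)).obj Z.toCx) G L)
  | [] => Models.const Z
  | i :: L => Models.tensor rfl (Models.fold Z w' hG L) (hG i)

/-- The components come from strict equivalences, so naturality may be checked on representatives of
a morphism; there the squares commute exactly, although the representatives respect `del` only up to
homotopy. The second conclusion keeps the strict equivalence, which cannot be recovered from the
isomorphism in the homotopy category and which the statement on homology needs. -/
theorem Models.exists_natIso {𝓕 𝓖 : (∀ j, MFComplex (A j) (v j)) ⥤ MFComplex R w}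
    {F G : Fam v ⥤ Cx R} (hF : Models 𝓕 F) (hG : Models 𝓖 G) (h : Cx.HEqv F G) :
    Nonempty (𝓕 ≅ 𝓖) ∧ ∀ X, Cx.HE (𝓕.obj X).toCx (𝓖.obj X).toCx := by
  obtain ⟨α, hα, nα⟩ := hF
  obtain ⟨β, hβ, nβ⟩ := hG
  obtain ⟨γ, hγ⟩ := h
  choose α' hα' h1 h2 using fun X => Cx.exists_inverse (α X) (hα X).1 (hα X).2
  have hα'' : ∀ X, Cx.IsHEquiv (α' X) := fun X => Cx.IsHEquiv.of_bijective (hα' X)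
    ⟨Function.LeftInverse.injective (h2 X), Function.RightInverse.surjective (h1 X)⟩
  have hδ : ∀ X, Cx.IsHEquiv (α' X ≫ γ.app X ≫ β X) := fun X =>
    (hα'' X).comp ((hγ X).comp (Cx.IsHEquiv.of_bijective (hβ X).1 (hβ X).2))
  choose e he using fun X => MFComplex.exists_iso (α' X ≫ γ.app X ≫ β X) (hδ X)
  refine ⟨⟨NatIso.ofComponents (fun X => e ⟨X⟩) fun {X Y} f => ?_⟩, fun X => ⟨_, hδ ⟨X⟩⟩⟩
  choose φ hφ using fun j => Quotient.exists_rep (s := MFComplex.homSetoid (X j) (Y j)) (f j)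
  obtain ⟨ψ, hψ, eψ⟩ := nα (X := ⟨X⟩) (Y := ⟨Y⟩) φ
  obtain ⟨χ, hχ, eχ⟩ := nβ (X := ⟨X⟩) (Y := ⟨Y⟩) φ
  have hf : f = fun j => Quotient.mk (MFComplex.homSetoid (X j) (Y j)) (φ j) :=
    funext fun j => (hφ j).symm
  rw [he, he, hf]
  refine (congrArg (· ≫ _) hψ).trans (Eq.trans ?_ (congrArg (_ ≫ ·) hχ).symm)
  refine congrArg (Quotient.mk _) (MFComplex.PreHom.ext (LinearMap.ext fun x => ?_))
  obtain ⟨y, rfl⟩ := (hα ⟨X⟩).2.2 x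
  change Cx.Hom.f (β ⟨Y⟩) (Cx.Hom.f (γ.app ⟨Y⟩) (Cx.Hom.f (α' ⟨Y⟩) (ψ.f (Cx.Hom.f (α ⟨X⟩) y)))) =
    χ.f (Cx.Hom.f (β ⟨X⟩) (Cx.Hom.f (γ.app ⟨X⟩) (Cx.Hom.f (α' ⟨X⟩) (Cx.Hom.f (α ⟨X⟩) y))))
  rw [eψ, h1, h1, eχ]
  exact congrArg _ (Cx.comp_f_eq (γ.naturality (X := (⟨X⟩ : Fam v)) (Y := ⟨Y⟩) φ) y)

end Models

/-! ### Homology with respect to `d` -/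

namespace MFComplex

variable {R : Type u} [CommRing R] {w : R} {M N : MFComplex R w}

/-- The map on cycles induced by a chain map. -/
def cyclesMap {f : M.toCx ⟶ N.toCx} (hf : Cx.IsChain f) (n : ℤ) (b : ZMod 2) :
    M.cycles n b →ₗ[R] N.cycles n b :=
  (Cx.Hom.f f : M.carrier →ₗ[R] N.carrier).restrict fun x hx => by
    have h : M.d x = 0 := hx.1
    have h2 : N.d (Cx.Hom.f f x) = 0 :=
      (hf.d x).symm.trans ((congrArg (Cx.Hom.f f) h).trans (map_zero (Cx.Hom.f f)))
    have h3 := f.homog n b x hx.2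
    rw [add_zero, add_zero] at h3
    exact ⟨h2, h3⟩

theorem boundaries_le_map {f : M.toCx ⟶ N.toCx} (hf : Cx.IsChain f) (n : ℤ) (b : ZMod 2) :
    M.boundaries n b ≤ (N.boundaries n b).comap (cyclesMap hf n b) := by
  rintro x ⟨y, hy⟩
  exact ⟨Cx.Hom.f f y, (hf.d y).symm.trans (congrArg (Cx.Hom.f f) hy)⟩

/-- The map on homology induced by a chain map. -/
def homologyMap {f : M.toCx ⟶ N.toCx} (hf : Cx.IsChain f) (n : ℤ) (b : ZMod 2) :
    (M.cycles n b ⧸ M.boundaries n b) →ₗ[R] (N.cycles n b ⧸ N.boundaries n b) :=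
  Submodule.mapQ _ _ (cyclesMap hf n b) (boundaries_le_map hf n b)

/-- On a cycle the term `h d` vanishes, and `d h` is a boundary. -/
theorem homologyMap_comp_eq_id {f : M.toCx ⟶ N.toCx} (hf : Cx.IsChain f) {g : N.toCx ⟶ M.toCx}
    (hg : Cx.IsChain g) {h : M.toCx.carrier →ₗ[R] M.toCx.carrier}
    (e : ∀ x, Cx.Hom.f g (Cx.Hom.f f x) = x + (M.toCx.d (h x) + h (M.toCx.d x))) (n : ℤ) (b : ZMod 2) :
    homologyMap hg n b ∘ₗ homologyMap hf n b = LinearMap.id := by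
  refine Submodule.linearMap_qext _ (LinearMap.ext fun x => ?_)
  refine (Submodule.Quotient.eq (M.boundaries n b)
    (x := cyclesMap hg n b (cyclesMap hf n b x)) (y := x)).2 ⟨h x.1, ?_⟩
  have hx : M.d x = 0 := x.2.1
  have h1 : Cx.Hom.f g (Cx.Hom.f f x.1) = (x.1 : M.carrier) + M.d (h x.1) :=
    (e x.1).trans (congrArg ((x.1 : M.carrier) + ·)
      ((congrArg (M.d (h x.1) + ·) ((congrArg h hx).trans (map_zero h))).trans (add_zero _)))
  have h2 : ∀ a b c : M.carrier, a = b + c → c = a - b := fun a b c h => by rw [h]; abel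
  exact h2 _ _ _ h1

/-- Homotopies for `d` become invisible in the homology of `d`, and `f` commutes with `del`
strictly. Hence the isomorphisms in the single degrees form an isomorphism of complexes. -/
theorem homologyComplex_iso (h : Cx.HE M.toCx N.toCx) (b : ZMod 2) :
    Nonempty (M.homologyComplex b ≅ N.homologyComplex b) := by
  obtain ⟨f, hf, g, hg, ⟨h, -, e⟩, ⟨h', -, e'⟩⟩ := h
  let E : ∀ n, (M.cycles n b ⧸ M.boundaries n b) ≃ₗ[R] (N.cycles n b ⧸ N.boundaries n b) :=
    fun n => LinearEquiv.ofLinearMap (homologyMap hf n b) (homologyMap hg n b)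
      (homologyMap_comp_eq_id hg hf e' n b) (homologyMap_comp_eq_id hf hg e n b)
  refine ⟨HomologicalComplex.Hom.isoOfComponents (fun n => (E n).toModuleIso) ?_⟩
  rintro i j rfl
  have hd : ∀ (M : MFComplex R w), (M.homologyComplex b).d i (i + 1) =
      ModuleCat.ofHom (Submodule.mapQ _ _ (M.delCycles i b) (M.boundaries_le i b)) := fun M =>
    CochainComplex.of_d (fun n => ModuleCat.of R (M.cycles n b ⧸ M.boundaries n b)) (fun n =>
      ModuleCat.ofHom (Submodule.mapQ _ _ (M.delCycles n b) (M.boundaries_le n b))) i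
  rw [hd, hd]
  refine ModuleCat.hom_ext (Submodule.linearMap_qext _ (LinearMap.ext fun x => ?_))
  refine congrArg (Submodule.mkQ (N.boundaries (i + 1) b)) (Subtype.ext ?_)
  exact (hf.del x.1).symm

end MFComplex

/-! ### Adjoining variables in stages -/

section IteratedPolynomial

open MvPolynomial

/-- Polynomials in the variables `β` over the polynomials in the variables `α`. -/
def polyHom {R : Type u} [CommRing R] {α β σ : Type} (a : α → σ) (b : β → σ) :
    MvPolynomial β (MvPolynomial α R) →+* MvPolynomial σ R :=
  eval₂Hom (rename a : MvPolynomial α R →ₐ[R] MvPolynomial σ R).toRingHom fun i => X (b i)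

theorem polyHom_bijective (R : Type u) [CommRing R] {α β σ : Type} {a : α → σ} {b : β → σ}
    (h : Function.Bijective (Sum.elim b a)) :
    Function.Bijective (polyHom (R := R) a b) := by
  let e : MvPolynomial β (MvPolynomial α R) ≃+* MvPolynomial σ R :=
    (sumRingEquiv R β α).symm.trans
      (renameEquiv R (Equiv.ofBijective _ h)).toRingEquiv
  have he : polyHom a b = (e : MvPolynomial β (MvPolynomial α R) →+* MvPolynomial σ R) := by
    refine ringHom_ext (fun q => ?_) fun i => ?_
    · have : (rename a : MvPolynomial α R →ₐ[R] MvPolynomial σ R).toRingHom =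
        (e : MvPolynomial β (MvPolynomial α R) →+* MvPolynomial σ R).comp C := by
        refine ringHom_ext (fun r => ?_) fun i => ?_
        · simp [e]
        · simp [e]
      exact (eval₂Hom_C _ _ _).trans (RingHom.congr_fun this q)
    · simp [polyHom, e]
  rw [he]
  exact e.bijective

/-- Polynomials in the variables `β` over the polynomials in the variables `α`. -/
def polyEquiv (R : Type u) [CommRing R] {α β σ : Type} {a : α → σ} {b : β → σ}
    (h : Function.Bijective (Sum.elim b a)) :
    MvPolynomial β (MvPolynomial α R) ≃+* MvPolynomial σ R :=
  RingEquiv.ofBijective _ (polyHom_bijective R h)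

section

variable {R : Type u} [CommRing R] {α β σ : Type} {a : α → σ} {b : β → σ}
    (h : Function.Bijective (Sum.elim b a))

theorem polyEquiv_C (q : MvPolynomial α R) : polyEquiv R h (C q) = rename a q :=
  eval₂Hom_C _ _ _

theorem polyEquiv_X (i : β) : polyEquiv R h (X i) = X (b i) := eval₂Hom_X' _ _ _

end

/-- Adjoining the sets `V j` one after the other amounts to adjoining their disjoint union at once.
The list must have no repetitions, since otherwise a set of variables would be adjoined twice. -/
theorem isIteratedPolynomial_of_bijective {ι : Type} {S A : ι → Type u} [∀ j, CommRing (S j)]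
    [∀ j, CommRing (A j)] [∀ j, Algebra (S j) (A j)] {V : ι → Type}
    (e : ∀ j, MvPolynomial (V j) (S j) ≃ₐ[S j] A j) {P : Type u} [CommRing P]
    [∀ j, Algebra (S j) P] [∀ j, Algebra (A j) P] : ∀ (L : List ι) (_ : L.Nodup)
    {R : Type u} [CommRing R] (f : R →+* P),
    Function.Bijective (eval₂Hom f fun q : {q : Σ j, V j // q.1 ∈ L} =>
      algebraMap (A q.1.1) P (e q.1.1 (X q.1.2))) → Cx.IsIteratedPolynomial e L R f
  | [], _, R, _, f, h => by
    have : IsEmpty {q : Σ j, V j // q.1 ∈ ([] : List ι)} := ⟨fun q => by simpa using q.2⟩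
    have hb := h.comp (isEmptyRingEquiv R {q : Σ j, V j // q.1 ∈ ([] : List ι)}).symm.bijective
    have : f = (eval₂Hom f fun q : {q : Σ j, V j // q.1 ∈ ([] : List ι)} =>
      algebraMap (A q.1.1) P (e q.1.1 (X q.1.2))).comp
        (isEmptyRingEquiv R {q : Σ j, V j // q.1 ∈ ([] : List ι)}).symm.toRingHom := by
      refine RingHom.ext fun r => ?_
      simp
    rw [Cx.IsIteratedPolynomial, this]
    exact hb
  | j :: L, hL, R, _, f, h => by
    rw [List.nodup_cons] at hL
    refine isIteratedPolynomial_of_bijective e L hL.2 _ ?_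
    let a : V j → {q : Σ j, V j // q.1 ∈ j :: L} := fun v => ⟨⟨j, v⟩, by simp⟩
    let b : {q : Σ j, V j // q.1 ∈ L} → {q : Σ j, V j // q.1 ∈ j :: L} :=
      fun q => ⟨q.1, by simp [q.2]⟩
    -- The variables for `j :: L` are those for `L` together with those of `V j`; the two sets are
    -- disjoint because `j` is not in `L`.
    have hab : Function.Bijective (Sum.elim b a) := by
      constructor
      · rintro (⟨q, hq⟩ | v) (⟨q', hq'⟩ | v') hh
        · have h1 : q = q' := congrArg Subtype.val hh
          exact congrArg Sum.inl (Subtype.ext h1)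
        · have h1 : q = ⟨j, v'⟩ := congrArg Subtype.val hh
          subst h1
          exact absurd hq hL.1
        · have h1 : ⟨j, v⟩ = q' := congrArg Subtype.val hh
          subst h1
          exact absurd hq' hL.1
        · have h1 : (⟨j, v⟩ : Σ j, V j) = ⟨j, v'⟩ := congrArg Subtype.val hh
          cases h1
          rfl
      · rintro ⟨⟨i, v⟩, hq⟩
        rcases List.mem_cons.1 hq with rfl | hi
        · exact ⟨Sum.inr v, rfl⟩
        · exact ⟨Sum.inl ⟨⟨i, v⟩, hi⟩, rfl⟩
    have hb := h.comp (polyEquiv R hab).bijective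
    refine Function.Bijective.of_comp_iff' (f := id) Function.bijective_id _ |>.1 ?_
    convert hb using 1
    have : (eval₂Hom (eval₂Hom f fun v : V j => algebraMap (A j) P (e j (X v)))
        fun q : {q : Σ j, V j // q.1 ∈ L} => algebraMap (A q.1.1) P (e q.1.1 (X q.1.2))) =
        (eval₂Hom f fun q : {q : Σ j, V j // q.1 ∈ j :: L} =>
          algebraMap (A q.1.1) P (e q.1.1 (X q.1.2))).comp
            (polyEquiv R hab : MvPolynomial _ (MvPolynomial (V j) R) →+* _) := by
      refine ringHom_ext (fun q => ?_) fun i => ?_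
      · rw [eval₂Hom_C, RingHom.comp_apply, RingHom.coe_coe, polyEquiv_C, eval₂Hom_rename]
        rfl
      · rw [eval₂Hom_X', RingHom.comp_apply, RingHom.coe_coe, polyEquiv_X, eval₂Hom_X']
    exact congrArg DFunLike.coe this

end IteratedPolynomial

/-! ### Gluing in terms of sets of variables -/

section Glue

open MvPolynomial

variable {k : Type u} [Field k] (p : Polynomial k)

/-- The pair of elements given by an arc, from the variables at its head and its tail. -/
def varPair {σ : Type} (x y : σ) : MvPolynomial σ k × MvPolynomial σ k := edgePair p (X x) (X y)

theorem polyEquiv_algebraMap {α β σ : Type} {a : α → σ} {b : β → σ}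
    (h : Function.Bijective (Sum.elim b a)) :
    (polyEquiv k h : MvPolynomial β (MvPolynomial α k) →+* MvPolynomial σ k).comp
      (algebraMap k (MvPolynomial β (MvPolynomial α k))) = algebraMap k (MvPolynomial σ k) := by
  refine RingHom.ext fun r => ?_
  rw [IsScalarTower.algebraMap_eq k (MvPolynomial α k) (MvPolynomial β (MvPolynomial α k))]
  exact (polyEquiv_C h _).trans (rename_C _ _)

theorem polyEquiv_endVar {β K σ : Type} {n : ℕ} {a : β ⊕ K → σ} {b : Fin n → σ}
    (h : Function.Bijective (Sum.elim b a)) {A : Type} (f : A → β) (y : A ⊕ Fin n) :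
    polyEquiv k h (endVar (fun t => X (Sum.inl (f t))) y) =
      X (y.elim (fun t => a (Sum.inl (f t))) b) := by
  rcases y with y | i
  · exact (polyEquiv_C h _).trans (rename_X _ _)
  · exact polyEquiv_X h i

/-- Gluing of arcs: the Koszul factorization of the arcs with common variables at the ends that are
glued is homotopy equivalent to the factorization of the glued arcs. -/
theorem glue_he {β K T H : Type} [Fintype K] [Fintype T] [Fintype H] {n : ℕ}
    (e : T ⊕ Fin n ≃ H ⊕ Fin n) (tv : T → β) (hv : H → β) {σ σ' : Type} {a : β ⊕ K → σ}
    {b : Fin n → σ} (h : Function.Bijective (Sum.elim b a)) {a' : β ⊕ K → σ'}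
    {b' : Fin (trace n e).2 → σ'} (h' : Function.Bijective (Sum.elim b' a'))
    [Algebra (MvPolynomial β k) (MvPolynomial σ k)]
    [Algebra (MvPolynomial β k) (MvPolynomial σ' k)]
    (hσ : ∀ q : MvPolynomial β k, algebraMap _ (MvPolynomial σ k) q =
      rename (fun i => a (Sum.inl i)) q)
    (hσ' : ∀ q : MvPolynomial β k, algebraMap _ (MvPolynomial σ' k) q =
      rename (fun i => a' (Sum.inl i)) q) :
    Cx.HE (Cx.restr (MvPolynomial β k) (Cx.kosz
        ((Finset.univ.val.map fun i => varPair p (a (Sum.inr i)) (a (Sum.inr i))) +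
          Finset.univ.val.map fun x => varPair p
            ((e x).elim (fun t => a (Sum.inl (hv t))) b) (x.elim (fun t => a (Sum.inl (tv t))) b))
        (Cx.unit (MvPolynomial σ k))))
      (Cx.restr (MvPolynomial β k) (Cx.kosz
        ((Finset.univ.val.map fun i => varPair p (a' (Sum.inr i)) (a' (Sum.inr i))) +
          (Finset.univ.val.map fun t => varPair p (a' (Sum.inl (hv ((trace n e).1 t))))
            (a' (Sum.inl (tv t)))) +
          Finset.univ.val.map fun i => varPair p (b' i) (b' i))
        (Cx.unit (MvPolynomial σ' k)))) := by
  letI : Algebra (MvPolynomial β k) (MvPolynomial (β ⊕ K) k) :=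
    (rename (Sum.inl : β → β ⊕ K) : MvPolynomial β k →ₐ[k] _).toRingHom.toAlgebra
  -- `K` indexes the loops that exist before the gluing. Their marks count as coefficients, and
  -- their pairs are the extra pairs in `trace_he`.
  let l : Multiset (MvPolynomial (β ⊕ K) k × MvPolynomial (β ⊕ K) k) :=
    Finset.univ.val.map fun i : K => varPair p (Sum.inr i) (Sum.inr i)
  have key := Cx.HE.restr (MvPolynomial β k) (trace_he p n e (fun t => X (Sum.inl (tv t)))
    (fun t => X (Sum.inl (hv t))) l _ rfl)
  -- Both sides of `key` live over polynomial rings built in two stages. They are identified with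
  -- the polynomial rings on `σ` and `σ'`, linearly over the ring in the variables `β`.
  have hφ : ∀ {n : ℕ} {τ : Type} {a : β ⊕ K → τ} {b : Fin n → τ}
      (h : Function.Bijective (Sum.elim b a)) [Algebra (MvPolynomial β k) (MvPolynomial τ k)],
      (∀ q : MvPolynomial β k, algebraMap _ (MvPolynomial τ k) q =
        rename (fun i => a (Sum.inl i)) q) → ∀ r : Multiset (MvPolynomial (Fin n)
          (MvPolynomial (β ⊕ K) k) × MvPolynomial (Fin n) (MvPolynomial (β ⊕ K) k)),
      Cx.SE (Cx.restr (MvPolynomial β k) (Cx.restr (MvPolynomial (β ⊕ K) k)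
          (Cx.kosz r (Cx.unit (MvPolynomial (Fin n) (MvPolynomial (β ⊕ K) k))))))
        (Cx.restr (MvPolynomial β k) (Cx.kosz (r.map (Cx.mapPair (polyEquiv k h :
          MvPolynomial (Fin n) (MvPolynomial (β ⊕ K) k) →+* MvPolynomial τ k)))
            (Cx.unit (MvPolynomial τ k)))) := by
    intro n τ a b h _ hτ r
    let φ : MvPolynomial (Fin n) (MvPolynomial (β ⊕ K) k) ≃ₐ[MvPolynomial β k]
      MvPolynomial τ k := AlgEquiv.ofRingEquiv (f := polyEquiv k h) fun q => by
        rw [IsScalarTower.algebraMap_apply (MvPolynomial β k) (MvPolynomial (β ⊕ K) k), hτ]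
        exact (polyEquiv_C h _).trans (rename_rename _ _ _)
    exact (Cx.restr_restr_se _ _).trans (Cx.restr_kosz_equiv φ r)
  have hl : ∀ {n : ℕ} {τ : Type} {a : β ⊕ K → τ} {b : Fin n → τ}
      (h : Function.Bijective (Sum.elim b a)), (l.map (Cx.mapPair C)).map (Cx.mapPair
        (polyEquiv k h : MvPolynomial (Fin n) (MvPolynomial (β ⊕ K) k) →+* MvPolynomial τ k)) =
      Finset.univ.val.map fun i => varPair p (a (Sum.inr i)) (a (Sum.inr i)) := by
    intro n τ a b h
    rw [Multiset.map_map, Multiset.map_map]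
    refine Multiset.map_congr rfl fun i _ => ?_
    rw [Function.comp_apply, Function.comp_apply, varPair, mapPair_C,
      mapPair_edgePair p (polyEquiv_algebraMap h), RingHom.coe_coe, polyEquiv_C, rename_X]
    rfl
  refine ((Cx.SE.of_eq ?_).trans (hφ h hσ _).symm).he.trans
    (key.trans ((hφ h' hσ' _).trans (Cx.SE.of_eq ?_)).he)
  · congr 2
    rw [Multiset.map_add, hl]
    congr 1
    rw [Multiset.map_map]
    refine Multiset.map_congr rfl fun x _ => ?_
    rw [Function.comp_apply, mapPair_edgePair p (polyEquiv_algebraMap h), RingHom.coe_coe,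
      polyEquiv_endVar, polyEquiv_endVar]
    rfl
  · congr 2
    rw [Multiset.map_add, Multiset.map_add, Multiset.map_add, hl]
    congr 1
    · congr 1
      rw [Multiset.map_map, Multiset.map_map]
      refine Multiset.map_congr rfl fun x _ => ?_
      rw [Function.comp_apply, Function.comp_apply, mapPair_C,
        mapPair_edgePair p (polyEquiv_algebraMap h'), RingHom.coe_coe, polyEquiv_C, polyEquiv_C,
        rename_X, rename_X]
      rfl
    · rw [Multiset.map_map]
      refine Multiset.map_congr rfl fun x _ => ?_
      rw [Function.comp_apply, mapPair_edgePair p (polyEquiv_algebraMap h'), RingHom.coe_coe,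
        polyEquiv_X]
      rfl

end Glue

/-! ### Tensor products in two steps and in one step -/

namespace Cx

variable {D : Type v} [Category.{w} D]

theorem restrF_const {R : Type u} [CommRing R] (B : Type u) [CommRing B] [Algebra B R] (N : Cx R) :
    SIso (restrF B ((Functor.const D).obj N)) ((Functor.const D).obj (restr B N)) :=
  SIso.of_app (F' := (Functor.const D).obj (restr B N)) (fun _ => 𝟙 _) (fun _ => rfl)
    (fun _ => IsChain.id _) fun _ => Function.bijective_id

theorem tensor_unit_se {R S : Type u} [CommRing R] [CommRing S] [Algebra S R] (N : Cx R) :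
    SE (tensor N (unit S)) N :=
  ((tens_unit (S := S) ((Functor.const (Discrete PUnit.{1})).obj N)).se ⟨⟨⟩⟩).symm

theorem tensor_kosz_unit {P A : Type u} [CommRing P] [CommRing A] [Algebra A P] {N : Cx P}
    {r : Multiset (P × P)} (hN : SE N (kosz r (unit P))) {Z : Cx A} {s : Multiset (A × A)}
    (hZ : SE Z (kosz s (unit A))) :
    SE (tensor N Z) (kosz (s.map (mapPair (algebraMap A P)) + r) (unit P)) :=
  (SE.tensor hN hZ).trans ((tensor_kosz s _ _).trans
    (((tensor_unit_se _).kosz _).trans (kosz_add _ _ _).symm))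

/-- The tensor product of Koszul factorizations is a Koszul factorization. -/
theorem fold_const_kosz {P : Type u} [CommRing P] {ι : Type} {A : ι → Type u}
    [∀ j, CommRing (A j)] [∀ j, Algebra (A j) P] {N : Cx P} {r : Multiset (P × P)}
    (hN : SE N (kosz r (unit P))) {Z : ∀ j, Cx (A j)} {s : ∀ j, Multiset (A j × A j)}
    (hZ : ∀ j, SE (Z j) (kosz (s j) (unit (A j)))) : ∀ L : List ι,
    SIso (fold ((Functor.const D).obj N) (fun j => (Functor.const D).obj (Z j)) L)
      ((Functor.const D).obj (kosz ((L.map fun j =>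
        (s j).map (mapPair (algebraMap (A j) P))).sum + r) (unit P)))
  | [] => SE.const D (hN.trans (SE.of_eq (by rw [List.map_nil, List.sum_nil, zero_add])))
  | j :: L => by
    refine (SIso.tens (fold_const_kosz hN hZ L) (SIso.refl _)).trans ((tens_const D _ _).trans
      (SE.const D ?_))
    rw [List.map_cons, List.sum_cons, add_assoc]
    exact tensor_kosz_unit (SE.refl _) (hZ j)

/-- The rings `T q` and `B₀` act through `B`, so the leading factor matters only as a complex over
`B`. An equivalence of the leading factors that is merely linear over `B` is therefore enough,
although their rings `R` and `R'` may differ. -/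
theorem restrF_fold_congr {B₀ B R R' : Type u} [CommRing B₀] [CommRing B] [CommRing R]
    [CommRing R'] [Algebra B₀ B] [Algebra B₀ R] [Algebra B₀ R'] [Algebra B R] [Algebra B R']
    [IsScalarTower B₀ B R] [IsScalarTower B₀ B R'] {Ω : Type} {T : Ω → Type u}
    [∀ q, CommRing (T q)] [∀ q, Algebra (T q) B] [∀ q, Algebra (T q) R] [∀ q, Algebra (T q) R']
    [∀ q, IsScalarTower (T q) B R] [∀ q, IsScalarTower (T q) B R'] {N : Cx R} {N' : Cx R'}
    (M : ∀ q, D ⥤ Cx (T q)) (L : List Ω) (h : HE (restr B N) (restr B N')) :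
    HEqv (restrF B₀ (fold ((Functor.const D).obj N) M L))
      (restrF B₀ (fold ((Functor.const D).obj N') M L)) := by
  have h1 := (restr_restr (T := B₀) B (fold ((Functor.const D).obj N) M L)).symm.trans
    (SIso.restr B₀ ((restr_fold B _ M L).trans
      (SIso.fold (restrF_const B N) (fun q => SIso.refl (M q)) L)))
  have h2 := (restr_restr (T := B₀) B (fold ((Functor.const D).obj N') M L)).symm.trans
    (SIso.restr B₀ ((restr_fold B _ M L).trans
      (SIso.fold (restrF_const B N') (fun q => SIso.refl (M q)) L)))
  exact h1.hEqv.trans ((HEqv.restr B₀ (HEqv.fold M (h.const D) L)).trans h2.symm.hEqv)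

section Composite

variable {B₀ B R R' P : Type u} [CommRing B₀] [CommRing B] [CommRing R] [CommRing R'] [CommRing P]
  {ι Ω : Type} {κ V : ι → Type} {S A : ι → Type u} {T : Ω → Type u} [∀ j, CommRing (S j)]
  [∀ j, CommRing (A j)] [∀ q, CommRing (T q)]
  [Algebra B₀ B] [Algebra B₀ R] [Algebra B₀ R'] [Algebra B₀ P] [Algebra B P] [Algebra B R']
  [Algebra R P] [IsScalarTower B₀ R P] [IsScalarTower B₀ B P] [IsScalarTower B₀ B R']
  [∀ j, Algebra (S j) (A j)] [∀ j, Algebra (S j) R] [∀ j, Algebra (S j) P]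
  [∀ j, Algebra (A j) P] [∀ j, IsScalarTower (S j) (A j) P] [∀ j, IsScalarTower (S j) R P]
  [∀ q, Algebra (T q) B] [∀ q, Algebra (T q) P] [∀ q, Algebra (T q) R']
  [∀ q, IsScalarTower (T q) B P] [∀ q, IsScalarTower (T q) B R']

/-- Tensor products of families with Koszul factorizations, in two steps and in one step. -/
theorem fold_composite (g : (Σ j, κ j) → Ω) [∀ j l, Algebra (T (g ⟨j, l⟩)) (A j)]
    [∀ j l, IsScalarTower (T (g ⟨j, l⟩)) (A j) P]
    (e : ∀ j, MvPolynomial (V j) (S j) ≃ₐ[S j] A j) {N : Cx R} {r : Multiset (R × R)}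
    (hN : SE N (kosz r (unit R))) {Z : ∀ j, Cx (A j)} {s : ∀ j, Multiset (A j × A j)}
    (hZ : ∀ j, SE (Z j) (kosz (s j) (unit (A j)))) {N' : Cx R'} (M : ∀ q, D ⥤ Cx (T q))
    (K : ∀ j, List (κ j)) (L : List ι) (L' : List Ω)
    (hL' : L'.Perm ((L.flatMap fun j => (K j).map (Sigma.mk j)).map g))
    (hP : IsIteratedPolynomial e L R (algebraMap R P))
    (h : HE (restr B (kosz ((L.map fun j => (s j).map (mapPair (algebraMap (A j) P))).sum +
      r.map (mapPair (algebraMap R P))) (unit P))) (restr B N')) :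
    HEqv (restrF B₀ (fold ((Functor.const D).obj N) (fun j => restrF (S j)
        (fold (S := fun l => T (g ⟨j, l⟩)) ((Functor.const D).obj (Z j))
          (fun l => M (g ⟨j, l⟩)) (K j))) L))
      (restrF B₀ (fold ((Functor.const D).obj N') M L')) := by
  have hNP : SE (tensor (unit P) N) (kosz (r.map (mapPair (algebraMap R P))) (unit P)) :=
    (tensor_kosz_unit (r := 0) (kosz_zero _).symm hN).trans (SE.of_eq (by rw [add_zero]))
  -- The inner restrictions to the rings `S j` are moved outwards, over the common ring `P`.
  -- Flattening the nested product in `h2` then puts all Koszul factors in front of all inputs.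
  have h1 := SIso.restr B₀ (fold_restr e (fun j => fold (S := fun l => T (g ⟨j, l⟩))
    ((Functor.const D).obj (Z j)) (fun l => M (g ⟨j, l⟩)) (K j)) L ((Functor.const D).obj N) hP)
  have h2 := fold_fold (T := fun q => T (g q)) (tens ((Functor.const D).obj (unit P))
    ((Functor.const D).obj N)) (fun j => (Functor.const D).obj (Z j)) (fun q => M (g q)) K L
  -- The product of the leading factors is again a Koszul factorization, on the union of their
  -- pairs.
  have h3 := (SIso.fold (tens_const D (unit P) N) (fun j => SIso.refl ((Functor.const D).obj (Z j)))
    L).trans (fold_const_kosz hNP hZ L)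
  have h4 := h2.trans (SIso.fold (S := fun q => T (g q)) h3 (fun q => SIso.refl (M (g q))) _)
  rw [← fold_map g] at h4
  have h5 := h4.trans (fold_perm _ M hL'.symm)
  exact ((h1.trans (restr_restr R _)).trans (SIso.restr B₀ h5)).hEqv.trans
    (restrF_fold_congr M L' h)

end Composite

end Cx

theorem Cx.koszul_kosz {R : Type u} [CommRing R] {E : Type} [Fintype E] {x y : E → R} {w : R}
    (h : ∑ e, x e * y e = w) :
    Cx.SE (koszul x y h).single.toCx
      (Cx.kosz (Finset.univ.val.map fun e => (x e, y e)) (Cx.unit R)) := by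
  subst h
  exact Cx.ext_kosz x y

/-! ### The functor of an arc diagram on strict families -/

namespace ArcDiagram

variable {k : Type u} [Field k] (p : Polynomial k) {ι : Type} [Fintype ι] {X : ι → SignSeq}
  {X₀ : SignSeq} (η : ArcDiagram X X₀)

theorem Z_kosz : Cx.SE (η.Z p).single.toCx (Cx.kosz
    (Finset.univ.val.map fun e => varPair p (η.head e) (η.tail e)) (Cx.unit (η.ring k))) :=
  Cx.koszul_kosz (η.koszul_pot p)

/-- The functor of an arc diagram on families of strict morphisms. -/
def model [LinearOrder ι] {D : Type v} [Category.{w} D] (G : ∀ j, D ⥤ Cx ((X j).ring k)) :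
    D ⥤ Cx (X₀.ring k) :=
  letI : Algebra (X₀.ring k) (η.ring k) := (η.outer k).toRingHom.toAlgebra
  letI : ∀ j, Algebra ((X j).ring k) (η.ring k) := fun j => (η.hole k j).toRingHom.toAlgebra
  Cx.restrF (X₀.ring k) (Cx.fold ((Functor.const D).obj (η.Z p).single.toCx) G
    (Finset.univ.sort (fun i j : ι => j ≤ i)))

theorem models [LinearOrder ι] {J : Type} {A : J → Type u} [∀ j, CommRing (A j)] {v : ∀ j, A j}
    {𝓖 : ∀ i, (∀ j, MFComplex (A j) (v j)) ⥤ MFComplex ((X i).ring k) (pot p (X i))}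
    {G : ∀ i, Fam v ⥤ Cx ((X i).ring k)} (hG : ∀ i, Models (𝓖 i) (G i)) :
    Models (Functor.pi' 𝓖 ⋙ η.functor p) (η.model p G) :=
  letI : Algebra (X₀.ring k) (η.ring k) := (η.outer k).toRingHom.toAlgebra
  letI : ∀ j, Algebra ((X j).ring k) (η.ring k) := fun j => (η.hole k j).toRingHom.toAlgebra
  Models.restrict _ (Models.fold (η.Z p).single (fun j => pot p (X j)) hG
    (Finset.univ.sort (fun i j : ι => j ≤ i)))

end ArcDiagram

/-- As a sum in the monoid of multisets, a family of pairs can be reindexed and split over disjoint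
unions like any finite sum. -/
theorem univ_map_eq_sum {E M : Type*} [Fintype E] (f : E → M) :
    Finset.univ.val.map f = ∑ e, ({f e} : Multiset M) :=
  (Multiset.sum_map_singleton _).symm.trans (congrArg _ (Multiset.map_map _ _ _))

theorem mapPair_varPair {k : Type u} [Field k] (p : Polynomial k) {σ τ : Type} (f : σ → τ)
    (x y : σ) {φ : MvPolynomial σ k →+* MvPolynomial τ k}
    (hφ : φ = (MvPolynomial.rename f : MvPolynomial σ k →ₐ[k] MvPolynomial τ k).toRingHom) :
    Cx.mapPair φ (varPair p x y) = varPair p (f x) (f y) := by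
  subst hφ
  refine (mapPair_edgePair p (f := (MvPolynomial.rename f :
    MvPolynomial σ k →ₐ[k] MvPolynomial τ k).toRingHom) (RingHom.ext fun r => MvPolynomial.rename_C f r) _ _).trans ?_
  refine congrArg₂ (edgePair p) ?_ ?_ <;> exact MvPolynomial.rename_X _ _

theorem sort_map_sum {ι M : Type*} [Fintype ι] [LinearOrder ι] [AddCommMonoid M] (f : ι → M) :
    ((Finset.univ.sort (fun i j : ι => j ≤ i)).map f).sum = ∑ j, f j := by
  rw [← List.sum_toFinset _ (Finset.sort_nodup _ _), Finset.sort_toFinset]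

/-! ### The composite of arc diagrams -/

namespace ArcDiagram

open MvPolynomial

variable {k : Type u} [Field k] (p : Polynomial k) {ι : Type} [Fintype ι] {κ : ι → Type}
  [∀ j, Fintype (κ j)] {X : ι → SignSeq} {X₀ : SignSeq} {Y : ∀ j, κ j → SignSeq}
  (η : ArcDiagram X X₀) (θ : ∀ j, ArcDiagram (Y j) (X j))

/-- The variables of `η` and of the diagrams `θ j` in its holes, with the variables of the common
boundary identified. -/
abbrev GluedVar : Type := η.Var ⊕ Σ j, (Σ l, (Y j l).Pt) ⊕ Fin (θ j).loops

/-- The inclusion of the variables of a diagram in a hole. -/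
def inner (j : ι) : (θ j).Var → GluedVar η θ :=
  Sum.elim (fun x => .inl (.inr (.inl ⟨j, x⟩))) fun v => .inr ⟨j, v⟩

/-- The boundary points of the composite diagram. -/
abbrev CompPt (X₀ : SignSeq) (Y : ∀ j, κ j → SignSeq) : Type :=
  X₀.Pt ⊕ Σ q : Lex (Σ j, κ j), (Y (ofLex q).1 (ofLex q).2).Pt

/-- The closed loops of the diagrams before the gluing. -/
abbrev OldLoop : Type := Fin η.loops ⊕ Σ j, Fin (θ j).loops

/-- The variables of the free points and of the loops. -/
def freeVar : CompPt X₀ Y ⊕ OldLoop η θ → GluedVar η θ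
  | .inl (.inl x) => .inl (.inl x)
  | .inl (.inr z) => .inr ⟨(ofLex z.1).1, .inl ⟨(ofLex z.1).2, z.2⟩⟩
  | .inr (.inl i) => .inl (.inr (.inr i))
  | .inr (.inr z) => .inr ⟨z.1, .inr z.2⟩

/-- The points of the common boundaries, numbered by `m`, are the variables at which arcs are glued;
the free points and the marks of the old loops play the role of coefficients. -/
theorem freeVar_bijective {n : ℕ} (m : (Σ j, (X j).Pt) ≃ Fin n) :
    Function.Bijective (Sum.elim (fun i => (.inl (.inr (.inl (m.symm i))) : GluedVar η θ))
      (freeVar η θ)) := by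
  rw [Function.bijective_iff_has_inverse]
  refine ⟨fun v => match v with
    | .inl (.inl x) => .inr (.inl (.inl x))
    | .inl (.inr (.inl z)) => .inl (m z)
    | .inl (.inr (.inr i)) => .inr (.inr (.inl i))
    | .inr ⟨j, .inl z⟩ => .inr (.inl (.inr ⟨toLex ⟨j, z.1⟩, z.2⟩))
    | .inr ⟨j, .inr i⟩ => .inr (.inr (.inr ⟨j, i⟩)), ?_, ?_⟩
  · rintro (i | ((x | z) | (i | z)))
    · simp
    all_goals rfl
  · rintro ((x | (z | i)) | ⟨j, (z | i)⟩)
    · rfl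
    · simp
    all_goals rfl

/-- The bijection from tails to heads given by the arcs before the gluing. -/
def preComp : (X₀.Neg ⊕ Σ q : Lex (Σ j, κ j), (Y (ofLex q).1 (ofLex q).2).Pos) ⊕ (Σ j, (X j).Pt) ≃
    (X₀.Pos ⊕ Σ q : Lex (Σ j, κ j), (Y (ofLex q).1 (ofLex q).2).Neg) ⊕ (Σ j, (X j).Pt) :=
  ((regroup (A := X₀.Neg) (C := fun j l => (Y j l).Pos)
        fun j => Equiv.sumCompl fun x => (X j).sgn x = true).trans
      (Equiv.sumCongr η.arc (Equiv.sigmaCongrRight fun j => (θ j).arc))).trans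
    (regroup (A := X₀.Pos) (C := fun j l => (Y j l).Neg)
      fun j => (Equiv.sumComm _ _).trans (Equiv.sumCompl fun x => (X j).sgn x = true)).symm

/-- A positive point of `X j` is a tail for `η` and a head for `θ j`, and for a negative point it is
the other way round. Hence the arcs of all diagrams together form the bijection `preComp`, with one
variable for each common boundary point, and the loops give the pairs on the marks. -/
theorem edges_eq {n : ℕ} (m : (Σ j, (X j).Pt) ≃ Fin n) :
    (∑ j, Finset.univ.val.map fun x => varPair (k := k) p (inner η θ j ((θ j).head x))
        (inner η θ j ((θ j).tail x))) +
      (Finset.univ.val.map fun x => varPair p (.inl (η.head x) : GluedVar η θ)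
        (.inl (η.tail x))) =
    (Finset.univ.val.map fun i => varPair p (freeVar η θ (.inr i)) (freeVar η θ (.inr i))) +
      Finset.univ.val.map fun x => varPair p
        (((((Equiv.sumCongr (Equiv.refl _) m.symm).trans (preComp η θ)).trans
          (Equiv.sumCongr (Equiv.refl _) m)) x).elim
            (fun t => freeVar η θ (.inl (Sum.map Subtype.val
              (Sigma.map id fun _ => Subtype.val) t)))
            (fun i => .inl (.inr (.inl (m.symm i)))))
        (x.elim (fun t => freeVar η θ (.inl (Sum.map Subtype.val
              (Sigma.map id fun _ => Subtype.val) t)))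
            (fun i => .inl (.inr (.inl (m.symm i))))) := by
  simp only [univ_map_eq_sum]
  -- The arcs of `preComp` are reindexed by the diagrams to which they belong; `htail`, `hhead` and
  -- `hpre` then identify the variables at the two ends of each arc.
  rw [← Equiv.sum_comp (Equiv.sumCongr (Equiv.refl (X₀.Neg ⊕
    Σ q : Lex (Σ j, κ j), (Y (ofLex q).1 (ofLex q).2).Pos)) m),
    ← Equiv.sum_comp (regroup (A := X₀.Neg) (C := fun j l => (Y j l).Pos)
        fun j => Equiv.sumCompl fun x => (X j).sgn x = true).symm]
  have htail : ∀ w, (((Equiv.sumCongr (Equiv.refl _) m) ((regroup (A := X₀.Neg)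
      (C := fun j l => (Y j l).Pos) fun j => Equiv.sumCompl fun x =>
        (X j).sgn x = true).symm w)).elim (fun t => freeVar η θ (.inl (Sum.map Subtype.val
              (Sigma.map id fun _ => Subtype.val) t)))
            (fun i => .inl (.inr (.inl (m.symm i))))) =
      w.elim (fun u => .inl (η.tail (.inl u))) fun u => inner η θ u.1 ((θ u.1).tail (.inl u.2)) := by
    rintro ((x | x) | ⟨j, (x | x)⟩)
    · rfl
    · change Sum.inl (Sum.inr (Sum.inl (m.symm (m _)))) = _
      rw [Equiv.symm_apply_apply]
      rfl
    · change Sum.inl (Sum.inr (Sum.inl (m.symm (m _)))) = _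
      rw [Equiv.symm_apply_apply]
      rfl
    · rfl
  have hhead : ∀ w, (((Equiv.sumCongr (Equiv.refl _) m) ((regroup (A := X₀.Pos)
      (C := fun j l => (Y j l).Neg)
      fun j => (Equiv.sumComm _ _).trans (Equiv.sumCompl fun x =>
        (X j).sgn x = true)).symm w)).elim (fun t => freeVar η θ (.inl (Sum.map Subtype.val
              (Sigma.map id fun _ => Subtype.val) t)))
            (fun i => .inl (.inr (.inl (m.symm i))))) =
      w.elim (fun u => .inl (u.elim (fun x => .inl x.1) (fun x => .inr (.inl ⟨x.1, x.2.1⟩))))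
        fun u => inner η θ u.1 (u.2.elim (fun x => .inl x.1) (fun x => .inr (.inl ⟨x.1, x.2.1⟩))) := by
    rintro ((x | x) | ⟨j, (x | x)⟩)
    · rfl
    · change Sum.inl (Sum.inr (Sum.inl (m.symm (m _)))) = _
      rw [Equiv.symm_apply_apply]
      rfl
    · change Sum.inl (Sum.inr (Sum.inl (m.symm (m _)))) = _
      rw [Equiv.symm_apply_apply]
      rfl
    · rfl
  have hpre : ∀ w, (((Equiv.sumCongr (Equiv.refl _) m.symm).trans (preComp η θ)).trans
          (Equiv.sumCongr (Equiv.refl _) m)) ((Equiv.sumCongr (Equiv.refl _) m) ((regroup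
          (A := X₀.Neg) (C := fun j l => (Y j l).Pos) fun j => Equiv.sumCompl fun x =>
            (X j).sgn x = true).symm w)) =
      (Equiv.sumCongr (Equiv.refl _) m) ((regroup (A := X₀.Pos)
        (C := fun j l => (Y j l).Neg) fun j => (Equiv.sumComm _ _).trans (Equiv.sumCompl fun x =>
          (X j).sgn x = true)).symm (Equiv.sumCongr η.arc
            (Equiv.sigmaCongrRight fun j => (θ j).arc) w)) := by
    intro w
    have h1 : ∀ y, Equiv.sumCongr (Equiv.refl (X₀.Neg ⊕
        Σ q : Lex (Σ j, κ j), (Y (ofLex q).1 (ofLex q).2).Pos)) m.symm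
        (Equiv.sumCongr (Equiv.refl _) m y) = y := by
      rintro (y | y) <;> simp
    rw [Equiv.trans_apply, Equiv.trans_apply, h1, preComp, Equiv.trans_apply, Equiv.trans_apply,
      Equiv.apply_symm_apply]
  simp only [hpre, htail, hhead, Fintype.sum_sum_type, Fintype.sum_sigma]
  simp only [Finset.sum_add_distrib]
  simp only [head, tail, freeVar, inner, Equiv.sumCongr_apply, Sum.map_inl, Sum.map_inr,
    Sum.elim_inl, Sum.elim_inr, Equiv.sigmaCongrRight_apply]
  abel

end ArcDiagram

namespace ArcDiagram

open MvPolynomial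

variable {k : Type u} [Field k] (p : Polynomial k) {ι : Type} [Fintype ι] {κ : ι → Type}
  [∀ j, Fintype (κ j)] {X : ι → SignSeq} {X₀ : SignSeq} {Y : ∀ j, κ j → SignSeq}
  (η : ArcDiagram X X₀) (θ : ∀ j, ArcDiagram (Y j) (X j))

/-- The algebra structure on a polynomial ring given by a map of the variables. -/
abbrev renameAlgebra (k : Type u) [Field k] {σ τ : Type} (f : σ → τ) :
    Algebra (MvPolynomial σ k) (MvPolynomial τ k) :=
  (rename f : MvPolynomial σ k →ₐ[k] MvPolynomial τ k).toRingHom.toAlgebra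

theorem isScalarTower_rename {σ τ υ : Type} {f : σ → τ} {g : τ → υ} {h : σ → υ}
    (hh : ∀ x, h x = g (f x)) :
    letI := renameAlgebra k f
    letI := renameAlgebra k g
    letI := renameAlgebra k h
    IsScalarTower (MvPolynomial σ k) (MvPolynomial τ k) (MvPolynomial υ k) := by
  obtain rfl : h = g ∘ f := funext hh
  letI := renameAlgebra k f
  letI := renameAlgebra k g
  letI := renameAlgebra k (g ∘ f)
  exact IsScalarTower.of_algebraMap_eq fun q => (rename_rename f g q).symm

/-- A diagram records only the number of its loops, so any bijection between the loops of the
composite and the old loops together with the newly formed ones will do. -/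
theorem exists_loop_equiv (t : ℕ) : Nonempty
    (Fin t ⊕ OldLoop η θ ≃ Fin (η.loops + (∑ j, (θ j).loops) + t)) :=
  ⟨Fintype.equivOfCardEq (by simp; ring)⟩

/-- The variables of the composite diagram. -/
def compVar {t : ℕ} (f : Fin t ⊕ OldLoop η θ ≃ Fin (η.comp θ).loops) :
    CompPt X₀ Y ⊕ OldLoop η θ → (η.comp θ).Var
  | .inl (.inl x) => .inl x
  | .inl (.inr z) => .inr (.inl z)
  | .inr i => .inr (.inr (f (.inr i)))

theorem compVar_bijective {t : ℕ} (f : Fin t ⊕ OldLoop η θ ≃ Fin (η.comp θ).loops) :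
    Function.Bijective (Sum.elim (fun i => (.inr (.inr (f (.inl i))) : (η.comp θ).Var))
      (compVar η θ f)) := by
  let e : Fin t ⊕ (CompPt X₀ Y ⊕ OldLoop η θ) ≃ (η.comp θ).Var :=
    ((((Equiv.sumAssoc _ _ _).symm.trans (Equiv.sumCongr (Equiv.sumComm _ _)
      (Equiv.refl _))).trans (Equiv.sumAssoc _ _ _)).trans (Equiv.sumCongr (Equiv.refl _) f)).trans
        (Equiv.sumAssoc _ _ _)
  have : Sum.elim (fun i => (.inr (.inr (f (.inl i))) : (η.comp θ).Var)) (compVar η θ f) = e := by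
    funext x
    rcases x with (i | ((x | z) | i)) <;> rfl
  rw [this]
  exact e.bijective

/-- The arcs of the composite are those of `trace` by definition, and `f` divides its loops into old
and new ones. This is the form of the result of `glue_he`. -/
theorem comp_edges {t : ℕ} (f : Fin t ⊕ OldLoop η θ ≃ Fin (η.comp θ).loops) :
    (Finset.univ.val.map fun x => varPair (k := k) p ((η.comp θ).head x) ((η.comp θ).tail x)) =
    (Finset.univ.val.map fun i => varPair p (compVar η θ f (.inr i)) (compVar η θ f (.inr i))) +
      (Finset.univ.val.map fun x => varPair p
        (compVar η θ f (.inl (Sum.map Subtype.val (Sigma.map id fun _ => Subtype.val)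
          ((trace _ (((Equiv.sumCongr (Equiv.refl _)
      (Fintype.equivFin (Σ j, (X j).Pt)).symm).trans (preComp η θ)).trans
        (Equiv.sumCongr (Equiv.refl _) (Fintype.equivFin (Σ j, (X j).Pt))))).1 x))))
        (compVar η θ f (.inl (Sum.map Subtype.val (Sigma.map id fun _ => Subtype.val) x)))) +
      Finset.univ.val.map fun i => varPair p (.inr (.inr (f (.inl i)))) (.inr (.inr (f (.inl i)))) := by
  simp only [univ_map_eq_sum]
  have hl : ∑ i, ({varPair p ((η.comp θ).head (.inr i)) ((η.comp θ).tail (.inr i))} :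
      Multiset ((η.comp θ).ring k × (η.comp θ).ring k)) = _ :=
    (Equiv.sum_comp f _).symm.trans (Fintype.sum_sum_type _)
  have hc : ∀ a b c : Multiset ((η.comp θ).ring k × (η.comp θ).ring k),
      a + (b + c) = c + a + b := fun a b c => by
    rw [add_comm b, ← add_assoc, add_comm a]
  have hh : ∀ x, (η.comp θ).head (.inl x) =
      compVar η θ f (.inl (Sum.map Subtype.val (Sigma.map id fun _ => Subtype.val)
          ((trace _ (((Equiv.sumCongr (Equiv.refl _)
      (Fintype.equivFin (Σ j, (X j).Pt)).symm).trans (preComp η θ)).trans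
        (Equiv.sumCongr (Equiv.refl _) (Fintype.equivFin (Σ j, (X j).Pt))))).1 x))) := by
    intro x
    change Sum.elim _ _ ((trace _ (((Equiv.sumCongr (Equiv.refl _)
      (Fintype.equivFin (Σ j, (X j).Pt)).symm).trans (preComp η θ)).trans
        (Equiv.sumCongr (Equiv.refl _) (Fintype.equivFin (Σ j, (X j).Pt))))).1 x) = _
    rcases (trace _ (((Equiv.sumCongr (Equiv.refl _)
      (Fintype.equivFin (Σ j, (X j).Pt)).symm).trans (preComp η θ)).trans
        (Equiv.sumCongr (Equiv.refl _) (Fintype.equivFin (Σ j, (X j).Pt))))).1 x with y | y <;> rfl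
  have htl : ∀ x, (η.comp θ).tail (.inl x) =
      compVar η θ f (.inl (Sum.map Subtype.val (Sigma.map id fun _ => Subtype.val) x)) := by
    rintro (x | x) <;> rfl
  refine (Fintype.sum_sum_type _).trans ((congrArg _ hl).trans ((hc _ _ _).trans ?_))
  refine congrArg₂ _ (congrArg₂ _ rfl (Finset.sum_congr rfl fun x _ => ?_)) rfl
  rw [hh, htl]

/-- Algebra and combinatorics meet here. `Cx.fold_composite` reduces the comparison to two Koszul
factorizations over the ring of the free points; their pairs are computed in `edges_eq` and
`comp_edges`, and `glue_he` provides the equivalence. -/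
theorem comp_model [LinearOrder ι] [∀ j, LinearOrder (κ j)] {D : Type v} [Category.{w} D]
    (M : ∀ q : Lex (Σ j, κ j), D ⥤ Cx ((Y (ofLex q).1 (ofLex q).2).ring k)) :
    Cx.HEqv (η.model p fun j => (θ j).model p fun l => M (toLex ⟨j, l⟩))
      ((η.comp θ).model p M) := by
  -- The common ring `P` has the variables `GluedVar`, and the ring `B` over which the comparison is
  -- linear has the variables `CompPt`. All algebra structures come from maps of variables, so each
  -- compatibility is an equality of such maps.
  letI : Algebra (X₀.ring k) (MvPolynomial (CompPt X₀ Y) k) :=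
    (rename (R := k) (Sum.inl : X₀.Pt → CompPt X₀ Y)).toRingHom.toAlgebra
  letI : Algebra (X₀.ring k) (η.ring k) := (η.outer k).toRingHom.toAlgebra
  letI : Algebra (X₀.ring k) ((η.comp θ).ring k) := ((η.comp θ).outer k).toRingHom.toAlgebra
  letI : Algebra (X₀.ring k) (MvPolynomial (GluedVar η θ) k) :=
    (rename (R := k) (fun x => (.inl (.inl x) : GluedVar η θ))).toRingHom.toAlgebra
  letI : Algebra (MvPolynomial (CompPt X₀ Y) k) (MvPolynomial (GluedVar η θ) k) :=
    (rename (R := k) (fun x => freeVar η θ (.inl x))).toRingHom.toAlgebra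
  letI : Algebra (MvPolynomial (CompPt X₀ Y) k) ((η.comp θ).ring k) :=
    (rename (R := k) (Sum.elim .inl fun z => .inr (.inl z) :
      CompPt X₀ Y → (η.comp θ).Var)).toRingHom.toAlgebra
  letI : Algebra (η.ring k) (MvPolynomial (GluedVar η θ) k) :=
    (rename (R := k) (Sum.inl : η.Var → GluedVar η θ)).toRingHom.toAlgebra
  letI : ∀ j, Algebra ((X j).ring k) ((θ j).ring k) := fun j =>
    ((θ j).outer k).toRingHom.toAlgebra
  letI : ∀ j, Algebra ((X j).ring k) (η.ring k) := fun j => (η.hole k j).toRingHom.toAlgebra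
  letI : ∀ j, Algebra ((X j).ring k) (MvPolynomial (GluedVar η θ) k) := fun j =>
    (rename (R := k) (fun x => (.inl (.inr (.inl ⟨j, x⟩)) : GluedVar η θ))).toRingHom.toAlgebra
  letI : ∀ j, Algebra ((θ j).ring k) (MvPolynomial (GluedVar η θ) k) := fun j =>
    (rename (R := k) (inner η θ j)).toRingHom.toAlgebra
  letI : ∀ q : Lex (Σ j, κ j), Algebra ((Y (ofLex q).1 (ofLex q).2).ring k)
      (MvPolynomial (CompPt X₀ Y) k) := fun q =>
    (rename (R := k) (fun x => (.inr ⟨q, x⟩ : CompPt X₀ Y))).toRingHom.toAlgebra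
  letI : ∀ q : Lex (Σ j, κ j), Algebra ((Y (ofLex q).1 (ofLex q).2).ring k)
      (MvPolynomial (GluedVar η θ) k) := fun q =>
    (rename (R := k) (fun x => freeVar η θ (.inl (.inr ⟨q, x⟩)))).toRingHom.toAlgebra
  letI : ∀ q : Lex (Σ j, κ j), Algebra ((Y (ofLex q).1 (ofLex q).2).ring k)
      ((η.comp θ).ring k) := fun q => ((η.comp θ).hole k q).toRingHom.toAlgebra
  letI : ∀ j l, Algebra ((Y (ofLex (toLex (⟨j, l⟩ : Σ j, κ j))).1
      (ofLex (toLex (⟨j, l⟩ : Σ j, κ j))).2).ring k) ((θ j).ring k) :=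
    fun j l => ((θ j).hole k l).toRingHom.toAlgebra
  haveI : IsScalarTower (X₀.ring k) (η.ring k) (MvPolynomial (GluedVar η θ) k) :=
    isScalarTower_rename fun _ => rfl
  haveI : IsScalarTower (X₀.ring k) (MvPolynomial (CompPt X₀ Y) k)
      (MvPolynomial (GluedVar η θ) k) :=
    isScalarTower_rename fun _ => rfl
  haveI : IsScalarTower (X₀.ring k) (MvPolynomial (CompPt X₀ Y) k) ((η.comp θ).ring k) :=
    isScalarTower_rename fun _ => rfl
  haveI : ∀ j, IsScalarTower ((X j).ring k) ((θ j).ring k) (MvPolynomial (GluedVar η θ) k) :=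
    fun j => isScalarTower_rename fun _ => rfl
  haveI : ∀ j, IsScalarTower ((X j).ring k) (η.ring k) (MvPolynomial (GluedVar η θ) k) :=
    fun j => isScalarTower_rename fun _ => rfl
  haveI : ∀ q : Lex (Σ j, κ j), IsScalarTower ((Y (ofLex q).1 (ofLex q).2).ring k)
      (MvPolynomial (CompPt X₀ Y) k) (MvPolynomial (GluedVar η θ) k) :=
    fun j => isScalarTower_rename fun _ => rfl
  haveI : ∀ q : Lex (Σ j, κ j), IsScalarTower ((Y (ofLex q).1 (ofLex q).2).ring k)
      (MvPolynomial (CompPt X₀ Y) k) ((η.comp θ).ring k) :=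
    fun j => isScalarTower_rename fun _ => rfl
  haveI : ∀ j l, IsScalarTower ((Y (ofLex (toLex (⟨j, l⟩ : Σ j, κ j))).1
      (ofLex (toLex (⟨j, l⟩ : Σ j, κ j))).2).ring k) ((θ j).ring k)
      (MvPolynomial (GluedVar η θ) k) :=
    fun j l => isScalarTower_rename fun _ => rfl
  have hb : ∀ j, Function.Bijective (Sum.elim (.inr : _ → (θ j).Var) .inl) :=
    fun j => (Equiv.sumComm _ _).bijective
  -- The ring of `θ j` is polynomial over the ring of its outer boundary, in the points of its holes
  -- and the marks of its loops.
  let e : ∀ j, MvPolynomial ((Σ l, (Y j l).Pt) ⊕ Fin (θ j).loops) ((X j).ring k)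
      ≃ₐ[(X j).ring k] (θ j).ring k := fun j =>
    AlgEquiv.ofRingEquiv (f := polyEquiv k (hb j)) fun q => polyEquiv_C (hb j) q
  have he : ∀ j v, e j (MvPolynomial.X v) = MvPolynomial.X (.inr v) := fun j v =>
    polyEquiv_X (hb j) v
  have he' : ∀ j v, algebraMap ((θ j).ring k) (MvPolynomial (GluedVar η θ) k)
      (e j (MvPolynomial.X v)) = MvPolynomial.X (.inr ⟨j, v⟩) := fun j v =>
    (congrArg _ (polyEquiv_X (hb j) v)).trans (rename_X (inner η θ j) _)
  let m := Fintype.equivFin (Σ j, (X j).Pt)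
  let t := ((Equiv.sumCongr (Equiv.refl _) m.symm).trans (preComp η θ)).trans
    (Equiv.sumCongr (Equiv.refl _) m)
  obtain ⟨f⟩ := exists_loop_equiv η θ (trace _ t).2
  refine Cx.fold_composite (T := fun q : Lex (Σ j, κ j) => (Y (ofLex q).1 (ofLex q).2).ring k)
    (P := MvPolynomial (GluedVar η θ) k) (B := MvPolynomial (CompPt X₀ Y) k)
    (R' := (η.comp θ).ring k) (N' := ((η.comp θ).Z p).single.toCx)
    (toLex : (Σ j, κ j) → Lex (Σ j, κ j)) e (η.Z_kosz p)
    (fun j => (θ j).Z_kosz p) M (fun j => Finset.univ.sort (fun a b : κ j => b ≤ a))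
    (Finset.univ.sort (fun i j : ι => j ≤ i)) (Finset.univ.sort
      (fun a b : Lex (Σ j, κ j) => b ≤ a)) ?_ ?_ ?_
  -- Both lists contain every hole of the composite exactly once.
  · refine (List.perm_ext_iff_of_nodup (Finset.sort_nodup _ _) (List.Nodup.map toLex.injective
      ?_)).2 fun q => ?_
    · rw [List.nodup_flatMap]
      refine ⟨fun j _ => (Finset.sort_nodup _ _).map sigma_mk_injective, ?_⟩
      refine (Finset.sort_nodup _ _).imp fun {a b} hab q h1 h2 => hab ?_
      obtain ⟨x, -, rfl⟩ := List.mem_map.1 h1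
      obtain ⟨y, -, h⟩ := List.mem_map.1 h2
      exact (congrArg Sigma.fst h).symm
    · simp only [Finset.mem_sort, Finset.mem_univ, List.mem_map, List.mem_flatMap, true_and,
        true_iff]
      exact ⟨ofLex q, ⟨(ofLex q).1, (ofLex q).2, rfl⟩, rfl⟩
  -- The variables of `P` are those of `η` and, for each `j`, the inner variables of `θ j`.
  · refine isIteratedPolynomial_of_bijective e _ (Finset.sort_nodup _ _) _ ?_
    have hs : Function.Bijective (Sum.elim (fun q : {q : Σ j, (Σ l, (Y j l).Pt) ⊕ Fin (θ j).loops //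
        q.1 ∈ Finset.univ.sort (fun i j : ι => j ≤ i)} => .inr q.1)
          (Sum.inl : η.Var → GluedVar η θ)) := by
      refine ⟨?_, ?_⟩
      · rintro (q | x) (q' | x') h
        · exact congrArg _ (Subtype.ext (Sum.inr_injective h))
        · cases h
        · cases h
        · exact congrArg _ (Sum.inl_injective h)
      · rintro (x | q)
        · exact ⟨.inr x, rfl⟩
        · exact ⟨.inl ⟨q, by simp⟩, rfl⟩
    refine (congrArg (fun g : MvPolynomial {q : Σ j, (Σ l, (Y j l).Pt) ⊕ Fin (θ j).loops //
      q.1 ∈ Finset.univ.sort (fun i j : ι => j ≤ i)} (η.ring k) →+* MvPolynomial (GluedVar η θ) k =>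
        Function.Bijective g) ?_).mpr (polyHom_bijective k hs)
    exact congrArg (eval₂Hom _) (funext fun q => he' _ _)
  -- The pairs of all diagrams, mapped to the common ring, are brought into the form required by
  -- `glue_he`.
  · have hm : ((Finset.univ.sort (fun i j : ι => j ≤ i)).map fun j =>
        (Finset.univ.val.map fun x => varPair (k := k) p ((θ j).head x) ((θ j).tail x)).map
          (Cx.mapPair (algebraMap ((θ j).ring k) (MvPolynomial (GluedVar η θ) k)))).sum +
        (Finset.univ.val.map fun x => varPair p (η.head x) (η.tail x)).map
          (Cx.mapPair (algebraMap (η.ring k) (MvPolynomial (GluedVar η θ) k))) = _ :=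
      Eq.trans (congrArg₂ _ ((sort_map_sum _).trans (Finset.sum_congr rfl fun j _ =>
        (Multiset.map_map _ _ _).trans (Multiset.map_congr rfl fun x _ =>
          mapPair_varPair p (inner η θ j) _ _ rfl)))
        ((Multiset.map_map _ _ _).trans (Multiset.map_congr rfl fun x _ =>
          mapPair_varPair p Sum.inl _ _ rfl))) (edges_eq p η θ m)
    refine (Cx.SE.of_eq (congrArg (fun r => Cx.restr (MvPolynomial (CompPt X₀ Y) k)
      (Cx.kosz r (Cx.unit (MvPolynomial (GluedVar η θ) k)))) hm)).he.trans
        ((glue_he p t (Sum.map Subtype.val (Sigma.map id fun _ => Subtype.val))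
          (Sum.map Subtype.val (Sigma.map id fun _ => Subtype.val)) (freeVar_bijective η θ m)
          (compVar_bijective η θ f) (fun q => rfl) fun q => congrArg (fun g => rename g q)
            (funext (by rintro (x | z) <;> rfl))).trans ?_)
    refine Cx.SE.he (Cx.SE.symm ?_)
    refine (Cx.SE.restr _ ((η.comp θ).Z_kosz p)).trans (Cx.SE.of_eq ?_)
    exact congrArg (fun r => Cx.restr (MvPolynomial (CompPt X₀ Y) k)
      (Cx.kosz r (Cx.unit ((η.comp θ).ring k)))) (comp_edges p η θ f)

end ArcDiagram

/-! ### Renaming the holes -/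

namespace ArcDiagram

open MvPolynomial

variable {k : Type u} [Field k] (p : Polynomial k) {ι ι' : Type} {X : ι → SignSeq}
  {X₀ : SignSeq} (e : ι' ≃ ι) (η : ArcDiagram X X₀)

/-- Renaming the holes, on the variables. -/
def relabelVar : (η.relabel e).Var ≃ η.Var :=
  Equiv.sumCongr (Equiv.refl _) (Equiv.sumCongr
    (Equiv.sigmaCongrLeft (β := fun j => (X j).Pt) e) (Equiv.refl _))

/-- Renaming the holes, on the arcs and loops. -/
def relabelEdge : (η.relabel e).Edge ≃ η.Edge :=
  Equiv.sumCongr (Equiv.sumCongr (Equiv.refl _)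
    (Equiv.sigmaCongrLeft (β := fun j => (X j).Pos) e)) (Equiv.refl _)

theorem relabelVar_tail (x : (η.relabel e).Edge) :
    η.relabelVar e ((η.relabel e).tail x) = η.tail (η.relabelEdge e x) := by
  rcases x with ((x | x) | x) <;> rfl

theorem relabelVar_head (x : (η.relabel e).Edge) :
    η.relabelVar e ((η.relabel e).head x) = η.head (η.relabelEdge e x) := by
  rcases x with (x | x)
  · have h : Equiv.sumCongr (Equiv.refl _) (Equiv.sigmaCongrLeft (β := fun j => (X j).Neg) e)
        ((η.relabel e).arc x) = η.arc (Equiv.sumCongr (Equiv.refl _)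
          (Equiv.sigmaCongrLeft (β := fun j => (X j).Pos) e) x) := Equiv.apply_symm_apply _ _
    change _ = Sum.elim _ _ (η.arc (Equiv.sumCongr (Equiv.refl _)
          (Equiv.sigmaCongrLeft (β := fun j => (X j).Pos) e) x))
    rw [← h]
    change η.relabelVar e (Sum.elim _ _ ((η.relabel e).arc x)) = _
    rcases (η.relabel e).arc x with y | y <;> rfl
  · rfl

variable [Fintype ι] [Fintype ι']

theorem relabel_edges :
    ((Finset.univ.val.map fun x => varPair (k := k) p ((η.relabel e).head x)
      ((η.relabel e).tail x)).map (Cx.mapPair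
        (rename (R := k) (η.relabelVar e)).toRingHom)) =
    Finset.univ.val.map fun x => varPair p (η.head x) (η.tail x) := by
  rw [Multiset.map_map, univ_map_eq_sum, univ_map_eq_sum, ← Equiv.sum_comp (η.relabelEdge e)]
  refine Finset.sum_congr rfl fun x _ => ?_
  rw [← relabelVar_head, ← relabelVar_tail]
  exact congrArg _ (mapPair_varPair p _ _ _ rfl)

/-- Renaming identifies the variables and the arcs of the two diagrams and thus their Koszul
factorizations. The inputs may then stand in a different order, which `Cx.fold_perm` repairs. -/
theorem relabel_model [LinearOrder ι] [LinearOrder ι'] {D : Type v} [Category.{w} D]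
    (G : ∀ i, D ⥤ Cx ((X i).ring k)) :
    Cx.HEqv ((η.relabel e).model p fun j => G (e j)) (η.model p G) := by
  letI : Algebra (X₀.ring k) (η.ring k) := (η.outer k).toRingHom.toAlgebra
  letI : Algebra (X₀.ring k) ((η.relabel e).ring k) := ((η.relabel e).outer k).toRingHom.toAlgebra
  letI : ∀ j, Algebra ((X j).ring k) (η.ring k) := fun j => (η.hole k j).toRingHom.toAlgebra
  letI : ∀ j, Algebra ((X (e j)).ring k) ((η.relabel e).ring k) := fun j =>
    ((η.relabel e).hole k j).toRingHom.toAlgebra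
  letI : Algebra ((η.relabel e).ring k) (η.ring k) := renameAlgebra k (η.relabelVar e)
  haveI : IsScalarTower (X₀.ring k) ((η.relabel e).ring k) (η.ring k) :=
    isScalarTower_rename fun _ => rfl
  haveI : ∀ j, IsScalarTower ((X (e j)).ring k) ((η.relabel e).ring k) (η.ring k) :=
    fun _ => isScalarTower_rename fun _ => rfl
  let φ : (η.relabel e).ring k ≃ₐ[(η.relabel e).ring k] η.ring k :=
    AlgEquiv.ofRingEquiv (f := (renameEquiv k (η.relabelVar e)).toRingEquiv) fun _ => rfl
  have h : Cx.SE (Cx.restr ((η.relabel e).ring k) ((η.relabel e).Z p).single.toCx)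
      (Cx.restr ((η.relabel e).ring k) (η.Z p).single.toCx) :=
    (Cx.SE.restr _ ((η.relabel e).Z_kosz p)).trans (((Cx.restr_kosz_equiv φ _).trans
      (Cx.SE.of_eq (congrArg (fun r => Cx.restr ((η.relabel e).ring k)
        (Cx.kosz r (Cx.unit (η.ring k)))) (relabel_edges p e η)))).trans
          (Cx.SE.restr _ (η.Z_kosz p)).symm)
  have h1 := Cx.restrF_fold_congr (B₀ := X₀.ring k) (fun j => G (e j))
    (Finset.univ.sort (fun i j : ι' => j ≤ i)) h.he
  have h2 : ((Finset.univ.sort (fun i j : ι' => j ≤ i)).map e).Perm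
      (Finset.univ.sort (fun i j : ι => j ≤ i)) :=
    (List.perm_ext_iff_of_nodup ((Finset.sort_nodup _ _).map e.injective)
      (Finset.sort_nodup _ _)).2 fun i => by
        simpa using ⟨e.symm i, e.apply_symm_apply i⟩
  have h3 := Cx.fold_perm ((Functor.const D).obj (η.Z p).single.toCx) G h2
  rw [Cx.fold_map] at h3
  exact h1.trans (Cx.SIso.restr (X₀.ring k) h3).hEqv

end ArcDiagram

/-! ### The canopolis and the Khovanov–Rozansky complexes -/

section Canopolis

variable {k : Type u} [Field k] (p : Polynomial k)

theorem comp_iso {ι : Type} [Fintype ι] [LinearOrder ι] {κ : ι → Type} [∀ j, Fintype (κ j)]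
    [∀ j, LinearOrder (κ j)] {X : ι → SignSeq} {X₀ : SignSeq} {Y : ∀ j, κ j → SignSeq}
    (η : ArcDiagram X X₀) (θ : ∀ j, ArcDiagram (Y j) (X j)) :
    Nonempty (Functor.pi' (fun j => Functor.pi' fun l => Pi.eval (fun q : Lex (Σ j, κ j) =>
          MFComplex ((Y (ofLex q).1 (ofLex q).2).ring k) (pot p (Y (ofLex q).1 (ofLex q).2)))
          (toLex ⟨j, l⟩)) ⋙
        Functor.pi (fun j => (θ j).functor p) ⋙ η.functor p ≅ (η.comp θ).functor p) ∧
    ∀ M, Cx.HE ((η.functor p).obj fun j => ((θ j).functor p).obj fun l => M (toLex ⟨j, l⟩)).toCx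
      (((η.comp θ).functor p).obj M).toCx := by
  have h1 := η.models p fun j => (θ j).models p fun l => Models.eval
    (v := fun q : Lex (Σ j, κ j) => pot p (Y (ofLex q).1 (ofLex q).2)) (toLex ⟨j, l⟩)
  have h2 := (η.comp θ).models p fun q => Models.eval
    (v := fun q : Lex (Σ j, κ j) => pot p (Y (ofLex q).1 (ofLex q).2)) q
  exact h1.exists_natIso h2 (η.comp_model p θ _)

theorem relabel_iso {ι ι' : Type} [Fintype ι] [LinearOrder ι] [Fintype ι'] [LinearOrder ι']
    {X : ι → SignSeq} {X₀ : SignSeq} (e : ι' ≃ ι) (η : ArcDiagram X X₀) :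
    Nonempty (Functor.pi' (fun j => Pi.eval (fun i => MFComplex ((X i).ring k) (pot p (X i)))
      (e j)) ⋙ (η.relabel e).functor p ≅ η.functor p) := by
  have h1 := (η.relabel e).models p fun j => Models.eval (v := fun i => pot p (X i)) (e j)
  have h2 := η.models p fun i => Models.eval (v := fun i => pot p (X i)) i
  exact (h1.exists_natIso h2 (η.relabel_model p e _)).1

end Canopolis

end KRCanopolis

end

theorem theorem2p1 {k : Type u} [Field k] (p : Polynomial k) (hp : p.eval 0 = 0) :
    IsCanopolis (C := fun X => MFComplex (X.ring k) (pot p X)) (fun η => η.functor p) ∧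
    ∀ c : CrossingData p,
      ∀ {ι : Type} [Fintype ι] [LinearOrder ι] {X : ι → SignSeq} {X₀ : SignSeq}
        (η : ArcDiagram X X₀) (T : ∀ j, Tangle (X j)),
        Nonempty (KR c (η.act T) ≅ (η.functor p).obj fun j => KR c (T j)) ∧
        (X₀.n = 0 → ∀ b : ZMod 2,
          Nonempty ((KR c (η.act T)).homologyComplex b ≅
            ((η.functor p).obj fun j => KR c (T j)).homologyComplex b)) := by
  refine ⟨⟨fun η θ => (comp_iso p η θ).1.map Iso.symm, fun e η => relabel_iso p e η⟩,
    fun c => fun η T => ?_⟩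
  -- By definition the complex of the glued tangle diagram is the value of the functor of the
  -- composite diagram at the complexes of the crossings, so the composition law is evaluated there.
  -- The crossing data enter only through these arguments.
  obtain ⟨⟨α⟩, h⟩ := comp_iso p η fun j => (T j).dia
  exact ⟨⟨(α.app fun q => c.complex ((T (ofLex q).1).positive (ofLex q).2)).symm⟩,
    fun _ b => (MFComplex.homologyComplex_iso (h fun q =>
      c.complex ((T (ofLex q).1).positive (ofLex q).2)) b).map Iso.symm⟩
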